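/- Conventions. $ZFC^-$ is $ZFC$ without power set, with collection in place of replacement and the well-ordering principle in place of choice. $V$ denotes a transitive model of $ZFC^-$ (a set or class with the true membership relation), and $\mathbf j:V\preceq\hat V$ an elementary embedding into a structure $\hat V$ for the language of set theory which is $\omega$-nonstandard, i.e. some natural number of $\hat V$ has infinitely many predecessors. A set $X\subseteq\hat V$ is pseudofinite if $X\subseteq\hat X$ for some $\hat X\in\hat V$ that is finite in the sense of $\hat V$. For a structure $M\in V$, $\mathbf j_{\rm std}(M)$ is the reduct of $\mathbf j(M)$ to the language of $M$; it is $\kappa$-pseudosaturated if every complete type in finitely many variables over a pseudofinite set of fewer than $\kappa$ elements of $\mathbf j_{\rm std}(M)$ is realized in it. A countable theory is a theory in a countable language equipped with an injection of its symbols into $\omega$. For a complete countable theory $T\in V$, $\hat V$ $\kappa$-pseudosaturates $T$ if $\mathbf j_{\rm std}(M)$ is $\kappa$-pseudosaturated for some model $M\in V$ of $T$. For $\lambda$ infinite and $\kappa$ infinite or $1$ (every structure counts as $1$-saturated), $T_0\trianglelefteq^\times_{\lambda\kappa}T_1$ means: there is a countable transitive $V\models ZFC^-$ with $T_0,T_1\in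 V$ such that for every $\mathbf j:V\preceq\hat V$ with $\hat V$ $\kappa$-saturated and $\omega$-nonstandard, if $\hat V$ $\lambda^+$-pseudosaturates $T_1$ then it $\lambda^+$-pseudosaturates $T_0$. Similarly, $T_0\trianglelefteq^*_{\lambda\kappa}T_1$ means: there are such a $V$ and models $M_0\models T_0$, $M_1\models T_1$ in $V$ such that for every such $\mathbf j$, if $\mathbf j_{\rm std}(M_1)$ is $\lambda^+$-saturated then so is $\mathbf j_{\rm std}(M_0)$. The relations $\trianglelefteq^\times_\kappa$, $\trianglelefteq^*_\kappa$ mean that this holds for all infinite $\lambda$. A pattern on $I$ is a set $\Delta$ of finite subsets of $I$ that is closed under subsets. $T$ admits $\Delta$ if there are a formula $\varphi(\bar x,\bar y)$, a model $N\models T$ and tuples $(\bar a_i)_{i\in I}$ from $N$ such that, for every finite $s\subseteq I$, $N\models\exists\bar x\bigwedge_{i\in s}\varphi(\bar x,\bar a_i)$ if and only if $s\in\Delta$. If $I,\Delta\in V$, let $\lambda_{\hat V}(\Delta)$ be the least cardinal $\mu$ for which there is a pseudofinite $X\subseteq\mathbf j(I)$ with $|X|\le\mu$, with all finite subsets of $X$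 in $\mathbf j(\Delta)$, and with no $\hat X\in\mathbf j(\Delta)$ such that $X\subseteq\hat X$; let $\lambda_{\hat V}(\Delta)=\infty$ if there is none. For $2\le k<n<\omega$ let $T_{n,k}$ be the theory of the random $k$-ary $n$-clique-free hypergraph. Let $S_k\subseteq[\omega]^k$ be a random $k$-ary hypergraph on $\omega$, and let $\Delta_{n,k}=\Delta_{n,k}(S_k)$ be the pattern on $[\omega]^{k-1}$ of all finite $s\subseteq[\omega]^{k-1}$ for which there is no $v\in[\omega]^{n-1}$ with $[v]^{k-1}\subseteq s$ and $[v]^k\subseteq S_k$. Theorem 7.12 and its corollary. Let $2\le k<n<\omega$. (1) Let $V\models ZFC^-$ be transitive with $S_k\in V$, let $\mathbf j:V\preceq\hat V$ be $\omega$-nonstandard, and let $\lambda$ be an infinite cardinal. Then $[\omega]^{k-1},\Delta_{n,k}\in V$, and $\hat V$ $\lambda^+$-pseudosaturates $T_{n,k}$ if and only if $\lambda<\lambda_{\hat V}(\Delta_{n,k})$. The same equivalence holds if "for some model $M\in V$" is replaced by "for every model $M\in V$" in the definition of pseudosaturation. (2) $T_{n,k}$ is a $\trianglelefteq^\times_1$-minimal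 theory admitting $\Delta_{n,k}$: it is complete, it admits $\Delta_{n,k}$, and $T_{n,k}\trianglelefteq^\times_1T$ for every complete countable theory $T$ that admits $\Delta_{n,k}$. The same is true with $\trianglelefteq^\times_\kappa$ or $\trianglelefteq^*_\kappa$ in place of $\trianglelefteq^\times_1$, for every $\kappa$ that is infinite or $1$. (3) $T_{n,k}\trianglelefteq^\times_1T_{n',k}$ for all $n'\ge n$. -/

import Mathlib

open FirstOrder FirstOrder.Language Cardinal

universe u w

noncomputable section

namespace CardChar

/-! ### The language of set theory and the theory of sets without power set -/

/-- The only symbol of the language of set theory is a binary relation symbol. -/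
inductive SetRel : ℕ → Type
  | mem : SetRel 2

/-- The language of set theory. -/
def SetLang : FirstOrder.Language.{0, 0} := ⟨fun _ => Empty, SetRel⟩

section InternalNotions

variable {W : Type w} [SetLang.Structure W]

/-- `E x y`: the structure `W` believes that `x` is a member of `y`. -/
def E (x y : W) : Prop :=
  Structure.RelMap (L := SetLang) (n := 2) SetRel.mem ![x, y]

/-- `p` is the Kuratowski pair `{{x}, {x, y}}` in the sense of `W`. -/
def IsPair (x y p : W) : Prop :=
  ∀ z : W, E z p ↔ (∀ t : W, E t z ↔ t = x) ∨ (∀ t : W, E t z ↔ (t = x ∨ t = y))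

/-- The ordered pair `(x, y)` is a member of `r`, in the sense of `W`. -/
def Related (r x y : W) : Prop := ∃ p : W, IsPair x y p ∧ E p r

/-- `t` is the tuple `(a₀, (a₁, (…, ∅)))` in the sense of `W` (of standard finite length). -/
def IsTuple : List W → W → Prop
  | [], t => ∀ z : W, ¬ E z t
  | a :: l, t => ∃ s : W, IsTuple l s ∧ IsPair a s t

/-- `I` contains the empty set and is closed under `y ↦ y ∪ {y}`, in the sense of `W`. -/
def IsInductive (I : W) : Prop :=
  (∃ e : W, E e I ∧ ∀ z : W, ¬ E z e) ∧
    ∀ y : W, E y I → ∃ s : W, E s I ∧ ∀ z : W, E z s ↔ (E z y ∨ z = y)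

/-- `x` is a natural number in the sense of `W`: it belongs to every inductive set of `W`. -/
def IsNat (x : W) : Prop := ∀ I : W, IsInductive I → E x I

/-- `X` is finite in the sense of `W`: some element `f` of `W` restricts to a bijection between
a natural number of `W` and `X`. -/
def IsFin (X : W) : Prop :=
  ∃ m f : W, IsNat m ∧
    (∀ i : W, E i m → ∃! y : W, E y X ∧ Related f i y) ∧
    (∀ y : W, E y X → ∃! i : W, E i m ∧ Related f i y)

/-- A subset of `W` is pseudofinite if it is covered by an element of `W` which is finite in the
sense of `W`. -/
def Pseudofinite (X : Set W) : Prop :=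
  ∃ Y : W, IsFin Y ∧ ∀ x ∈ X, E x Y

variable (W)

/-- `W` is `ω`-nonstandard: some natural number of `W` has infinitely many predecessors. -/
def OmegaNonstandard : Prop :=
  ∃ m : W, IsNat m ∧ {x : W | E x m}.Infinite

/-- `W` is a model of `ZFC⁻`, i.e. `ZFC` without power set, with the collection scheme in place of
replacement and the well-ordering principle in place of choice. The two schemes range over
all classes which are definable with parameters. -/
structure ModelsZFCMinus : Prop where
  extensionality : ∀ x y : W, (∀ z : W, E z x ↔ E z y) → x = y
  foundation : ∀ x : W, (∃ y : W, E y x) → ∃ y : W, E y x ∧ ∀ z : W, E z y → ¬ E z x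
  pairing : ∀ x y : W, ∃ p : W, ∀ z : W, E z p ↔ (z = x ∨ z = y)
  union : ∀ x : W, ∃ y : W, ∀ z : W, E z y ↔ ∃ t : W, E t x ∧ E z t
  infinity : ∃ I : W, IsInductive I
  separation : ∀ D : Set W, (Set.univ : Set W).Definable₁ SetLang D →
    ∀ x : W, ∃ y : W, ∀ z : W, E z y ↔ (E z x ∧ z ∈ D)
  collection : ∀ R : Set (W × W), (Set.univ : Set W).Definable₂ SetLang R →
    ∀ x : W, (∀ z : W, E z x → ∃ t : W, (z, t) ∈ R) →
      ∃ y : W, ∀ z : W, E z x → ∃ t : W, E t y ∧ (z, t) ∈ R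
  wellOrdering : ∀ x : W, ∃ r : W,
    (∀ a : W, E a x → ¬ Related r a a) ∧
    (∀ a b c : W, E a x → E b x → E c x → Related r a b → Related r b c → Related r a c) ∧
    (∀ a b : W, E a x → E b x → a = b ∨ Related r a b ∨ Related r b a) ∧
    (∀ s : W, (∃ a : W, E a s) → (∀ a : W, E a s → E a x) →
      ∃ a : W, E a s ∧ ∀ b : W, E b s → b = a ∨ Related r a b)

end InternalNotions

/-- A class `V` of sets is viewed as a structure with the true membership relation. -/
instance instSetStructure (V : Set ZFSet.{u}) : SetLang.Structure V where
  funMap := fun f => Empty.elim f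
  RelMap := fun {_} r =>
    match r with
    | SetRel.mem => fun a => (a 0 : ZFSet.{u}) ∈ (a 1 : ZFSet.{u})

/-- `V` is a transitive model of `ZFC⁻` (with the true membership relation). -/
def IsTransitiveModel (V : Set ZFSet.{u}) : Prop :=
  (∀ x ∈ V, ∀ y ∈ x, y ∈ V) ∧ ModelsZFCMinus V

/-! ### Coding of mathematical objects as sets -/

/-- The von Neumann natural number `n`. -/
def natCode : ℕ → ZFSet.{u}
  | 0 => ∅
  | n + 1 => insert (natCode n) (natCode n)

/-- The set of all codes of elements of `S`. -/
def codeSet {α : Type} (c : α → ZFSet.{u}) (S : Set α) : ZFSet.{u} :=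
  ZFSet.range (fun a : S => c a)

/-- The code of a finite set of natural numbers: the same set, in `ZFSet`. -/
def finsetCode (s : Finset ℕ) : ZFSet.{u} := codeSet natCode (s : Set ℕ)

/-- The tuple `(a₀, (a₁, (…, ∅)))`. -/
def tupleCode : List ZFSet.{u} → ZFSet.{u}
  | [] => ∅
  | a :: l => ZFSet.pair a (tupleCode l)

/-! ### Countable theories as sets -/

/-- A theory in a countable language, where the language comes with an injection of its symbols
into `ω`. Completeness is a separate property. -/
structure CountableTheory where
  /-- the language -/
  L : FirstOrder.Language.{0, 0}
  /-- the numbering of the symbols -/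
  num : L.Symbols → ℕ
  num_injective : Function.Injective num
  /-- the axioms -/
  thy : L.Theory

namespace CountableTheory

variable (T : CountableTheory)

/-- The theory is complete (in particular, satisfiable). -/
def Complete : Prop := T.thy.IsComplete

/-- The number of a function symbol. -/
def funCode {m : ℕ} (f : T.L.Functions m) : ZFSet.{u} := natCode (T.num (Sum.inl ⟨m, f⟩))

/-- The number of a relation symbol. -/
def relCode {m : ℕ} (r : T.L.Relations m) : ZFSet.{u} := natCode (T.num (Sum.inr ⟨m, r⟩))

/-- Terms as sets; variables are coded by `c`. -/
def termCode {α : Type} (c : α → ZFSet.{u}) : T.L.Term α → ZFSet.{u}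
  | .var x => ZFSet.pair (natCode 0) (c x)
  | .func f ts => ZFSet.pair (natCode 1)
      (ZFSet.pair (T.funCode f) (tupleCode (List.ofFn fun i => termCode c (ts i))))

/-- Formulas without free variables other than the first `m` de Bruijn levels, as sets. -/
def formulaCode : {m : ℕ} → T.L.BoundedFormula Empty m → ZFSet.{u}
  | _, .falsum => ZFSet.pair (natCode 0) ∅
  | _, .equal t₁ t₂ => ZFSet.pair (natCode 1)
      (ZFSet.pair (T.termCode (Sum.elim Empty.elim fun i : Fin _ => natCode i) t₁)
        (T.termCode (Sum.elim Empty.elim fun i : Fin _ => natCode i) t₂))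
  | _, .rel r ts => ZFSet.pair (natCode 2) (ZFSet.pair (T.relCode r)
      (tupleCode (List.ofFn fun i =>
        T.termCode (Sum.elim Empty.elim fun j : Fin _ => natCode j) (ts i))))
  | _, .imp φ ψ => ZFSet.pair (natCode 3) (ZFSet.pair (formulaCode φ) (formulaCode ψ))
  | _, .all φ => ZFSet.pair (natCode 4) (formulaCode φ)

/-- The signature as a set: every symbol is coded by its kind (`0` for function symbols, `1` for
relation symbols), its arity and its number. -/
def languageCode : ZFSet.{u} :=
  codeSet (fun s : T.L.Symbols => match s with
    | Sum.inl ⟨m, f⟩ => ZFSet.pair (natCode 0) (ZFSet.pair (natCode m) (T.funCode f))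
    | Sum.inr ⟨m, r⟩ => ZFSet.pair (natCode 1) (ZFSet.pair (natCode m) (T.relCode r))) Set.univ

/-- The theory as a set of codes of sentences. -/
def theoryCode : ZFSet.{u} := codeSet (fun φ : T.L.Sentence => T.formulaCode φ) T.thy

/-- The theory (with its language and numbering) belongs to `V`. -/
def MemClass (V : Set ZFSet.{u}) : Prop := T.languageCode ∈ V ∧ T.theoryCode ∈ V

end CountableTheory

/-! ### Structures in `V`, and their images under an elementary embedding -/

/-- The set of tuples from `U` coding an `m`-ary relation on `U`. -/
def relGraph {U : ZFSet.{u}} {m : ℕ} (R : (Fin m → U) → Prop) : ZFSet.{u} :=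
  ZFSet.range (fun a : {a : Fin m → U // R a} =>
    tupleCode (List.ofFn fun i => ((a : Fin m → U) i : ZFSet.{u})))

/-- The set of tuples `(a₀, …, aₘ₋₁, F a)` coding an `m`-ary function on `U`. -/
def funGraph {U : ZFSet.{u}} {m : ℕ} (F : (Fin m → U) → U) : ZFSet.{u} :=
  ZFSet.range (fun a : Fin m → U =>
    tupleCode ((List.ofFn fun i => (a i : ZFSet.{u})) ++ [(F a : ZFSet.{u})]))

/-- The graph of the interpretation of a symbol in a structure on `U`. -/
def symbolGraph (L : FirstOrder.Language.{0, 0}) {U : ZFSet.{u}} [L.Structure U] : L.Symbols → ZFSet.{u}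
  | Sum.inl ⟨_, f⟩ => funGraph (fun a : Fin _ → U => Structure.funMap f a)
  | Sum.inr ⟨_, r⟩ => relGraph (fun a : Fin _ → U => Structure.RelMap r a)

/-- A model of `T` that belongs to `V`: its universe is a nonempty set in `V`, and the function
that sends (the number of) each symbol to its interpretation is a set in `V`. -/
structure InnerModel (V : Set ZFSet.{u}) (T : CountableTheory) where
  /-- the universe -/
  carrier : V
  nonempty : Nonempty (carrier : ZFSet.{u})
  /-- the interpretation of the symbols -/
  str : T.L.Structure (carrier : ZFSet.{u})
  interp_mem : ZFSet.range (fun s : T.L.Symbols =>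
    ZFSet.pair (natCode (T.num s)) (symbolGraph T.L (U := carrier) s)) ∈ V
  models : (carrier : ZFSet.{u}) ⊨ T.thy

section Embedding

variable {V : Set ZFSet.{u}} {W : Type w} [SetLang.Structure W]

/-- The set of `W`-members of an element of `W`. -/
abbrev Members (x : W) : Type w := {y : W // E y x}

/-- The universe of `j(M)` is nonempty. -/
theorem members_nonempty {T : CountableTheory} (j : V ↪ₑ[SetLang] W)
    (hV : IsTransitiveModel V) (M : InnerModel V T) : Nonempty (Members (j M.carrier)) := by
  obtain ⟨x⟩ := M.nonempty
  refine ⟨⟨j ⟨x.1, hV.1 _ M.carrier.2 _ x.2⟩, ?_⟩⟩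
  have h : Structure.RelMap (L := SetLang) (n := 2) SetRel.mem
      ![(⟨x.1, hV.1 _ M.carrier.2 _ x.2⟩ : V), M.carrier] := x.2
  have h2 := (j.map_rel (n := 2) SetRel.mem _).2 h
  unfold E
  convert h2 using 1
  funext i
  fin_cases i <;> rfl

/-- `j_std(M)`: the universe consists of the `W`-members of `j(M)`, and a symbol of the (standard)
language, with interpretation `g ∈ V`, is interpreted by the tuples in `j(g)`. For a function
symbol, the value at `a` is the (unique) `b` such that `(a, b)` is in `j(g)`. -/
@[reducible] def stdStructure {T : CountableTheory} (j : V ↪ₑ[SetLang] W) (hV : IsTransitiveModel V)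
    (M : InnerModel V T) : T.L.Structure (Members (j M.carrier)) where
  funMap := fun {m} f a =>
    letI := M.str
    letI := members_nonempty j hV M
    Classical.epsilon fun b : Members (j M.carrier) =>
      ∃ g : V, (g : ZFSet.{u}) = symbolGraph T.L (U := M.carrier) (Sum.inl ⟨m, f⟩) ∧
        ∃ t : W, IsTuple ((List.ofFn fun i => (a i : W)) ++ [(b : W)]) t ∧ E t (j g)
  RelMap := fun {m} r a =>
    letI := M.str
    ∃ g : V, (g : ZFSet.{u}) = symbolGraph T.L (U := M.carrier) (Sum.inr ⟨m, r⟩) ∧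
      ∃ t : W, IsTuple (List.ofFn fun i => (a i : W)) t ∧ E t (j g)

end Embedding

/-! ### Saturation and pseudosaturation -/

/-- Every complete type over `A` in finitely many variables is realized in `N`. -/
def RealizesTypesOver (L : FirstOrder.Language.{0, 0}) (N : Type w) [L.Structure N] [Nonempty N]
    (A : Set N) : Prop :=
  ∀ m : ℕ, ∀ p : (L[[A]].completeTheory N).CompleteType (Fin m),
    p ∈ (L[[A]].completeTheory N).realizedTypes N (Fin m)

/-- `N` is `κ`-saturated. -/
def Saturated (L : FirstOrder.Language.{0, 0}) (N : Type w) [L.Structure N] [Nonempty N]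
    (κ : Cardinal.{w}) : Prop :=
  ∀ A : Set N, #A < κ → RealizesTypesOver L N A

section PseudoSaturation

variable {V : Set ZFSet.{u}} {W : Type w} [SetLang.Structure W]

/-- `j_std(M)` is `κ`-saturated. -/
def StdSaturated {T : CountableTheory} (j : V ↪ₑ[SetLang] W) (hV : IsTransitiveModel V)
    (M : InnerModel V T) (κ : Cardinal.{w}) : Prop :=
  letI := stdStructure j hV M
  haveI := members_nonempty j hV M
  Saturated T.L (Members (j M.carrier)) κ

/-- `j_std(M)` is `κ`-pseudosaturated: types over pseudofinite sets of size less than `κ` are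
realized. -/
def StdPseudosaturated {T : CountableTheory} (j : V ↪ₑ[SetLang] W) (hV : IsTransitiveModel V)
    (M : InnerModel V T) (κ : Cardinal.{w}) : Prop :=
  letI := stdStructure j hV M
  haveI := members_nonempty j hV M
  ∀ A : Set (Members (j M.carrier)), Pseudofinite (Subtype.val '' A : Set W) → #A < κ →
    RealizesTypesOver T.L (Members (j M.carrier)) A

/-- `W` `κ`-pseudosaturates `T`: for some model `M` of `T` in `V`, `j_std(M)` is
`κ`-pseudosaturated. -/
def Pseudosaturates (j : V ↪ₑ[SetLang] W) (hV : IsTransitiveModel V) (κ : Cardinal.{w})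
    (T : CountableTheory) : Prop :=
  ∃ M : InnerModel V T, StdPseudosaturated j hV M κ

/-- The variant of the previous notion which refers to every model `M` of `T` in `V`. -/
def PseudosaturatesEvery (j : V ↪ₑ[SetLang] W) (hV : IsTransitiveModel V) (κ : Cardinal.{w})
    (T : CountableTheory) : Prop :=
  ∀ M : InnerModel V T, StdPseudosaturated j hV M κ

/-- The cardinal `λ_W(Δ)` of a pattern `Δ ∈ V` on an index set `I ∈ V`: the least `μ` such that there
is a pseudofinite `X ⊆ j(I)` of size at most `μ`, all of whose finite subsets belong to `j(Δ)`, but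
which is not covered by any element of `j(Δ)`; it is `⊤` if there is no such `μ`. -/
def patternCardinal (j : V ↪ₑ[SetLang] W) (I D : V) : WithTop Cardinal.{w} :=
  sInf {μ | ∃ ν : Cardinal.{w}, μ = ν ∧ ∃ X : Set W,
    (∀ x ∈ X, E x (j I)) ∧ Pseudofinite X ∧ #X ≤ ν ∧
    (∀ F : Set W, F ⊆ X → F.Finite → ∃ d : W, E d (j D) ∧ ∀ y : W, E y d ↔ y ∈ F) ∧
    ¬ ∃ d : W, E d (j D) ∧ ∀ x ∈ X, E x d}

end PseudoSaturation

/-! ### The interpretability orders -/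

/-- The model `W` of set theory is `κ`-saturated, where `κ` is infinite or `1`; by convention,
every structure is `1`-saturated. -/
def SaturatedOrOne (W : Type w) [SetLang.Structure W] [Nonempty W] (κ : Cardinal.{w}) : Prop :=
  κ = 1 ∨ Saturated SetLang W κ

/-- The relation `T₀ ⊴^×_{λκ} T₁`. -/
def CrossLEAt (l κ : Cardinal.{w}) (T₀ T₁ : CountableTheory) : Prop :=
  ∃ (V : Set ZFSet.{0}) (hV : IsTransitiveModel V), V.Countable ∧ T₀.MemClass V ∧ T₁.MemClass V ∧
    ∀ (W : Type w) [SetLang.Structure W] [Nonempty W] (j : V ↪ₑ[SetLang] W),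
      SaturatedOrOne W κ → OmegaNonstandard W →
      Pseudosaturates j hV (Order.succ l) T₁ → Pseudosaturates j hV (Order.succ l) T₀

/-- The relation `T₀ ⊴^×_κ T₁`. -/
def CrossLE (κ : Cardinal.{w}) (T₀ T₁ : CountableTheory) : Prop :=
  ∀ l : Cardinal.{w}, ℵ₀ ≤ l → CrossLEAt l κ T₀ T₁

/-- The relation `T₀ ⊴^*_{λκ} T₁`. -/
def StarLEAt (l κ : Cardinal.{w}) (T₀ T₁ : CountableTheory) : Prop :=
  ∃ (V : Set ZFSet.{0}) (hV : IsTransitiveModel V), V.Countable ∧ T₀.MemClass V ∧ T₁.MemClass V ∧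
    ∃ (M₀ : InnerModel V T₀) (M₁ : InnerModel V T₁),
      ∀ (W : Type w) [SetLang.Structure W] [Nonempty W] (j : V ↪ₑ[SetLang] W),
        SaturatedOrOne W κ → OmegaNonstandard W →
        StdSaturated j hV M₁ (Order.succ l) → StdSaturated j hV M₀ (Order.succ l)

/-- The relation `T₀ ⊴^*_κ T₁`. -/
def StarLE (κ : Cardinal.{w}) (T₀ T₁ : CountableTheory) : Prop :=
  ∀ l : Cardinal.{w}, ℵ₀ ≤ l → StarLEAt l κ T₀ T₁

/-! ### Patterns -/

/-- The theory `T` admits the pattern `Δ` on `ι`: some formula `φ(x̄, ȳ)` does, as witnessed by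
parameters in some model of `T`. -/
def Admits (T : CountableTheory) {ι : Type} (Δ : Set (Finset ι)) : Prop :=
  ∃ (a b : ℕ) (φ : T.L.Formula (Fin a ⊕ Fin b)) (N : Theory.ModelType.{0, 0, 0} T.thy)
    (y : ι → Fin b → N), ∀ s : Finset ι,
      (∃ x : Fin a → N, ∀ i ∈ s, φ.Realize (Sum.elim x (y i))) ↔ s ∈ Δ

/-- `T` is a least element (with respect to the relation `le`) among the complete countable
theories which admit `Δ`. -/
def IsMinimalAdmitting (le : CountableTheory → CountableTheory → Prop) (T : CountableTheory)
    {ι : Type} (Δ : Set (Finset ι)) : Prop :=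
  T.Complete ∧ Admits T Δ ∧ ∀ T' : CountableTheory, T'.Complete → Admits T' Δ → le T T'

/-! ### Hypergraphs -/

/-- The `m`-element subsets of `ℕ`. -/
abbrev Sub (m : ℕ) : Type := {u : Finset ℕ // u.card = m}

/-- All edges of the hypergraph `S` have exactly `k` elements. -/
def IsHypergraph (k : ℕ) (S : Set (Finset ℕ)) : Prop := ∀ e ∈ S, e.card = k

/-- Every `k`-element subset of `v` is an edge of `S`. -/
def IsClique (k : ℕ) (S : Set (Finset ℕ)) (v : Finset ℕ) : Prop :=
  ∀ e ∈ v.powersetCard k, e ∈ S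

/-- `S` is a random `k`-ary hypergraph on `ω`: over every finite set of vertices, each possible
configuration of edges is realized by a new vertex. -/
def IsRandom (k : ℕ) (S : Set (Finset ℕ)) : Prop :=
  IsHypergraph k S ∧
  ∀ (A : Finset ℕ) (F : Set (Finset ℕ)),
    ∃ x, x ∉ A ∧ ∀ c ∈ A.powersetCard (k - 1), (insert x c ∈ S ↔ c ∈ F)

/-- `S` is a random `k`-ary `n`-clique free hypergraph on `ω`: over every finite set of vertices,
each configuration of edges that does not create an `n`-clique is realized by a new vertex. -/
def IsRandomCliqueFree (n k : ℕ) (S : Set (Finset ℕ)) : Prop :=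
  IsHypergraph k S ∧
  (∀ v : Finset ℕ, v.card = n → ¬ IsClique k S v) ∧
  ∀ (A : Finset ℕ) (F : Set (Finset ℕ)),
    (¬ ∃ v ⊆ A, v.card = n - 1 ∧ (∀ c ∈ v.powersetCard (k - 1), c ∈ F) ∧ IsClique k S v) →
    ∃ x, x ∉ A ∧ ∀ c ∈ A.powersetCard (k - 1), (insert x c ∈ S ↔ c ∈ F)

/-- The only symbol of the language of `k`-ary hypergraphs is a `k`-ary relation symbol. -/
inductive HyperRel (k : ℕ) : ℕ → Type
  | edge : HyperRel k k

/-- The language of `k`-ary hypergraphs. -/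
def HyperLang (k : ℕ) : FirstOrder.Language.{0, 0} := ⟨fun _ => Empty, HyperRel k⟩

/-- The hypergraph `S` as a first-order structure: `R(a)` holds if the entries of `a` are distinct
and form an edge. -/
@[reducible] def hyperStructure (k : ℕ) (S : Set (Finset ℕ)) : (HyperLang k).Structure ℕ where
  funMap := fun f => Empty.elim f
  RelMap := fun {_} _ a => Function.Injective a ∧ Finset.univ.image a ∈ S

/-- The theory `T_{n,k}` of the random `k`-ary `n`-clique free hypergraph. -/
def Tnk (n k : ℕ) : CountableTheory where
  L := HyperLang k
  num := fun _ => 0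
  num_injective := by
    rintro (⟨m, f⟩ | ⟨m, r⟩) (⟨m', f'⟩ | ⟨m', r'⟩) _
    · exact Empty.elim f
    · exact Empty.elim f
    · exact Empty.elim f'
    · cases r
      cases r'
      rfl
  thy := {φ | ∀ S : Set (Finset ℕ), IsRandomCliqueFree n k S →
    letI := hyperStructure k S
    ℕ ⊨ φ}

/-- The pattern `Δ_{n,k}(S)` on the `(k-1)`-element subsets of `ω`: all finite `s` for which there is
no `(n-1)`-clique `v` of `S` whose `(k-1)`-element subsets all belong to `s`. -/
def deltaPattern (n k : ℕ) (S : Set (Finset ℕ)) : Set (Finset (Sub (k - 1))) :=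
  {s | ¬ ∃ v : Finset ℕ, v.card = n - 1 ∧ (∀ c : Sub (k - 1), c.1 ⊆ v → c ∈ s) ∧ IsClique k S v}

/-- A hypergraph as a set. -/
def hypergraphCode (S : Set (Finset ℕ)) : ZFSet.{u} := codeSet finsetCode S

/-- The index set of the pattern `Δ_{n,k}(S)` as a set. -/
def indexCode (k : ℕ) : ZFSet.{u} := codeSet (fun c : Sub (k - 1) => finsetCode c.1) Set.univ

/-- The pattern `Δ_{n,k}(S)` as a set. -/
def deltaCode (n k : ℕ) (S : Set (Finset ℕ)) : ZFSet.{u} :=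
  codeSet (fun s : Finset (Sub (k - 1)) =>
    codeSet (fun c : Sub (k - 1) => finsetCode c.1) (s : Set (Sub (k - 1)))) (deltaPattern n k S)

end CardChar

end

open CardChar

noncomputable section

set_option linter.unusedSectionVars false

namespace CardChar

/-! ### Predicates on two structures which are defined by the same formula -/

section Calculus

universe u₁ u₂ u₃ u₄ u₅

variable {L : FirstOrder.Language.{u₁, u₂}} {M : Type u₃} {N : Type u₄} [L.Structure M]
  [L.Structure N] {γ : Type u₅} (p : γ → M) (q : γ → N)

/-! Write `Δ` for the pattern of `(n - 1)`-cliques of a random hypergraph `S`, and `λ` for the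
cardinal in question.

Transfer. Every statement that passes from `V` to `W` has to be given by one formula of set theory.
The class `CoDef` records that two predicates, one on each side, are defined by the same formula,
and its instances assemble the formula from the shape of the statement. `InnerModel.coDef_holds`
adds satisfaction in `M` and in `j_std(M)`, one standard formula at a time. In a transitive model,
finite means finite (`isFin_iff`), so a fact about finite sets that is proved outside holds in `V`.
After transfer it holds for all sets that are finite in the sense of `W`, and these cover the
pseudofinite sets.

From pseudosaturation to `λ < λ_W(Δ)`, for every complete `T` which admits `Δ`. Over a finite set
`s` of indices, every model of `T` has parameters for which a fixed formula represents `Δ` on `s`.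
By transfer this holds over a set `s`, finite in `W`, that covers a given small pseudofinite `X`. If
the finite subsets of `X` are in `j(Δ)`, then the instances with index in `X` are finitely
satisfiable over a small pseudofinite set of parameters. A common solution `x` exists, and some
member of `j(Δ)` contains all the indices in `s` whose instance holds at `x`; it covers `X`
(`StdPseudosaturated.lt_patternCardinal`).

From `λ < λ_W(Δ)` to pseudosaturation of `T_{n,k}`. By back and forth, realizing types over `A`
reduces to finding a vertex with a prescribed neighbourhood `F` over `A` together with finitely many
points. Cover `A` by a set `s` that is finite in `W` and embed `s` into the vertices of `j(S)` by
`f` so that each image `f[c]` of a `(k - 1)`-set `c` lies in its own `(n - 1)`-clique, whose other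
`(k - 1)`-subsets form `h(c)`, and so that no superfluous cliques arise. Let `X` consist of `f[c]`
for `c ∈ F` and of `h(c)` for `c ∉ F`. Its finite subsets are in `j(Δ)`: a clique violating this
would either be attached to a single `c`, which is impossible since `X` contains only one of the two
halves, or would come from a clique in `A` that is forbidden by the choice of `F`. A set `d` in
`j(Δ)` covering `X` contains `f[c]` exactly when `c ∈ F`, for if `c ∉ F`, then `d` already contains
`h(c)` and has no room for `f[c]`. Finally every such `d` is the trace of a vertex, since this holds
for finite sets in `V` (`IsGeneric.exists_cliqueEmbedding`,
`IsGeneric.extendsBy_of_lt_patternCardinal`).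

That `T_{n',k}` admits `Δ` for `n ≤ n'` is shown by a hypergraph with `n' - 1` parts, of which the
first `n - 1` carry copies of `S` (`IsRandomCliqueFree.partite_consistent_iff`). That `V` contains a
model of `T_{n,k}` at all follows from an explicit generic hypergraph on hereditarily finite sets
(`isGeneric_setHypergraph`).

Minimality for `⊴^×` combines the two implications, in a countable transitive model obtained by
Löwenheim-Skolem from the hereditarily countable sets. For `⊴^*` full saturation is at stake, so
every small subset of `j_std(M₀)` has to be pseudofinite. A theory which admits `Δ` has the
independence property. This yields a countable model with a sequence of instances that is finitely
satisfiable although no tuple satisfies infinitely many of them; if the image of this model is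
saturated, then all small subsets of `j(ω)` are pseudofinite (`StdSaturated.pseudofinite`). Taking
`M₀` on `ω` finishes the argument. -/

/-- The functions `f` on `M` and `g` on `N` of `n` variables are given by the same term, with
parameters interpreted by `p` and `q`. -/
class CoTerm (L : FirstOrder.Language.{u₁, u₂}) {M : Type u₃} {N : Type u₄} [L.Structure M]
    [L.Structure N] {γ : Type u₅} (p : γ → M) (q : γ → N) (n : ℕ)
    (f : (Fin n → M) → M) (g : (Fin n → N) → N) : Prop where
  out : ∃ t : L.Term (γ ⊕ Fin n), (∀ v, t.realize (Sum.elim p v) = f v) ∧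
    ∀ v, t.realize (Sum.elim q v) = g v

/-- The predicates `P` on `M` and `Q` on `N` of `n` variables are defined by the same formula, with
parameters interpreted by `p` and `q`. -/
class CoDef (L : FirstOrder.Language.{u₁, u₂}) {M : Type u₃} {N : Type u₄} [L.Structure M]
    [L.Structure N] {γ : Type u₅} (p : γ → M) (q : γ → N) (n : ℕ)
    (P : (Fin n → M) → Prop) (Q : (Fin n → N) → Prop) : Prop where
  out : ∃ φ : L.BoundedFormula γ n, (∀ v, φ.Realize p v ↔ P v) ∧ ∀ v, φ.Realize q v ↔ Q v

variable {p q} {n m : ℕ}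

instance CoTerm.var (i : Fin n) : CoTerm L p q n (fun v => v i) (fun v => v i) :=
  ⟨(Term.var (Sum.inr i)), fun _ => rfl, fun _ => rfl⟩

theorem CoTerm.param (c : γ) : CoTerm L p q n (fun _ => p c) (fun _ => q c) :=
  ⟨(Term.var (Sum.inl c)), fun _ => rfl, fun _ => rfl⟩

section Connectives

variable {P P' : (Fin n → M) → Prop} {Q Q' : (Fin n → N) → Prop}

instance CoDef.eq (f f' : (Fin n → M) → M) (g g' : (Fin n → N) → N) [h : CoTerm L p q n f g]
    [h' : CoTerm L p q n f' g'] :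
    CoDef L p q n (fun v => f v = f' v) (fun v => g v = g' v) := by
  obtain ⟨t, ht, ht'⟩ := h
  obtain ⟨s, hs, hs'⟩ := h'
  exact ⟨t.bdEqual s, fun v => by simp [ht, hs], fun v => by simp [ht', hs']⟩

theorem CoDef.rel {k : ℕ} (R : L.Relations k) (f : Fin k → (Fin n → M) → M)
    (g : Fin k → (Fin n → N) → N) (h : ∀ i, CoTerm L p q n (f i) (g i)) :
    CoDef L p q n (fun v => Structure.RelMap R fun i => f i v)
      (fun v => Structure.RelMap R fun i => g i v) := by
  choose t ht ht' using fun i => (h i).out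
  exact ⟨R.boundedFormula t, fun v => by simp [BoundedFormula.realize_rel, ht],
    fun v => by simp [BoundedFormula.realize_rel, ht']⟩

variable [h : CoDef L p q n P Q] [h' : CoDef L p q n P' Q']

instance CoDef.not : CoDef L p q n (fun v => ¬ P v) (fun v => ¬ Q v) := by
  obtain ⟨φ, hφ, hφ'⟩ := h
  exact ⟨φ.not, fun v => by simp [hφ], fun v => by simp [hφ']⟩

instance CoDef.imp : CoDef L p q n (fun v => P v → P' v) (fun v => Q v → Q' v) := by
  obtain ⟨φ, hφ, hφ'⟩ := h
  obtain ⟨ψ, hψ, hψ'⟩ := h'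
  exact ⟨φ.imp ψ, fun v => by simp [hφ, hψ], fun v => by simp [hφ', hψ']⟩

instance CoDef.and : CoDef L p q n (fun v => P v ∧ P' v) (fun v => Q v ∧ Q' v) := by
  obtain ⟨φ, hφ, hφ'⟩ := h
  obtain ⟨ψ, hψ, hψ'⟩ := h'
  exact ⟨φ ⊓ ψ, fun v => by simp [hφ, hψ], fun v => by simp [hφ', hψ']⟩

instance CoDef.or : CoDef L p q n (fun v => P v ∨ P' v) (fun v => Q v ∨ Q' v) := by
  obtain ⟨φ, hφ, hφ'⟩ := h
  obtain ⟨ψ, hψ, hψ'⟩ := h'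
  exact ⟨φ ⊔ ψ, fun v => by simp [hφ, hψ], fun v => by simp [hφ', hψ']⟩

instance CoDef.iff : CoDef L p q n (fun v => P v ↔ P' v) (fun v => Q v ↔ Q' v) := by
  obtain ⟨φ, hφ, hφ'⟩ := h
  obtain ⟨ψ, hψ, hψ'⟩ := h'
  exact ⟨φ.iff ψ, fun v => by simp [hφ, hψ], fun v => by simp [hφ', hψ']⟩

end Connectives

instance CoDef.const (P : Prop) : CoDef L p q n (fun _ => P) (fun _ => P) := by
  by_cases hP : P
  · exact ⟨⊤, fun v => by simp [hP], fun v => by simp [hP]⟩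
  · exact ⟨⊥, fun v => by simp [hP], fun v => by simp [hP]⟩

theorem CoDef.congr {P P' : (Fin n → M) → Prop} {Q Q' : (Fin n → N) → Prop}
    (h : CoDef L p q n P Q) (hP : ∀ v, P' v ↔ P v) (hQ : ∀ v, Q' v ↔ Q v) :
    CoDef L p q n P' Q' := by
  obtain ⟨φ, hφ, hφ'⟩ := h
  exact ⟨φ, fun v => by rw [hφ, hP], fun v => by rw [hφ', hQ]⟩

instance CoDef.all (P : (Fin n → M) → M → Prop) (Q : (Fin n → N) → N → Prop)
    [h : CoDef L p q (n + 1) (fun v => P (fun i => v i.castSucc) (v (Fin.last n)))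
      (fun v => Q (fun i => v i.castSucc) (v (Fin.last n)))] :
    CoDef L p q n (fun v => ∀ x, P v x) (fun v => ∀ x, Q v x) := by
  obtain ⟨φ, hφ, hφ'⟩ := h
  exact ⟨φ.all, fun v => by simp [hφ], fun v => by simp [hφ']⟩

instance CoDef.ex (P : (Fin n → M) → M → Prop) (Q : (Fin n → N) → N → Prop)
    [h : CoDef L p q (n + 1) (fun v => P (fun i => v i.castSucc) (v (Fin.last n)))
      (fun v => Q (fun i => v i.castSucc) (v (Fin.last n)))] :
    CoDef L p q n (fun v => ∃ x, P v x) (fun v => ∃ x, Q v x) := by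
  obtain ⟨φ, hφ, hφ'⟩ := h
  exact ⟨φ.ex, fun v => by simp [hφ], fun v => by simp [hφ']⟩

instance CoDef.existsUnique (P : (Fin n → M) → M → Prop) (Q : (Fin n → N) → N → Prop)
    [h : CoDef L p q n (fun v => ∃ x, P v x ∧ ∀ y, P v y → y = x)
      (fun v => ∃ x, Q v x ∧ ∀ y, Q v y → y = x)] :
    CoDef L p q n (fun v => ∃! x, P v x) (fun v => ∃! x, Q v x) := h

instance CoDef.finAll {ι : Type*} [Finite ι] (P : ι → (Fin n → M) → Prop)
    (Q : ι → (Fin n → N) → Prop) [h : ∀ i, CoDef L p q n (P i) (Q i)] :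
    CoDef L p q n (fun v => ∀ i, P i v) (fun v => ∀ i, Q i v) := by
  choose φ hφ hφ' using fun i => (h i).out
  exact ⟨BoundedFormula.iInf φ, fun v => by simp [hφ], fun v => by simp [hφ']⟩

instance CoDef.finEx {ι : Type*} [Finite ι] (P : ι → (Fin n → M) → Prop)
    (Q : ι → (Fin n → N) → Prop) [h : ∀ i, CoDef L p q n (P i) (Q i)] :
    CoDef L p q n (fun v => ∃ i, P i v) (fun v => ∃ i, Q i v) := by
  choose φ hφ hφ' using fun i => (h i).out
  exact ⟨BoundedFormula.iSup φ, fun v => by simp [hφ], fun v => by simp [hφ']⟩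

theorem forall_fin_succ_fun {A : Type*} {r : ℕ} {P : (Fin (r + 1) → A) → Prop} :
    (∀ a, P a) ↔ ∀ b : Fin r → A, ∀ x, P (Fin.snoc b x) :=
  ⟨fun h b x => h _, fun h a => by simpa using h (Fin.init a) (a (Fin.last r))⟩

/-- A quantifier over `r`-tuples is `r` single quantifiers. Peeling off the last entry leaves all
other indices in place, because `n + (r + 1)` is `n + r + 1` by definition. -/
theorem CoDef.blockAll_aux (r : ℕ) : ∀ {n : ℕ} (P : (Fin n → M) → (Fin r → M) → Prop)
    (Q : (Fin n → N) → (Fin r → N) → Prop)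
    (_ : CoDef L p q (n + r) (fun v => P (fun i => v (i.castAdd r)) (fun i => v (i.natAdd n)))
      (fun v => Q (fun i => v (i.castAdd r)) (fun i => v (i.natAdd n)))),
    CoDef L p q n (fun v => ∀ x, P v x) (fun v => ∀ x, Q v x) := by
  induction r with
  | zero =>
    intro n P Q h
    refine h.congr (fun v => ?_) (fun v => ?_)
    · exact ⟨fun h => h _, fun h x => by convert h; rfl⟩
    · exact ⟨fun h => h _, fun h x => by convert h; rfl⟩
  | succ r ih =>
    intro n P Q h
    refine (ih (fun v a => ∀ x, P v (Fin.snoc a x)) (fun v a => ∀ x, Q v (Fin.snoc a x)) ?_).congr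
      (fun v => forall_fin_succ_fun) (fun v => forall_fin_succ_fun)
    refine @CoDef.all _ _ _ _ _ _ _ _ _ _ _ ?_
    refine h.congr (fun v => ?_) (fun v => ?_)
    · refine iff_of_eq (congrArg₂ P rfl ?_)
      funext i
      refine Fin.lastCases ?_ (fun i => ?_) i
      · simp
      · simp
    · refine iff_of_eq (congrArg₂ Q rfl ?_)
      funext i
      refine Fin.lastCases ?_ (fun i => ?_) i
      · simp
      · simp

instance CoDef.blockAll {r : ℕ} (P : (Fin n → M) → (Fin r → M) → Prop)
    (Q : (Fin n → N) → (Fin r → N) → Prop)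
    [h : CoDef L p q (n + r) (fun v => P (fun i => v (i.castAdd r)) (fun i => v (i.natAdd n)))
      (fun v => Q (fun i => v (i.castAdd r)) (fun i => v (i.natAdd n)))] :
    CoDef L p q n (fun v => ∀ x, P v x) (fun v => ∀ x, Q v x) :=
  CoDef.blockAll_aux r P Q h

instance CoDef.blockEx {r : ℕ} (P : (Fin n → M) → (Fin r → M) → Prop)
    (Q : (Fin n → N) → (Fin r → N) → Prop)
    [h : CoDef L p q (n + r) (fun v => P (fun i => v (i.castAdd r)) (fun i => v (i.natAdd n)))
      (fun v => Q (fun i => v (i.castAdd r)) (fun i => v (i.natAdd n)))] :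
    CoDef L p q n (fun v => ∃ x, P v x) (fun v => ∃ x, Q v x) := by
  have := CoDef.blockAll_aux r (fun v x => ¬ P v x) (fun v x => ¬ Q v x) (CoDef.not (h := h))
  exact (CoDef.not (h := this)).congr (fun v => by push Not; rfl) (fun v => by push Not; rfl)

/-- Substitution of terms into a pair of corresponding predicates. -/
theorem CoDef.subst {P : (Fin m → M) → Prop} {Q : (Fin m → N) → Prop} (h : CoDef L p q m P Q)
    (f : Fin m → (Fin n → M) → M) (g : Fin m → (Fin n → N) → N)
    (h' : ∀ i, CoTerm L p q n (f i) (g i)) :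
    CoDef L p q n (fun v => P fun i => f i v) (fun v => Q fun i => g i v) := by
  obtain ⟨φ, hφ, hφ'⟩ := h
  choose t ht ht' using fun i => (h' i).out
  -- `toFormula` makes the indexed variables free, so that terms can be substituted for them;
  -- relabelling along `id` then turns the summand `Fin n` back into indexed variables.
  refine ⟨((φ.toFormula).subst (Sum.elim (fun c => Term.var (Sum.inl c)) t)).relabel id,
    fun v => ?_, fun v => ?_⟩
  · rw [BoundedFormula.realize_relabel, BoundedFormula.realize_subst, ← hφ]
    refine (iff_of_eq (congrArg _ (Subsingleton.elim _ default))).trans ?_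
    refine (BoundedFormula.realize_toFormula _ _).trans (iff_of_eq (congrArg₂ _ ?_ ?_))
    · rfl
    · funext i; exact ht i v
  · rw [BoundedFormula.realize_relabel, BoundedFormula.realize_subst, ← hφ']
    refine (iff_of_eq (congrArg _ (Subsingleton.elim _ default))).trans ?_
    refine (BoundedFormula.realize_toFormula _ _).trans (iff_of_eq (congrArg₂ _ ?_ ?_))
    · rfl
    · funext i; exact ht' i v

/-- A predicate applied to a tuple of variables. -/
def Ap {A : Type*} (P : (Fin m → A) → Prop) (a : Fin m → A) : Prop := P a

/-- The wrapper `Ap` gives an arbitrary predicate a head symbol that instance search can match; a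
bare application of a variable predicate would be a higher-order pattern. -/
instance CoDef.ap (P : (Fin m → M) → Prop) (Q : (Fin m → N) → Prop) [h : CoDef L p q m P Q]
    (f : Fin m → (Fin n → M) → M) (g : Fin m → (Fin n → N) → N)
    [h' : ∀ i, CoTerm L p q n (f i) (g i)] :
    CoDef L p q n (fun v => Ap P fun i => f i v) (fun v => Ap Q fun i => g i v) :=
  h.subst f g h'

theorem CoDef.subst₁ {P : M → Prop} {Q : N → Prop}
    (h : CoDef L p q 1 (fun v => P (v 0)) (fun v => Q (v 0)))
    (f₁ : (Fin n → M) → M) (g₁ : (Fin n → N) → N) [h₁ : CoTerm L p q n f₁ g₁] :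
    CoDef L p q n (fun v => P (f₁ v)) (fun v => Q (g₁ v)) :=
  h.subst (fun _ => f₁) (fun _ => g₁) (fun _ => h₁)

theorem CoDef.subst₂ {P : M → M → Prop} {Q : N → N → Prop}
    (h : CoDef L p q 2 (fun v => P (v 0) (v 1)) (fun v => Q (v 0) (v 1)))
    (f₁ f₂ : (Fin n → M) → M) (g₁ g₂ : (Fin n → N) → N) [h₁ : CoTerm L p q n f₁ g₁]
    [h₂ : CoTerm L p q n f₂ g₂] :
    CoDef L p q n (fun v => P (f₁ v) (f₂ v)) (fun v => Q (g₁ v) (g₂ v)) :=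
  h.subst ![f₁, f₂] ![g₁, g₂] (by simp [Fin.forall_fin_succ, h₁, h₂])

theorem CoDef.subst₃ {P : M → M → M → Prop} {Q : N → N → N → Prop}
    (h : CoDef L p q 3 (fun v => P (v 0) (v 1) (v 2)) (fun v => Q (v 0) (v 1) (v 2)))
    (f₁ f₂ f₃ : (Fin n → M) → M) (g₁ g₂ g₃ : (Fin n → N) → N) [h₁ : CoTerm L p q n f₁ g₁]
    [h₂ : CoTerm L p q n f₂ g₂] [h₃ : CoTerm L p q n f₃ g₃] :
    CoDef L p q n (fun v => P (f₁ v) (f₂ v) (f₃ v)) (fun v => Q (g₁ v) (g₂ v) (g₃ v)) :=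
  h.subst ![f₁, f₂, f₃] ![g₁, g₂, g₃] (by simp [Fin.forall_fin_succ, h₁, h₂, h₃])

/-- Without parameters, elementary equivalence can take the place of an elementary embedding. -/
theorem CoDef.sentence_iff {P : (Fin 0 → M) → Prop} {Q : (Fin 0 → N) → Prop}
    (e : Empty → M) (e' : Empty → N) (h : CoDef L e e' 0 P Q) (hMN : L.ElementarilyEquivalent M N) :
    P default ↔ Q default := by
  obtain ⟨φ, hφ, hφ'⟩ := h
  rw [← hφ, ← hφ', Subsingleton.elim e default, Subsingleton.elim e' default]
  exact hMN.realize_sentence φ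

end Calculus

/-! ### Definable notions in the language of set theory, and transfer along an elementary embedding
-/

section SetTheory

universe u₃ u₄ u₅

variable {M : Type u₃} {N : Type u₄} [SetLang.Structure M] [SetLang.Structure N] {γ : Type u₅}
  {p : γ → M} {q : γ → N} {n : ℕ}

instance CoTerm.elem (j : M ↪ₑ[SetLang] N) (c : M) :
    CoTerm SetLang id j n (fun _ => c) (fun _ => j c) := CoTerm.param (p := id) (q := j) c

/-- Elementary embeddings transfer corresponding statements. -/
theorem CoDef.transfer (j : M ↪ₑ[SetLang] N) {P : (Fin n → M) → Prop} {Q : (Fin n → N) → Prop}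
    (h : CoDef SetLang id j n P Q) (v : Fin n → M) : P v ↔ Q (j ∘ v) := by
  obtain ⟨φ, hφ, hφ'⟩ := h
  rw [← hφ, ← hφ']
  exact (j.map_boundedFormula φ id v).symm

/-- The form in which transfer is used: parameters from `M` on the left correspond to their images
under `j` on the right, and the common formula is found by instance search. -/
theorem transfer (j : M ↪ₑ[SetLang] N) (P : Prop) (Q : Prop)
    [h : CoDef SetLang id j 0 (fun _ => P) (fun _ => Q)] : P ↔ Q := h.transfer j default

section

variable (f₁ f₂ f₃ : (Fin n → M) → M) (g₁ g₂ g₃ : (Fin n → N) → N)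
    [h₁ : CoTerm SetLang p q n f₁ g₁] [h₂ : CoTerm SetLang p q n f₂ g₂]
    [h₃ : CoTerm SetLang p q n f₃ g₃]

instance CoDef.mem : CoDef SetLang p q n (fun v => E (f₁ v) (f₂ v)) (fun v => E (g₁ v) (g₂ v)) :=
  CoDef.subst₂ (P := E) (Q := E) ((CoDef.rel (L := SetLang) (SetRel.mem : SetLang.Relations 2)
    (fun i v => v i) (fun i v => v i) (fun i => inferInstance)).congr
      (fun v => by unfold E; refine iff_of_eq (congrArg _ ?_); funext i; fin_cases i <;> rfl)
      (fun v => by unfold E; refine iff_of_eq (congrArg _ ?_); funext i; fin_cases i <;> rfl)) _ _ _ _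

instance CoDef.isPair : CoDef SetLang p q n (fun v => IsPair (f₁ v) (f₂ v) (f₃ v))
    (fun v => IsPair (g₁ v) (g₂ v) (g₃ v)) :=
  CoDef.subst₃ (by unfold IsPair; infer_instance) _ _ _ _ _ _

instance CoDef.related : CoDef SetLang p q n (fun v => Related (f₁ v) (f₂ v) (f₃ v))
    (fun v => Related (g₁ v) (g₂ v) (g₃ v)) :=
  CoDef.subst₃ (by unfold Related; infer_instance) _ _ _ _ _ _

instance CoDef.isInductive : CoDef SetLang p q n (fun v => IsInductive (f₁ v))
    (fun v => IsInductive (g₁ v)) :=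
  CoDef.subst₁ (by unfold IsInductive; infer_instance) _ _

instance CoDef.isNat : CoDef SetLang p q n (fun v => IsNat (f₁ v)) (fun v => IsNat (g₁ v)) :=
  CoDef.subst₁ (by unfold IsNat; infer_instance) _ _

instance CoDef.isFin : CoDef SetLang p q n (fun v => IsFin (f₁ v)) (fun v => IsFin (g₁ v)) :=
  CoDef.subst₁ (by unfold IsFin; infer_instance) _ _

end

/-- The members of `c` are exactly the entries of the tuple `a`. -/
def Lists {W : Type*} [SetLang.Structure W] {r : ℕ} (a : Fin r → W) (c : W) : Prop :=
  ∀ z, E z c ↔ ∃ i, z = a i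

instance CoDef.lists {r : ℕ} (f : Fin r → (Fin n → M) → M) (f' : (Fin n → M) → M)
    (g : Fin r → (Fin n → N) → N) (g' : (Fin n → N) → N)
    [h : ∀ i, CoTerm SetLang p q n (f i) (g i)] [h' : CoTerm SetLang p q n f' g'] :
    CoDef SetLang p q n (fun v => Lists (fun i => f i v) (f' v))
      (fun v => Lists (fun i => g i v) (g' v)) := by
  have : CoDef SetLang p q (r + 1)
    (fun v : Fin (r + 1) → M => Lists (fun i : Fin r => v i.castSucc) (v (Fin.last r)))
      (fun v => Lists (fun i : Fin r => v i.castSucc) (v (Fin.last r))) := by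
    unfold Lists; infer_instance
  have := this.subst (fun i => Fin.lastCases (motive := fun _ => (Fin n → M) → M) f' f i)
    (fun i => Fin.lastCases (motive := fun _ => (Fin n → N) → N) g' g i)
    (fun i => by refine Fin.lastCases ?_ (fun i => ?_) i <;> simp <;> infer_instance)
  simpa using this

/-- The members of `t` code the tuple `a`. -/
def Tuple {W : Type*} [SetLang.Structure W] {r : ℕ} (a : Fin r → W) (t : W) : Prop :=
  IsTuple (List.ofFn a) t

theorem CoDef.tuple_aux (r : ℕ) : CoDef SetLang p q (r + 1)
    (fun v => Tuple (fun i : Fin r => v i.succ) (v 0))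
    (fun v => Tuple (fun i : Fin r => v i.succ) (v 0)) := by
  induction r with
  | zero => simp only [Tuple, List.ofFn_zero, IsTuple]; infer_instance
  | succ r ih =>
    simp only [Tuple, List.ofFn_succ, IsTuple]
    have := ih.subst (n := r + 2 + 1) (Fin.cons (fun v => v (Fin.last _))
      (fun i v => v i.succ.succ.castSucc)) (Fin.cons (fun v => v (Fin.last _))
      (fun i v => v i.succ.succ.castSucc)) (fun i => by
        refine Fin.cases ?_ (fun i => ?_) i <;> simp <;> infer_instance)
    simp only [Fin.cons_zero, Fin.cons_succ, Tuple] at this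
    infer_instance

instance CoDef.tuple {r : ℕ} (f : Fin r → (Fin n → M) → M) (f' : (Fin n → M) → M)
    (g : Fin r → (Fin n → N) → N) (g' : (Fin n → N) → N)
    [h : ∀ i, CoTerm SetLang p q n (f i) (g i)] [h' : CoTerm SetLang p q n f' g'] :
    CoDef SetLang p q n (fun v => Tuple (fun i => f i v) (f' v))
      (fun v => Tuple (fun i => g i v) (g' v)) := by
  have := (CoDef.tuple_aux (p := p) (q := q) r).subst (Fin.cons f' f : Fin (r + 1) → (Fin n → M) → M)
    (Fin.cons g' g : Fin (r + 1) → (Fin n → N) → N)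
    (fun i => by refine Fin.cases ?_ (fun i => ?_) i <;> simp <;> infer_instance)
  simpa using this

/-- The distinctness of the entries of a tuple. -/
instance CoDef.injective {r : ℕ} (f : Fin r → (Fin n → M) → M) (g : Fin r → (Fin n → N) → N)
    [h : ∀ i, CoTerm SetLang p q n (f i) (g i)] :
    CoDef SetLang p q n (fun v => Function.Injective (fun i => f i v))
      (fun v => Function.Injective (fun i => g i v)) := by
  unfold Function.Injective; infer_instance

end SetTheory

/-! ### Transitive classes -/

/-- A transitive class which contains the empty set and is closed under adding elements. -/
structure GoodClass (V : Set ZFSet.{u}) : Prop where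
  trans : ∀ x ∈ V, ∀ y ∈ x, y ∈ V
  empty_mem : ∅ ∈ V
  insert_mem : ∀ x ∈ V, ∀ y ∈ V, insert x y ∈ V

section

variable {V : Set ZFSet.{u}}

@[simp]
theorem E_iff {x y : V} : E x y ↔ (x : ZFSet.{u}) ∈ (y : ZFSet.{u}) := Iff.rfl

/-- Kuratowski pairs are absolute for a transitive class that contains both `{x}` and `{x, y}`; if
one of these were missing, a set without it could pass for the pair. -/
theorem isPair_iff_of_mem (hV : ∀ x ∈ V, ∀ y ∈ x, y ∈ V) {x y p : V} (h : {x.1} ∈ V)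
    (h' : {x.1, y.1} ∈ V) : IsPair x y p ↔ p.1 = ZFSet.pair x y := by
  have single (z : V) : (∀ t : V, E t z ↔ t = x) ↔ z.1 = {x.1} := by
    constructor
    · intro hz
      ext t
      rw [ZFSet.mem_singleton]
      exact ⟨fun ht => congrArg Subtype.val ((hz ⟨t, hV _ z.2 _ ht⟩).1 ht),
        fun ht => by subst ht; exact (hz x).2 rfl⟩
    · intro hz t
      rw [E_iff, hz, ZFSet.mem_singleton, Subtype.ext_iff]
  have double (z : V) : (∀ t : V, E t z ↔ (t = x ∨ t = y)) ↔ z.1 = {x.1, y.1} := by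
    constructor
    · intro hz
      ext t
      rw [ZFSet.mem_pair]
      constructor
      · exact fun ht => ((hz ⟨t, hV _ z.2 _ ht⟩).1 ht).imp (congrArg Subtype.val)
          (congrArg Subtype.val)
      · rintro (rfl | rfl)
        · exact (hz x).2 (Or.inl rfl)
        · exact (hz y).2 (Or.inr rfl)
    · intro hz t
      rw [E_iff, hz, ZFSet.mem_pair, Subtype.ext_iff, Subtype.ext_iff]
  simp only [IsPair, single, double]
  constructor
  · intro hp
    ext z
    rw [ZFSet.pair, ZFSet.mem_pair]
    constructor
    · exact fun hz => (hp ⟨z, hV _ p.2 _ hz⟩).1 hz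
    · rintro (rfl | rfl)
      · exact (hp ⟨_, h⟩).2 (Or.inl rfl)
      · exact (hp ⟨_, h'⟩).2 (Or.inr rfl)
  · intro hp z
    rw [E_iff, hp, ZFSet.pair, ZFSet.mem_pair]


/-- Hereditarily finite sets. -/
def IsHF (x : ZFSet.{u}) : Prop := x.Hereditarily fun y => {z | z ∈ y}.Finite

theorem isHF_iff {x : ZFSet.{u}} : IsHF x ↔ {z | z ∈ x}.Finite ∧ ∀ y ∈ x, IsHF y :=
  ZFSet.hereditarily_iff

theorem IsHF.insert {x y : ZFSet.{u}} (hx : IsHF x) (hy : IsHF y) : IsHF (insert x y) := by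
  rw [isHF_iff] at hy ⊢
  refine ⟨(hy.1.insert x).subset fun z hz => by simpa using hz, fun z hz => ?_⟩
  rcases ZFSet.mem_insert_iff.1 hz with rfl | hz
  exacts [hx, hy.2 _ hz]

theorem isHF_empty : IsHF (∅ : ZFSet.{u}) := by
  rw [isHF_iff]; simp

/-- Every finite set of sets is the set of members of a set. -/
theorem exists_mem_iff_of_finite {s : Set ZFSet.{u}} (hs : s.Finite) :
    ∃ y : ZFSet.{u}, ∀ z, z ∈ y ↔ z ∈ s := by
  induction s, hs using Set.Finite.induction_on with
  | empty => exact ⟨∅, by simp⟩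
  | @insert a s _ _ ih =>
    obtain ⟨y, hy⟩ := ih
    exact ⟨insert a y, by simp [hy]⟩

namespace GoodClass

theorem ext (hV : GoodClass V) {x y : V} (h : ∀ z : V, E z x ↔ E z y) : x = y := by
  refine Subtype.ext (ZFSet.ext fun z => ⟨fun hz => ?_, fun hz => ?_⟩)
  · exact (h ⟨z, hV.trans _ x.2 _ hz⟩).1 hz
  · exact (h ⟨z, hV.trans _ y.2 _ hz⟩).2 hz

theorem mem_of_finite (hV : GoodClass V) {x : ZFSet.{u}} (h : {z | z ∈ x}.Finite)
    (h' : ∀ z ∈ x, z ∈ V) : x ∈ V := by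
  have key : ∀ s : Set ZFSet.{u}, s.Finite → s ⊆ V → ∃ y ∈ V, ∀ z, z ∈ y ↔ z ∈ s := by
    intro s hs
    induction s, hs using Set.Finite.induction_on with
    | empty => exact fun _ => ⟨∅, hV.empty_mem, by simp⟩
    | @insert a s _ _ ih =>
      intro h
      obtain ⟨y, hy, hy'⟩ := ih ((Set.subset_insert _ _).trans h)
      exact ⟨insert a y, hV.insert_mem _ (h (Set.mem_insert _ _)) _ hy, by simp [hy']⟩
  obtain ⟨y, hy, hy'⟩ := key _ h h'
  rwa [show x = y from ZFSet.ext fun z => (hy' z).symm]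

theorem mem_of_isHF (hV : GoodClass V) {x : ZFSet.{u}} (h : IsHF x) : x ∈ V := by
  induction x using ZFSet.inductionOn with
  | _ x ih =>
    rw [isHF_iff] at h
    exact hV.mem_of_finite h.1 fun z hz => ih z hz (h.2 z hz)

theorem pair_mem (hV : GoodClass V) {x y : ZFSet.{u}} (hx : x ∈ V) (hy : y ∈ V) :
    ZFSet.pair x y ∈ V := by
  have (z : ZFSet.{u}) (hz : z ∈ V) : ({z} : ZFSet.{u}) ∈ V := by
    have := hV.insert_mem _ hz _ hV.empty_mem
    rwa [show insert z (∅ : ZFSet.{u}) = {z} from by ext; simp] at this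
  exact hV.insert_mem _ (this _ hx) _ (this _ (hV.insert_mem _ hx _ (this _ hy)))

theorem isPair_iff (hV : GoodClass V) {x y p : V} : IsPair x y p ↔ p.1 = ZFSet.pair x y := by
  have (z : ZFSet.{u}) (hz : z ∈ V) : ({z} : ZFSet.{u}) ∈ V := by
    have := hV.insert_mem _ hz _ hV.empty_mem
    rwa [show insert z (∅ : ZFSet.{u}) = {z} from by ext; simp] at this
  exact isPair_iff_of_mem hV.trans (this _ x.2) (hV.insert_mem _ x.2 _ (this _ y.2))

theorem related_iff (hV : GoodClass V) {r x y : V} : Related r x y ↔ ZFSet.pair x y ∈ r.1 := by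
  simp only [Related, hV.isPair_iff, E_iff]
  exact ⟨fun ⟨p, hp, h⟩ => hp ▸ h, fun h => ⟨⟨_, hV.pair_mem x.2 y.2⟩, rfl, h⟩⟩

theorem isTuple_iff (hV : GoodClass V) {l : List V} {t : V} :
    IsTuple l t ↔ t.1 = tupleCode (l.map Subtype.val) := by
  induction l generalizing t with
  | nil =>
    simp only [IsTuple, E_iff, List.map_nil, tupleCode]
    rw [ZFSet.eq_empty]
    exact ⟨fun h y hy => h ⟨y, hV.trans _ t.2 _ hy⟩ hy, fun h z hz => h _ hz⟩
  | cons a l ih =>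
    simp only [IsTuple, ih, hV.isPair_iff, List.map_cons, tupleCode]
    constructor
    · rintro ⟨s, hs, ht⟩
      rw [ht, hs]
    · intro ht
      -- The code of the tail is a member of a member of `t`, hence it belongs to `V` by
      -- transitivity.
      have h1 : ({a.1, tupleCode (l.map Subtype.val)} : ZFSet.{u}) ∈ V :=
        hV.trans _ t.2 _ (by rw [ht, ZFSet.pair]; simp)
      have h2 := hV.trans _ h1 (tupleCode (l.map Subtype.val)) (by simp)
      exact ⟨⟨_, h2⟩, rfl, ht⟩

theorem tupleCode_mem (hV : GoodClass V) (l : List V) : tupleCode (l.map Subtype.val) ∈ V := by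
  induction l with
  | nil => exact hV.empty_mem
  | cons a l ih => exact hV.pair_mem a.2 ih

theorem tuple_iff (hV : GoodClass V) {r : ℕ} {a : Fin r → V} {t : V} :
    Tuple a t ↔ t.1 = tupleCode (List.ofFn fun i => (a i).1) := by
  rw [Tuple, hV.isTuple_iff, List.map_ofFn]; rfl

theorem natCode_isHF (n : ℕ) : IsHF (natCode n : ZFSet.{u}) := by
  induction n with
  | zero => exact isHF_empty
  | succ n ih => exact ih.insert ih

theorem exists_of_finite (hV : GoodClass V) {s : Set V} (hs : s.Finite) :
    ∃ y : V, ∀ z, E z y ↔ z ∈ s := by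
  obtain ⟨y, hy⟩ := exists_mem_iff_of_finite (hs.image Subtype.val)
  refine ⟨⟨y, hV.mem_of_finite ((hs.image Subtype.val).subset fun z hz => (hy z).1 hz) ?_⟩, ?_⟩
  · intro z hz
    obtain ⟨x, -, rfl⟩ := (hy z).1 hz
    exact x.2
  · intro z
    rw [E_iff, hy, Subtype.val_injective.mem_set_image]

end GoodClass

theorem mem_natCode {x : ZFSet.{u}} {n : ℕ} : x ∈ natCode n ↔ ∃ m < n, x = natCode m := by
  induction n with
  | zero => simp [natCode]
  | succ n ih =>
    simp only [natCode, ZFSet.mem_insert_iff, ih]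
    constructor
    · rintro (rfl | ⟨m, hm, rfl⟩)
      · exact ⟨n, by omega, rfl⟩
      · exact ⟨m, by omega, rfl⟩
    · rintro ⟨m, hm, rfl⟩
      rcases Nat.lt_succ_iff_lt_or_eq.1 hm with h | h
      · exact Or.inr ⟨m, h, rfl⟩
      · exact Or.inl (by rw [h])

theorem natCode_injective : Function.Injective (natCode : ℕ → ZFSet.{u}) := by
  have (m n : ℕ) (h : m < n) : (natCode m : ZFSet.{u}) ≠ natCode n := fun he =>
    ZFSet.mem_irrefl (natCode n : ZFSet.{u}) (mem_natCode.2 ⟨m, h, he.symm⟩)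
  intro m n h
  rcases lt_trichotomy m n with h' | h' | h'
  exacts [(this _ _ h' h).elim, h', (this _ _ h' h.symm).elim]

theorem natCode_mem_natCode {m n : ℕ} : (natCode m : ZFSet.{u}) ∈ natCode n ↔ m < n := by
  rw [mem_natCode]
  exact ⟨fun ⟨i, hi, h⟩ => natCode_injective h ▸ hi, fun h => ⟨m, h, rfl⟩⟩

end

/-! ### Transitive models of set theory without power set -/

instance CoTerm.elem_id {M : Type*} [SetLang.Structure M] {n : ℕ} (c : M) :
    CoTerm SetLang (id : M → M) (id : M → M) n (fun _ => c) (fun _ => c) :=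
  CoTerm.param (p := id) (q := id) c

/-- Taken from a structure to itself with all elements as parameters, `CoDef` says that a predicate
is definable. In this way instance search also supplies the hypotheses of separation and collection.
-/
theorem CoDef.definable {M : Type*} [SetLang.Structure M] {n : ℕ} {P Q : (Fin n → M) → Prop}
    (h : CoDef SetLang (id : M → M) (id : M → M) n P Q) :
    (Set.univ : Set M).Definable SetLang {v | P v} := by
  obtain ⟨φ, hφ, -⟩ := h
  rw [Set.definable_iff_exists_formula_sum]
  refine ⟨φ.toFormula.relabel (Sum.map (fun c => ⟨c, trivial⟩) id), ?_⟩
  ext v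
  simp only [Set.mem_ofPred_eq, Formula.realize_relabel, BoundedFormula.realize_toFormula, ← hφ]
  rfl

namespace IsTransitiveModel

variable {V : Set ZFSet.{u}}

theorem good (hV : IsTransitiveModel V) : GoodClass V := by
  have pairing (x y : V) : ({x.1, y.1} : ZFSet.{u}) ∈ V := by
    obtain ⟨p, hp⟩ := hV.2.pairing x y
    rw [show ({x.1, y.1} : ZFSet.{u}) = p from ?_]
    · exact p.2
    ext z
    rw [ZFSet.mem_pair]
    constructor
    · rintro (rfl | rfl)
      · exact (hp x).2 (Or.inl rfl)
      · exact (hp y).2 (Or.inr rfl)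
    · exact fun hz => ((hp ⟨z, hV.1 _ p.2 _ hz⟩).1 hz).imp (congrArg Subtype.val)
          (congrArg Subtype.val)
  refine ⟨hV.1, ?_, fun x hx y hy => ?_⟩
  · obtain ⟨I, ⟨e, -, he⟩, -⟩ := hV.2.infinity
    rw [show (∅ : ZFSet.{u}) = e from ?_]
    · exact e.2
    · rw [eq_comm, ZFSet.eq_empty]
      exact fun z hz => he ⟨z, hV.1 _ e.2 _ hz⟩ hz
  -- The set `insert x y` is the union of `{{x}, y}`.
  · obtain ⟨u, hu⟩ := hV.2.union ⟨_, pairing ⟨_, pairing ⟨x, hx⟩ ⟨x, hx⟩⟩ ⟨y, hy⟩⟩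
    rw [show (insert x y : ZFSet.{u}) = u from ?_]
    · exact u.2
    ext z
    rw [ZFSet.mem_insert_iff]
    constructor
    · rintro (rfl | h)
      · exact (hu ⟨z, hx⟩).2 ⟨⟨_, pairing ⟨z, hx⟩ ⟨z, hx⟩⟩, by simp, by simp⟩
      · exact (hu ⟨z, hV.1 _ hy _ h⟩).2 ⟨⟨y, hy⟩, by simp, h⟩
    · intro h
      obtain ⟨t, ht, h'⟩ := (hu ⟨z, hV.1 _ u.2 _ h⟩).1 h
      simp only [E_iff, ZFSet.mem_pair] at ht h'
      rcases ht with ht | ht <;> rw [ht] at h' <;> simp_all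

theorem separation (hV : IsTransitiveModel V) (D : V → Prop)
    [h : CoDef SetLang (id : V → V) (id : V → V) 1 (fun v => D (v 0)) (fun v => D (v 0))] (x : V) :
    ∃ y : V, ∀ z : V, E z y ↔ (E z x ∧ D z) :=
  hV.2.separation {z | D z} h.definable x

theorem collection (hV : IsTransitiveModel V) (R : V → V → Prop)
    [h : CoDef SetLang (id : V → V) (id : V → V) 2 (fun v => R (v 0) (v 1))
      (fun v => R (v 0) (v 1))] (x : V) (h' : ∀ z, E z x → ∃ t, R z t) :
    ∃ y : V, ∀ z : V, E z x → ∃ t, E t y ∧ R z t :=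
  hV.2.collection {z | R z.1 z.2} h.definable x h'

/-- The natural numbers of `V`. -/
def nat (hV : IsTransitiveModel V) (n : ℕ) : V := ⟨natCode n, hV.good.mem_of_isHF
  (GoodClass.natCode_isHF n)⟩

theorem isNat_iff (hV : IsTransitiveModel V) {x : V} : IsNat x ↔ ∃ n, x = hV.nat n := by
  constructor
  · obtain ⟨x, hx⟩ := x
    induction x using ZFSet.inductionOn with
    | _ x ih =>
    intro h
    by_cases h0 : x = ∅
    · exact ⟨0, Subtype.ext h0⟩
    obtain ⟨I, hI⟩ := hV.2.infinity
    -- If `x` were neither empty nor the successor of a natural number, the natural numbers other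
    -- than `x` would still form an inductive set, and `x` would not belong to it.
    obtain ⟨J, hJ⟩ := hV.separation (fun z => IsNat z ∧ z ≠ ⟨x, hx⟩) I
    have hxJ : ¬ IsInductive J := fun hJ' => ((hJ _).1 (h J hJ')).2.2 rfl
    obtain ⟨y, hy, hyx⟩ : ∃ y : V, IsNat y ∧ insert y.1 y.1 = x := by
      by_contra! hne
      refine hxJ ⟨⟨⟨∅, hV.good.empty_mem⟩, (hJ _).2 ⟨?_, ?_, ?_⟩, fun z => by simp⟩, ?_⟩
      · obtain ⟨⟨e, he, he'⟩, -⟩ := hI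
        rwa [show (⟨∅, hV.good.empty_mem⟩ : V) = e from hV.good.ext fun z => by simp [he'] ]
      · rintro K ⟨⟨e, he, he'⟩, -⟩
        rwa [show (⟨∅, hV.good.empty_mem⟩ : V) = e from hV.good.ext fun z => by simp [he'] ]
      · rw [Ne, Subtype.ext_iff, eq_comm]
        exact h0
      · intro y hy
        obtain ⟨hyI, hy, hyx⟩ := (hJ y).1 hy
        have hsucc (K : V) (hK : IsInductive K) (hy : E y K) :
            (insert y.1 y.1 : ZFSet.{u}) ∈ K.1 := by
          obtain ⟨s, hs, hs'⟩ := hK.2 y hy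
          rwa [show (insert y.1 y.1 : ZFSet.{u}) = s from ?_]
          ext z
          rw [ZFSet.mem_insert_iff]
          constructor
          · rintro (rfl | hz)
            · exact (hs' y).2 (Or.inr rfl)
            · exact (hs' ⟨z, hV.1 _ y.2 _ hz⟩).2 (Or.inl hz)
          · intro hz
            exact ((hs' ⟨z, hV.1 _ s.2 _ hz⟩).1 hz).symm.imp (congrArg Subtype.val) id
        refine ⟨⟨insert y.1 y.1, hV.good.insert_mem _ y.2 _ y.2⟩, (hJ _).2 ⟨?_, ?_, ?_⟩, ?_⟩
        · exact hsucc I hI hyI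
        · exact fun K hK => hsucc K hK (hy K hK)
        · rw [Ne, Subtype.ext_iff]
          exact hne y hy
        · intro z
          rw [E_iff, ZFSet.mem_insert_iff, Subtype.ext_iff, or_comm]
          rfl
    subst hyx
    obtain ⟨n, hn⟩ := ih y.1 (ZFSet.mem_insert _ _) y.2 hy
    have hn : y.1 = natCode n := congrArg Subtype.val hn
    exact ⟨n + 1, Subtype.ext (by simp only [hn]; rfl)⟩
  · rintro ⟨n, rfl⟩ I hI
    induction n with
    | zero =>
      obtain ⟨⟨e, he, he'⟩, -⟩ := hI
      rwa [show hV.nat 0 = e from hV.good.ext fun z => by simp [he', nat, natCode] ]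
    | succ n ih =>
      obtain ⟨s, hs, hs'⟩ := hI.2 _ ih
      rwa [show hV.nat (n + 1) = s from hV.good.ext fun z => by
        rw [hs', E_iff, Subtype.ext_iff]; exact ((ZFSet.mem_insert_iff (y := natCode n)).trans or_comm) ]

/-- The natural numbers of `V` are the standard ones, and `V` contains all finite sets of its
elements, in particular the graphs of enumerations of finite sets. -/
theorem isFin_iff (hV : IsTransitiveModel V) {X : V} : IsFin X ↔ {z : V | E z X}.Finite := by
  constructor
  · rintro ⟨m, f, hm, h1, h2⟩
    obtain ⟨m, rfl⟩ := hV.isNat_iff.1 hm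
    have : Nonempty V := ⟨X⟩
    refine ((Set.finite_lt_nat m).image fun i => Classical.epsilon fun y =>
      E y X ∧ Related f (hV.nat i) y).subset fun y hy => ?_
    obtain ⟨i, ⟨hi, hiy⟩, -⟩ := h2 y hy
    obtain ⟨i', hi', h⟩ := mem_natCode.1 hi
    obtain rfl : i = hV.nat i' := Subtype.ext h
    refine ⟨i', hi', ?_⟩
    obtain ⟨y', -, hy''⟩ := h1 _ hi
    have := Classical.epsilon_spec (p := fun y => E y X ∧ Related f (hV.nat i') y) ⟨y, hy, hiy⟩
    exact (hy'' _ this).trans (hy'' _ ⟨hy, hiy⟩).symm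
  · intro h
    obtain ⟨m, ⟨e⟩⟩ := @Finite.exists_equiv_fin _ h.to_subtype
    obtain ⟨f, hf⟩ := hV.good.exists_of_finite (Set.finite_range fun i : Fin m =>
      (⟨ZFSet.pair (natCode i) (e.symm i).1.1, hV.good.pair_mem (hV.nat i).2 (e.symm i).1.2⟩ : V))
    have hf' (i : ℕ) (y : V) : Related f (hV.nat i) y ↔ ∃ h : i < m, y = e.symm ⟨i, h⟩ := by
      rw [hV.good.related_iff]
      refine (hf ⟨_, hV.good.pair_mem (hV.nat i).2 y.2⟩).trans ?_
      simp only [Set.mem_range, Subtype.mk.injEq, nat, ZFSet.pair_inj]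
      constructor
      · rintro ⟨l, hl, hl'⟩
        obtain rfl := natCode_injective hl
        exact ⟨l.2, Subtype.ext hl'.symm⟩
      · rintro ⟨hi, rfl⟩
        exact ⟨⟨i, hi⟩, rfl, rfl⟩
    refine ⟨hV.nat m, f, hV.isNat_iff.2 ⟨m, rfl⟩, ?_, ?_⟩
    · intro i hi
      obtain ⟨i', hi', h⟩ := mem_natCode.1 hi
      obtain rfl : i = hV.nat i' := Subtype.ext h
      refine ⟨_, ⟨(e.symm ⟨i', hi'⟩).2, (hf' _ _).2 ⟨hi', rfl⟩⟩, ?_⟩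
      rintro y ⟨-, hy⟩
      exact ((hf' _ _).1 hy).2
    · intro y hy
      refine ⟨hV.nat (e ⟨y, hy⟩), ⟨natCode_mem_natCode.2 (e ⟨y, hy⟩).2,
        (hf' _ _).2 ⟨(e ⟨y, hy⟩).2, by simp⟩⟩, ?_⟩
      rintro i ⟨hi, hi'⟩
      obtain ⟨i', hi'', h⟩ := mem_natCode.1 hi
      obtain rfl : i = hV.nat i' := Subtype.ext h
      obtain ⟨_, rfl⟩ := (hf' _ _).1 hi'
      simp

/-- The set `ω` belongs to `V`. -/
theorem exists_omega (hV : IsTransitiveModel V) : ∃ o : V, ∀ z, E z o ↔ ∃ n, z = hV.nat n := by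
  obtain ⟨I, hI⟩ := hV.2.infinity
  obtain ⟨o, ho⟩ := hV.separation IsNat I
  exact ⟨o, fun z => by rw [ho, hV.isNat_iff]; exact ⟨fun h => h.2, fun h =>
    ⟨hV.isNat_iff.2 h I hI, h⟩⟩⟩

end IsTransitiveModel

/-! ### Hereditarily finite sets -/

/-- The relation `r` ranks sets by indices: members of a set have smaller indices. -/
def IsRanking {W : Type*} [SetLang.Structure W] (r : W) : Prop :=
  ∀ i y, Related r i y → ∀ z, E z y → ∃ i', E i' i ∧ Related r i' z

/-- `x` has index `m` in some ranking. -/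
def HasRank {W : Type*} [SetLang.Structure W] (m x : W) : Prop :=
  ∃ r, IsRanking r ∧ Related r m x

instance CoDef.hasRank {M N γ : Type*} [SetLang.Structure M] [SetLang.Structure N] {n : ℕ}
    {p : γ → M} {q : γ → N}
    (f₁ f₂ : (Fin n → M) → M) (g₁ g₂ : (Fin n → N) → N)
    [h₁ : CoTerm SetLang p q n f₁ g₁] [h₂ : CoTerm SetLang p q n f₂ g₂] :
    CoDef SetLang p q n (fun v => HasRank (f₁ v) (f₂ v)) (fun v => HasRank (g₁ v) (g₂ v)) :=
  CoDef.subst₂ (by unfold HasRank IsRanking; infer_instance) _ _ _ _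

theorem IsHF.exists_ranking {x : ZFSet.{u}} (h : IsHF x) : ∃ r : Set (ℕ × ZFSet.{u}), r.Finite ∧
    (∀ a ∈ r, IsHF a.2 ∧ ∀ z ∈ a.2, ∃ i < a.1, (i, z) ∈ r) ∧ ∃ m, (m, x) ∈ r := by
  induction x using ZFSet.inductionOn with
  | _ x ih =>
  have hfin := (isHF_iff.1 h).1
  have hmem := (isHF_iff.1 h).2
  choose! r hr hr' m hm using fun z (hz : z ∈ x) => ih z hz (hmem z hz)
  obtain ⟨b, hb⟩ := (hfin.image m).bddAbove
  -- The rankings of the members are merged, and `x` receives an index above the indices of all its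
  -- members.
  refine ⟨Insert.insert (b + 1, x) (⋃ z ∈ {z | z ∈ x}, r z), (hfin.biUnion hr).insert _, ?_, b + 1,
    Set.mem_insert _ _⟩
  rintro a (rfl | ha)
  · refine ⟨h, fun z hz => ⟨m z, ?_, Or.inr (Set.mem_biUnion hz (hm z hz))⟩⟩
    exact Nat.lt_succ_of_le (hb ⟨z, hz, rfl⟩)
  · obtain ⟨y, hy, ha⟩ := Set.mem_iUnion₂.1 ha
    refine ⟨(hr' y hy a ha).1, fun z hz => ?_⟩
    obtain ⟨i, hi, hi'⟩ := (hr' y hy a ha).2 z hz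
    exact ⟨i, hi, Or.inr (Set.mem_biUnion hy hi')⟩

namespace IsTransitiveModel

variable {V : Set ZFSet.{u}}

theorem exists_hasRank (hV : IsTransitiveModel V) {x : V} (h : IsHF x.1) :
    ∃ m, HasRank (hV.nat m) x := by
  obtain ⟨r, hr, hr', m, hm⟩ := h.exists_ranking
  have hmem (a : ℕ × ZFSet.{u}) (ha : a ∈ r) : ZFSet.pair (natCode a.1) a.2 ∈ V :=
    hV.good.pair_mem (hV.nat a.1).2 (hV.good.mem_of_isHF (hr' a ha).1)
  have := hr.to_subtype
  obtain ⟨s, hs⟩ := hV.good.exists_of_finite (Set.finite_range fun a : r =>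
    (⟨_, hmem a.1 a.2⟩ : V))
  have hs' (i y : V) : Related s i y ↔ ∃ a ∈ r, i.1 = natCode a.1 ∧ y.1 = a.2 := by
    rw [hV.good.related_iff]
    refine (hs ⟨_, hV.good.pair_mem i.2 y.2⟩).trans ?_
    simp [ZFSet.pair_inj, eq_comm, and_comm]
  refine ⟨m, s, ?_, (hs' _ _).2 ⟨_, hm, rfl, rfl⟩⟩
  intro i y hiy z hz
  obtain ⟨a, ha, hi, hy⟩ := (hs' _ _).1 hiy
  rw [E_iff, hy] at hz
  obtain ⟨l, hl, hlr⟩ := (hr' a ha).2 _ hz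
  refine ⟨hV.nat l, ?_, (hs' _ _).2 ⟨_, hlr, rfl, rfl⟩⟩
  rw [E_iff, hi]
  exact natCode_mem_natCode.2 hl

theorem hasRank_lt (hV : IsTransitiveModel V) {m : ℕ} {x : V} (h : HasRank (hV.nat m) x) (z : V)
    (hz : E z x) : ∃ l < m, HasRank (hV.nat l) z := by
  obtain ⟨r, hr, hr'⟩ := h
  obtain ⟨i, hi, hiz⟩ := hr _ _ hr' z hz
  obtain ⟨l, hl, h⟩ := mem_natCode.1 hi
  obtain rfl : i = hV.nat l := Subtype.ext h
  exact ⟨l, hl, r, hr, hiz⟩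

/-- A set of index `m` is determined by its members, and these have indices below `m`, which leaves
finitely many possibilities by induction. -/
theorem finite_setOf_hasRank (hV : IsTransitiveModel V) (m : ℕ) :
    {x : V | HasRank (hV.nat m) x}.Finite := by
  induction m using Nat.strong_induction_on with
  | _ m ih =>
  have hB : (⋃ l ∈ {l | l < m}, {x : V | HasRank (hV.nat l) x}).Finite :=
    (Set.finite_lt_nat m).biUnion fun l hl => ih l hl
  refine Set.Finite.of_finite_image (f := fun x => {z : V | E z x}) (hB.finite_subsets.subset ?_)
    fun x _ y _ hxy => hV.good.ext fun z => Set.ext_iff.1 hxy z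
  rintro _ ⟨x, hx, rfl⟩ z hz
  obtain ⟨l, hl, h⟩ := hV.hasRank_lt hx z hz
  exact Set.mem_biUnion hl h

theorem isHF_of_hasRank (hV : IsTransitiveModel V) {m : ℕ} {x : V} (h : HasRank (hV.nat m) x) :
    IsHF x.1 := by
  induction m using Nat.strong_induction_on generalizing x with
  | _ m ih =>
  have hB : (⋃ l ∈ {l | l < m}, {x : V | HasRank (hV.nat l) x}).Finite :=
    (Set.finite_lt_nat m).biUnion fun l _ => hV.finite_setOf_hasRank l
  rw [isHF_iff]
  refine ⟨(hB.image Subtype.val).subset fun z hz => ?_, fun z hz => ?_⟩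
  · obtain ⟨l, hl, h⟩ := hV.hasRank_lt h ⟨z, hV.1 _ x.2 _ hz⟩ hz
    exact ⟨_, Set.mem_biUnion hl h, rfl⟩
  · obtain ⟨l, hl, h⟩ := hV.hasRank_lt h ⟨z, hV.1 _ x.2 _ hz⟩ hz
    exact ih l hl h

/-- The set of hereditarily finite sets belongs to `V`. -/
theorem exists_hf (hV : IsTransitiveModel V) : ∃ o : V, ∀ z, E z o ↔ IsHF z.1 := by
  obtain ⟨o, ho⟩ := hV.exists_omega
  -- There is no power set from which to separate the hereditarily finite sets. Instead, collection
  -- gathers, for each `m`, a set that contains all the finitely many sets of index `m`.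
  obtain ⟨Y, hY⟩ := hV.collection (fun m y => ∀ x, HasRank m x → E x y) o (fun z hz => by
    obtain ⟨m, rfl⟩ := (ho z).1 hz
    obtain ⟨y, hy⟩ := hV.good.exists_of_finite (hV.finite_setOf_hasRank m)
    exact ⟨y, fun x hx => (hy x).2 hx⟩)
  obtain ⟨U, hU⟩ := hV.2.union Y
  obtain ⟨o', ho'⟩ := hV.separation (fun x => ∃ m, IsNat m ∧ HasRank m x) U
  refine ⟨o', fun z => (ho' z).trans ⟨?_, fun hz => ?_⟩⟩
  · rintro ⟨-, m, hm, h⟩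
    obtain ⟨m, rfl⟩ := hV.isNat_iff.1 hm
    exact hV.isHF_of_hasRank h
  · obtain ⟨m, hm⟩ := hV.exists_hasRank hz
    obtain ⟨t, ht, ht'⟩ := hY (hV.nat m) ((ho _).2 ⟨m, rfl⟩)
    exact ⟨(hU z).2 ⟨t, ht, ht' z hm⟩, _, hV.isNat_iff.2 ⟨m, rfl⟩, hm⟩

/-- A class of hereditarily finite sets which is definable in `V` is a set of `V`. -/
theorem mem_of_definable (hV : IsTransitiveModel V) (D : V → Prop)
    [h : CoDef SetLang (id : V → V) (id : V → V) 1 (fun v => D (v 0)) (fun v => D (v 0))]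
    (x : ZFSet.{u}) (h : ∀ z, z ∈ x ↔ ∃ hz : z ∈ V, IsHF z ∧ D ⟨z, hz⟩) : x ∈ V := by
  obtain ⟨o, ho⟩ := hV.exists_hf
  obtain ⟨y, hy⟩ := hV.separation D o
  rw [show x = y from ?_]
  · exact y.2
  ext z
  rw [h]
  constructor
  · rintro ⟨hz, hz', hD⟩
    exact (hy ⟨z, hz⟩).2 ⟨(ho _).2 hz', hD⟩
  · intro hz
    have := (hy ⟨z, hV.1 _ y.2 _ hz⟩).1 hz
    exact ⟨_, (ho _).1 this.1, this.2⟩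

end IsTransitiveModel

/-! ### Codes of finite sets -/

theorem exists_injective_tuple {α : Type*} [DecidableEq α] {m : ℕ} {s : Finset α}
    (h : s.card = m) : ∃ a : Fin m → α, Function.Injective a ∧ Finset.univ.image a = s ∧
      Set.range a = s := by
  obtain ⟨e⟩ : Nonempty (Fin m ≃ s) := ⟨(s.equivFinOfCardEq h).symm⟩
  have : Set.range (fun i => (e i : α)) = s := by
    ext x
    exact ⟨by rintro ⟨i, rfl⟩; exact (e i).2, fun hx => ⟨e.symm ⟨x, hx⟩, by simp⟩⟩
  refine ⟨fun i => e i, Subtype.val_injective.comp e.injective, ?_, this⟩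
  rw [← Finset.coe_inj, ← this]
  simp

theorem mem_codeSet {α : Type} {c : α → ZFSet.{u}} {s : Set α} {z : ZFSet.{u}} :
    z ∈ codeSet c s ↔ ∃ a ∈ s, c a = z := by
  simp [codeSet]

theorem codeSet_injective {α : Type} {c : α → ZFSet.{u}} (hc : Function.Injective c) :
    Function.Injective (codeSet c) := by
  intro s t h
  ext a
  have := congrArg (c a ∈ ·) h
  simpa [mem_codeSet, hc.eq_iff] using this

theorem mem_codeSet_iff {α : Type} {c : α → ZFSet.{u}} (hc : Function.Injective c) {s : Set α}
    {a : α} : c a ∈ codeSet c s ↔ a ∈ s := by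
  simp [mem_codeSet, hc.eq_iff]

theorem isHF_codeSet {α : Type} {c : α → ZFSet.{u}} {s : Set α} (hs : s.Finite)
    (h : ∀ a, IsHF (c a)) : IsHF (codeSet c s) := by
  rw [isHF_iff]
  refine ⟨(hs.image c).subset fun z hz => mem_codeSet.1 hz, fun z hz => ?_⟩
  obtain ⟨a, -, rfl⟩ := mem_codeSet.1 hz
  exact h a

theorem finsetCode_injective : Function.Injective (finsetCode : Finset ℕ → ZFSet.{u}) :=
  (codeSet_injective natCode_injective).comp Finset.coe_injective

theorem isHF_finsetCode (s : Finset ℕ) : IsHF (finsetCode s : ZFSet.{u}) :=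
  isHF_codeSet s.finite_toSet GoodClass.natCode_isHF

theorem mem_finsetCode {s : Finset ℕ} {z : ZFSet.{u}} :
    z ∈ finsetCode s ↔ ∃ a ∈ s, natCode a = z := mem_codeSet

/-- The code of a set of `m` natural numbers. -/
def subCode (m : ℕ) (c : Sub m) : ZFSet.{u} := finsetCode c.1

theorem subCode_injective (m : ℕ) : Function.Injective (subCode m : Sub m → ZFSet.{u}) :=
  finsetCode_injective.comp Subtype.val_injective

theorem mem_indexCode {k : ℕ} {z : ZFSet.{u}} :
    z ∈ indexCode k ↔ ∃ c : Sub (k - 1), subCode (k - 1) c = z := by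
  simp [indexCode, mem_codeSet, subCode]

namespace IsTransitiveModel

variable {V : Set ZFSet.{u}}

/-- The code of a finite set of natural numbers, as an element of `V`. -/
def finset (hV : IsTransitiveModel V) (s : Finset ℕ) : V :=
  ⟨finsetCode s, hV.good.mem_of_isHF (isHF_finsetCode s)⟩

theorem nat_injective (hV : IsTransitiveModel V) : Function.Injective hV.nat :=
  fun _ _ h => natCode_injective (congrArg Subtype.val h)

theorem lists_nat_iff (hV : IsTransitiveModel V) {r : ℕ} {a : Fin r → ℕ} {c : V} :
    Lists (fun i => hV.nat (a i)) c ↔ c = hV.finset (Finset.univ.image a) := by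
  rw [Lists]
  constructor
  · intro h
    refine hV.good.ext fun z => (h z).trans ?_
    simp only [E_iff, finset, mem_finsetCode, Finset.mem_image, Finset.mem_univ, true_and,
      exists_exists_eq_and, Subtype.ext_iff]
    simp [nat, eq_comm]
  · rintro rfl z
    simp only [E_iff, finset, mem_finsetCode, Finset.mem_image, Finset.mem_univ, true_and,
      exists_exists_eq_and, Subtype.ext_iff]
    simp [nat, eq_comm]

theorem indexCode_mem (hV : IsTransitiveModel V) (k : ℕ) : indexCode k ∈ V := by
  obtain ⟨o, ho⟩ := hV.exists_omega
  refine hV.mem_of_definable (fun z => ∃ a : Fin (k - 1) → V, Function.Injective a ∧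
    (∀ i, E (a i) o) ∧ Lists a z) _ fun z => ?_
  simp only [indexCode, mem_codeSet, Set.mem_univ, true_and, ho]
  constructor
  · rintro ⟨c, rfl⟩
    obtain ⟨a, ha, ha', -⟩ := exists_injective_tuple c.2
    exact ⟨(hV.finset c).2, isHF_finsetCode _, fun i => hV.nat (a i), hV.nat_injective.comp ha,
      fun i => ⟨_, rfl⟩, hV.lists_nat_iff.2 (by rw [ha']; rfl)⟩
  · rintro ⟨hz, -, a, ha, ha', hL⟩
    choose b hb using ha'
    obtain rfl : a = fun i => hV.nat (b i) := funext hb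
    have hb' : Function.Injective b := ha.of_comp (f := hV.nat)
    refine ⟨⟨Finset.univ.image b, by rw [Finset.card_image_of_injective _ hb']; simp⟩, ?_⟩
    exact (congrArg Subtype.val (hV.lists_nat_iff.1 hL)).symm

/-- A finite set of indices is the same as a hereditarily finite subset of the index set, and the
absence of a bad clique is definable from `ω`, the index set and the code of `S`. -/
theorem deltaCode_mem (hV : IsTransitiveModel V) (n k : ℕ) (S : Set (Finset ℕ))
    (hSV : hypergraphCode S ∈ V) : deltaCode n k S ∈ V := by
  obtain ⟨o, ho⟩ := hV.exists_omega
  refine hV.mem_of_definable (fun z => (∀ c, E c z → E c ⟨_, hV.indexCode_mem k⟩) ∧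
    ¬ ∃ v : Fin (n - 1) → V, Function.Injective v ∧ (∀ i, E (v i) o) ∧
      (∀ c, E c ⟨_, hV.indexCode_mem k⟩ → (∀ y, E y c → ∃ i, y = v i) → E c z) ∧
      ∀ a : Fin k → V, Function.Injective a → (∀ l, ∃ i, a l = v i) →
        ∃ e, E e ⟨_, hSV⟩ ∧ Lists a e) _ fun z => ?_
  have key (s : Finset (Sub (k - 1))) : (¬ ∃ v : Fin (n - 1) → V, Function.Injective v ∧
      (∀ i, E (v i) o) ∧ (∀ c, E c ⟨_, hV.indexCode_mem k⟩ → (∀ y, E y c → ∃ i, y = v i) →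
        c.1 ∈ codeSet (subCode (k - 1)) (s : Set (Sub (k - 1)))) ∧
      ∀ a : Fin k → V, Function.Injective a → (∀ l, ∃ i, a l = v i) →
        ∃ e, E e ⟨_, hSV⟩ ∧ Lists a e) ↔ s ∈ deltaPattern n k S := by
    simp only [ho, deltaPattern, Set.mem_ofPred_eq]
    refine not_congr ⟨?_, ?_⟩
    · rintro ⟨v, hv, hvo, hvs, hvS⟩
      choose b hb using hvo
      obtain rfl : v = fun i => hV.nat (b i) := funext hb
      have hb' : Function.Injective b := hv.of_comp (f := hV.nat)
      refine ⟨Finset.univ.image b, by rw [Finset.card_image_of_injective _ hb']; simp,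
        fun c hc => ?_, fun e he => ?_⟩
      · have := hvs (hV.finset c) (mem_indexCode.2 ⟨c, rfl⟩) (fun y hy => ?_)
        · exact (mem_codeSet_iff (subCode_injective _)).1 this
        · obtain ⟨a, ha, hay⟩ := mem_finsetCode.1 hy
          obtain ⟨i, -, rfl⟩ := Finset.mem_image.1 (hc ha)
          exact ⟨i, Subtype.ext hay.symm⟩
      · rw [Finset.mem_powersetCard] at he
        obtain ⟨a, ha, ha', -⟩ := exists_injective_tuple he.2
        obtain ⟨e', he', hL⟩ := hvS (fun i => hV.nat (a i)) (hV.nat_injective.comp ha) fun l => by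
          have : a l ∈ Finset.univ.image b := he.1 (ha' ▸ Finset.mem_image_of_mem _ (by simp))
          obtain ⟨i, -, hi⟩ := Finset.mem_image.1 this
          exact ⟨i, congrArg hV.nat hi.symm⟩
        rw [hV.lists_nat_iff, ha'] at hL
        subst hL
        exact (mem_codeSet_iff finsetCode_injective).1 he'
    · rintro ⟨v, hv, hvs, hvS⟩
      obtain ⟨b, hb, hb', -⟩ := exists_injective_tuple hv
      refine ⟨fun i => hV.nat (b i), hV.nat_injective.comp hb, fun i => ⟨_, rfl⟩,
        fun c hc hcv => ?_, fun a ha hav => ?_⟩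
      · obtain ⟨d, hd⟩ := mem_indexCode.1 (E_iff.1 hc)
        obtain rfl : hV.finset d = c := Subtype.ext hd
        refine (mem_codeSet_iff (subCode_injective _)).2 (hvs d fun x hx => ?_)
        obtain ⟨i, hi⟩ := hcv (hV.nat x) (mem_finsetCode.2 ⟨x, hx, rfl⟩)
        rw [hV.nat_injective hi, ← hb']
        exact Finset.mem_image_of_mem _ (by simp)
      · choose f hf using hav
        obtain rfl : a = fun i => hV.nat (b (f i)) := funext hf
        have hf' : Function.Injective fun i => b (f i) := ha.of_comp (f := hV.nat)
        refine ⟨_, ?_, hV.lists_nat_iff.2 rfl⟩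
        refine (mem_codeSet_iff finsetCode_injective).2 (hvS _ ?_)
        rw [Finset.mem_powersetCard, Finset.card_image_of_injective _ hf', Finset.card_fin]
        refine ⟨fun x hx => ?_, rfl⟩
        obtain ⟨i, -, rfl⟩ := Finset.mem_image.1 hx
        rw [← hb']
        exact Finset.mem_image_of_mem _ (by simp)
  have hI : ∀ c : Sub (k - 1), IsHF (subCode (k - 1) c) := fun c => isHF_finsetCode _
  constructor
  · intro hz
    obtain ⟨s, hs, rfl⟩ := mem_codeSet.1 hz
    have hHF := isHF_codeSet s.finite_toSet hI
    refine ⟨hV.good.mem_of_isHF hHF, hHF, fun c hc => ?_, (key s).2 hs⟩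
    have hc' : c.1 ∈ codeSet (subCode (k - 1)) (s : Set (Sub (k - 1))) := hc
    obtain ⟨a, -, ha⟩ := mem_codeSet.1 hc'
    exact mem_indexCode.2 ⟨a, ha⟩
  · rintro ⟨hz, hHF, h1, h2⟩
    have hfin : {c : Sub (k - 1) | subCode (k - 1) c ∈ z}.Finite :=
      Set.Finite.preimage (subCode_injective _).injOn (isHF_iff.1 hHF).1
    have hzs : z = codeSet (subCode (k - 1)) (hfin.toFinset : Set (Sub (k - 1))) := by
      ext y
      rw [mem_codeSet]
      constructor
      · intro hy
        obtain ⟨c, hc⟩ := mem_indexCode.1 (E_iff.1 (h1 ⟨y, hV.1 _ hz _ hy⟩ hy))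
        refine ⟨c, ?_, hc⟩
        simp only [Set.Finite.coe_toFinset, Set.mem_ofPred_eq]
        rwa [hc]
      · rintro ⟨c, hc, rfl⟩
        simpa using hc
    refine mem_codeSet.2 ⟨hfin.toFinset, (key _).1 ?_, hzs.symm⟩
    rwa [← hzs]

end IsTransitiveModel

/-! ### Hypergraphs with the extension property -/

section Hypergraph

variable {α β : Type*} [DecidableEq α] [DecidableEq β]

/-- Every `k`-element subset of `v` is an edge. -/
def CliqueOn (k : ℕ) (S : Set (Finset α)) (v : Finset α) : Prop := ∀ e ⊆ v, e.card = k → e ∈ S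

/-- `F` can be the set of neighbours of a new vertex over `A` without creating an `n`-clique. -/
def Extendable (n k : ℕ) (S : Set (Finset α)) (A : Set α) (F : Set (Finset α)) : Prop :=
  ¬ ∃ v : Finset α, ↑v ⊆ A ∧ v.card = n - 1 ∧ (∀ c ⊆ v, c.card = k - 1 → c ∈ F) ∧ CliqueOn k S v

/-- Some vertex outside of `A` has `F` as its set of neighbours in `A`. -/
def ExtendsBy (k : ℕ) (S : Set (Finset α)) (A : Set α) (F : Set (Finset α)) : Prop :=
  ∃ x ∉ A, ∀ c : Finset α, ↑c ⊆ A → c.card = k - 1 → (insert x c ∈ S ↔ c ∈ F)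

/-- Random hypergraphs, with excluded `n`-cliques if `Q` holds. -/
structure IsGeneric (Q : Prop) (n k : ℕ) (S : Set (Finset α)) : Prop where
  card_eq : ∀ e ∈ S, e.card = k
  cliqueFree : Q → ∀ v : Finset α, v.card = n → ¬ CliqueOn k S v
  extendsBy : ∀ (A : Finset α) (F : Set (Finset α)), (Q → Extendable n k S A F) →
    ExtendsBy k S A F

theorem isClique_iff {k : ℕ} {S : Set (Finset ℕ)} {v : Finset ℕ} :
    IsClique k S v ↔ CliqueOn k S v := by
  simp [IsClique, CliqueOn, Finset.mem_powersetCard]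

theorem isRandomCliqueFree_iff {n k : ℕ} {S : Set (Finset ℕ)} :
    IsRandomCliqueFree n k S ↔ IsGeneric True n k S := by
  constructor
  · rintro ⟨h1, h2, h3⟩
    refine ⟨h1, fun _ v hv => isClique_iff.not.1 (h2 v hv), fun A F h => ?_⟩
    obtain ⟨x, hx, hx'⟩ := h3 A F (by
      rintro ⟨v, hv, hv', hvF, hvS⟩
      exact h trivial ⟨v, by simpa using hv, hv', fun c hc hc' =>
        hvF c (Finset.mem_powersetCard.2 ⟨hc, hc'⟩), isClique_iff.1 hvS⟩)
    exact ⟨x, by simpa using hx, fun c hc hc' =>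
      hx' c (Finset.mem_powersetCard.2 ⟨by simpa using hc, hc'⟩)⟩
  · rintro ⟨h1, h2, h3⟩
    refine ⟨h1, fun v hv => isClique_iff.not.2 (h2 trivial v hv), fun A F h => ?_⟩
    obtain ⟨x, hx, hx'⟩ := h3 A F (by
      rintro - ⟨v, hv, hv', hvF, hvS⟩
      exact h ⟨v, by simpa using hv, hv', fun c hc => hvF c (Finset.mem_powersetCard.1 hc).1
        (Finset.mem_powersetCard.1 hc).2, isClique_iff.2 hvS⟩)
    exact ⟨x, by simpa using hx, fun c hc => hx' c (by simpa using (Finset.mem_powersetCard.1 hc).1)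
      (Finset.mem_powersetCard.1 hc).2⟩

theorem isRandom_iff {n k : ℕ} {S : Set (Finset ℕ)} :
    IsRandom k S ↔ IsGeneric False n k S := by
  constructor
  · rintro ⟨h1, h3⟩
    refine ⟨h1, fun h => h.elim, fun A F h => ?_⟩
    obtain ⟨x, hx, hx'⟩ := h3 A F
    exact ⟨x, by simpa using hx, fun c hc hc' =>
      hx' c (Finset.mem_powersetCard.2 ⟨by simpa using hc, hc'⟩)⟩
  · rintro ⟨h1, h2, h3⟩
    refine ⟨h1, fun A F => ?_⟩
    obtain ⟨x, hx, hx'⟩ := h3 A F (fun h => h.elim)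
    exact ⟨x, by simpa using hx, fun c hc => hx' c (by simpa using (Finset.mem_powersetCard.1 hc).1)
      (Finset.mem_powersetCard.1 hc).2⟩

theorem IsGeneric.nonempty {Q : Prop} {n k : ℕ} {S : Set (Finset α)} (h : IsGeneric Q n k S)
    (hk : 2 ≤ k) (hn : k < n) : Nonempty α := by
  obtain ⟨x, -⟩ := h.extendsBy ∅ ∅ (by
    rintro - ⟨v, hv, hv', -⟩
    simp at hv
    subst hv
    simp at hv'
    omega)
  exact ⟨x⟩

/-! ### Embeddings into generic hypergraphs -/

/-- Countable hypergraphs (without `n`-cliques if `Q` holds) embed into generic ones. -/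
theorem IsGeneric.exists_embedding {Q : Prop} {n k : ℕ} {S : Set (Finset α)}
    (h : IsGeneric Q n k S) (hk : 2 ≤ k) (hn : k < n) (H : Set (Finset ℕ))
    (hH : Q → ∀ v : Finset ℕ, v.card = n → ¬ CliqueOn k H v) :
    ∃ f : ℕ → α, Function.Injective f ∧ ∀ e : Finset ℕ, e.card = k → (e.image f ∈ S ↔ e ∈ H) := by
  have := h.nonempty hk hn
  let good (m : ℕ) (p : ℕ → α) (x : α) : Prop := x ∉ (Finset.range m).image p ∧
    ∀ c ⊆ Finset.range m, c.card = k - 1 → (insert x (c.image p) ∈ S ↔ insert m c ∈ H)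
  -- The vertices are chosen one after another. The default value at later places is harmless, since
  -- `good m` looks only at the images of numbers below `m`.
  let f : ℕ → α := WellFoundedLT.fix (motive := fun _ => α) fun m p =>
    Classical.epsilon (good m fun i => if h : i < m then p i h else Classical.arbitrary α)
  have hf (m : ℕ) (hm : ∃ x, good m f x) : good m f (f m) := by
    have hcongr (x : α) : good m (fun i => if i < m then f i else Classical.arbitrary α) x ↔
        good m f x := by
      have (c : Finset ℕ) (hc : c ⊆ Finset.range m) :
          c.image (fun i => if i < m then f i else Classical.arbitrary α) = c.image f :=
        Finset.image_congr fun i hi => if_pos (Finset.mem_range.1 (hc hi))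
      simp only [good, this _ subset_rfl]
      refine and_congr_right fun _ => forall₃_congr fun c hc hc' => ?_
      rw [this c hc]
    have heq : f m = Classical.epsilon (good m fun i => if i < m then f i else
      Classical.arbitrary α) := WellFoundedLT.fix_eq _ m
    rw [← hcongr, heq]
    exact Classical.epsilon_spec (hm.imp fun x => (hcongr x).2)
  have key (m : ℕ) : Set.InjOn f (Finset.range m) ∧ ∀ e ⊆ Finset.range m, e.card = k →
      (e.image f ∈ S ↔ e ∈ H) := by
    induction m with
    | zero =>
      refine ⟨by simp, fun e he hek => ?_⟩
      simp at he
      subst he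
      simp at hek
      omega
    | succ m ih =>
      obtain ⟨hinj, hedge⟩ := ih
      have himg (c d : Finset ℕ) (hc : c ⊆ Finset.range m) (hd : d ⊆ Finset.range m)
          (h : c.image f = d.image f) : c = d := by
        rw [← Finset.coe_inj] at h ⊢
        rw [Finset.coe_image, Finset.coe_image] at h
        exact (hinj.image_eq_image_iff (by exact_mod_cast hc) (by exact_mod_cast hd)).1 h
      obtain ⟨hm, hm'⟩ := hf m (by
        obtain ⟨x, hx, hx'⟩ := h.extendsBy ((Finset.range m).image f)
          {c | ∃ d ⊆ Finset.range m, c = d.image f ∧ insert m d ∈ H} (by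
            -- An `(n - 1)`-clique all of whose `(k - 1)`-subsets are prescribed neighbours pulls
            -- back to a set `w`, and `insert m w` would be an `n`-clique of `H`.
            rintro hQ ⟨v, hv, hvc, hvF, hvS⟩
            rw [Finset.coe_subset, Finset.subset_image_iff] at hv
            obtain ⟨w, hw, rfl⟩ := hv
            have hw : w ⊆ Finset.range m := by exact_mod_cast hw
            have hwinj : Set.InjOn f w := hinj.mono (by exact_mod_cast hw)
            have hmw : m ∉ w := fun h => by simpa using hw h
            rw [Finset.card_image_of_injOn hwinj] at hvc
            refine hH hQ (insert m w) (by rw [Finset.card_insert_of_notMem hmw]; omega) ?_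
            intro e he hek
            by_cases hme : m ∈ e
            · obtain ⟨d, hd, hd', hdH⟩ := hvF ((e.erase m).image f)
                (Finset.image_subset_image (by rwa [← Finset.subset_insert_iff])) (by
                  rw [Finset.card_image_of_injOn (hwinj.mono
                    (by exact_mod_cast Finset.subset_insert_iff.1 he)),
                    Finset.card_erase_of_mem hme, hek])
              rw [← himg _ _ ((Finset.subset_insert_iff.1 he).trans hw) hd hd',
                Finset.insert_erase hme] at hdH
              exact hdH
            · have he' : e ⊆ w := (Finset.subset_insert_iff_of_notMem hme).1 he
              refine (hedge e (he'.trans hw) hek).1 (hvS _ (Finset.image_subset_image he') ?_)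
              rw [Finset.card_image_of_injOn (hwinj.mono (by exact_mod_cast he')), hek])
        refine ⟨x, by simpa using hx, fun c hc hck => ?_⟩
        rw [hx' (c.image f) (by exact_mod_cast Finset.image_subset_image hc) (by
          rw [Finset.card_image_of_injOn (hinj.mono (by exact_mod_cast hc)), hck])]
        constructor
        · rintro ⟨d, hd, hd', h⟩
          rwa [himg _ _ hc hd hd']
        · exact fun h => ⟨c, hc, rfl, h⟩)
      constructor
      · rw [Finset.range_add_one, Finset.coe_insert, Set.injOn_insert (by simp)]
        exact ⟨hinj, by exact_mod_cast hm⟩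
      · intro e he hek
        rw [Finset.range_add_one] at he
        by_cases hme : m ∈ e
        · have := hm' (e.erase m) (Finset.subset_insert_iff.1 he) (by
            rw [Finset.card_erase_of_mem hme, hek])
          rwa [← Finset.image_insert, Finset.insert_erase hme] at this
        · exact hedge e ((Finset.subset_insert_iff_of_notMem hme).1 he) hek
  have hle (e : Finset ℕ) : e ⊆ Finset.range (e.sup id + 1) := fun x hx =>
    Finset.mem_range.2 (Nat.lt_succ_of_le (Finset.le_sup (f := id) hx))
  refine ⟨f, fun i j hij => ?_, fun e he => (key _).2 e (hle e) he⟩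
  exact (key (max i j + 1)).1 (by simp) (by simp) hij

/-! ### Partial isomorphisms -/

/-- `g` restricts to an isomorphism of the induced hypergraph on `A` with its image. -/
structure PartialIso (k : ℕ) (S : Set (Finset α)) (S' : Set (Finset β)) (A : Set α) (g : α → β) :
    Prop where
  injOn : Set.InjOn g A
  edge_iff : ∀ e : Finset α, ↑e ⊆ A → e.card = k → (e ∈ S ↔ e.image g ∈ S')

namespace PartialIso

variable {n k : ℕ} {S : Set (Finset α)} {S' : Set (Finset β)} {A : Set α} {g : α → β}

theorem mono {B : Set α} (h : PartialIso k S S' A g) (hB : B ⊆ A) : PartialIso k S S' B g :=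
  ⟨h.injOn.mono hB, fun e he => h.edge_iff e (he.trans hB)⟩

theorem congr {g' : α → β} (h : PartialIso k S S' A g) (hg : Set.EqOn g g' A) :
    PartialIso k S S' A g' :=
  ⟨h.injOn.congr hg, fun e he hek => by
    rw [h.edge_iff e he hek, Finset.image_congr fun x hx => hg (he hx)]⟩

theorem symm [Nonempty α] (h : PartialIso k S S' A g) :
    PartialIso k S' S (g '' A) (Function.invFunOn g A) := by
  have hinv : Set.LeftInvOn (Function.invFunOn g A) g A := h.injOn.leftInvOn_invFunOn
  refine ⟨fun x hx y hy hxy => ?_, fun e he hek => ?_⟩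
  · obtain ⟨a, ha, rfl⟩ := hx
    obtain ⟨b, hb, rfl⟩ := hy
    rw [hinv ha, hinv hb] at hxy
    rw [hxy]
  · have hsub : ↑(e.image (Function.invFunOn g A)) ⊆ A := by
      intro x hx
      rw [Finset.coe_image] at hx
      obtain ⟨y, hy, rfl⟩ := hx
      obtain ⟨a, ha, rfl⟩ := he hy
      rwa [hinv ha]
    have himg : (e.image (Function.invFunOn g A)).image g = e := by
      rw [Finset.image_image]
      conv_rhs => rw [← Finset.image_id (s := e)]
      refine Finset.image_congr fun y hy => ?_
      obtain ⟨a, ha, rfl⟩ := he hy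
      simp [hinv ha]
    rw [h.edge_iff _ hsub, himg]
    rw [Finset.card_image_of_injOn, hek]
    intro x hx y hy hxy
    obtain ⟨a, ha, rfl⟩ := he hx
    obtain ⟨b, hb, rfl⟩ := he hy
    rw [hinv ha, hinv hb] at hxy
    rw [hxy]

/-- The forth step: pull the neighbourhood of `b` back along `g` and look for a vertex that realizes
it. It is extendable because the image of a bad `(n - 1)`-clique, together with `b`, would be an
`n`-clique of `S'`. The set `A` need not be finite as long as the extension property holds over it;
this is what saturation will provide. -/
theorem extend (h : PartialIso k S S' A g) (hk : 2 ≤ k) (hn : k < n)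
    (hS' : ∀ v : Finset β, v.card = n → ¬ CliqueOn k S' v)
    (hA : ∀ F, Extendable n k S A F → ExtendsBy k S A F) (b : β) :
    ∃ a, ∃ g' : α → β, g' a = b ∧ Set.EqOn g g' A ∧ PartialIso k S S' (insert a A) g' := by
  by_cases hb : b ∈ g '' A
  · obtain ⟨a, ha, rfl⟩ := hb
    exact ⟨a, g, rfl, fun _ _ => rfl, by rwa [Set.insert_eq_of_mem ha]⟩
  have hcard (c : Finset α) (hc : ↑c ⊆ A) : (c.image g).card = c.card :=
    Finset.card_image_of_injOn (h.injOn.mono hc)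
  have hbc (c : Finset α) (hc : ↑c ⊆ A) : b ∉ c.image g := fun hbc => by
    obtain ⟨a, ha, rfl⟩ := Finset.mem_image.1 hbc
    exact hb ⟨a, hc ha, rfl⟩
  obtain ⟨a, ha, haF⟩ := hA {c | insert b (c.image g) ∈ S'} (by
    rintro ⟨v, hvA, hvn, hvF, hvS⟩
    refine hS' (insert b (v.image g)) ?_ ?_
    · rw [Finset.card_insert_of_notMem (hbc v hvA), hcard v hvA, hvn]
      omega
    · intro e he hek
      have sub (e' : Finset β) (he' : e' ⊆ v.image g) : ∃ d ⊆ v, e' = d.image g := by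
        obtain ⟨d, hd, rfl⟩ := Finset.subset_image_iff.1 he'
        exact ⟨d, by exact_mod_cast hd, rfl⟩
      by_cases hbe : b ∈ e
      · obtain ⟨d, hd, hed⟩ := sub (e.erase b) (Finset.subset_insert_iff.1 he)
        have hdA : ↑d ⊆ A := subset_trans (by exact_mod_cast hd) hvA
        have := hvF d hd (by rw [← hcard d hdA, ← hed, Finset.card_erase_of_mem hbe, hek])
        rwa [Set.mem_ofPred_eq, ← hed, Finset.insert_erase hbe] at this
      · obtain ⟨d, hd, rfl⟩ := sub e ((Finset.subset_insert_iff_of_notMem hbe).1 he)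
        have hdA : ↑d ⊆ A := subset_trans (by exact_mod_cast hd) hvA
        rw [hcard d hdA] at hek
        exact (h.edge_iff d hdA hek).1 (hvS d hd hek))
  have heq : Set.EqOn g (Function.update g a b) A := fun x hx =>
    (Function.update_of_ne (fun h : x = a => ha (h ▸ hx)) _ _).symm
  have h' := h.congr heq
  refine ⟨a, Function.update g a b, by simp, heq, ⟨?_, fun e he hek => ?_⟩⟩
  · rw [Set.injOn_insert ha]
    refine ⟨h'.injOn, ?_⟩
    rw [Function.update_self, ← heq.image_eq]
    exact hb
  · by_cases hae : a ∈ e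
    · have heA : ↑(e.erase a) ⊆ A := fun x hx => by
        rw [Finset.mem_coe, Finset.mem_erase] at hx
        exact (he hx.2).resolve_left hx.1
      have := haF (e.erase a) heA (by rw [Finset.card_erase_of_mem hae, hek])
      rw [Finset.insert_erase hae] at this
      rw [this, Set.mem_ofPred_eq]
      conv_rhs => rw [← Finset.insert_erase hae]
      rw [Finset.image_insert, Function.update_self, Finset.image_congr fun x hx => heq (heA hx)]
    · exact h'.edge_iff e (fun x hx => (he hx).resolve_left fun h => hae (h ▸ hx)) hek

end PartialIso

end Hypergraph

/-! ### Models of the theory of random clique-free hypergraphs -/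

section Extension

variable {n k : ℕ} {α β : Type*} [DecidableEq α] [DecidableEq β]

/-- The back step is the forth step for the inverse map, inverted again. -/
theorem PartialIso.extend_back {S : Set (Finset α)} {S' : Set (Finset β)} {A : Set α} {g : α → β}
    [Nonempty α] [Nonempty β] (h : PartialIso k S S' A g) (hk : 2 ≤ k) (hn : k < n)
    (hS : ∀ v : Finset α, v.card = n → ¬ CliqueOn k S v)
    (hA : ∀ F, Extendable n k S' (g '' A) F → ExtendsBy k S' (g '' A) F) (a : α) :
    ∃ g' : α → β, Set.EqOn g g' A ∧ PartialIso k S S' (insert a A) g' := by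
  obtain ⟨b, h', rfl, heq, hiso⟩ := h.symm.extend hk hn hS hA a
  have hinv : Set.LeftInvOn (Function.invFunOn g A) g A := h.injOn.leftInvOn_invFunOn
  have himg : Set.image h' (insert b (Set.image g A)) = insert (h' b) A := by
    rw [Set.image_insert_eq, ← heq.image_eq, hinv.image_image]
  have := hiso.symm
  rw [himg] at this
  refine ⟨_, fun x hx => ?_, this⟩
  have hx' : h' (g x) = x := by rw [← heq ⟨x, hx, rfl⟩, hinv hx]
  conv_rhs => rw [← hx']
  exact (hiso.injOn.leftInvOn_invFunOn (Or.inr ⟨x, hx, rfl⟩)).symm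

theorem partialIso_empty (hk : 2 ≤ k) (S : Set (Finset α)) (S' : Set (Finset β)) (g : α → β) :
    PartialIso k S S' ∅ g := by
  refine ⟨by simp, fun e he hek => ?_⟩
  rw [Set.subset_empty_iff, Finset.coe_eq_empty] at he
  subst he
  simp at hek
  omega

end Extension

section Models

universe u₁ u₂ u₃

/-- The edge relation of a structure in the language of hypergraphs. -/
def EdgeRel {k : ℕ} {α : Type u₁} [(HyperLang k).Structure α] (a : Fin k → α) : Prop :=
  Structure.RelMap (L := HyperLang k) HyperRel.edge a

/-- The edges of a structure in the language of hypergraphs. -/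
def edgeSet (k : ℕ) (α : Type u₁) [(HyperLang k).Structure α] [DecidableEq α] : Set (Finset α) :=
  {e | ∃ a : Fin k → α, EdgeRel a ∧ Finset.univ.image a = e}

/-- The structure is a random `n`-clique-free hypergraph. -/
structure IsGenericModel (n k : ℕ) (α : Type u₁) [(HyperLang k).Structure α] [DecidableEq α] :
    Prop where
  edgeRel_iff : ∀ a : Fin k → α, EdgeRel a ↔
    Function.Injective a ∧ Finset.univ.image a ∈ edgeSet k α
  generic : IsGeneric True n k (edgeSet k α)

variable {n k : ℕ} {α : Type u₁} {β : Type u₂} [(HyperLang k).Structure α]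
  [(HyperLang k).Structure β] [DecidableEq α] [DecidableEq β]

/-- Formulas are preserved by finite partial isomorphisms between generic models. -/
theorem IsGenericModel.realize_iff (hk : 2 ≤ k) (hn : k < n) (hα : IsGenericModel n k α)
    (hβ : IsGenericModel n k β) {γ : Type u₃} {m : ℕ} (φ : (HyperLang k).BoundedFormula γ m) :
    ∃ s : Set γ, s.Finite ∧ ∀ (A : Set α) (g : α → β), A.Finite →
      PartialIso k (edgeSet k α) (edgeSet k β) A g → ∀ (v : γ → α) (v' : γ → β),
      (∀ c ∈ s, v c ∈ A ∧ g (v c) = v' c) → ∀ xs : Fin m → α, (∀ i, xs i ∈ A) →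
        (φ.Realize v xs ↔ φ.Realize v' (g ∘ xs)) := by
  have : Nonempty α := hα.generic.nonempty hk hn
  have : Nonempty β := hβ.generic.nonempty hk hn
  -- There are no function symbols, so a term is a variable and its value stays in `A`.
  have term {m : ℕ} (t : (HyperLang k).Term (γ ⊕ Fin m)) : ∃ s : Set γ, s.Finite ∧
      ∀ (A : Set α) (g : α → β) (v : γ → α) (v' : γ → β),
      (∀ c ∈ s, v c ∈ A ∧ g (v c) = v' c) → ∀ xs : Fin m → α, (∀ i, xs i ∈ A) →
        t.realize (Sum.elim v xs) ∈ A ∧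
          g (t.realize (Sum.elim v xs)) = t.realize (Sum.elim v' (g ∘ xs)) := by
    rcases t with (c | i) | ⟨f, _⟩
    · exact ⟨{c}, Set.finite_singleton _, fun A g v v' h xs _ => h c rfl⟩
    · exact ⟨∅, Set.finite_empty, fun A g v v' _ xs h => ⟨h i, rfl⟩⟩
    · exact Empty.elim f
  induction φ with
  | falsum => exact ⟨∅, Set.finite_empty, by simp [BoundedFormula.Realize]⟩
  | equal t₁ t₂ =>
    obtain ⟨s₁, hs₁, h₁⟩ := term t₁
    obtain ⟨s₂, hs₂, h₂⟩ := term t₂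
    refine ⟨s₁ ∪ s₂, hs₁.union hs₂, fun A g _ hg v v' h xs hxs => ?_⟩
    obtain ⟨h1, h1'⟩ := h₁ A g v v' (fun c hc => h c (Or.inl hc)) xs hxs
    obtain ⟨h2, h2'⟩ := h₂ A g v v' (fun c hc => h c (Or.inr hc)) xs hxs
    simp only [BoundedFormula.Realize, ← h1', ← h2']
    exact (hg.injOn.eq_iff h1 h2).symm
  | @rel _ l R ts =>
    choose s hs hs' using fun i => term (ts i)
    refine ⟨⋃ i, s i, Set.finite_iUnion hs, fun A g _ hg v v' h xs hxs => ?_⟩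
    have h1 := fun i => hs' i A g v v' (fun c hc => h c (Set.mem_iUnion.2 ⟨i, hc⟩)) xs hxs
    cases R
    simp only [BoundedFormula.Realize]
    refine (hα.edgeRel_iff _).trans (Iff.trans ?_ (hβ.edgeRel_iff _).symm)
    have heq : (fun i => (ts i).realize (Sum.elim v' (g ∘ xs))) =
      g ∘ fun i => (ts i).realize (Sum.elim v xs) := funext fun i => (h1 i).2.symm
    rw [heq, ← Finset.image_image]
    have hinj : Function.Injective (g ∘ fun i => (ts i).realize (Sum.elim v xs)) ↔
        Function.Injective fun i => (ts i).realize (Sum.elim v xs) :=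
      ⟨fun h => h.of_comp, fun h i j hij => h (hg.injOn (h1 i).1 (h1 j).1 hij)⟩
    rw [hinj]
    refine and_congr_right fun hi => hg.edge_iff _ ?_ ?_
    · intro x hx
      obtain ⟨i, -, rfl⟩ := Finset.mem_image.1 hx
      exact (h1 i).1
    · rw [Finset.card_image_of_injective _ hi, Finset.card_fin]
  | imp φ ψ ih₁ ih₂ =>
    obtain ⟨s₁, hs₁, h₁⟩ := ih₁
    obtain ⟨s₂, hs₂, h₂⟩ := ih₂
    refine ⟨s₁ ∪ s₂, hs₁.union hs₂, fun A g hA hg v v' h xs hxs => ?_⟩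
    simp only [BoundedFormula.Realize]
    rw [h₁ A g hA hg v v' (fun c hc => h c (Or.inl hc)) xs hxs,
      h₂ A g hA hg v v' (fun c hc => h c (Or.inr hc)) xs hxs]
  | all φ ih =>
    obtain ⟨s, hs, h'⟩ := ih
    refine ⟨s, hs, fun A g hA hg v v' h xs hxs => ?_⟩
    simp only [BoundedFormula.Realize]
    -- Each quantifier costs one back or forth step, after which the domain is `insert a A`; it
    -- stays finite, so that genericity applies again.
    have step (a : α) (g' : α → β) (heq : Set.EqOn g g' A)
        (hg' : PartialIso k (edgeSet k α) (edgeSet k β) (insert a A) g') :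
        φ.Realize v (Fin.snoc xs a) ↔ φ.Realize v' (Fin.snoc (g ∘ xs) (g' a)) := by
      rw [h' _ g' (hA.insert a) hg' v v' (fun c hc => ⟨Or.inr (h c hc).1, by
        rw [← heq (h c hc).1, (h c hc).2]⟩) (Fin.snoc xs a) (fun i => by
          refine Fin.lastCases ?_ (fun i => ?_) i <;> simp [hxs])]
      refine iff_of_eq (congrArg _ (funext fun i => ?_))
      refine Fin.lastCases ?_ (fun i => ?_) i
      · simp
      · simp [heq (hxs i)]
    constructor
    · intro hr b
      obtain ⟨a, g', rfl, heq, hg'⟩ := hg.extend hk hn (hβ.generic.cliqueFree trivial)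
        (fun F hF => by
          have := hα.generic.extendsBy hA.toFinset F
          rw [hA.coe_toFinset] at this
          exact this fun _ => hF) b
      exact (step a g' heq hg').1 (hr a)
    · intro hr a
      obtain ⟨g', heq, hg'⟩ := hg.extend_back hk hn (hα.generic.cliqueFree trivial)
        (fun F hF => by
          have := hβ.generic.extendsBy (hA.image g).toFinset F
          rw [(hA.image g).coe_toFinset] at this
          exact this fun _ => hF) a
      exact (step a g' heq hg').2 (hr _)

/-- Back and forth can start from the empty map, since edges have at least two vertices. -/
theorem IsGenericModel.elementarilyEquivalent (hk : 2 ≤ k) (hn : k < n)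
    (hα : IsGenericModel n k α) (hβ : IsGenericModel n k β) :
    (HyperLang k).ElementarilyEquivalent α β := by
  rw [elementarilyEquivalent_iff]
  intro φ
  obtain ⟨s, -, h⟩ := hα.realize_iff hk hn hβ φ
  have : Nonempty β := hβ.generic.nonempty hk hn
  have := h ∅ (fun _ => Classical.arbitrary β) Set.finite_empty (partialIso_empty hk _ _ _) default
    default (fun c => Empty.elim c) default (fun i => Fin.elim0 i)
  rwa [Subsingleton.elim (_ ∘ _) (default : Fin 0 → β)] at this

end Models

/-- The structure of a hypergraph on an arbitrary set of vertices. -/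
@[reducible] def hyperStructureOn {α : Type*} [DecidableEq α] (k : ℕ) (S : Set (Finset α)) :
    (HyperLang k).Structure α where
  funMap := fun f => Empty.elim f
  RelMap := fun {_} _ a => Function.Injective a ∧ Finset.univ.image a ∈ S

theorem edgeSet_hyperStructureOn {α : Type*} [DecidableEq α] {k : ℕ} {S : Set (Finset α)}
    (hS : ∀ e ∈ S, e.card = k) : letI := hyperStructureOn k S; edgeSet k α = S := by
  ext e
  constructor
  · rintro ⟨a, ⟨-, ha⟩, rfl⟩
    exact ha
  · intro he
    obtain ⟨a, ha, ha', -⟩ := exists_injective_tuple (hS e he)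
    exact ⟨a, ⟨ha, by rwa [ha']⟩, ha'⟩

theorem isGenericModel_hyperStructureOn {α : Type*} [DecidableEq α] {n k : ℕ} {S : Set (Finset α)}
    (h : IsGeneric True n k S) : letI := hyperStructureOn k S; IsGenericModel n k α := by
  let _ := hyperStructureOn k S
  have := edgeSet_hyperStructureOn h.card_eq
  exact ⟨fun a => by rw [this]; rfl, by rwa [this]⟩

/-! ### First-order axioms for genericity, and completeness of `T_{n,k}` -/

section Theory

instance CoDef.edgeRel {k : ℕ} {M N γ : Type*} [(HyperLang k).Structure M]
    [(HyperLang k).Structure N] {p : γ → M} {q : γ → N} {n : ℕ} (f : Fin k → (Fin n → M) → M)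
    (g : Fin k → (Fin n → N) → N) [h : ∀ i, CoTerm (HyperLang k) p q n (f i) (g i)] :
    CoDef (HyperLang k) p q n (fun v => EdgeRel fun i => f i v) (fun v => EdgeRel fun i => g i v) :=
  CoDef.rel (L := HyperLang k) HyperRel.edge f g h

instance CoDef.injective' {k : ℕ} {M N γ : Type*} [(HyperLang k).Structure M]
    [(HyperLang k).Structure N] {p : γ → M} {q : γ → N} {n r : ℕ} (f : Fin r → (Fin n → M) → M)
    (g : Fin r → (Fin n → N) → N) [h : ∀ i, CoTerm (HyperLang k) p q n (f i) (g i)] :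
    CoDef (HyperLang k) p q n (fun v => Function.Injective (fun i => f i v))
      (fun v => Function.Injective (fun i => g i v)) := by
  unfold Function.Injective; infer_instance

/-- The edge relation is irreflexive. -/
def EdgeInjective (k : ℕ) (α : Type*) [(HyperLang k).Structure α] : Prop :=
  ∀ a : Fin k → α, EdgeRel a → Function.Injective a

/-- The edge relation is symmetric. -/
def EdgeSymmetric (k : ℕ) (α : Type*) [(HyperLang k).Structure α] : Prop :=
  ∀ s : Equiv.Perm (Fin k), ∀ a : Fin k → α, EdgeRel a → EdgeRel fun i => a (s i)

/-- There are no `n`-cliques. -/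
def NoCliques (n k : ℕ) (α : Type*) [(HyperLang k).Structure α] : Prop :=
  ¬ ∃ v : Fin n → α, Function.Injective v ∧ ∀ f : Fin k → Fin n, Function.Injective f →
    EdgeRel fun i => v (f i)

/-- The extension property for `p` vertices and the configuration `F`. -/
def ExtensionAxiom (n k p : ℕ) (F : Set (Finset (Fin p))) (α : Type*)
    [(HyperLang (k + 1)).Structure α] : Prop :=
  ∀ a : Fin p → α, Function.Injective a →
    (¬ ∃ g : Fin (n - 1) → Fin p, Function.Injective g ∧
      (∀ f : Fin k → Fin (n - 1), Function.Injective f →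
        (Finset.univ.image fun i => g (f i)) ∈ F) ∧
      ∀ f : Fin (k + 1) → Fin (n - 1), Function.Injective f → EdgeRel fun i => a (g (f i))) →
    ∃ x, (∀ i, x ≠ a i) ∧ ∀ f : Fin k → Fin p, Function.Injective f →
      ∀ b : Fin (k + 1) → α, b 0 = x → (∀ i : Fin k, b i.succ = a (f i)) →
        (EdgeRel b ↔ Finset.univ.image f ∈ F)

theorem card_image_fin {α : Type*} [DecidableEq α] {m : ℕ} {f : Fin m → α}
    (hf : Function.Injective f) : (Finset.univ.image f).card = m := by
  rw [Finset.card_image_of_injective _ hf, Finset.card_fin]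

/-- Two injective enumerations of the same set differ by a permutation of the places. -/
theorem edgeRel_iff_of_symmetric {k : ℕ} {α : Type*} [(HyperLang k).Structure α] [DecidableEq α]
    (h₁ : EdgeInjective k α) (h₂ : EdgeSymmetric k α) (a : Fin k → α) : EdgeRel a ↔
      Function.Injective a ∧ Finset.univ.image a ∈ edgeSet k α := by
  refine ⟨fun h => ⟨h₁ a h, a, h, rfl⟩, ?_⟩
  rintro ⟨ha, b, hb, hab⟩
  have hb' := h₁ b hb
  have hr : Set.range b = Set.range a := by
    rw [← Finset.coe_inj] at hab
    simpa using hab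
  let s : Equiv.Perm (Fin k) := (Equiv.ofInjective a ha).trans
    ((Equiv.setCongr hr.symm).trans (Equiv.ofInjective b hb').symm)
  convert h₂ s b hb with i
  have : Equiv.ofInjective b hb' (s i) = Equiv.setCongr hr.symm (Equiv.ofInjective a ha i) := by
    simp [s]
  exact (congrArg Subtype.val this).symm

/-- Finite sets of vertices are replaced by injective tuples, which turns genericity into a list of
first-order sentences, and hence makes it invariant under elementary equivalence. The arity is
written as `k + 1` because an edge at a new vertex is this vertex followed by a `k`-tuple. -/
theorem isGenericModel_iff {n k : ℕ} {α : Type*} [(HyperLang (k + 1)).Structure α]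
    [DecidableEq α] : IsGenericModel n (k + 1) α ↔ EdgeInjective (k + 1) α ∧
      EdgeSymmetric (k + 1) α ∧ NoCliques n (k + 1) α ∧ ∀ p F, ExtensionAxiom n k p F α := by
  constructor
  · intro h
    have hclique {m : ℕ} (v : Fin m → α) (hv : Function.Injective v)
        (hf : ∀ f : Fin (k + 1) → Fin m, Function.Injective f → EdgeRel fun i => v (f i)) :
        CliqueOn (k + 1) (edgeSet (k + 1) α) (Finset.univ.image v) := by
      intro e he hek
      obtain ⟨d, -, rfl⟩ := Finset.subset_image_iff.1 he
      rw [Finset.card_image_of_injective _ hv] at hek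
      obtain ⟨f, hfi, hfd, -⟩ := exists_injective_tuple hek
      refine ⟨_, hf f hfi, ?_⟩
      rw [← hfd, Finset.image_image]
      rfl
    refine ⟨fun a ha => ((h.edgeRel_iff a).1 ha).1, fun s a ha => ?_, ?_, fun p F a ha hF => ?_⟩
    · rw [h.edgeRel_iff] at ha ⊢
      refine ⟨ha.1.comp s.injective, ?_⟩
      convert ha.2 using 1
      ext x
      simp only [Finset.mem_image, Finset.mem_univ, true_and]
      exact (s.surjective.exists (p := fun y => a y = x)).symm
    · rintro ⟨v, hv, hf⟩
      exact h.generic.cliqueFree trivial (Finset.univ.image v)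
        (by rw [Finset.card_image_of_injective _ hv, Finset.card_fin]) (hclique v hv hf)
    · have himg {c d : Finset (Fin p)} (h : c.image a = d.image a) : c = d :=
        Finset.image_injective ha h
      obtain ⟨x, hx, hxF⟩ := h.generic.extendsBy (Finset.univ.image a)
        {c | ∃ d ∈ F, c = d.image a} (by
          rintro - ⟨v, hva, hvn, hvF, hvS⟩
          obtain ⟨w, -, rfl⟩ := Finset.subset_image_iff.1 (by exact_mod_cast hva)
          rw [Finset.card_image_of_injective _ ha] at hvn
          obtain ⟨g, hg, hgw, -⟩ := exists_injective_tuple hvn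
          have hsub {l : ℕ} (f : Fin l → Fin (n - 1)) : (Finset.univ.image fun i => g (f i)) ⊆ w := by
            rw [← hgw]
            intro y hy
            obtain ⟨i, -, rfl⟩ := Finset.mem_image.1 hy
            exact Finset.mem_image_of_mem _ (Finset.mem_univ _)
          refine hF ⟨g, hg, fun f hf => ?_, fun f hf => ?_⟩
          · obtain ⟨d, hd, hd'⟩ := hvF ((Finset.univ.image fun i => g (f i)).image a)
              (Finset.image_subset_image (hsub f)) (by
                rw [Finset.card_image_of_injective _ ha]; exact card_image_fin (hg.comp hf))
            rwa [himg hd']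
          · rw [h.edgeRel_iff]
            refine ⟨ha.comp (hg.comp hf), ?_⟩
            have := hvS ((Finset.univ.image fun i => g (f i)).image a)
              (Finset.image_subset_image (hsub f)) (by
                rw [Finset.card_image_of_injective _ ha]; exact card_image_fin (hg.comp hf))
            rwa [Finset.image_image] at this)
      refine ⟨x, fun i hi => hx ?_, fun f hf b hb hb' => ?_⟩
      · rw [hi]
        simp
      · have hbimg : Finset.univ.image b = insert x ((Finset.univ.image f).image a) := by
          ext y
          simp only [Finset.mem_image, Finset.mem_univ, true_and, Finset.mem_insert,
            Fin.exists_fin_succ, hb, hb']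
          simp [eq_comm]
        have hxi (i : Fin k) : x ≠ a (f i) := fun hi => hx (by rw [hi]; simp)
        have hbinj : Function.Injective b := by
          intro i j
          refine Fin.cases ?_ (fun i => ?_) i <;> refine Fin.cases ?_ (fun j => ?_) j
          · simp
          · rw [hb, hb']
            exact fun h => (hxi j h).elim
          · rw [hb, hb']
            exact fun h => (hxi i h.symm).elim
          · rw [hb', hb']
            exact fun h => by rw [hf (ha h)]
        rw [h.edgeRel_iff, hbimg, hxF _ (by
          intro y hy
          obtain ⟨i, -, rfl⟩ := Finset.mem_image.1 hy
          simp) (by rw [Finset.card_image_of_injective _ ha, Finset.card_image_of_injective _ hf,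
            Finset.card_fin]; rfl)]
        refine ⟨fun h => ?_, fun h => ⟨hbinj, _, h, rfl⟩⟩
        obtain ⟨-, d, hd, hd'⟩ := h
        rwa [himg hd']
  · rintro ⟨h1, h2, h3, h4⟩
    have hedge := edgeRel_iff_of_symmetric h1 h2
    refine ⟨hedge, ?_, ?_, ?_⟩
    · rintro e ⟨a, ha, rfl⟩
      rw [Finset.card_image_of_injective _ (h1 a ha), Finset.card_fin]
    · rintro - v hv hcl
      obtain ⟨a, ha, hav, -⟩ := exists_injective_tuple hv
      refine h3 ⟨a, ha, fun f hf => (hedge _).2 ⟨ha.comp hf, hcl _ ?_ ?_⟩⟩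
      · rw [← hav]
        intro y hy
        obtain ⟨i, -, rfl⟩ := Finset.mem_image.1 hy
        exact Finset.mem_image_of_mem _ (Finset.mem_univ _)
      · exact card_image_fin (ha.comp hf)
    · intro A F hF
      obtain ⟨m, hm⟩ : ∃ m, A.card = m := ⟨_, rfl⟩
      obtain ⟨a, ha, haA, -⟩ := exists_injective_tuple hm
      obtain ⟨x, hx, hx'⟩ := h4 _ {d | d.image a ∈ F} a ha (by
        rintro ⟨g, hg, hgF, hgS⟩
        refine hF trivial ⟨(Finset.univ.image g).image a, ?_, ?_, ?_, ?_⟩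
        · rw [← haA]
          exact_mod_cast Finset.image_subset_image (Finset.subset_univ _)
        · rw [Finset.card_image_of_injective _ ha, Finset.card_image_of_injective _ hg,
            Finset.card_fin]
        · intro c hc hck
          rw [Finset.image_image] at hc
          obtain ⟨d, -, rfl⟩ := Finset.subset_image_iff.1 hc
          rw [Finset.card_image_of_injective _ (ha.comp hg)] at hck
          obtain ⟨f, hf, hfd, -⟩ := exists_injective_tuple hck
          have := hgF f hf
          rw [Set.mem_ofPred_eq, Finset.image_image] at this
          rw [← hfd, Finset.image_image]
          exact this
        · intro c hc hck
          rw [Finset.image_image] at hc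
          obtain ⟨d, -, rfl⟩ := Finset.subset_image_iff.1 hc
          rw [Finset.card_image_of_injective _ (ha.comp hg)] at hck
          obtain ⟨f, hf, hfd, -⟩ := exists_injective_tuple hck
          refine ⟨_, hgS f hf, ?_⟩
          rw [← hfd, Finset.image_image]
          rfl)
      refine ⟨x, fun hxA => ?_, fun c hc hck => ?_⟩
      · rw [Finset.mem_coe, ← haA] at hxA
        obtain ⟨i, -, hi⟩ := Finset.mem_image.1 hxA
        exact hx i hi.symm
      · rw [Finset.coe_subset, ← haA] at hc
        obtain ⟨d, -, rfl⟩ := Finset.subset_image_iff.1 hc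
        rw [Finset.card_image_of_injective _ ha] at hck
        obtain ⟨f, hf, hfd, -⟩ := exists_injective_tuple hck
        have := hx' f hf (Fin.cons x fun i => a (f i)) (by simp) (by simp)
        have hinj : Function.Injective (Fin.cons x fun i => a (f i) : Fin (k + 1) → α) := by
          rw [Fin.cons_injective_iff]
          exact ⟨fun ⟨i, hi⟩ => hx _ hi.symm, ha.comp hf⟩
        have himg : Finset.univ.image (Fin.cons x fun i => a (f i) : Fin (k + 1) → α) =
            insert x (d.image a) := by
          ext y
          simp only [← hfd, Finset.mem_image, Finset.mem_univ, true_and, Finset.mem_insert,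
            Fin.exists_fin_succ, Fin.cons_zero, Fin.cons_succ]
          simp [eq_comm]
        rw [hedge, himg, hfd] at this
        exact ⟨fun h => this.1 ⟨hinj, h⟩, fun h => (this.2 h).2⟩

/-- A structure which is elementarily equivalent to a generic model is a generic model. -/
theorem IsGenericModel.of_elementarilyEquivalent {n k : ℕ} (hk : 2 ≤ k) {α β : Type*}
    [(HyperLang k).Structure α] [(HyperLang k).Structure β] [DecidableEq α] [DecidableEq β]
    (hα : IsGenericModel n k α) (h : (HyperLang k).ElementarilyEquivalent α β) :
    IsGenericModel n k β := by
  obtain ⟨k, rfl⟩ : ∃ l, k = l + 1 := ⟨k - 1, by omega⟩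
  rw [isGenericModel_iff] at hα ⊢
  refine hα.imp ?_ (And.imp ?_ (And.imp ?_ fun h' p F => ?_))
  · refine (CoDef.sentence_iff (P := fun _ => EdgeInjective (k + 1) α)
      (Q := fun _ => EdgeInjective (k + 1) β) Empty.elim Empty.elim ?_ h).1
    unfold EdgeInjective; infer_instance
  · refine (CoDef.sentence_iff (P := fun _ => EdgeSymmetric (k + 1) α)
      (Q := fun _ => EdgeSymmetric (k + 1) β) Empty.elim Empty.elim ?_ h).1
    unfold EdgeSymmetric; infer_instance
  · refine (CoDef.sentence_iff (P := fun _ => NoCliques n (k + 1) α)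
      (Q := fun _ => NoCliques n (k + 1) β) Empty.elim Empty.elim ?_ h).1
    unfold NoCliques; infer_instance
  · refine (CoDef.sentence_iff (P := fun _ => ExtensionAxiom n k p F α)
      (Q := fun _ => ExtensionAxiom n k p F β) Empty.elim Empty.elim ?_ h).1 (h' p F)
    unfold ExtensionAxiom; infer_instance

theorem isGenericModel_nat {n k : ℕ} {S : Set (Finset ℕ)} (hS : IsRandomCliqueFree n k S) :
    @IsGenericModel n k ℕ (hyperStructure k S) _ :=
  isGenericModel_hyperStructureOn (isRandomCliqueFree_iff.1 hS)

/-- The axioms of `T_{n,k}`. -/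
abbrev hyperTheory (n k : ℕ) : (HyperLang k).Theory := (Tnk n k).thy

/-- All generic hypergraphs on the natural numbers are elementarily equivalent, so what is true in
all of them is what is true in any single one. -/
theorem hyperTheory_eq {n k : ℕ} (hk : 2 ≤ k) (hn : k < n) {S : Set (Finset ℕ)}
    (hS : IsRandomCliqueFree n k S) :
    hyperTheory n k = @completeTheory (HyperLang k) ℕ (hyperStructure k S) := by
  ext φ
  constructor
  · exact fun h => h S hS
  · intro h S' hS'
    exact (@ElementarilyEquivalent.realize_sentence _ _ _ (hyperStructure k S)
      (hyperStructure k S') (@IsGenericModel.elementarilyEquivalent n k ℕ ℕ (hyperStructure k S)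
      (hyperStructure k S') _ _ hk hn (isGenericModel_nat hS)
      (isGenericModel_nat hS')) φ).1 h

theorem Tnk_complete {n k : ℕ} (hk : 2 ≤ k) (hn : k < n) {S : Set (Finset ℕ)}
    (hS : IsRandomCliqueFree n k S) : (Tnk n k).Complete := by
  let _ := hyperStructure k S
  change (hyperTheory n k).IsComplete
  rw [hyperTheory_eq hk hn hS]
  exact completeTheory.isComplete (HyperLang k) ℕ

/-- The theory is complete, so its models are elementarily equivalent to a generic one, and
genericity is elementary. -/
theorem models_hyperTheory_iff {n k : ℕ} (hk : 2 ≤ k) (hn : k < n) {S : Set (Finset ℕ)}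
    (hS : IsRandomCliqueFree n k S) {α : Type*} [DecidableEq α] [(HyperLang k).Structure α]
    [Nonempty α] : α ⊨ hyperTheory n k ↔ IsGenericModel n k α := by
  let _ := hyperStructure k S
  rw [hyperTheory_eq hk hn hS]
  constructor
  · intro h
    refine (isGenericModel_nat hS).of_elementarilyEquivalent hk ?_
    rw [elementarilyEquivalent_iff]
    intro φ
    exact (completeTheory.isComplete (HyperLang k) ℕ).realize_sentence_iff φ ℕ |>.trans
      ((completeTheory.isComplete (HyperLang k) ℕ).realize_sentence_iff φ α).symm
  · intro h
    have := (isGenericModel_nat hS).elementarilyEquivalent hk hn h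
    exact ⟨fun φ hφ => (this.realize_sentence φ).1 hφ⟩

end Theory

/-! ### A generic hypergraph on the hereditarily finite sets -/

/-- One of the entries has as a member the set of all other entries. -/
def SetEdge {k : ℕ} (a : Fin k → ZFSet.{u}) : Prop :=
  ∃ i, ∃ c ∈ a i, ∀ t, t ∈ c ↔ ∃ j, j ≠ i ∧ t = a j

/-- There is no `(n - 1)`-clique all of whose `(k - 1)`-element subsets belong to `y`. -/
def CliqueAvoiding (n k : ℕ) (y : ZFSet.{u}) : Prop :=
  ¬ ∃ v : Fin (n - 1) → ZFSet.{u}, Function.Injective v ∧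
    (∀ f : Fin (k - 1) → Fin (n - 1), Function.Injective f → ∃ c ∈ y, ∀ t, t ∈ c ↔ ∃ i, t = v (f i)) ∧
    ∀ f : Fin k → Fin (n - 1), Function.Injective f → SetEdge fun i => v (f i)

/-- The vertices of the generic hypergraph. -/
def IsVertex (Q : Prop) (n k : ℕ) (x : ZFSet.{u}) : Prop :=
  IsHF x ∧ (Q → x.Hereditarily (CliqueAvoiding n k))

theorem exists_injective_apply_eq {n k : ℕ} (hk : 2 ≤ k) (hn : k < n) (i : Fin (n - 1)) :
    ∃ f : Fin (k - 1) → Fin (n - 1), Function.Injective f ∧ ∃ j, f j = i := by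
  obtain ⟨e, he⟩ : ∃ e : Equiv.Perm (Fin (n - 1)), e ⟨0, by omega⟩ = i :=
    ⟨Equiv.swap ⟨0, by omega⟩ i, by simp⟩
  exact ⟨fun j => e (Fin.castLE (by omega) j), e.injective.comp
    (Fin.castLE_injective (by omega : k - 1 ≤ n - 1)), ⟨0, by omega⟩, he⟩

/-- Among the first `k` vertices of the clique, leave out one at a time. The resulting count of `k`
distinct members with `k - 1` elements each is a cheap way to see that a given set is clique
avoiding. -/
theorem exists_subsets_of_not_cliqueAvoiding {n k : ℕ} (hk : 2 ≤ k) (hn : k < n) {y : ZFSet.{u}}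
    (h : ¬ CliqueAvoiding n k y) : ∃ c : Fin k → ZFSet.{u}, Function.Injective c ∧
      ∀ i, c i ∈ y ∧ {t | t ∈ c i}.ncard = k - 1 := by
  obtain ⟨k, rfl⟩ : ∃ l, k = l + 1 := ⟨k - 1, by omega⟩
  simp only [CliqueAvoiding, not_not] at h
  obtain ⟨v, hv, hc, -⟩ := h
  have hle : k + 1 ≤ n - 1 := by omega
  have hinj (i : Fin (k + 1)) : Function.Injective fun j : Fin (k + 1 - 1) =>
      Fin.castLE hle (i.succAbove j) :=
    (Fin.castLE_injective hle).comp Fin.succAbove_right_injective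
  choose c hcy hct using fun i => hc _ (hinj i)
  refine ⟨c, fun i j hij => ?_, fun i => ⟨hcy i, ?_⟩⟩
  · by_contra hne
    obtain ⟨l, hl⟩ := Fin.exists_succAbove_eq hne
    have h1 : v (Fin.castLE hle i) ∈ c j := (hct j _).2 ⟨l, by rw [hl]⟩
    rw [← hij, hct] at h1
    obtain ⟨l', hl'⟩ := h1
    exact Fin.succAbove_ne i l' (Fin.castLE_injective hle (hv hl')).symm
  · have : {t | t ∈ c i} = Set.range fun l => v (Fin.castLE hle (i.succAbove l)) := by
      ext t
      rw [Set.mem_ofPred_eq, hct]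
      simp [eq_comm]
    have hcomp := hv.comp (hinj i)
    simp only [Function.comp_def] at hcomp
    rw [this, ← Set.image_univ]
    exact (Set.ncard_image_of_injective _ hcomp).trans (by simp [Set.ncard_univ])

theorem setOf_mem_natCode (n : ℕ) :
    {t : ZFSet.{u} | t ∈ natCode n} = natCode '' (Set.Iio n) := by
  ext t
  rw [Set.mem_ofPred_eq, mem_natCode]
  simp [eq_comm]

theorem ncard_natCode (n : ℕ) : {t : ZFSet.{u} | t ∈ natCode n}.ncard = n := by
  rw [setOf_mem_natCode, Set.ncard_image_of_injective _ natCode_injective]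
  simp [← Finset.coe_Iio]

/-- A natural number has at most one member with exactly `k - 1` elements, namely `k - 1` itself,
and `k ≥ 2` of them would be needed. -/
theorem cliqueAvoiding_natCode {n k : ℕ} (hk : 2 ≤ k) (hn : k < n) (m : ℕ) :
    CliqueAvoiding n k (natCode m : ZFSet.{u}) := by
  by_contra h
  obtain ⟨c, hc, hcm⟩ := exists_subsets_of_not_cliqueAvoiding hk hn h
  have (i : Fin k) : c i = natCode (k - 1) := by
    obtain ⟨l, -, hl⟩ := mem_natCode.1 (hcm i).1
    have := (hcm i).2
    rw [hl, ncard_natCode] at this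
    rw [hl, this]
  have := hc ((this ⟨0, by omega⟩).trans (this ⟨1, by omega⟩).symm)
  simp at this

theorem hereditarily_natCode {n k : ℕ} (hk : 2 ≤ k) (hn : k < n) (m : ℕ) :
    (natCode m : ZFSet.{u}).Hereditarily (CliqueAvoiding n k) := by
  induction m using Nat.strong_induction_on with
  | _ m ih =>
  rw [ZFSet.hereditarily_iff]
  refine ⟨cliqueAvoiding_natCode hk hn m, fun y hy => ?_⟩
  obtain ⟨l, hl, rfl⟩ := mem_natCode.1 hy
  exact ih l hl

theorem isVertex_natCode {n k : ℕ} (hk : 2 ≤ k) (hn : k < n) (Q : Prop) (m : ℕ) :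
    IsVertex Q n k (natCode m : ZFSet.{u}) :=
  ⟨GoodClass.natCode_isHF m, fun _ => hereditarily_natCode hk hn m⟩

theorem rank_natCode (n : ℕ) : (natCode n : ZFSet.{u}).rank = n := by
  induction n with
  | zero => simp [natCode]
  | succ n ih =>
    rw [natCode, ZFSet.rank_insert, ih]
    simp

theorem IsHF.exists_rank_le {x : ZFSet.{u}} (h : IsHF x) : ∃ n : ℕ, x.rank ≤ n := by
  induction x using ZFSet.inductionOn with
  | _ x ih =>
  choose! r hr using fun z hz => ih z hz ((isHF_iff.1 h).2 z hz)
  obtain ⟨b, hb⟩ := ((isHF_iff.1 h).1.image r).bddAbove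
  refine ⟨b + 1, ZFSet.rank_le_iff.2 fun {z} hz => ?_⟩
  refine (hr z hz).trans_lt ?_
  exact_mod_cast Nat.lt_succ_of_le (hb ⟨z, hz, rfl⟩)

section Generic

variable {α : Type*} [DecidableEq α] {n k : ℕ} {Q : Prop} {ι : α → ZFSet.{u}}

/-- The hypergraph on a type of vertices which are represented by sets. -/
def setHypergraph (k : ℕ) (ι : α → ZFSet.{u}) : Set (Finset α) :=
  {e | e.card = k ∧ ∃ y ∈ e, ∃ c ∈ ι y, ∀ t, t ∈ c ↔ ∃ z ∈ e, z ≠ y ∧ t = ι z}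

theorem image_mem_setHypergraph {a : Fin k → α}
    (ha : Function.Injective a) :
    Finset.univ.image a ∈ setHypergraph k ι ↔ SetEdge fun i => ι (a i) := by
  simp only [setHypergraph, Set.mem_ofPred_eq, card_image_fin ha, true_and, SetEdge,
    Finset.mem_image, Finset.mem_univ, exists_exists_eq_and, ha.ne_iff]

theorem exists_rank_lt (hH : ∀ a, IsHF (ι a)) (A : Finset α) : ∃ m : ℕ, ∀ a ∈ A,
    (ι a).rank < m := by
  choose r hr using fun a => (hH a).exists_rank_le
  refine ⟨A.sup r + 1, fun a ha => (hr a).trans_lt ?_⟩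
  exact_mod_cast Nat.lt_succ_of_le (Finset.le_sup ha)

/-- Each edge is caused by its vertex of largest rank, because the cause contains a set which
contains all the others. In an `n`-clique the vertex of largest rank would therefore have as members
all `(k - 1)`-subsets of the other vertices, which form an `(n - 1)`-clique, and so would not be
clique avoiding. For the extension property the new vertex is the set of the codes of the prescribed
neighbours, padded by one large natural number. It is clique avoiding because the vertices of a
violating clique occur in codes, hence lie in `A` and contradict extendability. -/
theorem isGeneric_setHypergraph (hk : 2 ≤ k) (hn : k < n) (hι : Function.Injective ι)
    (hr : ∀ x, (∃ a, ι a = x) ↔ IsVertex Q n k x) : IsGeneric Q n k (setHypergraph k ι) := by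
  have hvert (a : α) : IsVertex Q n k (ι a) := (hr _).1 ⟨a, rfl⟩
  refine ⟨fun e he => he.1, fun hQ v hv hcl => ?_, fun A F hF => ?_⟩
  · obtain ⟨x, hx, hxmax⟩ := v.exists_max_image (fun x => (ι x).rank)
      (Finset.card_pos.1 (by omega))
    have hcard : (v.erase x).card = n - 1 := by rw [Finset.card_erase_of_mem hx, hv]
    obtain ⟨a, ha, hav, -⟩ := exists_injective_tuple hcard
    have hav' (i) : a i ≠ x ∧ a i ∈ v := by
      have : a i ∈ v.erase x := hav ▸ Finset.mem_image_of_mem _ (Finset.mem_univ _)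
      rwa [Finset.mem_erase] at this
    have hx' := ((ZFSet.hereditarily_iff).1 ((hvert x).2 hQ)).1
    refine hx' ⟨fun i => ι (a i), hι.comp ha, fun f hf => ?_, fun f hf => ?_⟩
    · have hxf : x ∉ Finset.univ.image fun i => a (f i) := by
        intro h
        obtain ⟨i, -, hi⟩ := Finset.mem_image.1 h
        exact (hav' _).1 hi
      obtain ⟨-, y, hy, c, hc, hct⟩ := hcl (insert x (Finset.univ.image fun i => a (f i))) (by
          intro y hy
          rcases Finset.mem_insert.1 hy with rfl | hy
          · exact hx
          · obtain ⟨i, -, rfl⟩ := Finset.mem_image.1 hy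
            exact (hav' _).2) (by
          rw [Finset.card_insert_of_notMem hxf, show (fun i => a (f i)) = a ∘ f from rfl,
            card_image_fin (ha.comp hf)]
          omega)
      have hyx : y = x := by
        by_contra hne
        have h1 : ι x ∈ c := (hct _).2 ⟨x, Finset.mem_insert_self _ _, Ne.symm hne, rfl⟩
        have hyv : y ∈ v := by
          obtain ⟨i, -, rfl⟩ := Finset.mem_image.1 ((Finset.mem_insert.1 hy).resolve_left hne)
          exact (hav' _).2
        exact absurd ((ZFSet.rank_lt_of_mem h1).trans (ZFSet.rank_lt_of_mem hc))
          (not_lt.2 (hxmax y hyv))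
      subst hyx
      refine ⟨c, hc, fun t => (hct t).trans ⟨?_, ?_⟩⟩
      · rintro ⟨z, hz, hzy, rfl⟩
        obtain ⟨i, -, rfl⟩ := Finset.mem_image.1 ((Finset.mem_insert.1 hz).resolve_left hzy)
        exact ⟨i, rfl⟩
      · rintro ⟨i, rfl⟩
        exact ⟨_, Finset.mem_insert_of_mem (Finset.mem_image_of_mem _ (Finset.mem_univ _)),
          (hav' _).1, rfl⟩
    · refine (image_mem_setHypergraph (ha.comp hf)).1 (hcl _ ?_ (card_image_fin (ha.comp hf)))
      intro y hy
      obtain ⟨i, -, rfl⟩ := Finset.mem_image.1 hy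
      exact (hav' _).2
  · obtain ⟨m, hm⟩ := exists_rank_lt (fun a => (hvert a).1) A
    -- The bound `m` on the ranks makes the member `natCode N` lift the new vertex above all of `A`,
    -- so that the new vertex is the cause of its edges. The bound `k` keeps `natCode N` from being
    -- the code of a set of `k - 1` vertices.
    let N := max m k
    have hN (a) (ha : a ∈ A) : (ι a).rank < (natCode N : ZFSet.{u}).rank := by
      rw [rank_natCode]
      exact (hm a ha).trans_le (by exact_mod_cast le_max_left m k)
    choose code hcode using fun c : Finset α =>
      exists_mem_iff_of_finite (c.finite_toSet.image ι)
    have hcode' (c : Finset α) (t : ZFSet.{u}) : t ∈ code c ↔ ∃ z ∈ c, t = ι z := by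
      rw [hcode]; simp [eq_comm]
    have hcode_inj {c d : Finset α} (h : ∀ t, t ∈ code c ↔ t ∈ code d) : c = d := by
      ext a
      have := h (ι a)
      simpa [hcode', hι.eq_iff] using this
    have hncard (c : Finset α) : {t | t ∈ code c}.ncard = c.card := by
      rw [show {t | t ∈ code c} = ι '' c from Set.ext (hcode c),
        Set.ncard_image_of_injective _ hι, Set.ncard_coe_finset]
    obtain ⟨x, hx⟩ := exists_mem_iff_of_finite
      ((((A.powersetCard (k - 1)).finite_toSet.inter_of_left F).image code).insert (natCode N))
    have hx' (t : ZFSet.{u}) : t ∈ x ↔ t = natCode N ∨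
        ∃ c ⊆ A, c.card = k - 1 ∧ c ∈ F ∧ t = code c := by
      rw [hx]
      simp [Finset.mem_powersetCard, and_assoc, eq_comm]
    have hxHF : IsHF x := by
      rw [isHF_iff]
      refine ⟨?_, fun t ht => ?_⟩
      · exact (((((A.powersetCard (k - 1)).finite_toSet.inter_of_left F).image code).insert
          (natCode N))).subset fun t ht => (hx t).1 ht
      · rcases (hx' t).1 ht with rfl | ⟨c, -, -, -, rfl⟩
        · exact GoodClass.natCode_isHF N
        · rw [isHF_iff]
          refine ⟨(c.finite_toSet.image ι).subset fun t ht => (hcode c t).1 ht, fun t ht => ?_⟩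
          obtain ⟨z, -, rfl⟩ := (hcode' c t).1 ht
          exact (hvert z).1
    have hpad {c : Finset α} (hc : c.card = k - 1) (h : ∀ t, t ∈ natCode N ↔ t ∈ code c) :
        False := by
      have h1 := ncard_natCode.{u} N
      rw [show {t : ZFSet.{u} | t ∈ natCode N} = {t | t ∈ code c} from Set.ext h, hncard, hc] at h1
      have : k ≤ N := le_max_right m k
      omega
    have hxrank (a) (ha : a ∈ A) : (ι a).rank < x.rank :=
      (hN a ha).trans (ZFSet.rank_lt_of_mem ((hx' _).2 (Or.inl rfl)))
    obtain ⟨b, rfl⟩ : ∃ b, ι b = x := by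
      refine (hr x).2 ⟨hxHF, fun hQ => ZFSet.hereditarily_iff.2 ⟨?_, fun t ht => ?_⟩⟩
      · rintro ⟨v, hv, hvc, hvS⟩
        have hvc' (f : Fin (k - 1) → Fin (n - 1)) (hf : Function.Injective f) :
            ∃ c ⊆ A, c.card = k - 1 ∧ c ∈ F ∧ ∀ t, t ∈ code c ↔ ∃ i, t = v (f i) := by
          obtain ⟨t, ht, htf⟩ := hvc f hf
          rcases (hx' t).1 ht with rfl | ⟨c, hcA, hc, hcF, rfl⟩
          · exfalso
            have h1 := ncard_natCode.{u} N
            rw [show {t : ZFSet.{u} | t ∈ natCode N} = Set.range (v ∘ f) from Set.ext fun t => by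
              rw [Set.mem_ofPred_eq, htf]; simp [eq_comm], ← Set.image_univ,
              Set.ncard_image_of_injective _ (hv.comp hf), Set.ncard_univ] at h1
            have : k ≤ N := le_max_right m k
            simp at h1
            omega
          · exact ⟨c, hcA, hc, hcF, htf⟩
        have hvA (i : Fin (n - 1)) : ∃ a ∈ A, v i = ι a := by
          obtain ⟨f, hf, j, hfj⟩ : ∃ f : Fin (k - 1) → Fin (n - 1), Function.Injective f ∧
              ∃ j, f j = i := by
            exact exists_injective_apply_eq hk hn i
          obtain ⟨c, hcA, -, -, hct⟩ := hvc' f hf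
          obtain ⟨z, hz, hz'⟩ := (hcode' c _).1 ((hct (v i)).2 ⟨j, by rw [hfj]⟩)
          exact ⟨z, hcA hz, hz'⟩
        choose w hwA hw using hvA
        obtain rfl : v = fun i => ι (w i) := funext hw
        have hwi : Function.Injective w := hv.of_comp (f := ι)
        refine hF hQ ⟨Finset.univ.image w, ?_, card_image_fin hwi, fun c hc hck => ?_,
          fun e he hek => ?_⟩
        · intro y hy
          obtain ⟨i, -, rfl⟩ := Finset.mem_image.1 hy
          exact hwA i
        · obtain ⟨d, -, rfl⟩ := Finset.subset_image_iff.1 hc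
          rw [Finset.card_image_of_injective _ hwi] at hck
          obtain ⟨f, hf, hfd, -⟩ := exists_injective_tuple hck
          obtain ⟨c, -, -, hcF, hct⟩ := hvc' f hf
          rwa [show d.image w = c from hcode_inj fun t => by
            rw [hct, hcode', ← hfd]
            simp]
        · obtain ⟨d, -, rfl⟩ := Finset.subset_image_iff.1 he
          rw [Finset.card_image_of_injective _ hwi] at hek
          obtain ⟨f, hf, hfd, -⟩ := exists_injective_tuple hek
          rw [← hfd, Finset.image_image]
          exact (image_mem_setHypergraph (hwi.comp hf)).2 (hvS f hf)
      · rcases (hx' t).1 ht with rfl | ⟨c, -, hck, -, rfl⟩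
        · exact hereditarily_natCode hk hn N
        · rw [ZFSet.hereditarily_iff]
          -- The code of `c` has only `k - 1` members, too few to violate clique avoidance.
          refine ⟨by_contra fun h => ?_, fun t ht => ?_⟩
          · obtain ⟨d, hd, hdc⟩ := exists_subsets_of_not_cliqueAvoiding hk hn h
            have h1 : Set.range d ⊆ {t | t ∈ code c} := by
              rintro _ ⟨i, rfl⟩
              exact (hdc i).1
            have h2 := Set.ncard_le_ncard h1 (by
              rw [show {t | t ∈ code c} = ι '' c from Set.ext (hcode c)]
              exact c.finite_toSet.image ι)
            rw [hncard, hck, ← Set.image_univ, Set.ncard_image_of_injective _ hd,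
              Set.ncard_univ] at h2
            simp at h2
            omega
          · obtain ⟨z, -, rfl⟩ := (hcode' c t).1 ht
            exact (hvert z).2 hQ
    have hbA : b ∉ A := fun h => lt_irrefl _ (hxrank b h)
    refine ⟨b, hbA, fun c hcA hck => ?_⟩
    have hcA : c ⊆ A := hcA
    have hbc : b ∉ c := fun h => hbA (hcA h)
    constructor
    · rintro ⟨-, y, hy, d, hd, hdt⟩
      have hyb : y = b := by
        by_contra hne
        have h1 : ι b ∈ d := (hdt _).2 ⟨b, Finset.mem_insert_self _ _, Ne.symm hne, rfl⟩
        exact lt_asymm (hxrank y (hcA ((Finset.mem_insert.1 hy).resolve_left hne)))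
          ((ZFSet.rank_lt_of_mem h1).trans (ZFSet.rank_lt_of_mem hd))
      subst hyb
      have hdt' (t) : t ∈ d ↔ t ∈ code c := by
        rw [hdt, hcode']
        constructor
        · rintro ⟨z, hz, hzy, rfl⟩
          exact ⟨z, (Finset.mem_insert.1 hz).resolve_left hzy, rfl⟩
        · rintro ⟨z, hz, rfl⟩
          exact ⟨z, Finset.mem_insert_of_mem hz, fun h => hbc (h ▸ hz), rfl⟩
      rcases (hx' d).1 hd with rfl | ⟨c', -, -, hcF, rfl⟩
      · exact (hpad hck hdt').elim
      · rwa [← hcode_inj hdt']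
    · intro hcF
      refine ⟨by rw [Finset.card_insert_of_notMem hbc]; omega, b, Finset.mem_insert_self _ _,
        code c, (hx' _).2 (Or.inr ⟨c, hcA, hck, hcF, rfl⟩), fun t => ?_⟩
      rw [hcode']
      constructor
      · rintro ⟨z, hz, rfl⟩
        exact ⟨z, Finset.mem_insert_of_mem hz, fun h => hbc (h ▸ hz), rfl⟩
      · rintro ⟨z, hz, hzy, rfl⟩
        exact ⟨z, (Finset.mem_insert.1 hz).resolve_left hzy, rfl⟩

end Generic

theorem countable_isHF : {x : ZFSet.{u} | IsHF x}.Countable := by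
  have hfin (m : ℕ) : {x : ZFSet.{u} | IsHF x ∧ x.rank ≤ m}.Finite := by
    induction m with
    | zero =>
      refine (Set.finite_singleton ∅).subset fun x hx => ?_
      rw [Set.mem_singleton_iff, ZFSet.eq_empty]
      exact fun y hy => not_lt_bot ((ZFSet.rank_lt_of_mem hy).trans_le (by simpa using hx.2))
    | succ m ih =>
      refine Set.Finite.of_finite_image (f := fun x => {z | z ∈ x}) (ih.finite_subsets.subset ?_)
        fun x _ y _ hxy => ZFSet.ext fun z => Set.ext_iff.1 hxy z
      rintro _ ⟨x, hx, rfl⟩ z hz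
      refine ⟨(isHF_iff.1 hx.1).2 z hz, ?_⟩
      have := (ZFSet.rank_lt_of_mem hz).trans_le hx.2
      rw [Nat.cast_add_one] at this
      exact Order.lt_succ_iff.1 (by simpa using this)
  refine (Set.countable_iUnion fun m => (hfin m).countable).mono fun x hx => ?_
  obtain ⟨m, hm⟩ := IsHF.exists_rank_le hx
  exact Set.mem_iUnion.2 ⟨m, hx, hm⟩

/-- There is a generic hypergraph on the natural numbers. -/
theorem exists_isGeneric_nat (Q : Prop) {n k : ℕ} (hk : 2 ≤ k) (hn : k < n) :
    ∃ S : Set (Finset ℕ), IsGeneric Q n k S := by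
  have : Countable {x : ZFSet.{0} | IsVertex Q n k x} :=
    (countable_isHF.mono fun x hx => hx.1).to_subtype
  have : Infinite {x : ZFSet.{0} | IsVertex Q n k x} :=
    Infinite.of_injective (fun m => ⟨natCode m, isVertex_natCode hk hn Q m⟩)
      fun _ _ h => natCode_injective (congrArg Subtype.val h)
  obtain ⟨e⟩ : Nonempty ({x : ZFSet.{0} | IsVertex Q n k x} ≃ ℕ) := nonempty_equiv_of_countable
  refine ⟨_, isGeneric_setHypergraph (ι := fun i => (e.symm i).1) hk hn
    (Subtype.val_injective.comp e.symm.injective) fun x => ?_⟩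
  exact ⟨by rintro ⟨a, rfl⟩; exact (e.symm a).2, fun hx => ⟨e ⟨x, hx⟩, by simp⟩⟩

theorem exists_isRandomCliqueFree {n k : ℕ} (hk : 2 ≤ k) (hn : k < n) :
    ∃ S : Set (Finset ℕ), IsRandomCliqueFree n k S :=
  (exists_isGeneric_nat True hk hn).imp fun _ => isRandomCliqueFree_iff.2

theorem exists_isRandom {k : ℕ} (hk : 2 ≤ k) : ∃ S : Set (Finset ℕ), IsRandom k S :=
  (exists_isGeneric_nat False hk (Nat.lt_succ_self k)).imp fun _ => isRandom_iff.2

/-! ### A model of the theory of random clique-free hypergraphs in every transitive model -/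

/-- The relation `SetEdge` in a model of set theory. -/
def InnerEdge {W : Type*} [SetLang.Structure W] {k : ℕ} (a : Fin k → W) : Prop :=
  ∃ i, ∃ c, E c (a i) ∧ ∀ t, E t c ↔ ∃ j, j ≠ i ∧ t = a j

/-- The property `CliqueAvoiding` in a model of set theory. -/
def InnerCliqueAvoiding {W : Type*} [SetLang.Structure W] (n k : ℕ) (y : W) : Prop :=
  ¬ ∃ v : Fin (n - 1) → W, Function.Injective v ∧
    (∀ f : Fin (k - 1) → Fin (n - 1), Function.Injective f → ∃ c, E c y ∧
      ∀ t, E t c ↔ ∃ i, t = v (f i)) ∧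
    ∀ f : Fin k → Fin (n - 1), Function.Injective f → InnerEdge fun i => v (f i)

section

variable {M N γ : Type*} [SetLang.Structure M] [SetLang.Structure N] {p : γ → M} {q : γ → N} {n : ℕ}

instance CoDef.innerEdge {k : ℕ} (f : Fin k → (Fin n → M) → M) (g : Fin k → (Fin n → N) → N)
    [h : ∀ i, CoTerm SetLang p q n (f i) (g i)] :
    CoDef SetLang p q n (fun v => InnerEdge fun i => f i v) (fun v => InnerEdge fun i => g i v) :=
  CoDef.subst (P := InnerEdge) (Q := InnerEdge) (by unfold InnerEdge; infer_instance) f g h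

instance CoDef.innerCliqueAvoiding {m k : ℕ} (f : (Fin n → M) → M) (g : (Fin n → N) → N)
    [h : CoTerm SetLang p q n f g] : CoDef SetLang p q n (fun v => InnerCliqueAvoiding m k (f v))
      (fun v => InnerCliqueAvoiding m k (g v)) :=
  CoDef.subst₁ (by unfold InnerCliqueAvoiding; infer_instance) _ _

end

theorem goodClass_isHF : GoodClass {x : ZFSet.{u} | IsHF x} :=
  ⟨fun _ hx y hy => (isHF_iff.1 hx).2 y hy, isHF_empty, fun _ hx _ hy => hx.insert hy⟩

namespace GoodClass

variable {V : Set ZFSet.{u}} {n k : ℕ}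

theorem innerEdge_iff (hV : GoodClass V) {a : Fin k → V} :
    InnerEdge a ↔ SetEdge fun i => (a i).1 := by
  constructor
  · rintro ⟨i, c, hc, h⟩
    refine ⟨i, c, hc, fun t => ⟨fun ht => ?_, ?_⟩⟩
    · obtain ⟨j, hj, hjt⟩ := (h ⟨t, hV.trans _ c.2 _ ht⟩).1 ht
      exact ⟨j, hj, congrArg Subtype.val hjt⟩
    · rintro ⟨j, hj, rfl⟩
      exact (h (a j)).2 ⟨j, hj, rfl⟩
  · rintro ⟨i, c, hc, h⟩
    refine ⟨i, ⟨c, hV.trans _ (a i).2 _ hc⟩, hc, fun t => (h t.1).trans ?_⟩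
    simp only [Subtype.ext_iff]

/-- The clique on the right consists of arbitrary sets. They lie in `V` all the same, since each
vertex belongs to one of the `(k - 1)`-subsets, and these are members of `y`. -/
theorem innerCliqueAvoiding_iff (hV : GoodClass V) (hk : 2 ≤ k) (hn : k < n) {y : V} :
    InnerCliqueAvoiding n k y ↔ CliqueAvoiding n k y.1 := by
  refine not_congr ⟨?_, ?_⟩
  · rintro ⟨v, hv, hc, he⟩
    refine ⟨fun i => (v i).1, Subtype.val_injective.comp hv, fun f hf => ?_,
      fun f hf => hV.innerEdge_iff.1 (he f hf)⟩
    obtain ⟨c, hcy, hct⟩ := hc f hf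
    refine ⟨c, hcy, fun t => ⟨fun ht => ?_, ?_⟩⟩
    · obtain ⟨i, hi⟩ := (hct ⟨t, hV.trans _ c.2 _ ht⟩).1 ht
      exact ⟨i, congrArg Subtype.val hi⟩
    · rintro ⟨i, rfl⟩
      exact (hct _).2 ⟨i, rfl⟩
  · rintro ⟨v, hv, hc, he⟩
    have hvV (i) : v i ∈ V := by
      obtain ⟨f, hf, j, rfl⟩ := exists_injective_apply_eq hk hn i
      obtain ⟨c, hcy, hct⟩ := hc f hf
      exact hV.trans _ (hV.trans _ y.2 _ hcy) _ ((hct _).2 ⟨j, rfl⟩)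
    refine ⟨fun i => ⟨v i, hvV i⟩, fun i j h => hv (congrArg Subtype.val h), fun f hf => ?_,
      fun f hf => hV.innerEdge_iff.2 (he f hf)⟩
    obtain ⟨c, hcy, hct⟩ := hc f hf
    refine ⟨⟨c, hV.trans _ y.2 _ hcy⟩, hcy, fun t => (hct t.1).trans ?_⟩
    simp only [Subtype.ext_iff]

end GoodClass

namespace IsTransitiveModel

variable {V : Set ZFSet.{u}} {n k : ℕ}

theorem exists_vertexSet (hV : IsTransitiveModel V) (hk : 2 ≤ k) (hn : k < n) :
    ∃ U : V, ∀ x, x ∈ U.1 ↔ IsVertex True n k x := by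
  obtain ⟨o, ho⟩ := hV.exists_hf
  have hU (x : ZFSet.{u}) : x ∈ ZFSet.sep (IsVertex True n k) o.1 ↔ IsVertex True n k x := by
    rw [ZFSet.mem_sep]
    exact ⟨And.right, fun h => ⟨(ho ⟨x, hV.good.mem_of_isHF h.1⟩).2 h.1, h⟩⟩
  -- To be hereditarily clique avoiding is expressed by membership in a transitive set of clique
  -- avoiding sets, which is first-order; a finite such set is cut out of a ranking of `x`.
  refine ⟨⟨_, hV.mem_of_definable (fun x => ∃ t, E x t ∧ (∀ y z, E y t → E z y → E z t) ∧
    ∀ y, E y t → InnerCliqueAvoiding n k y) _ fun x => (hU x).trans ?_⟩, hU⟩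
  constructor
  · rintro ⟨hx, hx'⟩
    obtain ⟨r, hr, hr', m, hm⟩ := hx.exists_ranking
    obtain ⟨t, ht⟩ := exists_mem_iff_of_finite
      ((hr.image Prod.snd).inter_of_left {y | y.Hereditarily (CliqueAvoiding n k)})
    have htV : t ∈ V := by
      refine hV.good.mem_of_finite (((hr.image Prod.snd).inter_of_left _).subset
        fun y hy => (ht y).1 hy) fun y hy => ?_
      obtain ⟨⟨a, ha, rfl⟩, -⟩ := (ht y).1 hy
      exact hV.good.mem_of_isHF (hr' a ha).1
    refine ⟨hV.good.mem_of_isHF hx, hx, ⟨t, htV⟩, (ht x).2 ⟨⟨_, hm, rfl⟩, hx' trivial⟩, ?_, ?_⟩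
    · intro y z hy hz
      obtain ⟨⟨a, ha, hay⟩, hy'⟩ := (ht y).1 hy
      obtain ⟨i, -, hi⟩ := (hr' a ha).2 z (by rw [hay]; exact hz)
      exact (ht z).2 ⟨⟨_, hi, rfl⟩, (ZFSet.hereditarily_iff.1 hy').2 z hz⟩
    · intro y hy
      rw [hV.good.innerCliqueAvoiding_iff hk hn]
      exact (ZFSet.hereditarily_iff.1 ((ht y).1 hy).2).1
  · rintro ⟨hxV, hx, t, hxt, htr, htc⟩
    refine ⟨hx, fun _ => ?_⟩
    have key (y : ZFSet.{u}) : ∀ hy : y ∈ V, E ⟨y, hy⟩ t → y.Hereditarily (CliqueAvoiding n k) := by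
      induction y using ZFSet.inductionOn with
      | _ y ih =>
      intro hy hyt
      rw [ZFSet.hereditarily_iff]
      exact ⟨(hV.good.innerCliqueAvoiding_iff hk hn).1 (htc _ hyt), fun z hz =>
        ih z hz (hV.1 _ hy _ hz) (htr ⟨y, hy⟩ ⟨z, hV.1 _ hy _ hz⟩ hyt hz)⟩
    exact key x hxV hxt

/-- The edge relation of the generic hypergraph on hereditarily finite sets is definable in `V`, so
the hypergraph belongs to `V`. Without some model in `V`, neither form of pseudosaturation could be
compared with the other. -/
theorem nonempty_innerModel (hV : IsTransitiveModel V) (hk : 2 ≤ k) (hn : k < n) :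
    Nonempty (InnerModel V (Tnk n k)) := by
  classical
  obtain ⟨U, hU⟩ := hV.exists_vertexSet hk hn
  obtain ⟨S, hS⟩ := exists_isRandomCliqueFree hk hn
  have hne : Nonempty (U.1 : ZFSet.{u}) := ⟨⟨natCode 0, (hU _).2 (isVertex_natCode hk hn _ 0)⟩⟩
  let H : Set (Finset (U.1 : ZFSet.{u})) := setHypergraph k Subtype.val
  have hH : IsGeneric True n k H := isGeneric_setHypergraph hk hn Subtype.val_injective
    fun x => ⟨by rintro ⟨a, rfl⟩; exact (hU _).1 a.2, fun hx => ⟨⟨x, (hU x).2 hx⟩, rfl⟩⟩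
  have hHF (x : (U.1 : ZFSet.{u})) : IsHF x.1 := ((hU _).1 x.2).1
  have hmem : relGraph (fun a : Fin k → (U.1 : ZFSet.{u}) => Function.Injective a ∧
      Finset.univ.image a ∈ H) ∈ V := by
    refine hV.mem_of_definable (fun t => ∃ a : Fin k → V, Function.Injective a ∧
      (∀ i, E (a i) U) ∧ InnerEdge a ∧ Tuple a t) _ fun t => ?_
    simp only [relGraph, ZFSet.mem_range, Subtype.exists]
    constructor
    · rintro ⟨a, ⟨ha, ha'⟩, rfl⟩
      have hHFt : IsHF (tupleCode (List.ofFn fun i => (a i : ZFSet.{u}))) := by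
        have := goodClass_isHF.tupleCode_mem (List.ofFn fun i => ⟨(a i).1, hHF _⟩)
        rwa [List.map_ofFn] at this
      refine ⟨hV.good.mem_of_isHF hHFt, hHFt, fun i => ⟨a i, hV.1 _ U.2 _ (a i).2⟩,
        fun i j h => ha (Subtype.ext (congrArg (fun x : V => x.1) h)), fun i => (a i).2, ?_,
        hV.good.tuple_iff.2 rfl⟩
      exact hV.good.innerEdge_iff.2 ((image_mem_setHypergraph ha).1 ha')
    · rintro ⟨htV, -, a, ha, haU, haE, ht⟩
      have hinj : Function.Injective fun i => (⟨(a i).1, haU i⟩ : (U.1 : ZFSet.{u})) :=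
        fun i j h => ha (Subtype.ext (congrArg (fun x : (U.1 : ZFSet.{u}) => x.1) h))
      exact ⟨fun i => ⟨(a i).1, haU i⟩, ⟨hinj,
        (image_mem_setHypergraph hinj).2 (hV.good.innerEdge_iff.1 haE)⟩,
        (hV.good.tuple_iff.1 ht).symm⟩
  let _ : (HyperLang k).Structure (U.1 : ZFSet.{u}) := hyperStructureOn k H
  let _ : (Tnk n k).L.Structure (U.1 : ZFSet.{u}) := hyperStructureOn k H
  refine ⟨⟨U, hne, hyperStructureOn k H, ?_,
    (models_hyperTheory_iff hk hn hS).2 (isGenericModel_hyperStructureOn hH)⟩⟩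
  have hrange (z : ZFSet.{u}) (hz : z ∈ ZFSet.range fun s : (Tnk n k).L.Symbols =>
      ZFSet.pair (natCode ((Tnk n k).num s)) (symbolGraph (Tnk n k).L (U := U.1) s)) :
      z = ZFSet.pair (natCode 0) (relGraph (fun a : Fin k → (U.1 : ZFSet.{u}) =>
        Function.Injective a ∧ Finset.univ.image a ∈ H)) := by
    rw [ZFSet.mem_range] at hz
    obtain ⟨⟨m, f⟩ | ⟨m, r⟩, rfl⟩ := hz
    · exact Empty.elim f
    · cases r
      rfl
  refine hV.good.mem_of_finite ((Set.finite_singleton _).subset hrange) fun z hz => ?_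
  rw [hrange z hz]
  exact hV.good.pair_mem (hV.nat 0).2 hmem

end IsTransitiveModel

/-! ### Realizing types -/

section Types

variable {L : FirstOrder.Language.{0, 0}} {N : Type w} [L.Structure N] [Nonempty N] {A : Set N}

/-- If all types over `A` are realized, then finitely satisfiable sets of formulas with parameters
in `A` are satisfiable. -/
theorem RealizesTypesOver.exists_realize (h : RealizesTypesOver L N A) {m : ℕ} {κ : Type*}
    (φ : κ → L.Formula (A ⊕ Fin m))
    (hφ : ∀ s : Finset κ, ∃ x : Fin m → N, ∀ i ∈ s, (φ i).Realize (Sum.elim Subtype.val x)) :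
    ∃ x : Fin m → N, ∀ i, (φ i).Realize (Sum.elim Subtype.val x) := by
  classical
  let ψ : κ → L[[A]].Formula (Fin m) := fun i => BoundedFormula.constantsVarsEquiv.symm (φ i)
  have hψ (i : κ) (x : Fin m → N) : (ψ i).Realize x ↔ (φ i).Realize (Sum.elim Subtype.val x) := by
    have := BoundedFormula.realize_constantsVarsEquiv (M := N) (φ := ψ i) (v := x) (xs := default)
    rw [Formula.Realize, ← this]
    simp only [ψ, Equiv.apply_symm_apply]
    rfl
  let S : Finset κ → L[[A]][[Fin m]].Theory := fun s =>
    (L[[A]].lhomWithConstants (Fin m)).onTheory (L[[A]].completeTheory N) ∪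
      (fun i => Formula.equivSentence (ψ i)) '' s
  have hS : Monotone S := fun s t hst => Set.union_subset_union_right _ (Set.image_mono hst)
  have hsat : Theory.IsSatisfiable (⋃ s, S s) := by
    rw [Theory.isSatisfiable_directed_union_iff hS.directed_le]
    intro s
    obtain ⟨x, hx⟩ := hφ s
    let p := (L[[A]].completeTheory N).typeOf x
    refine p.isMaximal.1.mono (Set.union_subset p.subset ?_)
    rintro _ ⟨i, hi, rfl⟩
    exact Theory.CompleteType.formula_mem_typeOf.2 ((hψ i x).2 (hx i hi))
  obtain ⟨p, hp⟩ := Set.nonempty_iff_ne_empty.2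
    ((not_congr (Theory.CompleteType.setOfPred_subset_eq_empty_iff (T := L[[A]].completeTheory N)
      (⋃ s, S s))).2 (not_not.2 (by
        rw [Set.union_eq_self_of_subset_left]
        · exact hsat
        exact Set.subset_union_left.trans (Set.subset_iUnion S ∅))))
  obtain ⟨x, hx⟩ := h m p
  refine ⟨x, fun i => (hψ i x).1 ?_⟩
  rw [← Theory.CompleteType.formula_mem_typeOf (T := L[[A]].completeTheory N), hx]
  exact hp (Set.mem_iUnion.2 ⟨{i}, Or.inr ⟨i, by simp, rfl⟩⟩)

/-- A complete type is realized in some model of the theory with constants, so it suffices to find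
in `N` a copy of a tuple from such a model. -/
theorem realizesTypesOver_of_forall (h : ∀ (m : ℕ) (K : Type w) [L[[A]].Structure K] [Nonempty K]
    [K ⊨ L[[A]].completeTheory N] (v : Fin m → K), ∃ x : Fin m → N,
      ∀ φ : L[[A]].Formula (Fin m), φ.Realize x ↔ φ.Realize v) : RealizesTypesOver L N A := by
  intro m p
  obtain ⟨K, v, rfl⟩ := Theory.exists_modelType_is_realized_in _ p
  obtain ⟨x, hx⟩ := h m K v
  refine ⟨x, SetLike.ext fun φ => ?_⟩
  rw [Theory.CompleteType.mem_typeOf, Theory.CompleteType.mem_typeOf]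
  exact hx _

end Types

section Hypergraphs

variable {n k : ℕ} {N : Type w} [(HyperLang k).Structure N] [DecidableEq N] [Nonempty N]

/-- Types over `A` are realized if the extension property holds over all finite extensions
of `A`. -/
theorem IsGenericModel.realizesTypesOver (hk : 2 ≤ k) (hn : k < n) (hN : IsGenericModel n k N)
    (A : Set N) (hA : ∀ B : Set N, B.Finite → ∀ F, Extendable n k (edgeSet k N) (A ∪ B) F →
      ExtendsBy k (edgeSet k N) (A ∪ B) F) : RealizesTypesOver (HyperLang k) N A := by
  classical
  refine realizesTypesOver_of_forall fun m K _ _ _ v => ?_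
  let _ : (HyperLang k).Structure K := ((HyperLang k).lhomWithConstants A).reduct K
  have hexp : ((HyperLang k).lhomWithConstants A).IsExpansionOn K :=
    LHom.isExpansionOn_reduct _ _
  have hNK : (HyperLang k)[[A]].ElementarilyEquivalent N K := by
    rw [elementarilyEquivalent_iff]
    intro φ
    exact ((completeTheory.isComplete (HyperLang k)[[A]] N).realize_sentence_iff φ N).trans
      ((completeTheory.isComplete (HyperLang k)[[A]] N).realize_sentence_iff φ K).symm
  have hK : IsGenericModel n k K := by
    refine hN.of_elementarilyEquivalent hk ?_
    rw [elementarilyEquivalent_iff]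
    intro φ
    rw [← LHom.realize_onSentence N ((HyperLang k).lhomWithConstants A),
      ← LHom.realize_onSentence K ((HyperLang k).lhomWithConstants A)]
    exact hNK.realize_sentence _
  let c : A → K := fun a => ((HyperLang k).con a : K)
  have hc (φ : (HyperLang k).Formula A) : φ.Realize (Subtype.val : A → N) ↔ φ.Realize c := by
    have := hNK.realize_sentence (Formula.equivSentence φ)
    rwa [Formula.realize_equivSentence, Formula.realize_equivSentence] at this
  let g₀ : N → K := fun x => if h : x ∈ A then c ⟨x, h⟩ else Classical.arbitrary K
  have hg₀ (a : A) : g₀ a = c a := by simp [g₀]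
  have hcinj : Function.Injective c := by
    intro a b hab
    have := (hc ((Term.var a).equal (Term.var b))).2 (by simpa [Formula.realize_equal] using hab)
    exact Subtype.ext (by simpa [Formula.realize_equal] using this)
  have hiso : PartialIso k (edgeSet k N) (edgeSet k K) A g₀ := by
    refine ⟨fun a ha b hb hab => ?_, fun e he hek => ?_⟩
    · rw [hg₀ ⟨a, ha⟩, hg₀ ⟨b, hb⟩] at hab
      exact congrArg Subtype.val (hcinj hab)
    · obtain ⟨a, ha, rfl, -⟩ := exists_injective_tuple hek
      have haA (i) : a i ∈ A := he (by simp)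
      have h1 : EdgeRel a ↔ EdgeRel fun i => c ⟨a i, haA i⟩ :=
        hc (Relations.formula (L := HyperLang k) HyperRel.edge fun i => Term.var ⟨a i, haA i⟩)
      have h2 := hN.edgeRel_iff a
      have h3 := hK.edgeRel_iff fun i => c ⟨a i, haA i⟩
      rw [Finset.image_image, show g₀ ∘ a = fun i => c ⟨a i, haA i⟩ from
        funext fun i => hg₀ ⟨a i, haA i⟩]
      have ha' : Function.Injective fun i => c ⟨a i, haA i⟩ := fun i j h =>
        ha (congrArg Subtype.val (hcinj h))
      rw [and_iff_right ha] at h2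
      rw [and_iff_right ha'] at h3
      exact h2.symm.trans (h1.trans h3)
  -- The map that matches the constants is extended until its range contains the entries of `v`. The
  -- domain at each stage is `A` with finitely many points added, which is where the hypothesis `hA`
  -- enters.
  have key (T : Set K) (hT : T.Finite) : ∃ (B : Set N) (g : N → K), B.Finite ∧ Set.EqOn g₀ g A ∧
      PartialIso k (edgeSet k N) (edgeSet k K) (A ∪ B) g ∧ T ⊆ g '' B := by
    induction T, hT using Set.Finite.induction_on with
    | empty => exact ⟨∅, g₀, Set.finite_empty, fun _ _ => rfl, by simpa using hiso, by simp⟩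
    | @insert b T _ _ ih =>
      obtain ⟨B, g, hB, hg, hg', hT⟩ := ih
      obtain ⟨a, g', hab, heq, h'⟩ := hg'.extend hk hn (hK.generic.cliqueFree trivial) (hA B hB) b
      refine ⟨insert a B, g', hB.insert a, fun x hx => (hg hx).trans (heq (Or.inl hx)), ?_, ?_⟩
      · rwa [Set.union_insert]
      · rintro y (rfl | hy)
        · exact ⟨a, Set.mem_insert _ _, hab⟩
        · obtain ⟨x, hx, rfl⟩ := hT hy
          exact ⟨x, Or.inr hx, (heq (Or.inr hx)).symm⟩
  obtain ⟨B, g, hB, hg, hiso, hT⟩ := key (Set.range v) (Set.finite_range v)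
  choose x hxB hxv using fun i => hT ⟨i, rfl⟩
  refine ⟨x, fun φ => ?_⟩
  have hφN := BoundedFormula.realize_constantsVarsEquiv (M := N) (φ := φ) (v := x) (xs := default)
  have hφK := BoundedFormula.realize_constantsVarsEquiv (M := K) (φ := φ) (v := v) (xs := default)
  refine hφN.symm.trans (Iff.trans ?_ hφK)
  -- A single formula involves finitely many constants, so the infinite partial isomorphism may be
  -- restricted to a finite one.
  obtain ⟨s, hs, h⟩ := hN.realize_iff hk hn hK (BoundedFormula.constantsVarsEquiv φ)
  have := h (Sum.elim (fun a : A => ((HyperLang k).con a : N)) x '' s) g (hs.image _)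
    (hiso.mono ?_) (Sum.elim (fun a : A => ((HyperLang k).con a : N)) x)
    (Sum.elim (fun a : A => ((HyperLang k).con a : K)) v) ?_ default fun i => Fin.elim0 i
  · rwa [Subsingleton.elim (g ∘ default) (default : Fin 0 → K)] at this
  · rintro _ ⟨a | i, -, rfl⟩
    · exact Or.inl a.2
    · exact Or.inr (hxB i)
  · rintro (a | i) h
    · refine ⟨⟨_, h, rfl⟩, ?_⟩
      exact (hg a.2).symm.trans (hg₀ a)
    · exact ⟨⟨_, h, rfl⟩, hxv i⟩

end Hypergraphs

/-! ### Structures which are represented in a model of set theory -/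

section Represents

variable {L : FirstOrder.Language.{0, 0}}

/-- The structure `N` is represented by the element `U` of `W`, its universe, and the elements
`g s`, the interpretations of the symbols. -/
structure Represents (L : FirstOrder.Language.{0, 0}) {N W : Type*} [L.Structure N]
    [SetLang.Structure W] (ι : N → W) (U : W) (g : L.Symbols → W) : Prop where
  injective : Function.Injective ι
  exists_iff : ∀ y, (∃ x, ι x = y) ↔ E y U
  relMap_iff : ∀ {m : ℕ} (r : L.Relations m) (a : Fin m → N), Structure.RelMap r a ↔
    ∃ t, Tuple (fun i => ι (a i)) t ∧ E t (g (Sum.inr ⟨m, r⟩))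
  funMap_iff : ∀ {m : ℕ} (f : L.Functions m) (c : Fin (m + 1) → N),
    Structure.funMap f (fun i => c i.castSucc) = c (Fin.last m) ↔
      ∃ t, Tuple (fun i => ι (c i)) t ∧ E t (g (Sum.inl ⟨m, f⟩))

/-- The formula `φ` holds of the elements of `N` represented by `v`. -/
def Holds {N W : Type*} [L.Structure N] (ι : N → W) {m : ℕ} (φ : L.BoundedFormula Empty m)
    (v : Fin m → W) : Prop :=
  ∃ x : Fin m → N, (∀ i, v i = ι (x i)) ∧ φ.Realize default x

/-- The term `t` has the value represented by `y` at the elements of `N` represented by `v`. -/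
def HasValue {N W : Type*} [L.Structure N] (ι : N → W) {m : ℕ} (t : L.Term (Empty ⊕ Fin m))
    (v : Fin m → W) (y : W) : Prop :=
  ∃ x : Fin m → N, (∀ i, v i = ι (x i)) ∧ y = ι (t.realize (Sum.elim default x))

namespace Represents

variable {N W : Type*} [L.Structure N] [SetLang.Structure W] {ι : N → W} {U : W}
  {g : L.Symbols → W} {m : ℕ}

theorem forall_iff (h : Represents L ι U g) {v : Fin m → W} :
    (∀ i, E (v i) U) ↔ ∃ x : Fin m → N, v = fun i => ι (x i) := by
  constructor
  · intro hv
    choose x hx using fun i => (h.exists_iff _).2 (hv i)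
    exact ⟨x, funext fun i => (hx i).symm⟩
  · rintro ⟨x, rfl⟩ i
    exact (h.exists_iff _).1 ⟨_, rfl⟩

theorem forall_mem (h : Represents L ι U g) (x : Fin m → N) : ∀ i, E (ι (x i)) U :=
  h.forall_iff.2 ⟨x, rfl⟩

theorem holds_iff (h : Represents L ι U g) (φ : L.BoundedFormula Empty m) (x : Fin m → N) :
    Holds ι φ (fun i => ι (x i)) ↔ φ.Realize default x := by
  constructor
  · rintro ⟨y, hy, hφ⟩
    rwa [show x = y from funext fun i => h.injective (hy i)]
  · exact fun hφ => ⟨x, fun i => rfl, hφ⟩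

theorem hasValue_iff (h : Represents L ι U g) (t : L.Term (Empty ⊕ Fin m)) (x : Fin m → N) (y : W) :
    HasValue ι t (fun i => ι (x i)) y ↔ y = ι (t.realize (Sum.elim default x)) := by
  constructor
  · rintro ⟨z, hz, hy⟩
    rwa [show x = z from funext fun i => h.injective (hz i)]
  · exact fun hy => ⟨x, fun i => rfl, hy⟩

/-- A description of a predicate on tuples of `W` which is concentrated on `U` can be checked on
the elements of `N`. -/
theorem congr_of_forall (h : Represents L ι U g) {P Q : (Fin m → W) → Prop}
    (hP : ∀ v, P v → ∃ x : Fin m → N, ∀ i, v i = ι (x i))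
    (hPQ : ∀ x : Fin m → N, P (fun i => ι (x i)) ↔ Q fun i => ι (x i)) (v : Fin m → W) :
    P v ↔ (∀ i, E (v i) U) ∧ Q v := by
  rw [h.forall_iff]
  constructor
  · intro hv
    obtain ⟨x, hx⟩ := hP v hv
    obtain rfl : v = fun i => ι (x i) := funext hx
    exact ⟨⟨x, rfl⟩, (hPQ x).1 hv⟩
  · rintro ⟨⟨x, rfl⟩, hQ⟩
    exact (hPQ x).2 hQ

theorem hasValue_var (h : Represents L ι U g) (i : Fin m) (v : Fin m → W) (y : W) :
    HasValue (L := L) ι (Term.var (Sum.inr i)) v y ↔ (∀ i, E (v i) U) ∧ y = v i :=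
  h.congr_of_forall (P := fun v => HasValue ι (Term.var (Sum.inr i)) v y)
    (Q := fun v => y = v i) (fun _ hv => ⟨_, hv.choose_spec.1⟩) (fun x => h.hasValue_iff _ x y) v

theorem hasValue_func (h : Represents L ι U g) {l : ℕ} (f : L.Functions l)
    (ts : Fin l → L.Term (Empty ⊕ Fin m)) (v : Fin m → W) (y : W) :
    HasValue ι (Term.func f ts) v y ↔ (∀ i, E (v i) U) ∧ ∃ b : Fin (l + 1) → W,
      (∀ i, E (b i) U) ∧ (∀ i : Fin l, HasValue ι (ts i) v (b i.castSucc)) ∧ b (Fin.last l) = y ∧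
        ∃ t, Tuple b t ∧ E t (g (Sum.inl ⟨l, f⟩)) := by
  refine h.congr_of_forall (P := fun v => HasValue ι (Term.func f ts) v y)
    (Q := fun v => ∃ b : Fin (l + 1) → W, (∀ i, E (b i) U) ∧
      (∀ i : Fin l, HasValue ι (ts i) v (b i.castSucc)) ∧ b (Fin.last l) = y ∧
        ∃ t, Tuple b t ∧ E t (g (Sum.inl ⟨l, f⟩)))
    (fun v hv => ⟨_, hv.choose_spec.1⟩) (fun x => ?_) v
  simp only [h.hasValue_iff]
  constructor
  · rintro rfl
    let c : Fin (l + 1) → N := Fin.snoc (fun i => (ts i).realize (Sum.elim default x))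
      ((Term.func f ts).realize (Sum.elim default x))
    refine ⟨fun i => ι (c i), h.forall_mem c, by simp [c], by simp [c], ?_⟩
    rw [← h.funMap_iff]
    simp [c, Term.realize]
  · rintro ⟨b, hbU, hb, rfl, ht⟩
    obtain ⟨z, rfl⟩ := h.forall_iff.1 hbU
    rw [← h.funMap_iff] at ht
    simp only [← ht, Term.realize]
    congr 2
    exact funext fun i => h.injective (hb i)

theorem holds_equal (h : Represents L ι U g) (t₁ t₂ : L.Term (Empty ⊕ Fin m)) (v : Fin m → W) :
    Holds ι (BoundedFormula.equal t₁ t₂) v ↔ (∀ i, E (v i) U) ∧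
      ∃ y, HasValue ι t₁ v y ∧ HasValue ι t₂ v y := by
  refine h.congr_of_forall (P := fun v => Holds ι (BoundedFormula.equal t₁ t₂) v)
    (Q := fun v => ∃ y, HasValue ι t₁ v y ∧ HasValue ι t₂ v y)
    (fun v hv => ⟨_, hv.choose_spec.1⟩) (fun x => ?_) v
  simp only [h.hasValue_iff, h.holds_iff, exists_eq_left, h.injective.eq_iff]
  rfl

theorem holds_rel (h : Represents L ι U g) {l : ℕ} (r : L.Relations l)
    (ts : Fin l → L.Term (Empty ⊕ Fin m)) (v : Fin m → W) :
    Holds ι (BoundedFormula.rel r ts) v ↔ (∀ i, E (v i) U) ∧ ∃ b : Fin l → W,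
      (∀ i, HasValue ι (ts i) v (b i)) ∧ ∃ t, Tuple b t ∧ E t (g (Sum.inr ⟨l, r⟩)) := by
  refine h.congr_of_forall (P := fun v => Holds ι (BoundedFormula.rel r ts) v)
    (Q := fun v => ∃ b : Fin l → W,
      (∀ i, HasValue ι (ts i) v (b i)) ∧ ∃ t, Tuple b t ∧ E t (g (Sum.inr ⟨l, r⟩)))
    (fun v hv => ⟨_, hv.choose_spec.1⟩) (fun x => ?_) v
  simp only [h.hasValue_iff, h.holds_iff, BoundedFormula.Realize]
  rw [h.relMap_iff]
  constructor
  · exact fun ht => ⟨_, fun i => rfl, ht⟩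
  · rintro ⟨b, hb, ht⟩
    obtain rfl : b = _ := funext hb
    exact ht

theorem holds_imp (h : Represents L ι U g) (φ ψ : L.BoundedFormula Empty m) (v : Fin m → W) :
    Holds ι (φ.imp ψ) v ↔ (∀ i, E (v i) U) ∧ (Holds ι φ v → Holds ι ψ v) := by
  refine h.congr_of_forall (P := fun v => Holds ι (φ.imp ψ) v)
    (Q := fun v => Holds ι φ v → Holds ι ψ v) (fun v hv => ⟨_, hv.choose_spec.1⟩) (fun x => ?_) v
  simp only [h.holds_iff, BoundedFormula.Realize]

theorem holds_all (h : Represents L ι U g) (φ : L.BoundedFormula Empty (m + 1)) (v : Fin m → W) :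
    Holds ι φ.all v ↔ (∀ i, E (v i) U) ∧ ∀ y, E y U → ∀ b : Fin (m + 1) → W,
      (∀ i : Fin m, b i.castSucc = v i) → b (Fin.last m) = y → Holds ι φ b := by
  refine h.congr_of_forall (P := fun v => Holds ι φ.all v)
    (Q := fun v => ∀ y, E y U → ∀ b : Fin (m + 1) → W,
      (∀ i : Fin m, b i.castSucc = v i) → b (Fin.last m) = y → Holds ι φ b)
    (fun v hv => ⟨_, hv.choose_spec.1⟩) (fun x => ?_) v
  simp only [h.holds_iff, BoundedFormula.Realize]
  constructor
  · rintro hφ _ hy b hb rfl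
    obtain ⟨z, hz⟩ := (h.exists_iff _).2 hy
    rw [show b = fun i => ι ((Fin.snoc x z : Fin (m + 1) → N) i) from funext fun i => by
      refine Fin.lastCases ?_ (fun i => ?_) i <;> simp [hb, hz], h.holds_iff]
    exact hφ z
  · intro hφ z
    refine (h.holds_iff φ _).1 (hφ (ι z) ((h.exists_iff _).1 ⟨z, rfl⟩) _ ?_ ?_) <;> simp

end Represents

theorem CoDef.substLast {L : FirstOrder.Language} {M N γ : Type*} [L.Structure M] [L.Structure N]
    {p : γ → M} {q : γ → N} {n m : ℕ} {P : (Fin m → M) → M → Prop} {Q : (Fin m → N) → N → Prop}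
    (h : CoDef L p q (m + 1) (fun v => P (fun i => v i.castSucc) (v (Fin.last m)))
      (fun v => Q (fun i => v i.castSucc) (v (Fin.last m))))
    (f : Fin m → (Fin n → M) → M) (f' : (Fin n → M) → M)
    (g : Fin m → (Fin n → N) → N) (g' : (Fin n → N) → N)
    [h' : ∀ i, CoTerm L p q n (f i) (g i)] [h'' : CoTerm L p q n f' g'] :
    CoDef L p q n (fun v => P (fun i => f i v) (f' v)) (fun v => Q (fun i => g i v) (g' v)) := by
  have := h.subst (fun i => Fin.lastCases (motive := fun _ => (Fin n → M) → M) f' f i)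
    (fun i => Fin.lastCases (motive := fun _ => (Fin n → N) → N) g' g i)
    (fun i => by refine Fin.lastCases ?_ (fun i => ?_) i <;> simp <;> infer_instance)
  simpa using this

section

variable {M M' W W' γ : Type*} [SetLang.Structure W] [SetLang.Structure W'] [L.Structure M]
  [L.Structure M'] {p : γ → W} {q : γ → W'} {ι : M → W} {ι' : M' → W'} {U : W} {U' : W'}
  {g : L.Symbols → W} {g' : L.Symbols → W'}

/-- Evaluation of a compound term is described by a set-theoretic formula in which only the
universe, the graph of the symbol and the values of the subterms occur; these correspond on the two
sides by induction. -/
theorem CoDef.hasValue (h : Represents L ι U g) (h' : Represents L ι' U' g')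
    (hU : ∀ n, CoTerm SetLang p q n (fun _ => U) (fun _ => U'))
    (hg : ∀ n s, CoTerm SetLang p q n (fun _ => g s) (fun _ => g' s)) {m : ℕ}
    (t : L.Term (Empty ⊕ Fin m)) : CoDef SetLang p q (m + 1)
      (fun v => HasValue ι t (fun i => v i.castSucc) (v (Fin.last m)))
        (fun v => HasValue ι' t (fun i => v i.castSucc) (v (Fin.last m))) := by
  induction t with
  | var i =>
    obtain i | i := i
    · exact Empty.elim i
    simp only [h.hasValue_var, h'.hasValue_var]
    infer_instance
  | @func l f ts ih =>
    have ih' (i : Fin l) {n : ℕ} (f₁ : Fin m → (Fin n → W) → W) (f₂ : (Fin n → W) → W)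
        (f₁' : Fin m → (Fin n → W') → W') (f₂' : (Fin n → W') → W')
        [∀ i, CoTerm SetLang p q n (f₁ i) (f₁' i)] [CoTerm SetLang p q n f₂ f₂'] :=
      (ih i).substLast f₁ f₂ f₁' f₂'
    simp only [h.hasValue_func, h'.hasValue_func]
    infer_instance

/-- Truth in corresponding structures is defined by corresponding formulas. -/
theorem CoDef.holds (h : Represents L ι U g) (h' : Represents L ι' U' g')
    (hU : ∀ n, CoTerm SetLang p q n (fun _ => U) (fun _ => U'))
    (hg : ∀ n s, CoTerm SetLang p q n (fun _ => g s) (fun _ => g' s)) {m : ℕ}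
    (φ : L.BoundedFormula Empty m) : CoDef SetLang p q m (Holds ι φ) (Holds ι' φ) := by
  have hv {m : ℕ} (t : L.Term (Empty ⊕ Fin m)) {n : ℕ} (f₁ : Fin m → (Fin n → W) → W)
      (f₂ : (Fin n → W) → W) (f₁' : Fin m → (Fin n → W') → W') (f₂' : (Fin n → W') → W')
      [∀ i, CoTerm SetLang p q n (f₁ i) (f₁' i)] [CoTerm SetLang p q n f₂ f₂'] :=
    (CoDef.hasValue h h' hU hg t).substLast f₁ f₂ f₁' f₂'
  induction φ with
  | falsum =>
    refine (CoDef.const False).congr (fun v => ?_) (fun v => ?_) <;> simp [Holds, BoundedFormula.Realize]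
  | equal t₁ t₂ =>
    refine CoDef.congr (P := fun v => _) (Q := fun v => _) ?_ (h.holds_equal t₁ t₂)
      (h'.holds_equal t₁ t₂)
    infer_instance
  | rel r ts =>
    refine CoDef.congr (P := fun v => _) (Q := fun v => _) ?_ (h.holds_rel r ts) (h'.holds_rel r ts)
    infer_instance
  | imp φ ψ ih₁ ih₂ =>
    have i₁ : CoDef SetLang p q _ (fun v => Holds ι φ v) (fun v => Holds ι' φ v) := ih₁
    have i₂ : CoDef SetLang p q _ (fun v => Holds ι ψ v) (fun v => Holds ι' ψ v) := ih₂
    refine CoDef.congr (P := fun v => _) (Q := fun v => _) ?_ (h.holds_imp φ ψ) (h'.holds_imp φ ψ)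
    infer_instance
  | all φ ih =>
    refine CoDef.congr (P := fun v => _) (Q := fun v => _) ?_ (h.holds_all φ) (h'.holds_all φ)
    have ih' {n : ℕ} (f : Fin _ → (Fin n → W) → W) (f' : Fin _ → (Fin n → W') → W')
        [i : ∀ i, CoTerm SetLang p q n (f i) (f' i)] := ih.subst f f' i
    infer_instance

end

end Represents

/-! ### Models in `V` and their images under `j` as represented structures -/

theorem tupleCode_injective : Function.Injective (tupleCode : List ZFSet.{u} → ZFSet.{u}) := by
  have hne (x y : ZFSet.{u}) : ZFSet.pair x y ≠ ∅ := fun h => by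
    have : ({x} : ZFSet.{u}) ∈ ZFSet.pair x y := by simp [ZFSet.pair]
    rw [h] at this
    exact ZFSet.notMem_empty _ this
  intro l
  induction l with
  | nil =>
    rintro (_ | ⟨b, l'⟩) h
    · rfl
    · exact (hne _ _ h.symm).elim
  | cons a l ih =>
    rintro (_ | ⟨b, l'⟩) h
    · exact (hne _ _ h).elim
    · obtain ⟨rfl, h'⟩ := ZFSet.pair_inj.1 h
      rw [ih h']

/-- The tuple `c` belongs to `g`. -/
def InGraph {W : Type*} [SetLang.Structure W] {m : ℕ} (c : Fin m → W) (g : W) : Prop :=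
  ∃ t, Tuple c t ∧ E t g

/-- The set `g` is the graph of a function of `m` variables on `U`. -/
def IsFunGraph {W : Type*} [SetLang.Structure W] (m : ℕ) (U g : W) : Prop :=
  (∀ a : Fin m → W, (∀ i, E (a i) U) → ∃ b, E b U ∧ ∃ c : Fin (m + 1) → W,
    (∀ i : Fin m, c i.castSucc = a i) ∧ c (Fin.last m) = b ∧ InGraph c g) ∧
  ∀ c c' : Fin (m + 1) → W, (∀ i : Fin m, c i.castSucc = c' i.castSucc) → InGraph c g →
    InGraph c' g → c (Fin.last m) = c' (Fin.last m)

instance CoDef.inGraph {M N γ : Type*} [SetLang.Structure M] [SetLang.Structure N] {n m : ℕ}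
    {p : γ → M} {q : γ → N}
    (f : Fin m → (Fin n → M) → M) (f' : (Fin n → M) → M) (g : Fin m → (Fin n → N) → N)
    (g' : (Fin n → N) → N) [∀ i, CoTerm SetLang p q n (f i) (g i)] [CoTerm SetLang p q n f' g'] :
    CoDef SetLang p q n (fun v => InGraph (fun i => f i v) (f' v))
      (fun v => InGraph (fun i => g i v) (g' v)) :=
  CoDef.substLast (P := InGraph) (Q := InGraph) (by unfold InGraph; infer_instance) f f' g g'

section

variable {V : Set ZFSet.{u}} {T : CountableTheory}

theorem GoodClass.inGraph_iff (hV : GoodClass V) {m : ℕ} {c : Fin m → V} {g : V} :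
    InGraph c g ↔ tupleCode (List.ofFn fun i => (c i).1) ∈ g.1 := by
  simp only [InGraph, hV.tuple_iff]
  exact ⟨fun ⟨t, ht, h⟩ => ht ▸ h, fun h => ⟨⟨_, hV.trans _ g.2 _ h⟩, rfl, h⟩⟩

theorem mem_relGraph {U : ZFSet.{u}} {m : ℕ} {R : (Fin m → U) → Prop} {a : Fin m → U} :
    tupleCode (List.ofFn fun i => (a i : ZFSet.{u})) ∈ relGraph R ↔ R a := by
  rw [relGraph, ZFSet.mem_range]
  constructor
  · rintro ⟨⟨b, hb⟩, h⟩
    have := List.ofFn_injective (tupleCode_injective h)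
    rwa [show a = b from funext fun i => Subtype.ext (congrFun this i).symm]
  · exact fun h => ⟨⟨a, h⟩, rfl⟩

theorem mem_funGraph {U : ZFSet.{u}} {m : ℕ} {F : (Fin m → U) → U} {x : Fin (m + 1) → ZFSet.{u}} :
    tupleCode (List.ofFn x) ∈ funGraph F ↔
      ∃ a : Fin m → U, (∀ i : Fin m, x i.castSucc = a i) ∧ x (Fin.last m) = F a := by
  rw [funGraph, ZFSet.mem_range]
  refine exists_congr fun a => ?_
  rw [List.ofFn_succ', List.concat_eq_append, tupleCode_injective.eq_iff,
    ← List.concat_eq_append, ← List.concat_eq_append, List.concat_inj, List.ofFn_injective.eq_iff,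
    funext_iff]
  simp [eq_comm]

namespace InnerModel

/-- The elements of the universe of `M`, as elements of `V`. -/
def elem (hV : IsTransitiveModel V) (M : InnerModel V T) (x : (M.carrier : ZFSet.{u})) : V :=
  ⟨x.1, hV.1 _ M.carrier.2 _ x.2⟩

/-- The interpretations of the symbols in `M`, as elements of `V`. -/
def graph (hV : IsTransitiveModel V) (M : InnerModel V T) (s : T.L.Symbols) : V :=
  ⟨letI := M.str; symbolGraph T.L (U := M.carrier) s, by
    have h1 := hV.1 _ M.interp_mem (ZFSet.pair (natCode (T.num s))
      (letI := M.str; symbolGraph T.L (U := M.carrier) s)) (ZFSet.mem_range.2 ⟨s, rfl⟩)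
    have h2 := hV.1 _ h1 {natCode (T.num s), _} (by rw [ZFSet.pair]; simp; right; rfl)
    exact hV.1 _ h2 _ (by simp)⟩

theorem represents (hV : IsTransitiveModel V) (M : InnerModel V T) :
    letI := M.str; Represents T.L (M.elem hV) M.carrier (M.graph hV) := by
  let _ := M.str
  refine ⟨fun x y h => Subtype.ext (congrArg (fun z : V => z.1) h), fun y => ?_, fun {m} r a => ?_,
    fun {m} f c => ?_⟩
  · exact ⟨by rintro ⟨x, rfl⟩; exact x.2, fun h => ⟨⟨y.1, h⟩, rfl⟩⟩
  · refine Iff.trans ?_ hV.good.inGraph_iff.symm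
    exact mem_relGraph.symm
  · refine Iff.trans ?_ hV.good.inGraph_iff.symm
    refine Iff.trans ?_ mem_funGraph.symm
    constructor
    · intro h
      exact ⟨fun i => c i.castSucc, fun i => rfl, congrArg Subtype.val h.symm⟩
    · rintro ⟨a, ha, h⟩
      rw [show (fun i : Fin m => c i.castSucc) = a from funext fun i => Subtype.ext (ha i)]
      exact Subtype.ext h.symm

/-- Existence and uniqueness of values is a first-order property of the graph. Its transfer
determines the value that is picked in `stdStructure`. -/
theorem isFunGraph (hV : IsTransitiveModel V) (M : InnerModel V T) {m : ℕ} (f : T.L.Functions m) :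
    IsFunGraph m M.carrier (M.graph hV (Sum.inl ⟨m, f⟩)) := by
  let _ := M.str
  have h := M.represents hV
  have hgraph (c : Fin (m + 1) → V) : InGraph c (M.graph hV (Sum.inl ⟨m, f⟩)) ↔
      ∃ a : Fin m → (M.carrier : ZFSet.{u}), (∀ i : Fin m, (c i.castSucc).1 = a i) ∧
        (c (Fin.last m)).1 = Structure.funMap f a := hV.good.inGraph_iff.trans mem_funGraph
  refine ⟨fun a ha => ?_, fun c c' hcc' hc hc' => ?_⟩
  · obtain ⟨x, rfl⟩ := h.forall_iff.1 ha
    let c : Fin (m + 1) → (M.carrier : ZFSet.{u}) := Fin.snoc x (Structure.funMap f x)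
    refine ⟨M.elem hV (Structure.funMap f x), (h.exists_iff _).1 ⟨_, rfl⟩,
      fun i => M.elem hV (c i), by simp [c], by simp [c], ?_⟩
    exact (h.funMap_iff f c).1 (by simp [c])
  · obtain ⟨a, ha, ha'⟩ := (hgraph c).1 hc
    obtain ⟨b, hb, hb'⟩ := (hgraph c').1 hc'
    obtain rfl : a = b := funext fun i => Subtype.ext (by rw [← ha, ← hb, hcc'])
    exact Subtype.ext (ha'.trans hb'.symm)

variable {W : Type w} [SetLang.Structure W]

/-- Only function symbols need an argument: the choice operator in `stdStructure` returns the right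
value because the image of the graph is again the graph of a function on the image of the universe.
-/
theorem represents_std (hV : IsTransitiveModel V) (M : InnerModel V T) (j : V ↪ₑ[SetLang] W) :
    letI := stdStructure j hV M
    Represents T.L (Subtype.val : Members (j M.carrier) → W) (j M.carrier)
      fun s => j (M.graph hV s) := by
  let _ := stdStructure j hV M
  have hg (s : T.L.Symbols) (P : V → Prop) : (∃ g : V, (g : ZFSet.{u}) =
      (letI := M.str; symbolGraph T.L (U := M.carrier) s) ∧ P g) ↔ P (M.graph hV s) :=
    ⟨fun ⟨g, hg, h⟩ => by rwa [show g = M.graph hV s from Subtype.ext hg] at h,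
      fun h => ⟨_, rfl, h⟩⟩
  refine ⟨Subtype.val_injective, fun y => ?_, fun {m} r a => ?_, fun {m} f c => ?_⟩
  · exact ⟨by rintro ⟨x, rfl⟩; exact x.2, fun h => ⟨⟨y, h⟩, rfl⟩⟩
  · exact hg (Sum.inr ⟨m, r⟩) fun g => InGraph (fun i => (a i).1) (j g)
  · have hfun : IsFunGraph m (j M.carrier) (j (M.graph hV (Sum.inl ⟨m, f⟩))) :=
      (@transfer _ _ _ _ j (IsFunGraph m M.carrier (M.graph hV (Sum.inl ⟨m, f⟩))) _
        (by unfold IsFunGraph; infer_instance)).1 (M.isFunGraph hV f)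
    let P (a : Fin m → Members (j M.carrier)) (b : Members (j M.carrier)) : Prop :=
      InGraph (fun i => ((Fin.snoc a b : Fin (m + 1) → Members (j M.carrier)) i).1)
        (j (M.graph hV (Sum.inl ⟨m, f⟩)))
    have hP (a) (b) : (∃ g : V, (g : ZFSet.{u}) =
        (letI := M.str; symbolGraph T.L (U := M.carrier) (Sum.inl ⟨m, f⟩)) ∧
        ∃ t : W, IsTuple ((List.ofFn fun i => (a i).1) ++ [b.1]) t ∧ E t (j g)) ↔ P a b := by
      refine (hg _ fun g => ∃ t : W, IsTuple ((List.ofFn fun i => (a i).1) ++ [b.1]) t ∧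
        E t (j g)).trans ?_
      simp only [P, InGraph, Tuple, List.ofFn_succ', List.concat_eq_append, Fin.snoc_castSucc,
        Fin.snoc_last]
    have hne := members_nonempty j hV M
    have hfm (a) : Structure.funMap f a = Classical.epsilon (P a) := by
      change @Classical.epsilon _ hne _ = _
      congr 1
      exact funext fun b => propext (hP a b)
    have hspec (a) : P a (Structure.funMap f a) := by
      rw [hfm]
      refine Classical.epsilon_spec (p := P a) ?_
      obtain ⟨b, hb, c, hca, rfl, hc⟩ := hfun.1 (fun i => (a i).1) fun i => (a i).2
      refine ⟨⟨_, hb⟩, ?_⟩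
      convert hc using 1
      funext i
      refine Fin.lastCases ?_ (fun i => ?_) i <;> simp [hca]
    have hcs : (Fin.snoc (fun i => c i.castSucc) (c (Fin.last m)) :
        Fin (m + 1) → Members (j M.carrier)) = c := by
      funext i
      refine Fin.lastCases ?_ (fun i => ?_) i <;> simp
    have hPc : P (fun i => c i.castSucc) (c (Fin.last m)) ↔ InGraph (fun i => (c i).1)
        (j (M.graph hV (Sum.inl ⟨m, f⟩))) := by simp only [P, hcs]
    refine Iff.trans ?_ hPc
    constructor
    · intro h
      rw [← h]
      exact hspec _
    · intro h
      have := hfun.2 _ _ (fun i => by simp) (hspec fun i => c i.castSucc) h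
      simp only [Fin.snoc_last] at this
      exact Subtype.ext this

/-- The formulas which hold in `M` and in `j_std(M)` are defined by the same formulas of the language
of set theory. -/
theorem coDef_holds (hV : IsTransitiveModel V) (M : InnerModel V T) (j : V ↪ₑ[SetLang] W) {m : ℕ}
    (φ : T.L.BoundedFormula Empty m) :
    CoDef SetLang id j m (letI := M.str; Holds (M.elem hV) φ) (letI := stdStructure j hV M
      Holds (Subtype.val : Members (j M.carrier) → W) φ) := by
  let _ := M.str
  let _ := stdStructure j hV M
  exact CoDef.holds (M.represents hV) (M.represents_std hV j) (fun _ => inferInstance)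
    (fun _ _ => inferInstance) φ

/-- Each axiom is a standard formula, and its truth in `M` is a single statement about `V` that `j`
preserves. -/
theorem models_std (hV : IsTransitiveModel V) (M : InnerModel V T) (j : V ↪ₑ[SetLang] W) :
    letI := stdStructure j hV M; Members (j M.carrier) ⊨ T.thy := by
  let _ := M.str
  let _ := stdStructure j hV M
  refine ⟨fun φ hφ => ?_⟩
  have h1 := M.models.realize_of_mem φ hφ
  have h2 := (M.coDef_holds hV j φ).transfer j default
  have h3 := (M.represents hV).holds_iff φ default
  have h4 := (M.represents_std hV j).holds_iff φ default
  rw [Subsingleton.elim (fun i => M.elem hV _) default] at h3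
  rw [Subsingleton.elim (fun i => Subtype.val _) (j ∘ default)] at h4
  exact h4.1 (h2.1 (h3.2 h1))

end InnerModel

end

/-! ### Pseudosaturation and patterns -/

section

variable {V : Set ZFSet.{u}} {W : Type w} [SetLang.Structure W]

/-- All small pseudofinite sets which are finitely consistent with the pattern are covered. -/
theorem lt_patternCardinal_iff (j : V ↪ₑ[SetLang] W) (I D : V) (l : Cardinal.{w}) :
    (l : WithTop Cardinal.{w}) < patternCardinal j I D ↔ ∀ X : Set W, (∀ x ∈ X, E x (j I)) →
      Pseudofinite X → #X ≤ l →
      (∀ F : Set W, F ⊆ X → F.Finite → ∃ d : W, E d (j D) ∧ ∀ y : W, E y d ↔ y ∈ F) →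
      ∃ d : W, E d (j D) ∧ ∀ x ∈ X, E x d := by
  unfold patternCardinal
  set s : Set (WithTop Cardinal.{w}) := {μ | _} with hs
  constructor
  · intro h X h1 h2 h3 h4
    by_contra h5
    exact not_le_of_gt h (sInf_le ⟨l, rfl, X, h1, h2, h3, h4, h5⟩)
  · intro h
    by_contra hle
    rw [not_lt] at hle
    obtain hs | hs := s.eq_empty_or_nonempty
    · rw [hs] at hle
      rw [show sInf (∅ : Set (WithTop Cardinal.{w})) = ⊤ from WithTop.sInf_empty, top_le_iff] at hle
      exact WithTop.coe_ne_top hle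
    -- The infimum of a nonempty set of cardinals is attained.
    · obtain ⟨ν, hν, X, h1, h2, h3, h4, h5⟩ := csInf_mem hs
      rw [hν, WithTop.coe_le_coe] at hle
      exact h5 (h X h1 h2 (h3.trans hle) h4)

end

instance CoDef.boundedFormula {L : FirstOrder.Language} {M N : Type*} [L.Structure M]
    [L.Structure N] {n m : ℕ} (φ : L.BoundedFormula Empty m) (f : Fin m → (Fin n → M) → M)
    (g : Fin m → (Fin n → N) → N) [h : ∀ i, CoTerm L (default : Empty → M) default n (f i) (g i)] :
    CoDef L (default : Empty → M) (default : Empty → N) n (fun v => φ.Realize default fun i => f i v)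
      (fun v => φ.Realize default fun i => g i v) :=
  CoDef.subst (P := φ.Realize default) (Q := φ.Realize default)
    ⟨φ, fun _ => Iff.rfl, fun _ => Iff.rfl⟩ f g h

/-- The formula `φ` admits the pattern `Δ` on a set of `r` indices. -/
def AdmitsFin {L : FirstOrder.Language} {a b : ℕ} (φ : L.BoundedFormula Empty (a + b)) {r : ℕ}
    (Δ : Finset (Fin r) → Prop) (N : Type*) [L.Structure N] : Prop :=
  ∃ y : Fin (r * b) → N, ∀ s : Finset (Fin r), (∃ x : Fin a → N, ∀ i, i ∈ s →
    ∀ z : Fin (a + b) → N, (∀ l, z (Fin.castAdd b l) = x l) →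
      (∀ l, z (Fin.natAdd a l) = y (finProdFinEquiv (i, l))) → φ.Realize default z) ↔ Δ s

theorem eq_append_iff {M : Type*} {a b : ℕ} {x : Fin a → M} {y : Fin b → M} {z : Fin (a + b) → M} :
    ((∀ l, z (Fin.castAdd b l) = x l) ∧ ∀ l, z (Fin.natAdd a l) = y l) ↔ z = Fin.append x y := by
  constructor
  · rintro ⟨h1, h2⟩
    funext i
    refine Fin.addCases (fun i => ?_) (fun i => ?_) i <;> simp [h1, h2]
  · rintro rfl
    simp

theorem forall_eq_append_iff {M : Type*} {a b : ℕ} {x : Fin a → M} {y : Fin b → M}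
    {P : (Fin (a + b) → M) → Prop} : (∀ z : Fin (a + b) → M, (∀ l, z (Fin.castAdd b l) = x l) →
      (∀ l, z (Fin.natAdd a l) = y l) → P z) ↔ P (Fin.append x y) := by
  simp only [← and_imp (c := P _), eq_append_iff, forall_eq]

/-- A formula in two blocks of variables, as a formula in one block of variables. -/
def appendFormula {L : FirstOrder.Language.{0, 0}} {a b : ℕ} (φ : L.Formula (Fin a ⊕ Fin b)) :
    L.BoundedFormula Empty (a + b) :=
  BoundedFormula.relabel (fun s => Sum.inr (finSumFinEquiv s)) φ

theorem realize_appendFormula {L : FirstOrder.Language.{0, 0}} {a b : ℕ}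
    (φ : L.Formula (Fin a ⊕ Fin b)) {M : Type*} [L.Structure M] (x : Fin a → M) (z : Fin b → M) :
    (appendFormula φ).Realize default (Fin.append x z) ↔ φ.Realize (Sum.elim x z) := by
  refine BoundedFormula.realize_relabel.trans ?_
  rw [Formula.Realize]
  refine iff_of_eq (congrArg₂ _ ?_ (Subsingleton.elim _ _))
  funext i
  rcases i with i | i <;> simp

/-- A formula which witnesses that a complete theory admits `Δ` does so in every model, for
finite sets of indices. -/
theorem Admits.exists_forall_finset {T : CountableTheory} (hT : T.Complete) {ι : Type}
    {Δ : Set (Finset ι)} (h : Admits T Δ) : ∃ (a b : ℕ) (φ : T.L.BoundedFormula Empty (a + b)),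
      ∀ (M : Type u) [T.L.Structure M] [Nonempty M] [M ⊨ T.thy] (s : Finset ι),
        ∃ y : ι → Fin b → M, ∀ t ⊆ s,
          (∃ x : Fin a → M, ∀ i ∈ t, φ.Realize default (Fin.append x (y i))) ↔ t ∈ Δ := by
  classical
  obtain ⟨a, b, φ, N, y, hy⟩ := h
  refine ⟨a, b, appendFormula φ, fun M _ _ _ s => ?_⟩
  let e := s.equivFin
  have hNM : T.L.ElementarilyEquivalent N M := by
    rw [elementarilyEquivalent_iff]
    exact fun φ => (hT.realize_sentence_iff φ N).trans (hT.realize_sentence_iff φ M).symm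
  let Δ' : Finset (Fin s.card) → Prop := fun t => t.image (fun i => (e.symm i : ι)) ∈ Δ
  -- On a finite set of indices, to represent the pattern is a single first-order sentence, so by
  -- completeness it passes from `N` to every other model.
  have hN : AdmitsFin (appendFormula φ) Δ' N := by
    refine ⟨fun i => y (e.symm (finProdFinEquiv.symm i).1) (finProdFinEquiv.symm i).2, fun t => ?_⟩
    simp only [forall_eq_append_iff, realize_appendFormula, Equiv.symm_apply_apply, Δ', ← hy,
      Finset.forall_mem_image]
  obtain ⟨z, hz⟩ : AdmitsFin (appendFormula φ) Δ' M :=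
    (CoDef.sentence_iff (P := fun _ => AdmitsFin (appendFormula φ) Δ' N)
    (Q := fun _ => AdmitsFin (appendFormula φ) Δ' M) default default
    (by unfold AdmitsFin; infer_instance) hNM).1 hN
  simp only [forall_eq_append_iff] at hz
  refine ⟨fun i l => if hi : i ∈ s then z (finProdFinEquiv (e ⟨i, hi⟩, l))
    else Classical.arbitrary M, fun t ht => ?_⟩
  have himg : (Finset.univ.filter fun i => (e.symm i : ι) ∈ t).image (fun i => (e.symm i : ι)) = t := by
    ext i
    simp only [Finset.mem_image, Finset.mem_filter, Finset.mem_univ, true_and]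
    exact ⟨by rintro ⟨l, hl, rfl⟩; exact hl, fun hi => ⟨e ⟨i, ht hi⟩, by simpa using hi, by simp⟩⟩
  have := hz (Finset.univ.filter fun i => (e.symm i : ι) ∈ t)
  simp only [Δ', himg] at this
  rw [← this]
  refine exists_congr fun x => ⟨fun h i hi => ?_, fun h i hi => ?_⟩
  · have := h (e.symm i) (by simpa using hi)
    simpa using this
  · have := h (e ⟨i, ht hi⟩) (by simpa using hi)
    simpa [ht hi] using this

/-- Over every finite set `s` there are parameters for which the predicate `P` represents the
pattern `D`. -/
def ReflectsPattern {W : Type*} [SetLang.Structure W] {a b : ℕ} (P : (Fin (a + b) → W) → Prop)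
    (U I D : W) : Prop :=
  ∀ s, IsFin s → ∃ e : Fin b → W, ∃ Y, IsFin Y ∧
    (∀ i, E i s → E i I → ∀ l : Fin b, ∃ y, E y U ∧ E y Y ∧ Related (e l) i y ∧
      ∀ y', Related (e l) i y' → y' = y) ∧
    (∀ d, E d D → (∀ i, E i d → E i s) → ∃ x : Fin a → W, (∀ l, E (x l) U) ∧
      ∀ i, E i d → ∀ z : Fin (a + b) → W, (∀ l, z (Fin.castAdd b l) = x l) →
        (∀ l, Related (e l) i (z (Fin.natAdd a l))) → Ap P z) ∧
    ∀ x : Fin a → W, (∀ l, E (x l) U) → ∃ d, E d D ∧ ∀ i, E i s → E i I →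
      (∀ z : Fin (a + b) → W, (∀ l, z (Fin.castAdd b l) = x l) →
        (∀ l, Related (e l) i (z (Fin.natAdd a l))) → Ap P z) → E i d

section

variable {V : Set ZFSet.{u}} {T : CountableTheory} {ι : Type} {Δ : Set (Finset ι)}
  {c : ι → ZFSet.{u}} {a b : ℕ} {φ : T.L.BoundedFormula Empty (a + b)}

/-- The parameters over a finite `s` form finite functions, which belong to `V`. The last clause of
`ReflectsPattern` holds because the set of all indices in `s` whose instance is satisfied by a given
tuple is consistent, hence is itself a member of the pattern. -/
theorem InnerModel.reflectsPattern (hV : IsTransitiveModel V) (M : InnerModel V T)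
    (hφ : letI := M.str; ∀ (s : Finset ι), ∃ y : ι → Fin b → (M.carrier : ZFSet.{u}), ∀ t ⊆ s,
      (∃ x : Fin a → (M.carrier : ZFSet.{u}), ∀ i ∈ t, φ.Realize default (Fin.append x (y i))) ↔
        t ∈ Δ)
    (hc : Function.Injective c) {I D : V} (hI : ∀ z, z ∈ I.1 ↔ ∃ i, c i = z)
    (hD : ∀ z, z ∈ D.1 ↔ ∃ s ∈ Δ, codeSet c (s : Set ι) = z) :
    letI := M.str; ReflectsPattern (Holds (M.elem hV) φ) M.carrier I D := by
  classical
  let _ := M.str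
  have hM := M.represents hV
  intro s hs
  rw [hV.isFin_iff] at hs
  have hcV (i : ι) : c i ∈ V := hV.1 _ I.2 _ ((hI _).2 ⟨i, rfl⟩)
  have hcV' : Function.Injective fun i => (⟨c i, hcV i⟩ : V) := fun i j h =>
    hc (congrArg Subtype.val h)
  obtain ⟨s₀, hs₀⟩ : ∃ s₀ : Finset ι, ∀ i, i ∈ s₀ ↔ c i ∈ s.1 :=
    ⟨(hs.preimage hcV'.injOn).toFinset, fun i => by simp⟩
  obtain ⟨y, hy⟩ := hφ s₀
  have hpV (i : ι) (l : Fin b) : ZFSet.pair (c i) (y i l).1 ∈ V :=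
    hV.good.pair_mem (hcV i) (M.elem hV (y i l)).2
  choose e he using fun l : Fin b => hV.good.exists_of_finite
    (s₀.finite_toSet.image fun i => (⟨_, hpV i l⟩ : V))
  have hrel (l : Fin b) (i : ι) (hi : i ∈ s₀) (z : V) :
      Related (e l) ⟨c i, hcV i⟩ z ↔ z = M.elem hV (y i l) := by
    rw [hV.good.related_iff]
    refine (he l ⟨_, hV.good.pair_mem (hcV i) z.2⟩).trans ?_
    simp only [Set.mem_image, Subtype.mk.injEq, ZFSet.pair_inj, hc.eq_iff,
      Finset.mem_coe]
    constructor
    · rintro ⟨_, -, rfl, h⟩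
      exact Subtype.ext h.symm
    · rintro rfl
      exact ⟨i, hi, rfl, rfl⟩
  -- The finite set `Y` of all parameters is recorded because, after transfer, it witnesses that the
  -- set of parameters is pseudofinite.
  obtain ⟨Y, hY⟩ := hV.good.exists_of_finite
    ((s₀.finite_toSet.prod (Set.finite_univ : (Set.univ : Set (Fin b)).Finite)).image
      fun i => M.elem hV (y i.1 i.2))
  have hz (i : ι) (hi : i ∈ s₀) (x : Fin a → (M.carrier : ZFSet.{u})) :
      (∀ z : Fin (a + b) → V, (∀ l, z (Fin.castAdd b l) = M.elem hV (x l)) →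
        (∀ l, Related (e l) ⟨c i, hcV i⟩ (z (Fin.natAdd a l))) → Ap (Holds (M.elem hV) φ) z) ↔
      φ.Realize default (Fin.append x (y i)) := by
    simp only [hrel _ i hi, forall_eq_append_iff]
    rw [← hM.holds_iff, Ap]
    refine iff_of_eq (congrArg _ (funext fun l => ?_))
    refine Fin.addCases (fun l => ?_) (fun l => ?_) l <;> simp
  refine ⟨e, Y, hV.isFin_iff.2 (((s₀.finite_toSet.prod Set.finite_univ).image _).subset
    fun z hz => (hY z).1 hz), ?_, ?_, ?_⟩
  · intro i his hiI l
    obtain ⟨i, hi⟩ := (hI i.1).1 hiI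
    obtain rfl : (⟨c i, hcV i⟩ : V) = _ := Subtype.ext hi
    have hi' := (hs₀ i).2 his
    refine ⟨M.elem hV (y i l), (y i l).2, (hY _).2 ⟨(i, l), ⟨hi', trivial⟩, rfl⟩,
      (hrel l i hi' _).2 rfl, fun z hz => (hrel l i hi' _).1 hz⟩
  · intro d hd hds
    obtain ⟨t, ht, htd⟩ := (hD d.1).1 hd
    have hts : t ⊆ s₀ := fun i hi => (hs₀ i).2 (hds ⟨c i, hcV i⟩ (by
      rw [E_iff, ← htd]
      exact (mem_codeSet_iff hc).2 hi))
    obtain ⟨x, hx⟩ := (hy t hts).2 ht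
    refine ⟨fun l => M.elem hV (x l), fun l => (x l).2, fun i hi => ?_⟩
    rw [E_iff, ← htd] at hi
    obtain ⟨i', hi', h⟩ := mem_codeSet.1 hi
    obtain rfl : (⟨c i', hcV i'⟩ : V) = _ := Subtype.ext h
    exact (hz i' (hts hi') x).2 (hx i' hi')
  · intro x hx
    obtain ⟨x, rfl⟩ := hM.forall_iff.1 hx
    have ht := (hy (s₀.filter fun i => φ.Realize default (Fin.append x (y i)))
      (Finset.filter_subset _ _)).1 ⟨x, fun i hi => (Finset.mem_filter.1 hi).2⟩
    have hd := (hD _).2 ⟨_, ht, rfl⟩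
    refine ⟨⟨_, hV.1 _ D.2 _ hd⟩, hd, fun i his hiI hi => ?_⟩
    obtain ⟨i, hi'⟩ := (hI i.1).1 hiI
    obtain rfl : (⟨c i, hcV i⟩ : V) = _ := Subtype.ext hi'
    have hi' := (hs₀ i).2 his
    refine (mem_codeSet_iff hc).2 ?_
    simp only [Finset.coe_filter, Set.mem_ofPred_eq]
    exact ⟨hi', (hz i hi' x).1 hi⟩

variable {W : Type w} [SetLang.Structure W]

set_option synthInstance.maxSize 1000 in
set_option synthInstance.maxHeartbeats 200000 in
/-- If `j_std(M)` is pseudosaturated, then the characteristic cardinals of the patterns admitted by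
the theory of `M` are large. -/
theorem StdPseudosaturated.lt_patternCardinal {j : V ↪ₑ[SetLang] W} {hV : IsTransitiveModel V}
    {M : InnerModel V T} {l : Cardinal.{w}} (hl : ℵ₀ ≤ l)
    (h : StdPseudosaturated j hV M (Order.succ l)) (hT : T.Complete) (hΔ : Admits T Δ)
    (hc : Function.Injective c) {I D : V} (hI : ∀ z, z ∈ I.1 ↔ ∃ i, c i = z)
    (hD : ∀ z, z ∈ D.1 ↔ ∃ s ∈ Δ, codeSet c (s : Set ι) = z) :
    (l : WithTop Cardinal.{w}) < patternCardinal j I D := by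
  obtain ⟨a, b, φ, hφ⟩ := hΔ.exists_forall_finset hT
  have hrefl : letI := stdStructure j hV M; ReflectsPattern
      (Holds (Subtype.val : Members (j M.carrier) → W) φ) (j M.carrier) (j I) (j D) := by
    have := M.nonempty
    let _ := M.str
    let _ := stdStructure j hV M
    have := M.models
    have : CoDef SetLang id j (a + b) (Holds (M.elem hV) φ)
      (Holds (Subtype.val : Members (j M.carrier) → W) φ) := M.coDef_holds hV j φ
    have h1 := M.reflectsPattern hV (hφ (M.carrier : ZFSet.{u})) hc hI hD
    exact (@transfer _ _ _ _ j (ReflectsPattern (Holds (M.elem hV) φ) M.carrier I D)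
      (ReflectsPattern (Holds (Subtype.val : Members (j M.carrier) → W) φ) (j M.carrier) (j I) (j D))
      (by unfold ReflectsPattern; infer_instance)).1 h1
  let _ := stdStructure j hV M
  have := members_nonempty j hV M
  have hrep := M.represents_std hV j
  rw [lt_patternCardinal_iff]
  rintro X hXI ⟨s, hs, hXs⟩ hXl hX
  obtain ⟨e, Y, hY, h1, h2, h3⟩ := hrefl s hs
  choose y hyU hyY hyr hyu using fun (i : X) l => h1 i.1 (hXs _ i.2) (hXI _ i.2) l
  let y' : X × Fin b → Members (j M.carrier) := fun i => ⟨y i.1 i.2, hyU i.1 i.2⟩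
  let A : Set (Members (j M.carrier)) := Set.range y'
  -- The parameter set is covered by `Y` and has at most `λ · b ≤ λ` elements.
  have hA := h A ⟨Y, hY, by rintro _ ⟨_, ⟨i, rfl⟩, rfl⟩; exact hyY _ _⟩ (by
    rw [Order.lt_succ_iff]
    refine (mk_range_le.trans ?_)
    rw [mk_prod, lift_id', mk_fin]
    refine (mul_le_mul' hXl ?_).trans (mul_eq_self hl).le
    simpa using (natCast_lt_aleph0 (n := b)).le.trans hl)
  let ψ : X → T.L.Formula (A ⊕ Fin a) := fun i =>
    φ.toFormula.relabel (Sum.elim Empty.elim (Fin.append Sum.inr fun l => Sum.inl ⟨y' (i, l), _, rfl⟩))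
  have hψ (i : X) (x : Fin a → Members (j M.carrier)) :
      (ψ i).Realize (Sum.elim Subtype.val x) ↔
        ∀ z : Fin (a + b) → W, (∀ l, z (Fin.castAdd b l) = x l) →
        (∀ l, Related (e l) i (z (Fin.natAdd a l))) → 
          Ap (Holds (Subtype.val : Members (j M.carrier) → W) φ) z := by
    have hr (l z) : Related (e l) i z ↔ z = y i l :=
      ⟨hyu i l z, by rintro rfl; exact hyr i l⟩
    simp only [hr, forall_eq_append_iff, ψ, Formula.realize_relabel,
      BoundedFormula.realize_toFormula, Ap]
    have := hrep.holds_iff φ (Fin.append x fun l => y' (i, l))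
    refine Iff.trans (iff_of_eq (congrArg₂ _ (Subsingleton.elim _ _) (funext fun l => ?_)))
      (this.symm.trans (iff_of_eq (congrArg _ (funext fun l => ?_))))
    · refine Fin.addCases (fun l => ?_) (fun l => ?_) l <;> simp
    · refine Fin.addCases (fun l => ?_) (fun l => ?_) l <;> simp [y']
  -- A finite set of indices from `X` is coded by some `d` in `j(D)`, and the second clause of
  -- `ReflectsPattern` solves all its instances simultaneously.
  obtain ⟨x, hx⟩ := hA.exists_realize ψ fun F => by
    obtain ⟨d, hd, hdF⟩ := hX (Subtype.val '' (F : Set X)) (by simp)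
      (F.finite_toSet.image _)
    obtain ⟨x, hxU, hx⟩ := h2 d hd fun i hi => by
      obtain ⟨i, -, rfl⟩ := (hdF i).1 hi
      exact hXs _ i.2
    refine ⟨fun l => ⟨x l, hxU l⟩, fun i hi => (hψ i _).2 (hx i ((hdF _).2 ⟨i, hi, rfl⟩))⟩
  obtain ⟨d, hd, hd'⟩ := h3 (fun l => (x l).1) fun l => (x l).2
  -- The indices in `s` whose instance holds at `x` are covered by a member of `j(D)`, and all of
  -- `X` is among them.
  exact ⟨d, hd, fun i hi => hd' i (hXs i hi) (hXI i hi) ((hψ ⟨i, hi⟩ x).1 (hx ⟨i, hi⟩))⟩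

end

/-! ### Embedding finite hypergraphs together with large cliques -/

section

variable {α β : Type*} [DecidableEq α] [DecidableEq β] {n k : ℕ}

/-- Every finite hypergraph embeds into a random hypergraph. -/
theorem IsGeneric.exists_partialIso {S : Set (Finset α)} (hS : IsGeneric False n k S) (hk : 2 ≤ k)
    [Nonempty α] (H : Set (Finset β)) (B : Finset β) : ∃ f : β → α, PartialIso k H S B f := by
  induction B using Finset.induction_on with
  | empty => exact ⟨fun _ => Classical.arbitrary α, by simpa using partialIso_empty hk H S _⟩
  | insert b B hb ih =>
    obtain ⟨f, hf⟩ := ih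
    obtain ⟨x, hx, hxF⟩ := hS.extendsBy (B.image f) {y | ∃ c ⊆ B, c.image f = y ∧ insert b c ∈ H}
      False.elim
    have hx' (c : β) (hc : c ∈ B) : x ≠ f c := fun h => hx (by rw [h]; simpa using ⟨c, hc, rfl⟩)
    have heq : Set.EqOn f (Function.update f b x) B := fun y hy =>
      (Function.update_of_ne (fun h : y = b => hb (h ▸ hy)) _ _).symm
    have h' := hf.congr heq
    refine ⟨Function.update f b x, ?_, fun e he hek => ?_⟩
    · rw [Finset.coe_insert, Set.injOn_insert hb]
      refine ⟨h'.injOn, ?_⟩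
      rw [Function.update_self, ← heq.image_eq]
      rintro ⟨c, hc, h⟩
      exact hx' c hc h.symm
    · by_cases hbe : b ∈ e
      · have heB : e.erase b ⊆ B := fun y hy => by
          rw [Finset.mem_erase] at hy
          exact (Finset.mem_insert.1 (he hy.2)).resolve_left hy.1
        have hcard : ((e.erase b).image f).card = k - 1 := by
          rw [Finset.card_image_of_injOn (hf.injOn.mono (by exact_mod_cast heB)),
            Finset.card_erase_of_mem hbe, hek]
        have := hxF ((e.erase b).image f) (by exact_mod_cast Finset.image_subset_image heB) hcard
        conv_rhs => rw [← Finset.insert_erase hbe]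
        rw [Finset.image_insert, Function.update_self,
          ← Finset.image_congr fun y hy => heq (heB hy), this]
        constructor
        · intro h
          exact ⟨_, heB, rfl, by rwa [Finset.insert_erase hbe]⟩
        · rintro ⟨c, hc, hce, h⟩
          rwa [show e = insert b c from ?_]
          rw [← Finset.insert_erase hbe]
          congr 1
          rw [← Finset.coe_inj] at hce ⊢
          rw [Finset.coe_image, Finset.coe_image] at hce
          exact ((hf.injOn.image_eq_image_iff (by exact_mod_cast hc)
            (by exact_mod_cast heB)).1 hce).symm
      · exact h'.edge_iff e (fun y hy => (Finset.mem_insert.1 (he hy)).resolve_left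
          fun h => hbe (h ▸ hy)) hek

theorem image_inj_of_injOn {f : α → β} {s t u : Finset α} (hf : Set.InjOn f u) (hs : s ⊆ u)
    (ht : t ⊆ u) (h : s.image f = t.image f) : s = t := by
  rw [← Finset.coe_inj] at h ⊢
  rw [Finset.coe_image, Finset.coe_image] at h
  exact (hf.image_eq_image_iff (by exact_mod_cast hs) (by exact_mod_cast ht)).1 h

/-- The vertices of the clique attached to the set `c`. -/
def cliqueOver (m : ℕ) (c : Finset α) : Finset (α ⊕ Finset α × Fin m) :=
  c.disjSum ({c} ×ˢ Finset.univ)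

theorem card_cliqueOver (m : ℕ) (c : Finset α) : (cliqueOver m c).card = c.card + m := by
  simp [cliqueOver]

theorem inl_mem_cliqueOver {m : ℕ} {c : Finset α} {a : α} :
    Sum.inl a ∈ cliqueOver m c ↔ a ∈ c := by
  simp [cliqueOver]

theorem inr_mem_cliqueOver {m : ℕ} {c : Finset α} {p : Finset α × Fin m} :
    Sum.inr p ∈ cliqueOver m c ↔ p.1 = c := by
  simp only [cliqueOver, Finset.inr_mem_disjSum, Finset.mem_product, Finset.mem_singleton,
    Finset.mem_univ, and_true]

/-- The map `f` embeds the finite hypergraph `A` into `S` in such a way that the image of every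
`(k - 1)`-element set `c` lies in an `(n - 1)`-clique whose other `(k - 1)`-element subsets are
listed by `h c`, and such that there are no unnecessary cliques. -/
structure CliqueEmbedding (n k : ℕ) (SA : Set (Finset α)) (S : Set (Finset β)) (A : Finset α)
    (f : α → β) (h : Finset α → Finset (Finset β)) : Prop where
  injOn : Set.InjOn f A
  nonempty : ∀ c ⊆ A, c.card = k - 1 → (h c).Nonempty
  card_le : ∀ c ⊆ A, c.card = k - 1 → (h c).card ≤ (n - 1).choose (k - 1)
  card_eq : ∀ c ⊆ A, c.card = k - 1 → ∀ e ∈ h c, e.card = k - 1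
  ne_image : ∀ c ⊆ A, c.card = k - 1 → ∀ e ∈ h c, ∀ c' ⊆ A, c'.card = k - 1 → c'.image f ≠ e
  eq_of_mem : ∀ c ⊆ A, c.card = k - 1 → ∀ e ∈ h c, ∀ c' ⊆ A, c'.card = k - 1 → e ∈ h c' → c' = c
  exists_vertex : ∀ d, Extendable n k S Set.univ d → ∃ x ∉ A, ∀ c ⊆ A, c.card = k - 1 →
    (insert x c ∈ SA ↔ c.image f ∈ d)
  exists_notMem : ∀ d, Extendable n k S Set.univ d → ∀ c ⊆ A, c.card = k - 1 → c.image f ∈ d →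
    ∃ e ∈ h c, e ∉ d
  extendable_or : ∀ d : Set (Finset β), (∀ y ∈ d, ∃ c ⊆ A, c.card = k - 1 ∧ (c.image f = y ∨ y ∈ h c)) →
    Extendable n k S Set.univ d ∨
    (∃ c ⊆ A, c.card = k - 1 ∧ c.image f ∈ d ∧ ∀ e ∈ h c, e ∈ d) ∨
    ∃ v ⊆ A, v.card = n - 1 ∧ (∀ c ⊆ v, c.card = k - 1 → c.image f ∈ d) ∧ CliqueOn k SA v

/-- Glue to the finite hypergraph on `A`, for each of its `(k - 1)`-sets `c`, a complete hypergraph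
that contains `c` and otherwise new vertices, and embed the result into the random hypergraph `S`. A
listed `(k - 1)`-set contains a new vertex, which tells it apart from the images and determines the
`c` to which it is attached. A bad `(n - 1)`-clique with a new vertex is one of the glued cliques,
and a bad clique without new vertices is a clique of `SA`. For `exists_vertex`, the trace of `d` on
`A` is extendable since a bad clique in `A` would be mapped to a bad clique in `S`. -/
theorem IsGeneric.exists_cliqueEmbedding (hk : 2 ≤ k) (hn : k < n) {SA : Set (Finset α)}
    (hSA : IsGeneric True n k SA) {S : Set (Finset β)} (hS : IsGeneric False n k S) (A : Finset α) :
    ∃ f h, CliqueEmbedding n k SA S A f h := by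
  have : Nonempty β := hS.nonempty hk hn
  -- Each `c` receives `n - k` new vertices, so that `(k - 1) + (n - k) = n - 1` vertices form its
  -- clique.
  let B : Finset (α ⊕ Finset α × Fin (n - k)) := A.disjSum (A.powersetCard (k - 1) ×ˢ Finset.univ)
  let H : Set (Finset (α ⊕ Finset α × Fin (n - k))) := {e | (∃ e' ∈ SA, e'.image Sum.inl = e) ∨
    ∃ c ⊆ A, c.card = k - 1 ∧ e ⊆ cliqueOver (n - k) c}
  obtain ⟨g, hg⟩ := hS.exists_partialIso hk H B
  have hinl {c : Finset α} (hc : c ⊆ A) : c.image Sum.inl ⊆ B := by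
    intro y hy
    obtain ⟨a, ha, rfl⟩ := Finset.mem_image.1 hy
    simpa [B] using hc ha
  have hblk {c : Finset α} (hc : c ⊆ A) (hck : c.card = k - 1) : cliqueOver (n - k) c ⊆ B := by
    rintro (a | p) h
    · rw [inl_mem_cliqueOver] at h
      simpa [B] using hc h
    · rw [inr_mem_cliqueOver] at h
      simp [B, h, Finset.mem_powersetCard, hc, hck]
  have hcardblk {c : Finset α} (hck : c.card = k - 1) : (cliqueOver (n - k) c).card = n - 1 := by
    rw [card_cliqueOver, hck]; omega
  have hcard {e} (he : e ⊆ B) : (e.image g).card = e.card :=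
    Finset.card_image_of_injOn (hg.injOn.mono (by exact_mod_cast he))
  have himg {c : Finset α} : c.image (fun a => g (Sum.inl a)) = (c.image Sum.inl).image g := by
    rw [Finset.image_image]; rfl
  have hcardinl (c : Finset α) : (c.image (Sum.inl : α → α ⊕ Finset α × Fin (n - k))).card = c.card :=
    Finset.card_image_of_injective _ Sum.inl_injective
  have hinlblk (c : Finset α) : c.image Sum.inl ⊆ cliqueOver (n - k) c := by
    intro y hy
    obtain ⟨a, ha, rfl⟩ := Finset.mem_image.1 hy
    exact inl_mem_cliqueOver.2 ha
  have hclq {c : Finset α} (hc : c ⊆ A) (hck : c.card = k - 1) :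
      CliqueOn k S ((cliqueOver (n - k) c).image g) := by
    intro e he hek
    obtain ⟨e', he', rfl⟩ := Finset.subset_image_iff.1 he
    have he' : e' ⊆ cliqueOver (n - k) c := by exact_mod_cast he'
    have heB := he'.trans (hblk hc hck)
    rw [hcard heB] at hek
    exact (hg.edge_iff e' (by exact_mod_cast heB) hek).1 (Or.inr ⟨c, hc, hck, he'⟩)
  let h : Finset α → Finset (Finset β) := fun c =>
    (((cliqueOver (n - k) c).image g).powersetCard (k - 1)).erase (c.image fun a => g (Sum.inl a))
  have hmem {c : Finset α} (hc : c ⊆ A) (hck : c.card = k - 1) (e : Finset β) :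
      e ∈ h c ↔ ∃ e' ⊆ cliqueOver (n - k) c, e'.card = k - 1 ∧ e' ≠ c.image Sum.inl ∧
        e'.image g = e := by
    simp only [h, Finset.mem_erase, Finset.mem_powersetCard, himg]
    constructor
    · rintro ⟨hne, he, hek⟩
      obtain ⟨e', he', rfl⟩ := Finset.subset_image_iff.1 he
      have he' : e' ⊆ cliqueOver (n - k) c := by exact_mod_cast he'
      rw [hcard (he'.trans (hblk hc hck))] at hek
      exact ⟨e', he', hek, fun h => hne (by rw [h]), rfl⟩
    · rintro ⟨e', he', hek, hne, rfl⟩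
      have heB := he'.trans (hblk hc hck)
      exact ⟨fun h => hne (image_inj_of_injOn hg.injOn heB (hinl hc) h),
        Finset.image_subset_image he', by rw [hcard heB, hek]⟩
  refine ⟨fun a => g (Sum.inl a), h, ?_, ?_, ?_, ?_, ?_, ?_, ?_, ?_, ?_⟩
  · intro a ha b hb hab
    exact Sum.inl_injective (hg.injOn (by simpa [B] using ha) (by simpa [B] using hb) hab)
  · intro c hc hck
    let z : α ⊕ Finset α × Fin (n - k) := Sum.inr (c, ⟨0, by omega⟩)
    have hz : z ∈ cliqueOver (n - k) c := inr_mem_cliqueOver.2 rfl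
    obtain ⟨e', hze, he', hek⟩ := Finset.exists_subsuperset_card_eq
      (Finset.singleton_subset_iff.2 hz) (n := k - 1) (by simp; omega)
      (by rw [hcardblk hck]; omega)
    refine ⟨_, (hmem hc hck _).2 ⟨e', he', hek, fun h => ?_, rfl⟩⟩
    have := Finset.singleton_subset_iff.1 hze
    rw [h] at this
    simp [z] at this
  · intro c hc hck
    refine (Finset.card_le_card (Finset.erase_subset _ _)).trans ?_
    rw [Finset.card_powersetCard, hcard (hblk hc hck), hcardblk hck]
  · intro c hc hck e he
    obtain ⟨e', he', hek, -, rfl⟩ := (hmem hc hck e).1 he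
    rw [hcard (he'.trans (hblk hc hck)), hek]
  · intro c hc hck e he c' hc' hck' heq
    obtain ⟨e', he', hek, hne, rfl⟩ := (hmem hc hck e).1 he
    rw [himg] at heq
    have := image_inj_of_injOn hg.injOn (hinl hc') (he'.trans (hblk hc hck)) heq
    subst this
    have hsub : c' ⊆ c := fun a ha => inl_mem_cliqueOver.1 (he' (Finset.mem_image_of_mem _ ha))
    exact hne (by rw [Finset.eq_of_subset_of_card_le hsub (by omega)])
  · intro c hc hck e he c' hc' hck' hec'
    obtain ⟨e', he', hek, hne, rfl⟩ := (hmem hc hck e).1 he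
    obtain ⟨e'', he'', -, -, heq⟩ := (hmem hc' hck' _).1 hec'
    have := image_inj_of_injOn hg.injOn (he''.trans (hblk hc' hck'))
      (he'.trans (hblk hc hck)) heq
    subst this
    by_contra hcc
    refine hne (Finset.eq_of_subset_of_card_le (fun y hy => ?_) (by rw [hcardinl]; omega))
    rcases y with a | p
    · exact Finset.mem_image_of_mem _ (inl_mem_cliqueOver.1 (he' hy))
    · exact (hcc ((inr_mem_cliqueOver.1 (he'' hy)).symm.trans (inr_mem_cliqueOver.1 (he' hy)))).elim
  · intro d hd
    obtain ⟨x, hx, hxF⟩ := hSA.extendsBy A {c | c.image (fun a => g (Sum.inl a)) ∈ d} (by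
      rintro - ⟨v, hv, hvn, hvF, hvS⟩
      have hv : v ⊆ A := by exact_mod_cast hv
      refine hd ⟨v.image fun a => g (Sum.inl a), Set.subset_univ _, ?_, fun c hc hck => ?_,
        fun e he hek => ?_⟩
      · rw [himg, hcard (hinl hv), hcardinl, hvn]
      · obtain ⟨c, hcv, rfl⟩ := Finset.subset_image_iff.1 hc
        have hcv : c ⊆ v := by exact_mod_cast hcv
        rw [himg, hcard (hinl (hcv.trans hv)), hcardinl] at hck
        exact hvF c hcv hck
      · obtain ⟨c, hcv, rfl⟩ := Finset.subset_image_iff.1 he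
        have hcv : c ⊆ v := by exact_mod_cast hcv
        rw [himg, hcard (hinl (hcv.trans hv))] at hek
        rw [himg]
        refine (hg.edge_iff _ (by exact_mod_cast hinl (hcv.trans hv)) hek).1 (Or.inl ⟨c, ?_, rfl⟩)
        exact hvS c hcv (by rwa [hcardinl] at hek))
    exact ⟨x, hx, fun c hc hck => hxF c (by exact_mod_cast hc) hck⟩
  · intro d hd c hc hck hcd
    by_contra! hall
    refine hd ⟨(cliqueOver (n - k) c).image g, Set.subset_univ _,
      by rw [hcard (hblk hc hck), hcardblk hck], fun e he hek => ?_, hclq hc hck⟩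
    by_cases hec : e = c.image fun a => g (Sum.inl a)
    · rwa [hec]
    · exact hall e (Finset.mem_erase.2 ⟨hec, Finset.mem_powersetCard.2 ⟨he, hek⟩⟩)
  · intro d hd
    by_cases hext : Extendable n k S Set.univ d
    · exact Or.inl hext
    right
    simp only [Extendable, not_not] at hext
    obtain ⟨v, -, hvn, hvd, hvS⟩ := hext
    -- As `k - 1 ≥ 1`, every vertex of `v` lies in a `(k - 1)`-subset of `v`. This subset is in `d`,
    -- hence is an image or a listed set, and both consist of values of `g` on `B`.
    have hvB : (v : Set β) ⊆ g '' B := by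
      intro x hx
      obtain ⟨e, hxe, hev, hek⟩ := Finset.exists_subsuperset_card_eq
        (Finset.singleton_subset_iff.2 hx) (n := k - 1) (by simp; omega) (by omega)
      obtain ⟨c, hc, hck, hce⟩ := hd e (hvd e hev hek)
      have hxe := Finset.singleton_subset_iff.1 hxe
      rcases hce with rfl | hce
      · rw [himg] at hxe
        obtain ⟨y, hy, rfl⟩ := Finset.mem_image.1 hxe
        exact ⟨y, hinl hc hy, rfl⟩
      · obtain ⟨e', he', -, -, rfl⟩ := (hmem hc hck e).1 hce
        obtain ⟨y, hy, rfl⟩ := Finset.mem_image.1 hxe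
        exact ⟨y, hblk hc hck (he' hy), rfl⟩
    obtain ⟨w, hwB, rfl⟩ := Finset.subset_set_image_iff.1 hvB
    have hwB : w ⊆ B := by exact_mod_cast hwB
    rw [hcard hwB] at hvn
    have hwH (e) (he : e ⊆ w) (hek : e.card = k) : e ∈ H :=
      (hg.edge_iff e (by exact_mod_cast he.trans hwB) hek).2
        (hvS _ (Finset.image_subset_image he) (by rw [hcard (he.trans hwB), hek]))
    by_cases hinr : ∃ p, Sum.inr p ∈ w
    · left
      obtain ⟨p, hp⟩ := hinr
      have hpB := hwB hp
      simp only [B, Finset.inr_mem_disjSum, Finset.mem_product, Finset.mem_powersetCard,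
        Finset.mem_univ, and_true] at hpB
      obtain ⟨hpA, hpk⟩ := hpB
      -- As `k ≥ 2`, any other vertex shares an edge with the new vertex `p`, and all edges through
      -- `p` lie inside the clique glued to `p.1`.
      have hsub : w ⊆ cliqueOver (n - k) p.1 := by
        intro y hy
        obtain ⟨e, hye, hew, hek⟩ := Finset.exists_subsuperset_card_eq
          (s := {y, Sum.inr p}) (t := w) (by simp [Finset.insert_subset_iff, hy, hp]) (n := k)
          ((Finset.card_insert_le _ _).trans (by simpa using hk)) (by omega)
        simp only [Finset.insert_subset_iff, Finset.singleton_subset_iff] at hye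
        rcases hwH e hew hek with ⟨e', -, rfl⟩ | ⟨c, -, -, hec⟩
        · simp at hye
        · have := inr_mem_cliqueOver.1 (hec hye.2)
          rw [this]
          exact hec hye.1
      have hw := Finset.eq_of_subset_of_card_le hsub (by rw [hcardblk hpk, hvn])
      subst hw
      refine ⟨p.1, hpA, hpk, ?_, fun e he => ?_⟩
      · refine hvd _ ?_ ?_
        · rw [himg]
          exact Finset.image_subset_image (hinlblk _)
        · rw [himg, hcard (hinl hpA), hcardinl, hpk]
      · have := Finset.mem_powersetCard.1 (Finset.mem_erase.1 he).2
        exact hvd e this.1 this.2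
    · right
      obtain ⟨v, hvw⟩ : ∃ v : Finset α, v.image Sum.inl = w := by
        refine ⟨w.preimage Sum.inl Sum.inl_injective.injOn, ?_⟩
        ext y
        rcases y with a | p
        · simp
        · simpa using fun h => hinr ⟨p, h⟩
      subst hvw
      have hvA : v ⊆ A := fun a ha => by
        simpa [B] using hwB (Finset.mem_image_of_mem _ ha)
      rw [hcardinl] at hvn
      refine ⟨v, hvA, hvn, fun c hc hck => ?_, fun e he hek => ?_⟩
      · rw [himg]
        exact hvd _ (Finset.image_subset_image (Finset.image_subset_image hc))
          (by rw [hcard (hinl (hc.trans hvA)), hcardinl, hck])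
      -- An edge on old vertices cannot come from a glued clique, since only the `k - 1` elements of
      -- `c` are old there.
      · rcases hwH _ (Finset.image_subset_image he) (by rw [hcardinl, hek]) with
          ⟨e', he', heq⟩ | ⟨c, -, hck, hec⟩
        · rwa [← Finset.image_injective Sum.inl_injective heq]
        · have hsub : e ⊆ c := fun a ha =>
            inl_mem_cliqueOver.1 (hec (Finset.mem_image_of_mem _ ha))
          have := Finset.card_le_card hsub
          omega

end

/-! ### Embeddings with large cliques in models of set theory -/

section

variable {W : Type*} [SetLang.Structure W]

/-- The tuple `a` consists of distinct elements of `U` and `s`. -/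
def DistinctIn {m : ℕ} (U s : W) (a : Fin m → W) : Prop :=
  Function.Injective a ∧ ∀ i, E (a i) U ∧ E (a i) s

/-- The set `y` consists of the values of `f` at the entries of `a`. -/
def ImageIs {m : ℕ} (f : W) (a : Fin m → W) (y : W) : Prop :=
  ∃ b : Fin m → W, (∀ i, Related f (a i) (b i)) ∧ Lists b y

/-- The set `f` is a clique embedding of the part of the hypergraph `(U, R)` in `s`, with the
relation `h` listing the sets attached to the image of a set of `k` vertices. -/
def InnerCliqueEmbedding (n k r : ℕ) (U R I D s f h Y : W) : Prop :=
  (∀ a : Fin k → W, DistinctIn U s a → ∃ y, ImageIs f a y ∧ E y I ∧ E y Y ∧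
    ∀ y', ImageIs f a y' → y' = y) ∧
  (∀ a a' : Fin k → W, ∀ y, DistinctIn U s a → DistinctIn U s a' → ImageIs f a y →
    ImageIs f a' y → ∀ i, ∃ i', a i = a' i') ∧
  (∀ y e, Related h y e → E e I ∧ E e Y ∧ ∀ a : Fin k → W, DistinctIn U s a →
    ¬ ImageIs f a e) ∧
  (∀ y y' e, Related h y e → Related h y' e → y = y') ∧
  (∀ a : Fin k → W, ∀ y, DistinctIn U s a → ImageIs f a y → ∃ e, Related h y e) ∧
  (∀ y, ∃ b : Fin r → W, ∀ e, Related h y e → ∃ i, e = b i) ∧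
  (∀ d, E d D → ∃ x, E x U ∧ ¬ E x s ∧ ∀ a : Fin k → W, ∀ y, DistinctIn U s a →
    ImageIs f a y → ∀ z : Fin (k + 1) → W, (∀ i : Fin k, z i.succ = a i) → z 0 = x →
      (InGraph z R ↔ E y d)) ∧
  (∀ d, E d D → ∀ a : Fin k → W, ∀ y, DistinctIn U s a → ImageIs f a y → E y d →
    ∃ e, Related h y e ∧ ¬ E e d) ∧
  (∀ d, (∀ y, E y d → (∃ a : Fin k → W, DistinctIn U s a ∧ ImageIs f a y) ∨
    ∃ y', Related h y' y) → E d D ∨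
    (∃ a : Fin k → W, ∃ y, DistinctIn U s a ∧ ImageIs f a y ∧ E y d ∧ ∀ e, Related h y e → E e d) ∨
    ∃ v : Fin (n - 1) → W, DistinctIn U s v ∧
      (∀ g : Fin k → Fin (n - 1), Function.Injective g →
        ∃ y, ImageIs f (fun i => v (g i)) y ∧ E y d) ∧
      ∀ g : Fin (k + 1) → Fin (n - 1), Function.Injective g → InGraph (fun i => v (g i)) R)

/-- Every finite set of vertices has a clique embedding. -/
def ReflectsCliques (n k r : ℕ) (U R I D : W) : Prop :=
  ∀ s, IsFin s → ∃ f h Y, IsFin Y ∧ InnerCliqueEmbedding n k r U R I D s f h Y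

end

set_option synthInstance.maxSize 2000 in
set_option synthInstance.maxHeartbeats 400000 in
theorem ReflectsCliques.transfer {M N : Type*} [SetLang.Structure M] [SetLang.Structure N]
    (j : M ↪ₑ[SetLang] N) {n k r : ℕ} {U R I D : M} (h : ReflectsCliques n k r U R I D) :
    ReflectsCliques n k r (j U) (j R) (j I) (j D) := by
  refine (@CardChar.transfer _ _ _ _ j (ReflectsCliques n k r U R I D)
    (ReflectsCliques n k r (j U) (j R) (j I) (j D)) ?_).1 h
  unfold ReflectsCliques InnerCliqueEmbedding DistinctIn ImageIs
  infer_instance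

section

variable {V : Set ZFSet.{u}}

theorem IsTransitiveModel.finset_injective (hV : IsTransitiveModel V) :
    Function.Injective hV.finset := fun _ _ h => finsetCode_injective (congrArg Subtype.val h)

/-- Describes members of the coded pattern by their finite sets of indices, so that the clauses of
`CliqueEmbedding` can be read for arbitrary elements `d` of `V`. -/
theorem IsTransitiveModel.mem_deltaCode_iff (hV : IsTransitiveModel V) {n k : ℕ}
    {S : Set (Finset ℕ)} {I D : V} (hI : I.1 = indexCode k) (hD : D.1 = deltaCode n k S) (d : V) :
    E d D ↔ (∀ y, E y d → E y I) ∧ {y | E y d}.Finite ∧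
      Extendable n k S Set.univ {e | E (hV.finset e) d} := by
  have key (s : Finset (Sub (k - 1))) (hs : d.1 = codeSet (subCode (k - 1)) (s : Set (Sub (k - 1)))) :
      Extendable n k S Set.univ {e | E (hV.finset e) d} ↔ s ∈ deltaPattern n k S := by
    refine not_congr (exists_congr fun v => ?_)
    rw [isClique_iff, and_iff_right (Set.subset_univ _)]
    refine and_congr_right fun _ => and_congr_left fun _ => ?_
    have hmem (c : Sub (k - 1)) : E (hV.finset c.1) d ↔ c ∈ s := by
      rw [E_iff, hs]
      exact mem_codeSet_iff (subCode_injective _)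
    exact ⟨fun h c hc => (hmem c).1 (h c.1 hc c.2), fun h c hc hck => (hmem ⟨c, hck⟩).2 (h ⟨c, hck⟩ hc)⟩
  rw [E_iff, hD]
  constructor
  · intro h
    obtain ⟨s, hs, hsd⟩ := mem_codeSet.1 h
    refine ⟨fun y hy => ?_, ?_, (key s hsd.symm).2 hs⟩
    · rw [E_iff, ← hsd] at hy
      obtain ⟨c, -, hc⟩ := mem_codeSet.1 hy
      rw [E_iff, hI]
      exact mem_indexCode.2 ⟨c, hc⟩
    · refine Set.Finite.of_finite_image (f := Subtype.val)
        ((s.finite_toSet.image (subCode (k - 1))).subset ?_) Subtype.val_injective.injOn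
      rintro _ ⟨y, hy, rfl⟩
      rw [Set.mem_ofPred_eq, E_iff, ← hsd] at hy
      exact mem_codeSet.1 hy
  · rintro ⟨hdI, hfin, hext⟩
    have hfin' : {c : Sub (k - 1) | subCode (k - 1) c ∈ d.1}.Finite := by
      refine Set.Finite.preimage (f := fun c : Sub (k - 1) => hV.finset c.1)
        (fun c _ c' _ h => Subtype.ext (hV.finset_injective h)) hfin
    have hsd : d.1 = codeSet (subCode (k - 1)) (hfin'.toFinset : Set (Sub (k - 1))) := by
      ext y
      rw [mem_codeSet]
      constructor
      · intro hy
        have := hdI ⟨y, hV.1 _ d.2 _ hy⟩ hy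
        rw [E_iff, hI] at this
        obtain ⟨c, hc⟩ := mem_indexCode.1 this
        refine ⟨c, ?_, hc⟩
        simp only [Set.Finite.coe_toFinset, Set.mem_ofPred_eq]
        rwa [hc]
      · rintro ⟨c, hc, rfl⟩
        simpa using hc
    exact mem_codeSet.2 ⟨_, (key _ hsd).1 hext, hsd.symm⟩

end

theorem exists_fin_cover {α : Type*} {r : ℕ} {t : Finset α} (h : t.card ≤ r) (x : α) :
    ∃ b : Fin r → α, ∀ e ∈ t, ∃ i, e = b i := by
  refine ⟨fun i => if hi : i.1 < t.card then t.equivFin.symm ⟨i, hi⟩ else x, fun e he => ?_⟩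
  refine ⟨⟨t.equivFin ⟨e, he⟩, (t.equivFin ⟨e, he⟩).2.trans_le h⟩, ?_⟩
  simp

theorem univ_image_cons {α : Type*} [DecidableEq α] {k : ℕ} (x : α) (a : Fin k → α) :
    Finset.univ.image (Fin.cons x a : Fin (k + 1) → α) = insert x (Finset.univ.image a) := by
  ext y
  simp [Fin.exists_fin_succ, eq_comm]

section

variable {V : Set ZFSet.{u}} {n k : ℕ}

/-- The interpretation of the edge relation in a model of `T_{n,k}`. -/
def InnerModel.edgeGraph (hV : IsTransitiveModel V) (M : InnerModel V (Tnk n k)) : V :=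
  M.graph hV (Sum.inr ⟨k, HyperRel.edge⟩)

/-- The map and the list of attached sets given by `IsGeneric.exists_cliqueEmbedding` are finite and
thus elements of `V`; all clauses are phrased with tuples so that they are first-order. The set `Y`
collects all indices involved and will witness pseudofiniteness. The standard number `(n - 1).choose
k` bounds how many sets are attached to one image, and this controls cardinalities after transfer.
-/
theorem InnerModel.reflectsCliques (hV : IsTransitiveModel V) (hk : 2 ≤ k + 1) (hn : k + 1 < n)
    (M : InnerModel V (Tnk n (k + 1))) {S : Set (Finset ℕ)} (hS : IsRandom (k + 1) S) {I D : V}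
    (hI : I.1 = indexCode (k + 1)) (hD : D.1 = deltaCode n (k + 1) S) :
    ReflectsCliques n k ((n - 1).choose k) M.carrier (M.edgeGraph hV) I D := by
  classical
  let _ : (HyperLang (k + 1)).Structure (M.carrier : ZFSet.{u}) := M.str
  let _ : (Tnk n (k + 1)).L.Structure (M.carrier : ZFSet.{u}) := M.str
  have := M.nonempty
  have hM := M.represents hV
  obtain ⟨S₀, hS₀⟩ := exists_isRandomCliqueFree hk hn
  have hgen : IsGenericModel n (k + 1) (M.carrier : ZFSet.{u}) :=
    (models_hyperTheory_iff hk hn hS₀).1 M.models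
  have hedge (z : Fin (k + 1) → (M.carrier : ZFSet.{u})) :
      InGraph (fun i => M.elem hV (z i)) (M.edgeGraph hV) ↔
        Function.Injective z ∧ Finset.univ.image z ∈ edgeSet (k + 1) (M.carrier : ZFSet.{u}) :=
    (hM.relMap_iff HyperRel.edge z).symm.trans (hgen.edgeRel_iff z)
  intro s hs
  rw [hV.isFin_iff] at hs
  obtain ⟨A, hA⟩ : ∃ A : Finset (M.carrier : ZFSet.{u}), ∀ x, x ∈ A ↔ E (M.elem hV x) s :=
    ⟨(hs.preimage hM.injective.injOn).toFinset, fun x => by simp⟩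
  obtain ⟨f₀, h₀, hf⟩ := hgen.generic.exists_cliqueEmbedding hk hn (isRandom_iff.1 hS) A
  have hk1 : k + 1 - 1 = k := rfl
  have hdist {m : ℕ} (a : Fin m → V) : DistinctIn M.carrier s a ↔
      ∃ a₀ : Fin m → (M.carrier : ZFSet.{u}), Function.Injective a₀ ∧ (∀ i, a₀ i ∈ A) ∧
        a = fun i => M.elem hV (a₀ i) := by
    constructor
    · rintro ⟨ha, has⟩
      obtain ⟨a₀, rfl⟩ := hM.forall_iff.1 fun i => (has i).1
      exact ⟨a₀, ha.of_comp (f := M.elem hV), fun i => (hA _).2 (has i).2, rfl⟩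
    · rintro ⟨a₀, ha, haA, rfl⟩
      exact ⟨hM.injective.comp ha, fun i => ⟨(a₀ i).2, (hA _).1 (haA i)⟩⟩
  have hpair (x : (M.carrier : ZFSet.{u})) : ZFSet.pair x.1 (natCode (f₀ x)) ∈ V :=
    hV.good.pair_mem (M.elem hV x).2 (hV.nat _).2
  obtain ⟨f, hf'⟩ := hV.good.exists_of_finite (A.finite_toSet.image fun x => (⟨_, hpair x⟩ : V))
  have hrel (x) (hx : x ∈ A) (b : V) : Related f (M.elem hV x) b ↔ b = hV.nat (f₀ x) := by
    rw [hV.good.related_iff]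
    refine (hf' ⟨_, hV.good.pair_mem (M.elem hV x).2 b.2⟩).trans ?_
    simp only [Set.mem_image, Subtype.mk.injEq, ZFSet.pair_inj, Finset.mem_coe]
    constructor
    · rintro ⟨y, -, hy, hb⟩
      obtain rfl : y = x := Subtype.ext hy
      exact Subtype.ext hb.symm
    · rintro rfl
      exact ⟨x, hx, rfl, rfl⟩
  have himage {m : ℕ} (a : Fin m → (M.carrier : ZFSet.{u})) (ha : ∀ i, a i ∈ A) (y : V) :
      ImageIs f (fun i => M.elem hV (a i)) y ↔
        y = hV.finset ((Finset.univ.image a).image f₀) := by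
    simp only [ImageIs, fun i => hrel (a i) (ha i)]
    rw [Finset.image_image]
    constructor
    · rintro ⟨b, hb, hL⟩
      obtain rfl : b = fun i => hV.nat (f₀ (a i)) := funext hb
      exact hV.lists_nat_iff.1 hL
    · rintro rfl
      exact ⟨_, fun i => rfl, hV.lists_nat_iff.2 rfl⟩
  have htuple {m : ℕ} (a : Fin m → (M.carrier : ZFSet.{u})) (ha : Function.Injective a)
      (haA : ∀ i, a i ∈ A) : Finset.univ.image a ⊆ A ∧ (Finset.univ.image a).card = m := by
    refine ⟨fun x hx => ?_, card_image_fin ha⟩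
    obtain ⟨i, -, rfl⟩ := Finset.mem_image.1 hx
    exact haA i
  have htuple' {m : ℕ} (c : Finset (M.carrier : ZFSet.{u})) (hc : c ⊆ A) (hck : c.card = m) :
      ∃ a : Fin m → (M.carrier : ZFSet.{u}), Function.Injective a ∧ (∀ i, a i ∈ A) ∧
        Finset.univ.image a = c := by
    obtain ⟨a, ha, hac, -⟩ := exists_injective_tuple hck
    exact ⟨a, ha, fun i => hc (hac ▸ Finset.mem_image_of_mem _ (Finset.mem_univ _)), hac⟩
  have hpair' (y e : Finset ℕ) : ZFSet.pair (finsetCode y) (finsetCode e) ∈ V :=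
    hV.good.pair_mem (hV.finset y).2 (hV.finset e).2
  obtain ⟨h, hh⟩ := hV.good.exists_of_finite (((A.powersetCard k).biUnion fun c =>
    (h₀ c).image fun e => (c.image f₀, e)).finite_toSet.image fun p =>
      (⟨_, hpair' p.1 p.2⟩ : V))
  have hrelh (y e : V) : Related h y e ↔ ∃ c ⊆ A, c.card = k ∧ ∃ e₀ ∈ h₀ c,
      y = hV.finset (c.image f₀) ∧ e = hV.finset e₀ := by
    rw [hV.good.related_iff]
    refine (hh ⟨_, hV.good.pair_mem y.2 e.2⟩).trans ?_
    simp only [Set.mem_image, Subtype.mk.injEq, ZFSet.pair_inj, Finset.coe_biUnion, Set.mem_iUnion,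
      Finset.mem_coe, Finset.mem_powersetCard, Finset.mem_image]
    constructor
    · rintro ⟨p, ⟨c, ⟨hcA, hck⟩, e₀, he₀, rfl⟩, h1, h2⟩
      exact ⟨c, hcA, hck, e₀, he₀, Subtype.ext h1.symm, Subtype.ext h2.symm⟩
    · rintro ⟨c, hcA, hck, e₀, he₀, rfl, rfl⟩
      exact ⟨_, ⟨c, ⟨hcA, hck⟩, e₀, he₀, rfl⟩, rfl, rfl⟩
  obtain ⟨Y, hY⟩ := hV.good.exists_of_finite (((A.powersetCard k).biUnion fun c =>
    insert (c.image f₀) (h₀ c)).finite_toSet.image hV.finset)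
  have hY' (e : Finset ℕ) : E (hV.finset e) Y ↔
      ∃ c ⊆ A, c.card = k ∧ (e = c.image f₀ ∨ e ∈ h₀ c) := by
    rw [hY, hV.finset_injective.mem_set_image]
    simp [Finset.mem_powersetCard, and_assoc]
  have hinj {c c'} (hc : c ⊆ A) (hc' : c' ⊆ A) (h : c.image f₀ = c'.image f₀) : c = c' :=
    image_inj_of_injOn hf.injOn hc hc' h
  have hcard {c} (hc : c ⊆ A) : (c.image f₀).card = c.card :=
    Finset.card_image_of_injOn (hf.injOn.mono (by exact_mod_cast hc))
  have hII (e : Finset ℕ) (he : e.card = k) : E (hV.finset e) I := by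
    rw [E_iff, hI]
    exact mem_indexCode.2 ⟨⟨e, he⟩, rfl⟩
  have hYfin : {z | E z Y}.Finite :=
    (((A.powersetCard k).biUnion fun c => insert (c.image f₀) (h₀ c)).finite_toSet.image
      hV.finset).subset fun z hz => (hY z).1 hz
  refine ⟨f, h, Y, hV.isFin_iff.2 hYfin, ?_, ?_, ?_, ?_, ?_, ?_, ?_, ?_, ?_⟩
  · intro a ha
    obtain ⟨a, hai, haA, rfl⟩ := (hdist a).1 ha
    obtain ⟨hcA, hck⟩ := htuple a hai haA
    exact ⟨_, (himage a haA _).2 rfl, hII _ (by rw [hcard hcA, hck]),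
      (hY' _).2 ⟨_, hcA, hck, Or.inl rfl⟩, fun y hy => (himage a haA y).1 hy⟩
  · intro a a' y ha ha' hy hy' i
    obtain ⟨a, hai, haA, rfl⟩ := (hdist a).1 ha
    obtain ⟨a', hai', haA', rfl⟩ := (hdist a').1 ha'
    rw [himage a haA] at hy
    rw [himage a' haA', hy] at hy'
    have := hinj (htuple a hai haA).1 (htuple a' hai' haA').1 (hV.finset_injective hy')
    have hi : a i ∈ Finset.univ.image a' := this ▸ Finset.mem_image_of_mem _ (Finset.mem_univ _)
    obtain ⟨i', -, hi'⟩ := Finset.mem_image.1 hi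
    exact ⟨i', congrArg (M.elem hV) hi'.symm⟩
  · intro y e hye
    obtain ⟨c, hc, hck, e₀, he₀, -, rfl⟩ := (hrelh y e).1 hye
    refine ⟨hII _ (hf.card_eq c hc hck e₀ he₀), (hY' _).2 ⟨c, hc, hck, Or.inr he₀⟩,
      fun a ha hae => ?_⟩
    obtain ⟨a, hai, haA, rfl⟩ := (hdist a).1 ha
    rw [himage a haA] at hae
    exact hf.ne_image c hc hck e₀ he₀ _ (htuple a hai haA).1 (htuple a hai haA).2
      (hV.finset_injective hae).symm
  · intro y y' e hy hy'
    obtain ⟨c, hc, hck, e₀, he₀, rfl, rfl⟩ := (hrelh y e).1 hy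
    obtain ⟨c', hc', hck', e₀', he₀', rfl, he⟩ := (hrelh y' _).1 hy'
    rw [← hV.finset_injective he] at he₀'
    rw [hf.eq_of_mem c hc hck e₀ he₀ c' hc' hck' he₀']
  · intro a y ha hay
    obtain ⟨a, hai, haA, rfl⟩ := (hdist a).1 ha
    rw [himage a haA] at hay
    obtain ⟨hcA, hck⟩ := htuple a hai haA
    obtain ⟨e, he⟩ := hf.nonempty _ hcA hck
    exact ⟨hV.finset e, (hrelh _ _).2 ⟨_, hcA, hck, e, he, hay, rfl⟩⟩
  · intro y
    by_cases hy : ∃ c ⊆ A, c.card = k ∧ y = hV.finset (c.image f₀)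
    · obtain ⟨c, hcA, hck, rfl⟩ := hy
      obtain ⟨b, hb⟩ := exists_fin_cover (hf.card_le c hcA hck) ∅
      refine ⟨fun i => hV.finset (b i), fun e he => ?_⟩
      obtain ⟨c', hcA', -, e₀, he₀, h1, rfl⟩ := (hrelh _ e).1 he
      rw [← hinj hcA hcA' (hV.finset_injective h1)] at he₀
      obtain ⟨i, rfl⟩ := hb e₀ he₀
      exact ⟨i, rfl⟩
    · refine ⟨fun _ => y, fun e he => (hy ?_).elim⟩
      obtain ⟨c, hcA, hck, -, -, h1, -⟩ := (hrelh _ e).1 he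
      exact ⟨c, hcA, hck, h1⟩
  · intro d hd
    obtain ⟨x, hxA, hx⟩ := hf.exists_vertex _ ((hV.mem_deltaCode_iff hI hD d).1 hd).2.2
    refine ⟨M.elem hV x, x.2, fun h => hxA ((hA x).2 h), fun a y ha hay z hz hz0 => ?_⟩
    obtain ⟨a, hai, haA, rfl⟩ := (hdist a).1 ha
    rw [himage a haA] at hay
    obtain ⟨hcA, hck⟩ := htuple a hai haA
    rw [show z = fun i => M.elem hV ((Fin.cons x a : Fin (k + 1) → (M.carrier : ZFSet.{u})) i) from
      funext fun i => by refine Fin.cases ?_ (fun i => ?_) i <;> simp [hz, hz0], hedge,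
      univ_image_cons, hx _ hcA hck, hay, Set.mem_ofPred_eq, and_iff_right]
    rw [Fin.cons_injective_iff]
    exact ⟨fun ⟨i, hi⟩ => hxA (hi ▸ haA i), hai⟩
  · intro d hd a y ha hay hyd
    obtain ⟨a, hai, haA, rfl⟩ := (hdist a).1 ha
    rw [himage a haA] at hay
    subst hay
    obtain ⟨hcA, hck⟩ := htuple a hai haA
    obtain ⟨e, he, hed⟩ := hf.exists_notMem _ ((hV.mem_deltaCode_iff hI hD d).1 hd).2.2 _ hcA hck hyd
    exact ⟨hV.finset e, (hrelh _ _).2 ⟨_, hcA, hck, e, he, rfl, rfl⟩, hed⟩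
  · intro d hd
    have hd' (y : V) (hy : E y d) : ∃ c ⊆ A, c.card = k ∧
        ∃ e, y = hV.finset e ∧ (e = c.image f₀ ∨ e ∈ h₀ c) := by
      rcases hd y hy with ⟨a, ha, hay⟩ | ⟨y', hyy'⟩
      · obtain ⟨a, hai, haA, rfl⟩ := (hdist a).1 ha
        obtain ⟨hcA, hck⟩ := htuple a hai haA
        exact ⟨_, hcA, hck, _, (himage a haA y).1 hay, Or.inl rfl⟩
      · obtain ⟨c, hcA, hck, e₀, he₀, -, rfl⟩ := (hrelh _ _).1 hyy'
        exact ⟨c, hcA, hck, e₀, rfl, Or.inr he₀⟩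
    rcases hf.extendable_or {e | E (hV.finset e) d} (fun e he => by
      obtain ⟨c, hcA, hck, e', h1, h2⟩ := hd' (hV.finset e) he
      rw [← hV.finset_injective h1] at h2
      exact ⟨c, hcA, hck, h2.imp_left Eq.symm⟩) with hext | ⟨c, hcA, hck, hcd, hch⟩ |
        ⟨v, hvA, hvn, hvd, hvS⟩
    · left
      refine (hV.mem_deltaCode_iff hI hD d).2 ⟨fun y hy => ?_, hYfin.subset fun y hy => ?_, hext⟩
      · obtain ⟨c, hcA, hck, e, rfl, he⟩ := hd' y hy
        refine hII e ?_
        rcases he with rfl | he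
        · rw [hcard hcA, hck]
        · exact hf.card_eq c hcA hck e he
      · obtain ⟨c, hcA, hck, e, rfl, he⟩ := hd' y hy
        exact (hY' e).2 ⟨c, hcA, hck, he⟩
    · right; left
      obtain ⟨a, ha, haA, rfl⟩ := htuple' c hcA hck
      refine ⟨fun i => M.elem hV (a i), _, (hdist _).2 ⟨a, ha, haA, rfl⟩, (himage a haA _).2 rfl, hcd,
        fun e he => ?_⟩
      obtain ⟨c', hcA', -, e₀, he₀, h1, rfl⟩ := (hrelh _ e).1 he
      rw [← hinj hcA hcA' (hV.finset_injective h1)] at he₀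
      exact hch e₀ he₀
    · right; right
      obtain ⟨v, hv, hvA', rfl⟩ := htuple' v hvA hvn
      refine ⟨fun i => M.elem hV (v i), (hdist _).2 ⟨v, hv, hvA', rfl⟩, fun g hg => ?_,
        fun g hg => ?_⟩
      · refine ⟨_, (himage (fun i => v (g i)) (fun i => hvA' _) _).2 rfl, hvd _ ?_
          (card_image_fin (hv.comp hg))⟩
        intro y hy
        obtain ⟨i, -, rfl⟩ := Finset.mem_image.1 hy
        exact Finset.mem_image_of_mem _ (Finset.mem_univ _)
      · refine (hedge fun i => v (g i)).2 ⟨hv.comp hg, hvS _ ?_ (card_image_fin (hv.comp hg))⟩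
        intro y hy
        obtain ⟨i, -, rfl⟩ := Finset.mem_image.1 hy
        exact Finset.mem_image_of_mem _ (Finset.mem_univ _)

end

/-! ### Pseudosaturation of the random clique free hypergraphs -/

section

variable {V : Set ZFSet.{u}} {W : Type w} [SetLang.Structure W]

theorem IsTransitiveModel.exists_adjoin (hV : IsTransitiveModel V) (j : V ↪ₑ[SetLang] W) (Y x : W)
    (hY : IsFin Y) : ∃ Y', IsFin Y' ∧ ∀ z, E z Y' ↔ E z Y ∨ z = x := by
  refine (transfer j (∀ Y x : V, IsFin Y → ∃ Y', IsFin Y' ∧ ∀ z, E z Y' ↔ E z Y ∨ z = x)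
    (∀ Y x : W, IsFin Y → ∃ Y', IsFin Y' ∧ ∀ z, E z Y' ↔ E z Y ∨ z = x)).1 ?_ Y x hY
  intro Y x hY
  rw [hV.isFin_iff] at hY
  obtain ⟨Y', hY'⟩ := hV.good.exists_of_finite (hY.insert x)
  refine ⟨Y', hV.isFin_iff.2 ((hY.insert x).subset fun z hz => (hY' z).1 hz), fun z => ?_⟩
  rw [hY', Set.mem_insert_iff, or_comm]
  rfl

theorem IsTransitiveModel.exists_empty (hV : IsTransitiveModel V) (j : V ↪ₑ[SetLang] W) :
    ∃ Y : W, IsFin Y ∧ ∀ z, ¬ E z Y := by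
  refine (transfer j (∃ Y : V, IsFin Y ∧ ∀ z, ¬ E z Y) (∃ Y : W, IsFin Y ∧ ∀ z, ¬ E z Y)).1 ?_
  obtain ⟨Y, hY⟩ := hV.good.exists_of_finite (Set.finite_empty (α := V))
  exact ⟨Y, hV.isFin_iff.2 (Set.finite_empty.subset fun z hz => (hY z).1 hz), fun z hz => (hY z).1 hz⟩

theorem IsTransitiveModel.exists_code_of_finite (hV : IsTransitiveModel V) (j : V ↪ₑ[SetLang] W)
    {F : Set W} (hF : F.Finite) : ∃ d : W, IsFin d ∧ ∀ y, E y d ↔ y ∈ F := by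
  induction F, hF using Set.Finite.induction_on with
  | empty =>
    obtain ⟨Y, hY, hY'⟩ := hV.exists_empty j
    exact ⟨Y, hY, fun y => iff_of_false (hY' y) id⟩
  | @insert a s _ _ ih =>
    obtain ⟨d, hd, hd'⟩ := ih
    obtain ⟨Y, hY, hY'⟩ := hV.exists_adjoin j d a hd
    exact ⟨Y, hY, fun y => by rw [hY', hd', Set.mem_insert_iff, or_comm]⟩

theorem Pseudofinite.union_finite (hV : IsTransitiveModel V) (j : V ↪ₑ[SetLang] W) {X F : Set W}
    (hX : Pseudofinite X) (hF : F.Finite) : Pseudofinite (X ∪ F) := by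
  induction F, hF using Set.Finite.induction_on with
  | empty => rwa [Set.union_empty]
  | @insert a s _ _ ih =>
    obtain ⟨d, hd, hd'⟩ := ih
    obtain ⟨Y, hY, hY'⟩ := hV.exists_adjoin j d a hd
    refine ⟨Y, hY, fun y hy => (hY' y).2 ?_⟩
    rw [Set.union_insert, Set.mem_insert_iff] at hy
    exact hy.symm.imp_left (hd' y)

theorem exists_injective_fin {k m : ℕ} (hk : 1 ≤ k) (hkm : k ≤ m) (i : Fin m) :
    ∃ g : Fin k → Fin m, Function.Injective g ∧ ∃ i', g i' = i := by
  let e := Equiv.swap (Fin.castLE hkm ⟨0, hk⟩) i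
  exact ⟨fun x => e (Fin.castLE hkm x), e.injective.comp (Fin.castLE_injective hkm), ⟨0, hk⟩, by simp [e]⟩

/-- The elements of a clique embedding which have to be in a pattern, for the extension of `A` by a
vertex with the neighbours `F`. -/
def requiredIndices {k : ℕ} {N : Type*} [DecidableEq N] (ι : N → W) (A : Set N)
    (F : Set (Finset N)) (f h : W) : Set W :=
  {y | ∃ a : Fin k → N, Function.Injective a ∧ (∀ i, a i ∈ A) ∧
    ((Finset.univ.image a ∈ F ∧ ImageIs f (ι ∘ a) y) ∨
      (Finset.univ.image a ∉ F ∧ ∃ y₀, ImageIs f (ι ∘ a) y₀ ∧ Related h y₀ y))}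

/-- There are at most `λ` tuples of length `k` from `A`, and each contributes its image or at most
`r` attached sets. It matters that `r` is a standard number: a set that is merely finite in `W` may
have more than `λ` members. -/
theorem mk_requiredIndices_le {N : Type w} [DecidableEq N] {k r : ℕ} {ι : N → W} {A : Set N}
    {F : Set (Finset N)} {f h : W} {l : Cardinal.{w}} (hl : ℵ₀ ≤ l) (hA : #A ≤ l)
    (hf : ∀ a : Fin k → N, Function.Injective a → (∀ i, a i ∈ A) →
      ∃ y, ∀ y', ImageIs f (ι ∘ a) y' → y' = y)
    (hh : ∀ y, ∃ b : Fin r → W, ∀ e, Related h y e → ∃ i, e = b i) :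
    #(requiredIndices (k := k) ι A F f h) ≤ l := by
  classical
  have hf' (a : Fin k → A) : ∃ y, Function.Injective a → ∀ y', ImageIs f (fun i => ι (a i)) y' → y' = y := by
    by_cases ha : Function.Injective a
    · obtain ⟨y, hy⟩ := hf (fun i => a i) (Subtype.val_injective.comp ha) fun i => (a i).2
      exact ⟨y, fun _ => hy⟩
    · exact ⟨f, fun h => (ha h).elim⟩
  choose G hG using hf'
  choose b hb using hh
  have hsub : requiredIndices (k := k) ι A F f h ⊆ Set.range
      fun p : (Fin k → A) × Option (Fin r) => p.2.elim (G p.1) (b (G p.1)) := by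
    rintro y ⟨a, ha, haA, ⟨-, hy⟩ | ⟨-, y₀, hy₀, hy⟩⟩
    · exact ⟨(fun i => ⟨a i, haA i⟩, none), (hG (fun i => ⟨a i, haA i⟩)
        (fun i j h => ha (congrArg Subtype.val h)) y hy).symm⟩
    · rw [hG (fun i => ⟨a i, haA i⟩) (fun i j h => ha (congrArg Subtype.val h)) y₀ hy₀] at hy
      obtain ⟨i, hi⟩ := hb _ y hy
      exact ⟨(fun i => ⟨a i, haA i⟩, some i), hi.symm⟩
  refine (mk_le_mk_of_subset hsub).trans (mk_range_le.trans ?_)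
  rw [mk_prod, lift_uzero]
  refine mul_le_of_le hl ?_ ?_
  · rw [mk_arrow, lift_uzero, mk_fin, lift_natCast]
    exact (power_le_power_right hA).trans (power_nat_le hl)
  · exact (lift_lt_aleph0.2 (mk_lt_aleph0)).le.trans hl

/-- The heart of the implication towards pseudosaturation. The prescribed neighbourhood `F` is
translated into a set `X` of indices; a member of the pattern that covers `X` is the trace of a
vertex, and this vertex has the neighbourhood `F` over `A`. The arity of the hypergraph is `k + 1`.
-/
theorem IsGeneric.extendsBy_of_lt_patternCardinal {V : Set ZFSet.{u}} (hV : IsTransitiveModel V)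
    (j : V ↪ₑ[SetLang] W) {n k r : ℕ} (hk : 1 ≤ k) (hn : k + 1 < n) {N : Type w} [DecidableEq N]
    {ι : N → W} (hι : Function.Injective ι) {U R : W} (hU : ∀ y, (∃ x, ι x = y) ↔ E y U)
    {S : Set (Finset N)} (hS : ∀ z : Fin (k + 1) → N, InGraph (ι ∘ z) R ↔
      Function.Injective z ∧ Finset.univ.image z ∈ S) {I D : V}
    (hR : ReflectsCliques n k r U R (j I) (j D)) {l : Cardinal.{w}} (hl : ℵ₀ ≤ l)
    (hlD : (l : WithTop Cardinal.{w}) < patternCardinal j I D) {A : Set N} (hA : #A ≤ l)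
    (hAfin : Pseudofinite (ι '' A)) {F : Set (Finset N)} (hF : Extendable n (k + 1) S A F) :
    ExtendsBy (k + 1) S A F := by
  classical
  obtain ⟨s, hs, hAs⟩ := hAfin
  obtain ⟨f, h, Y, hY, himg, hinj, hatt, hdis, hex, hbdd, hvert, hnot, hor⟩ := hR s hs
  have hd {m : ℕ} {a : Fin m → N} (ha : Function.Injective a) (haA : ∀ i, a i ∈ A) :
      DistinctIn U s (ι ∘ a) :=
    ⟨hι.comp ha, fun i => ⟨(hU _).1 ⟨_, rfl⟩, hAs _ ⟨_, haA i, rfl⟩⟩⟩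
  have hsub {a a' : Fin k → N} (h : ∀ i, ∃ i', (ι ∘ a) i = (ι ∘ a') i') :
      Finset.univ.image a ⊆ Finset.univ.image a' := by
    intro x hx
    obtain ⟨i, -, rfl⟩ := Finset.mem_image.1 hx
    obtain ⟨i', hi'⟩ := h i
    exact Finset.mem_image.2 ⟨i', Finset.mem_univ _, (hι hi').symm⟩
  -- The image of a tuple in `F` is required directly. For a tuple outside of `F`, the sets attached
  -- to its image are required instead, since a member of the pattern which contains them all cannot
  -- contain the image.
  set X : Set W := requiredIndices (k := k) ι A F f h with hX
  have hXY (y) (hy : y ∈ X) : E y (j I) ∧ E y Y := by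
    obtain ⟨a, ha, haA, ⟨-, hy⟩ | ⟨-, y₀, -, hy⟩⟩ := hy
    · obtain ⟨y', -, h1, h2, h3⟩ := himg _ (hd ha haA)
      rw [h3 y hy]
      exact ⟨h1, h2⟩
    · exact ⟨(hatt y₀ y hy).1, (hatt y₀ y hy).2.1⟩
  have hXimg {a : Fin k → W} {y : W} (ha : DistinctIn U s a) (hay : ImageIs f a y) (hy : y ∈ X) :
      ∃ a' : Fin k → N, Function.Injective a' ∧ (∀ i, a' i ∈ A) ∧ Finset.univ.image a' ∈ F ∧
        ImageIs f (ι ∘ a') y := by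
    obtain ⟨a', ha', haA', ⟨hF', hy⟩ | ⟨-, y₀, -, hy⟩⟩ := hy
    · exact ⟨a', ha', haA', hF', hy⟩
    · exact ((hatt y₀ y hy).2.2 a ha hay).elim
  have hXatt {a : Fin k → N} {y e : W} (ha : Function.Injective a) (haA : ∀ i, a i ∈ A)
      (hay : ImageIs f (ι ∘ a) y) (hye : Related h y e) (he : e ∈ X) : Finset.univ.image a ∉ F := by
    obtain ⟨a', ha', haA', ⟨-, he⟩ | ⟨hF', y₀, hy₀, he⟩⟩ := he
    · exact ((hatt y e hye).2.2 _ (hd ha' haA') he).elim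
    · rw [hdis _ _ _ he hye] at hy₀
      have h1 := hsub (hinj _ _ y (hd ha haA) (hd ha' haA') hay hy₀)
      have h2 := hsub (hinj _ _ y (hd ha' haA') (hd ha haA) hy₀ hay)
      rwa [h1.antisymm h2]
  obtain ⟨d, hdD, hXd⟩ := (lt_patternCardinal_iff j I D l).1 hlD X (fun y hy => (hXY y hy).1)
    ⟨Y, hY, fun y hy => (hXY y hy).2⟩
    (mk_requiredIndices_le hl hA (fun a ha haA => (himg _ (hd ha haA)).imp fun y hy => hy.2.2.2) hbdd)
    (fun X₀ hX₀ hfin => by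
      obtain ⟨d, -, hdX⟩ := hV.exists_code_of_finite j hfin
      refine ⟨d, ?_, hdX⟩
      have hdX' (y) (hy : E y d) : y ∈ X := hX₀ ((hdX y).1 hy)
      -- Two of the three cases are impossible. In the second one, a tuple has its image in `X`, so
      -- it is in `F`, and its attached sets in `X`, so it is not in `F`. In the third one, there is
      -- a clique in `A` all of whose `k`-subsets are in `F`, contrary to extendability.
      rcases hor d (fun y hy => by
        obtain ⟨a, ha, haA, ⟨-, hy⟩ | ⟨-, y₀, -, hy⟩⟩ := hdX' y hy
        · exact Or.inl ⟨_, hd ha haA, hy⟩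
        · exact Or.inr ⟨_, hy⟩) with h | ⟨a, y, ha, hay, hyd, he⟩ | ⟨v, hv, hvd, hvR⟩
      · exact h
      · obtain ⟨a', ha', haA', hF', hy'⟩ := hXimg ha hay (hdX' y hyd)
        obtain ⟨e, hye⟩ := hex _ y (hd ha' haA') hy'
        exact (hXatt ha' haA' hy' hye (hdX' e (he e hye)) hF').elim
      · have hcomp {g : Fin k → Fin (n - 1)} (hg : Function.Injective g) :
            DistinctIn U s fun i => v (g i) := ⟨hv.1.comp hg, fun i => hv.2 _⟩
        have hvA (i) : ∃ x ∈ A, ι x = v i := by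
          obtain ⟨g, hg, i', rfl⟩ := exists_injective_fin hk (by omega) i
          obtain ⟨y, hy, hyd⟩ := hvd g hg
          obtain ⟨a, ha, haA, -, hay⟩ := hXimg (hcomp hg) hy (hdX' y hyd)
          obtain ⟨l, hl⟩ := hinj _ _ y (hcomp hg) (hd ha haA) hy hay i'
          exact ⟨_, haA l, hl.symm⟩
        choose v' hvA' hv' using hvA
        obtain rfl : v = ι ∘ v' := funext fun i => (hv' i).symm
        have hvinj : Function.Injective v' := hv.1.of_comp
        refine (hF ⟨Finset.univ.image v', ?_, card_image_fin hvinj, ?_, ?_⟩).elim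
        · intro x hx
          obtain ⟨i, -, rfl⟩ := Finset.mem_image.1 (Finset.mem_coe.1 hx)
          exact hvA' i
        · intro c hc hck
          obtain ⟨b, hb, rfl, -⟩ := exists_injective_tuple hck
          have hbv (i) : ∃ l, v' l = b i := by
            simpa using hc (Finset.mem_image_of_mem b (Finset.mem_univ i))
          choose g hg using hbv
          obtain rfl : b = fun i => v' (g i) := funext fun i => (hg i).symm
          have hg' : Function.Injective g := fun i i' h => hb (congrArg v' h)
          obtain ⟨y, hy, hyd⟩ := hvd g hg'
          obtain ⟨a, ha, haA, haF, hay⟩ := hXimg (hcomp hg') hy (hdX' y hyd)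
          have h1 := hsub (a := fun i => v' (g i)) (hinj _ _ y (hcomp hg') (hd ha haA) hy hay)
          have h2 := hsub (a' := fun i => v' (g i)) (hinj _ _ y (hd ha haA) (hcomp hg') hay hy)
          have := h1.antisymm h2
          exact (this ▸ haF : Finset.univ.image (fun i : Fin k => v' (g i)) ∈ F)
        · intro e he hek
          obtain ⟨b, hb, rfl, -⟩ := exists_injective_tuple hek
          have hbv (i) : ∃ l, v' l = b i := by
            simpa using he (Finset.mem_image_of_mem b (Finset.mem_univ i))
          choose g hg using hbv
          obtain rfl : b = fun i => v' (g i) := funext fun i => (hg i).symm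
          exact ((hS fun i => v' (g i)).1 (hvR g fun i i' h => hb (congrArg v' h))).2)
  -- The vertex lies outside of the whole cover `s`, hence outside of `A`.
  obtain ⟨x, hxU, hxs, hx⟩ := hvert d hdD
  obtain ⟨x, rfl⟩ := (hU x).2 hxU
  have hxA : x ∉ A := fun h => hxs (hAs _ ⟨x, h, rfl⟩)
  refine ⟨x, hxA, fun c hcA hck => ?_⟩
  obtain ⟨a, ha, rfl, -⟩ := exists_injective_tuple hck
  replace hcA (i) : a i ∈ A := hcA (by simp)
  obtain ⟨y, hay, -⟩ := himg _ (hd ha hcA)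
  have hz := hx _ y (hd ha hcA) hay (ι ∘ (Fin.cons x a : Fin (k + 1) → N)) (fun i => by simp)
    (by simp)
  rw [hS, univ_image_cons, and_iff_right (Fin.cons_injective_iff.2
    ⟨fun ⟨i, hi⟩ => hxA (hi ▸ hcA i), ha⟩)] at hz
  refine hz.trans ⟨fun hyd => ?_, fun hF' => hXd y ⟨a, ha, hcA, Or.inl ⟨hF', hay⟩⟩⟩
  by_contra hF'
  -- If the image of a tuple outside of `F` were in `d`, then some attached set would be missing
  -- from `d`, although `d` covers `X`.
  obtain ⟨e, hye, hed⟩ := hnot d hdD _ y (hd ha hcA) hay hyd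
  exact hed (hXd e ⟨a, ha, hcA, Or.inr ⟨hF', y, hay, hye⟩⟩)

/-- Adding finitely many points to `A` keeps it pseudofinite and of size at most `λ`, so the
extension property is available over all the sets that occur in `IsGenericModel.realizesTypesOver`.
-/
theorem InnerModel.stdPseudosaturated_of_lt_patternCardinal {V : Set ZFSet.{u}}
    (hV : IsTransitiveModel V) (j : V ↪ₑ[SetLang] W) {n k : ℕ} (hk : 2 ≤ k) (hn : k < n)
    (M : InnerModel V (Tnk n k)) {S : Set (Finset ℕ)} (hS : IsRandom k S) {I D : V}
    (hI : I.1 = indexCode k) (hD : D.1 = deltaCode n k S) {l : Cardinal.{w}} (hl : ℵ₀ ≤ l)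
    (hlD : (l : WithTop Cardinal.{w}) < patternCardinal j I D) :
    StdPseudosaturated j hV M (Order.succ l) := by
  classical
  obtain ⟨k, rfl⟩ : ∃ k', k = k' + 1 := ⟨k - 1, by omega⟩
  let _ := stdStructure j hV M
  have := members_nonempty j hV M
  intro A hAfin hA
  rw [Order.lt_succ_iff] at hA
  have hrep := M.represents_std hV j
  obtain ⟨S₀, hS₀⟩ := exists_isRandomCliqueFree hk hn
  let _ : (HyperLang (k + 1)).Structure (Members (j M.carrier)) := stdStructure j hV M
  have hgen : IsGenericModel n (k + 1) (Members (j M.carrier)) :=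
    (models_hyperTheory_iff hk hn hS₀).1 (M.models_std hV j)
  have hedge (z : Fin (k + 1) → Members (j M.carrier)) :
      InGraph (Subtype.val ∘ z) (j (M.edgeGraph hV)) ↔
        Function.Injective z ∧ Finset.univ.image z ∈ edgeSet (k + 1) (Members (j M.carrier)) :=
    (hrep.relMap_iff HyperRel.edge z).symm.trans (hgen.edgeRel_iff z)
  refine hgen.realizesTypesOver hk hn A fun B hB F hF => ?_
  refine IsGeneric.extendsBy_of_lt_patternCardinal hV j (by omega) hn hrep.injective hrep.exists_iff
    hedge ((M.reflectsCliques hV hk hn hS hI hD).transfer j) hl hlD ?_ ?_ hF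
  · refine (mk_union_le A B).trans (add_le_of_le hl hA ?_)
    exact (hB.lt_aleph0).le.trans hl
  · rw [Set.image_union]
    exact hAfin.union_finite hV j (hB.image _)

end

/-! ### The patterns admitted by the random clique free hypergraphs -/

section

variable {α β : Type*}

theorem cliqueOn_image [DecidableEq β] {f : α → β} (hf : Function.Injective f) {k : ℕ} {S : Set (Finset β)}
    {G : Set (Finset α)} (h : ∀ e : Finset α, e.card = k → (e.image f ∈ S ↔ e ∈ G)) (v : Finset α) :
    CliqueOn k S (v.image f) ↔ CliqueOn k G v := by
  constructor
  · intro hv e he hek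
    exact (h e hek).1 (hv _ (Finset.image_subset_image he)
      (by rw [Finset.card_image_of_injective _ hf, hek]))
  · intro hv e he hek
    obtain ⟨e, he', rfl⟩ := Finset.subset_image_iff.1 he
    rw [Finset.card_image_of_injective _ hf] at hek
    exact (h e hek).2 (hv e (by exact_mod_cast he') hek)

theorem injOn_of_forall_card [DecidableEq α] {f : α → β} {k : ℕ} (hk : 2 ≤ k) {v : Finset α} (hv : k ≤ v.card)
    (h : ∀ e ⊆ v, e.card = k → Set.InjOn f e) : Set.InjOn f v := by
  intro x hx y hy hxy
  obtain ⟨e, he, hev, hek⟩ := Finset.exists_subsuperset_card_eq (s := {x, y}) (t := v) (n := k)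
    (by intro z; simp only [Finset.mem_insert, Finset.mem_singleton]; rintro (rfl | rfl) <;> assumption)
    (Finset.card_le_two.trans hk) hv
  exact h e hev hek (he (by simp)) (he (by simp)) hxy

end

/-- The multipartite hypergraph with `m` parts, the first `q` of which carry copies of `S`, where
the edges which meet the other parts are arbitrary. -/
def partiteGraph (q m : ℕ) (S : Set (Finset ℕ)) : Set (Finset (ℕ × Fin m)) :=
  {e | Set.InjOn Prod.snd (e : Set (ℕ × Fin m)) ∧
    ((∀ p ∈ e, p.2.1 < q) → Set.InjOn Prod.fst (e : Set (ℕ × Fin m)) ∧ e.image Prod.fst ∈ S)}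

/-- Edges meet each part at most once, and any two vertices of a clique with at least `k ≥ 2`
vertices share an edge, so the clique is a partial transversal of the `m` parts. -/
theorem card_le_of_cliqueOn_partiteGraph {q m k : ℕ} (hk : 2 ≤ k) {S : Set (Finset ℕ)}
    {v : Finset (ℕ × Fin m)} (hkv : k ≤ v.card) (hv : CliqueOn k (partiteGraph q m S) v) :
    Set.InjOn Prod.snd (v : Set (ℕ × Fin m)) ∧ v.card ≤ m := by
  have h := injOn_of_forall_card hk hkv fun e he hek => (hv e he hek).1
  refine ⟨h, ?_⟩
  have := Finset.card_le_univ (v.image Prod.snd)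
  rwa [Finset.card_image_of_injOn h, Fintype.card_fin] at this

/-- With `m` parts there is no `(m + 1)`-clique, so the multipartite hypergraph, being countable,
embeds into the generic one. -/
theorem IsGeneric.exists_partiteGraph_embedding {q m k : ℕ} (hk : 2 ≤ k) (hm : k ≤ m)
    (S : Set (Finset ℕ)) {S₀ : Set (Finset ℕ)} (hS₀ : IsGeneric True (m + 1) k S₀) :
    ∃ g : ℕ × Fin m → ℕ, Function.Injective g ∧ ∀ e : Finset (ℕ × Fin m), e.card = k →
      (e.image g ∈ S₀ ↔ e ∈ partiteGraph q m S) := by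
  have : NeZero m := ⟨by omega⟩
  obtain ⟨enc⟩ : Nonempty (ℕ × Fin m ≃ ℕ) := nonempty_equiv_of_countable
  obtain ⟨f, hf, hf'⟩ := hS₀.exists_embedding hk (by omega)
    {e | e.image enc.symm ∈ partiteGraph q m S} (fun _ v hv hcl => by
      replace hcl := (cliqueOn_image enc.symm.injective (S := partiteGraph q m S)
        (fun e _ => Iff.rfl) v).2 hcl
      have hcard : (v.image enc.symm).card = m + 1 := by
        rw [Finset.card_image_of_injective _ enc.symm.injective, hv]
      have := (card_le_of_cliqueOn_partiteGraph hk (by omega) hcl).2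
      omega)
  refine ⟨f ∘ enc, hf.comp enc.injective, fun e he => ?_⟩
  rw [← Finset.image_image, hf' _ (by rw [Finset.card_image_of_injective _ enc.injective, he])]
  simp [Finset.image_image]

/-- The vertices of the multipartite hypergraph over the entries of `c`. -/
def partitePoint (q : ℕ) {k m : ℕ} (c : Fin k → ℕ) (p : Fin k × Fin m) : ℕ × Fin m :=
  (if p.2.1 < q then c p.1 else 0, p.2)

/-- The choices of vertices from distinct parts, and over distinct entries in the first `q` parts. -/
def PartiteChoice (q : ℕ) {k m : ℕ} (h : Fin k → Fin k × Fin m) : Prop :=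
  Function.Injective (fun i => (h i).2) ∧
    ∀ i i', (h i).2.1 < q → (h i').2.1 < q → (h i).1 = (h i').1 → i = i'

theorem PartiteChoice.injective {q k m : ℕ} {h : Fin k → Fin k × Fin m} (hh : PartiteChoice q h)
    (c : Fin k → ℕ) : Function.Injective fun i => partitePoint q c (h i) :=
  fun _ _ hij => hh.1 (congrArg (fun p : ℕ × Fin m => p.2) hij)

/-- Every choice of `k` vertices from a transversal is a choice over `k` entries. -/
theorem exists_partiteChoice {q k m : ℕ} (hk : 1 ≤ k) (hkq : k ≤ q) {v : Fin q → ℕ}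
    (hv : Function.Injective v) {t : Fin k → Fin m} (ht : Function.Injective t) :
    ∃ c : Finset ℕ, c ⊆ Finset.univ.image v ∧ c.card = k ∧ ∀ e : Fin k → ℕ,
      Finset.univ.image e = c → ∃ h : Fin k → Fin k × Fin m, PartiteChoice q h ∧
        ∀ i, partitePoint q e (h i) = (if hi : (t i).1 < q then v ⟨t i, hi⟩ else 0, t i) := by
  -- The entries of `v` that are used in the first `q` parts may number fewer than `k`; the set `c`
  -- pads them to exactly `k` entries of `v`.
  obtain ⟨c, hc, hcv, hck⟩ := Finset.exists_subsuperset_card_eq (n := k)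
    (s := (Finset.univ.filter fun i => (t i).1 < q).image
      fun i => if hi : (t i).1 < q then v ⟨t i, hi⟩ else 0) (t := Finset.univ.image v)
    (by
      intro y hy
      obtain ⟨i, hi, rfl⟩ := Finset.mem_image.1 hy
      simp [(Finset.mem_filter.1 hi).2])
    (Finset.card_image_le.trans ((Finset.card_filter_le _ _).trans (by simp)))
    (by rwa [card_image_fin hv])
  refine ⟨c, hcv, hck, fun e he => ?_⟩
  have hl (i) : ∃ l : Fin k, ∀ hi : (t i).1 < q, e l = v ⟨t i, hi⟩ := by
    by_cases hi : (t i).1 < q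
    · have : v ⟨t i, hi⟩ ∈ Finset.univ.image e := by
        rw [he]
        exact hc (Finset.mem_image.2 ⟨i, by simpa using hi, by simp [hi]⟩)
      obtain ⟨l, -, hl⟩ := Finset.mem_image.1 this
      exact ⟨l, fun _ => hl⟩
    · exact ⟨⟨0, hk⟩, fun h => (hi h).elim⟩
  choose l hl using hl
  refine ⟨fun i => (l i, t i), ⟨ht, fun i i' hi hi' h => ht ?_⟩, fun i => ?_⟩
  · have h1 := (hl i hi).symm.trans ((congrArg e h).trans (hl i' hi'))
    exact Fin.ext (congrArg (fun z : Fin q => z.1) (hv h1))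
  · by_cases hi : (t i).1 < q
    · simp [partitePoint, hi, hl i hi]
    · simp [partitePoint, hi]

/-- An `(n - 1)`-clique of `S` all of whose `k`-subsets are in `s`, spread over the first `n - 1`
parts and completed by one vertex in each remaining part, is an `(n' - 1)`-clique; the required `x`
would turn it into an `n'`-clique. Conversely, if there is no such clique in `S`, then a vertex
joined to just the required `k`-sets creates no `n'`-clique: an `(n' - 1)`-clique meets every part,
and its vertices in the first `n - 1` parts project to a clique of `S` with all `k`-subsets in `s`.
The arity is `k + 1`. -/
theorem IsRandomCliqueFree.partite_consistent_iff {n n' k : ℕ} (hk : 1 ≤ k) (hkn : k + 1 < n)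
    (hn : n ≤ n') {S S₀ : Set (Finset ℕ)} (hS₀ : IsRandomCliqueFree n' (k + 1) S₀)
    {g : ℕ × Fin (n' - 1) → ℕ} (hg : Function.Injective g)
    (hg' : ∀ e : Finset (ℕ × Fin (n' - 1)), e.card = k + 1 →
      (e.image g ∈ S₀ ↔ e ∈ partiteGraph (n - 1) (n' - 1) S))
    {enum : Sub k → Fin k → ℕ} (henum : ∀ c, Finset.univ.image (enum c) = c.1)
    (s : Finset (Sub k)) :
    (∃ x : ℕ, ∀ c ∈ s, ∀ h : Fin k → Fin k × Fin (n' - 1), PartiteChoice (n - 1) h →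
      Function.Injective (Fin.cons x fun i => g (partitePoint (n - 1) (enum c) (h i)) :
        Fin (k + 1) → ℕ) ∧
      insert x (Finset.univ.image fun i => g (partitePoint (n - 1) (enum c) (h i))) ∈ S₀) ↔
    s ∈ deltaPattern n (k + 1) S := by
  have hgen := isRandomCliqueFree_iff.1 hS₀
  constructor
  · rintro ⟨x, hx⟩ ⟨v, hvn, hvs, hvS⟩
    obtain ⟨v, hv, rfl, -⟩ := exists_injective_tuple hvn
    rw [isClique_iff] at hvS
    -- In the parts that carry no copy of `S`, the vertex with first coordinate `0` is used, as in
    -- `partitePoint`.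
    let u : Fin (n' - 1) → ℕ × Fin (n' - 1) := fun i => (if hi : i.1 < n - 1 then v ⟨i, hi⟩ else 0, i)
    have hu : Function.Injective u := fun i i' h => congrArg (fun p : ℕ × Fin (n' - 1) => p.2) h
    have hedge (t : Fin k → Fin (n' - 1)) (ht : Function.Injective t) :
        Function.Injective (Fin.cons x fun i => g (u (t i)) : Fin (k + 1) → ℕ) ∧
          insert x (Finset.univ.image fun i => g (u (t i))) ∈ S₀ := by
      obtain ⟨c, hcv, hck, hc⟩ := exists_partiteChoice hk (by omega) hv ht
      obtain ⟨h, hh, hh'⟩ := hc (enum ⟨c, hck⟩) (henum _)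
      have := hx ⟨c, hck⟩ (hvs ⟨c, hck⟩ hcv) h hh
      simp only [hh'] at this
      exact this
    have hxu (i) : x ≠ g (u i) := by
      obtain ⟨t, ht, l, rfl⟩ := exists_injective_fin hk (by omega) i
      exact fun hxi => (Fin.cons_injective_iff.1 (hedge t ht).1).1 ⟨l, hxi.symm⟩
    refine hgen.cliqueFree trivial (insert x (Finset.univ.image fun i => g (u i))) ?_ ?_
    · rw [Finset.card_insert_of_notMem (by simpa using fun i => (hxu i).symm),
        card_image_fin (f := fun i => g (u i)) (hg.comp hu)]
      omega
    · intro e he hek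
      by_cases hxe : x ∈ e
      · obtain ⟨t, ht, hte, -⟩ := exists_injective_tuple
          (show (e.erase x).card = k by rw [Finset.card_erase_of_mem hxe, hek]; rfl)
        have htu (i) : ∃ l, g (u l) = t i := by
          have h1 : t i ∈ e.erase x := hte ▸ Finset.mem_image_of_mem _ (Finset.mem_univ _)
          have h2 := he (Finset.mem_of_mem_erase h1)
          rw [Finset.mem_insert, or_iff_right (Finset.ne_of_mem_erase h1)] at h2
          simpa using h2
        choose t' ht' using htu
        obtain rfl : t = fun i => g (u (t' i)) := funext fun i => (ht' i).symm
        rw [← Finset.insert_erase hxe, ← hte]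
        exact (hedge t' fun i i' h => ht (congrArg (fun i => g (u i)) h)).2
      · rw [Finset.subset_insert_iff_of_notMem hxe] at he
        rw [show (fun i => g (u i)) = g ∘ u from rfl, ← Finset.image_image] at he
        obtain ⟨e, he', rfl⟩ := Finset.subset_image_iff.1 he
        rw [Finset.card_image_of_injective _ hg] at hek
        replace he (p) (hp : p ∈ e) : ∃ i, p = u i := by
          obtain ⟨i, -, hi⟩ := Finset.mem_image.1 (he' hp)
          exact ⟨i, hi.symm⟩
        rw [hg' e hek]
        refine ⟨fun p hp p' hp' h => ?_, fun hlow => ?_⟩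
        · obtain ⟨i, rfl⟩ := he p hp
          obtain ⟨i', rfl⟩ := he p' hp'
          exact congrArg u h
        · have hu' (i : Fin (n' - 1)) (hi : i.1 < n - 1) : (u i).1 = v ⟨i, hi⟩ := dif_pos hi
          have hinj : Set.InjOn Prod.fst (e : Set (ℕ × Fin (n' - 1))) := by
            intro p hp p' hp' h
            have h1 := hlow p hp
            have h2 := hlow p' hp'
            obtain ⟨i, rfl⟩ := he p hp
            obtain ⟨i', rfl⟩ := he p' hp'
            rw [hu' i h1, hu' i' h2] at h
            have := congrArg (fun z : Fin (n - 1) => z.1) (hv h)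
            exact congrArg u (Fin.ext this)
          refine ⟨hinj, hvS _ (fun y hy => ?_) (by rw [Finset.card_image_of_injOn hinj, hek])⟩
          obtain ⟨p, hp, rfl⟩ := Finset.mem_image.1 hy
          have h1 := hlow p hp
          obtain ⟨i, rfl⟩ := he p hp
          rw [hu' i h1]
          exact Finset.mem_image_of_mem _ (Finset.mem_univ _)
  · intro hs
    let pts (c : Sub k) (h : Fin k → Fin k × Fin (n' - 1)) : Finset (ℕ × Fin (n' - 1)) :=
      Finset.univ.image fun i => partitePoint (n - 1) (enum c) (h i)
    have hpts (c h) : (pts c h).image g =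
        Finset.univ.image fun i => g (partitePoint (n - 1) (enum c) (h i)) := by
      rw [Finset.image_image]
      rfl
    let A : Finset ℕ := s.biUnion fun c =>
      (Finset.univ.image (partitePoint (n - 1) (enum c))).image g
    obtain ⟨x, hxA, hx⟩ := hgen.extendsBy A
      {e | ∃ c ∈ s, ∃ h, PartiteChoice (n - 1) h ∧ e = (pts c h).image g} (by
      rintro - ⟨v, hvA, hvn, hvF, hvS⟩
      have hvA' : v ⊆ (s.biUnion fun c =>
          Finset.univ.image (partitePoint (n - 1) (enum c))).image g := by
        intro y hy
        have := hvA hy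
        simp only [A, Finset.coe_biUnion, Set.mem_iUnion, Finset.mem_coe] at this
        obtain ⟨c, hc, hy⟩ := this
        obtain ⟨p, hp, rfl⟩ := Finset.mem_image.1 hy
        exact Finset.mem_image_of_mem _ (Finset.mem_biUnion.2 ⟨c, hc, hp⟩)
      obtain ⟨u, -, rfl⟩ := Finset.subset_image_iff.1 hvA'
      rw [Finset.card_image_of_injective _ hg] at hvn
      rw [cliqueOn_image hg hg'] at hvS
      have hu := (card_le_of_cliqueOn_partiteGraph (by omega) (by omega) hvS).1
      have husnd : u.image Prod.snd = Finset.univ := by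
        rw [← Finset.card_eq_iff_eq_univ, Finset.card_image_of_injOn hu, hvn, Fintype.card_fin]
      -- There are `n' - 1` vertices in distinct parts, so exactly `n - 1` of them are in the parts
      -- that carry `S`.
      set L := u.filter fun p => p.2.1 < n - 1 with hL
      have hLu : L ⊆ u := Finset.filter_subset _ _
      have hLcard : L.card = n - 1 := by
        rw [← Finset.card_image_of_injOn (hu.mono (by exact_mod_cast hLu))]
        have : L.image Prod.snd = Finset.univ.filter fun i : Fin (n' - 1) => i.1 < n - 1 := by
          rw [← husnd, Finset.filter_image]
        rw [this, Fin.card_filter_val_lt]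
        omega
      have hLlow (p) (hp : p ∈ L) : p.2.1 < n - 1 := (Finset.mem_filter.1 hp).2
      have hLe (e) (he : e ⊆ L) (hek : e.card = k + 1) :=
        (hvS e (he.trans hLu) hek).2 fun p hp => hLlow p (he hp)
      have hLinj : Set.InjOn Prod.fst (L : Set (ℕ × Fin (n' - 1))) :=
        injOn_of_forall_card (by omega) (by omega) fun e he hek => (hLe e he hek).1
      refine hs ⟨L.image Prod.fst, by rw [Finset.card_image_of_injOn hLinj, hLcard], ?_, ?_⟩
      · rintro ⟨c, hck⟩ hcL
        obtain ⟨e, he, rfl⟩ := Finset.subset_image_iff.1 hcL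
        have he' : e ⊆ L := by exact_mod_cast he
        have hek : e.card = k := by
          exact (Finset.card_image_of_injOn (hLinj.mono he)).symm.trans hck
        obtain ⟨c', hc's, h, hh, heq⟩ := hvF (e.image g) (Finset.image_subset_image (he'.trans hLu))
          (by rw [Finset.card_image_of_injective _ hg, hek]; rfl)
        obtain rfl := Finset.image_injective hg heq
        rw [show (⟨_, hck⟩ : Sub k) = c' from Subtype.ext ?_]
        · exact hc's
        refine (Finset.eq_of_subset_of_card_le ?_ (le_of_eq ?_))
        · intro y hy
          obtain ⟨p, hp, rfl⟩ := Finset.mem_image.1 hy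
          have hlow := hLlow p (he' hp)
          obtain ⟨i, -, rfl⟩ := Finset.mem_image.1 hp
          rw [← henum c']
          simp only [partitePoint] at hlow ⊢
          rw [if_pos hlow]
          exact Finset.mem_image_of_mem _ (Finset.mem_univ _)
        · exact c'.2.trans hck.symm
      · rw [isClique_iff]
        intro e he hek
        obtain ⟨e, he', rfl⟩ := Finset.subset_image_iff.1 he
        rw [Finset.card_image_of_injOn (hLinj.mono he')] at hek
        exact (hLe e (by exact_mod_cast he') hek).2)
    refine ⟨x, fun c hc h hh => ?_⟩
    have hmemA (i) : g (partitePoint (n - 1) (enum c) (h i)) ∈ A :=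
      Finset.mem_biUnion.2 ⟨c, hc, Finset.mem_image_of_mem _ (Finset.mem_image_of_mem _
        (Finset.mem_univ _))⟩
    have hinj : Function.Injective fun i => g (partitePoint (n - 1) (enum c) (h i)) :=
      hg.comp (hh.injective _)
    refine ⟨Fin.cons_injective_iff.2 ⟨fun ⟨i, hi⟩ => hxA (hi ▸ hmemA i), hinj⟩, ?_⟩
    refine (hx _ ?_ (card_image_fin hinj)).2 ⟨c, hc, h, hh, (hpts c h).symm⟩
    intro y hy
    obtain ⟨i, -, rfl⟩ := Finset.mem_image.1 (Finset.mem_coe.1 hy)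
    exact hmemA i

/-- The theory of the random `n'`-clique free hypergraph admits the patterns `Δ_{n,k}(S)` for
`n ≤ n'`. -/
theorem admits_deltaPattern {n n' k : ℕ} (hk : 2 ≤ k) (hkn : k < n) (hn : n ≤ n')
    (S : Set (Finset ℕ)) : Admits (Tnk n' k) (deltaPattern n k S) := by
  classical
  obtain ⟨k, rfl⟩ : ∃ k', k = k' + 1 := ⟨k - 1, by omega⟩
  obtain ⟨S₀, hS₀⟩ := exists_isRandomCliqueFree hk (hkn.trans_le hn)
  obtain ⟨g, hg, hg'⟩ := IsGeneric.exists_partiteGraph_embedding (q := n - 1) (m := n' - 1) hk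
    (by omega) S (show IsGeneric True (n' - 1 + 1) (k + 1) S₀ by
      rw [show n' - 1 + 1 = n' by omega]; exact isRandomCliqueFree_iff.1 hS₀)
  have henum (c : Sub k) : ∃ e : Fin k → ℕ, Finset.univ.image e = c.1 := by
    obtain ⟨e, -, he, -⟩ := exists_injective_tuple c.2
    exact ⟨e, he⟩
  choose enum henum using henum
  let _ : (HyperLang (k + 1)).Structure ℕ := hyperStructure (k + 1) S₀
  let _ : (Tnk n' (k + 1)).L.Structure ℕ := hyperStructure (k + 1) S₀
  have hmod : ℕ ⊨ (Tnk n' (k + 1)).thy :=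
    (models_hyperTheory_iff hk (hkn.trans_le hn) hS₀).2 (isGenericModel_nat hS₀)
  -- The formula says that `x` forms an edge with every admissible choice of `k` points over the
  -- index; its parameters are the `k * (n' - 1)` points, one for each entry of the index and each
  -- part.
  let φ : (Tnk n' (k + 1)).L.Formula (Fin 1 ⊕ Fin (k * (n' - 1))) :=
    Formula.iInf fun h : {h : Fin k → Fin k × Fin (n' - 1) // PartiteChoice (n - 1) h} =>
      Relations.formula (L := (Tnk n' (k + 1)).L) (n := k + 1) HyperRel.edge
        (Fin.cons (Term.var (Sum.inl 0)) fun i => Term.var (Sum.inr (finProdFinEquiv (h.1 i))))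
  refine ⟨1, k * (n' - 1), φ, Theory.ModelType.of _ ℕ,
    fun c p => g (partitePoint (n - 1) (enum c) (finProdFinEquiv.symm p)), fun s => ?_⟩
  refine Iff.trans ?_ (hS₀.partite_consistent_iff (by omega) hkn hn hg hg' henum s)
  have key (x : Fin 1 → ℕ) (c : Sub k) : φ.Realize (Sum.elim x fun p =>
      g (partitePoint (n - 1) (enum c) (finProdFinEquiv.symm p))) ↔
      ∀ h : Fin k → Fin k × Fin (n' - 1), PartiteChoice (n - 1) h →
      Function.Injective (Fin.cons (x 0) fun i => g (partitePoint (n - 1) (enum c) (h i)) :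
        Fin (k + 1) → ℕ) ∧
      insert (x 0) (Finset.univ.image fun i => g (partitePoint (n - 1) (enum c) (h i))) ∈ S₀ := by
    rw [Formula.realize_iInf, Subtype.forall]
    refine forall₂_congr fun h hh => ?_
    refine Formula.realize_rel.trans ?_
    change Function.Injective _ ∧ Finset.univ.image _ ∈ S₀ ↔ _
    have : (fun i => Term.realize (Sum.elim x fun p =>
        g (partitePoint (n - 1) (enum c) (finProdFinEquiv.symm p)))
        ((Fin.cons (Term.var (Sum.inl 0)) fun i => Term.var (Sum.inr (finProdFinEquiv (h i))) :
          Fin (k + 1) → (Tnk n' (k + 1)).L.Term (Fin 1 ⊕ Fin (k * (n' - 1)))) i)) =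
        (Fin.cons (x 0) fun i => g (partitePoint (n - 1) (enum c) (h i)) : Fin (k + 1) → ℕ) := by
      funext i
      refine Fin.cases rfl (fun i => ?_) i
      change g (partitePoint (n - 1) (enum c) (finProdFinEquiv.symm (finProdFinEquiv (h i)))) = _
      rw [Equiv.symm_apply_apply]
      rfl
    rw [this, univ_image_cons]
  constructor
  · rintro ⟨x, hx⟩
    exact ⟨x 0, fun c hc => (key x c).1 (hx c hc)⟩
  · rintro ⟨x, hx⟩
    exact ⟨fun _ => x, fun c hc => (key (fun _ => x) c).2 (hx c hc)⟩

/-! ### Hereditarily countable sets -/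

/-- The class of hereditarily countable sets. -/
def HC : Set ZFSet.{0} := {x | x.Hereditarily fun y => {z | z ∈ y}.Countable}

theorem mem_HC {x : ZFSet.{0}} : x ∈ HC ↔ {z | z ∈ x}.Countable ∧ ∀ y ∈ x, y ∈ HC :=
  ZFSet.hereditarily_iff

theorem IsHF.mem_HC {x : ZFSet.{0}} (h : IsHF x) : x ∈ HC := by
  induction x using ZFSet.inductionOn with
  | _ x ih =>
    rw [isHF_iff] at h
    exact CardChar.mem_HC.2 ⟨h.1.countable, fun z hz => ih z hz (h.2 z hz)⟩

theorem codeSet_mem_HC {α : Type} [Countable α] {c : α → ZFSet.{0}} {s : Set α}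
    (h : ∀ a ∈ s, c a ∈ HC) : codeSet c s ∈ HC := by
  refine mem_HC.2 ⟨((Set.to_countable s).image c).mono fun z hz => mem_codeSet.1 hz, fun z hz => ?_⟩
  obtain ⟨a, ha, rfl⟩ := mem_codeSet.1 hz
  exact h a ha

namespace HC

theorem exists_of_countable {s : Set HC} (hs : s.Countable) : ∃ y : HC, ∀ z, E z y ↔ z ∈ s := by
  have := hs.to_subtype
  have : Small.{0} s := Countable.toSmall s
  have key (z : ZFSet.{0}) : z ∈ ZFSet.range (fun a : s => a.1.1) ↔ ∃ h : z ∈ HC, ⟨z, h⟩ ∈ s := by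
    rw [ZFSet.mem_range]
    constructor
    · rintro ⟨a, rfl⟩
      exact ⟨a.1.2, a.2⟩
    · rintro ⟨h, hz⟩
      exact ⟨⟨⟨z, h⟩, hz⟩, rfl⟩
  refine ⟨⟨_, mem_HC.2 ⟨(hs.image Subtype.val).mono fun z hz => ?_, fun z hz => ((key z).1 hz).1⟩⟩,
    fun z => (key z.1).trans ⟨fun h => h.2, fun h => ⟨z.2, h⟩⟩⟩
  obtain ⟨h, hz⟩ := (key z).1 hz
  exact ⟨_, hz, rfl⟩

theorem countable_members (x : HC) : {z : HC | E z x}.Countable :=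
  (mem_HC.1 x.2).1.preimage Subtype.val_injective

/-- Every countable set of hereditarily countable sets is again one of them, so separation and
collection hold for arbitrary classes, the latter by choosing countably many values. An injection
into the natural numbers provides the well-ordering. -/
theorem isTransitiveModel : IsTransitiveModel HC := by
  have htrans : ∀ x ∈ HC, ∀ y ∈ x, y ∈ HC := fun x hx => (mem_HC.1 hx).2
  have hgood : GoodClass HC := by
    refine ⟨htrans, isHF_empty.mem_HC, fun x hx y hy => ?_⟩
    rw [mem_HC] at hy ⊢
    refine ⟨(hy.1.insert x).mono fun z hz => by simpa using hz, fun z hz => ?_⟩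
    rcases ZFSet.mem_insert_iff.1 hz with rfl | hz
    exacts [hx, hy.2 _ hz]
  refine ⟨htrans, fun x y h => hgood.ext h, ?_, fun x y => ?_, fun x => ?_, ?_, fun D _ x => ?_,
    fun R _ x h => ?_, fun x => ?_⟩
  · rintro x ⟨y, hy⟩
    obtain ⟨z, hz, hz'⟩ := ZFSet.regularity x.1 (by
      rintro h
      rw [E_iff, h] at hy
      exact ZFSet.notMem_empty _ hy)
    refine ⟨⟨z, htrans _ x.2 _ hz⟩, hz, fun t ht ht' => ?_⟩
    have : t.1 ∈ x.1 ∩ z := ZFSet.mem_inter.2 ⟨ht', ht⟩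
    rw [hz'] at this
    exact ZFSet.notMem_empty _ this
  · obtain ⟨p, hp⟩ := exists_of_countable (s := {x, y}) (by simp)
    exact ⟨p, fun z => by simp [hp]⟩
  · obtain ⟨y, hy⟩ := exists_of_countable (s := ⋃ t ∈ {t | E t x}, {z | E z t})
      ((countable_members x).biUnion fun t _ => countable_members t)
    exact ⟨y, fun z => by simp [hy]⟩
  · obtain ⟨y, hy⟩ := exists_of_countable (Set.countable_range fun m : ℕ =>
      (⟨natCode m, (GoodClass.natCode_isHF m).mem_HC⟩ : HC))
    refine ⟨y, ⟨⟨_, isHF_empty.mem_HC⟩, (hy _).2 ⟨0, rfl⟩, fun z => ZFSet.notMem_empty _⟩,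
      fun z hz => ?_⟩
    obtain ⟨m, rfl⟩ := (hy z).1 hz
    refine ⟨⟨natCode (m + 1), (GoodClass.natCode_isHF _).mem_HC⟩, (hy _).2 ⟨m + 1, rfl⟩, fun z => ?_⟩
    change z.1 ∈ insert _ _ ↔ _
    rw [ZFSet.mem_insert_iff, Subtype.ext_iff, or_comm]
    rfl
  · obtain ⟨y, hy⟩ := exists_of_countable (s := {z | E z x ∧ z ∈ D})
      ((countable_members x).mono fun z hz => hz.1)
    exact ⟨y, hy⟩
  · choose! t ht using h
    obtain ⟨y, hy⟩ := exists_of_countable ((countable_members x).image t)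
    exact ⟨y, fun z hz => ⟨t z, (hy _).2 ⟨z, hz, rfl⟩, ht z hz⟩⟩
  · obtain ⟨e, he⟩ := Set.countable_iff_exists_injOn.1 (countable_members x)
    have hp (p : HC × HC) : ZFSet.pair p.1.1 p.2.1 ∈ HC := hgood.pair_mem p.1.2 p.2.2
    have hcount : {p : HC × HC | E p.1 x ∧ E p.2 x ∧ e p.1 < e p.2}.Countable :=
      Set.Countable.mono (by rintro p ⟨h1, h2, -⟩; exact ⟨h1, h2⟩)
        ((countable_members x).prod (countable_members x))
    obtain ⟨r, hr⟩ := exists_of_countable (hcount.image fun p => (⟨_, hp p⟩ : HC))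
    have hr' (a b : HC) : Related r a b ↔ E a x ∧ E b x ∧ e a < e b := by
      rw [hgood.related_iff]
      refine (hr ⟨_, hp (a, b)⟩).trans ?_
      simp only [Set.mem_image, Subtype.mk.injEq, ZFSet.pair_inj, Set.mem_ofPred_eq, Prod.exists]
      constructor
      · rintro ⟨a', b', h, h1, h2⟩
        rwa [← Subtype.ext h1, ← Subtype.ext h2]
      · exact fun h => ⟨a, b, h, rfl, rfl⟩
    refine ⟨r, ?_⟩
    simp only [hr']
    refine ⟨fun a _ h => lt_irrefl _ h.2.2, fun a b c ha hb hc hab hbc =>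
      ⟨ha, hc, hab.2.2.trans hbc.2.2⟩, fun a b ha hb => ?_, fun s hs hsx => ?_⟩
    · rcases lt_trichotomy (e a) (e b) with h | h | h
      · exact Or.inr (Or.inl ⟨ha, hb, h⟩)
      · exact Or.inl (he ha hb h)
      · exact Or.inr (Or.inr ⟨hb, ha, h⟩)
    · obtain ⟨a, has, ha⟩ := exists_minimalFor_of_wellFoundedLT (fun a => E a s) e hs
      refine ⟨a, has, fun b hb => ?_⟩
      rcases lt_trichotomy (e a) (e b) with h | h | h
      · exact Or.inr ⟨hsx a has, hsx b hb, h⟩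
      · exact Or.inl (he (hsx b hb) (hsx a has) h.symm)
      · exact (not_lt_of_ge (ha hb h.le) h).elim

end HC

/-! ### Countable elementary submodels -/

/-- The defining formula is read in `N`, with its parameters moved by `j`. -/
theorem CoDef.exists_of_definable {M N : Type*} [SetLang.Structure M] [SetLang.Structure N]
    (j : M ↪ₑ[SetLang] N) {m : ℕ} {D : Set (Fin m → M)}
    (h : (Set.univ : Set M).Definable SetLang D) :
    ∃ Q : (Fin m → N) → Prop, CoDef SetLang id j m (fun v => v ∈ D) Q := by
  rw [Set.definable_iff_exists_formula_sum] at h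
  obtain ⟨φ, rfl⟩ := h
  let g : (Set.univ : Set M) ⊕ Fin m → M ⊕ Fin m := Sum.map Subtype.val id
  refine ⟨fun v => (BoundedFormula.relabel g φ).Realize j v, (BoundedFormula.relabel g φ),
    fun v => ?_, fun v => Iff.rfl⟩
  rw [BoundedFormula.realize_relabel, Set.mem_ofPred_eq, Formula.Realize]
  refine iff_of_eq (congrArg₂ _ ?_ (Subsingleton.elim _ _))
  funext i
  rcases i with i | i <;> rfl

section

variable {M N : Type*} [SetLang.Structure M] [SetLang.Structure N]

set_option synthInstance.maxSize 1000 in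
set_option synthInstance.maxHeartbeats 200000 in
/-- Elementary substructures of full models of `ZFC⁻` are models of `ZFC⁻`. -/
theorem ModelsZFCMinus.of_elementary (j : M ↪ₑ[SetLang] N) (hN : ModelsZFCMinus N)
    (hsep : ∀ D : N → Prop, ∀ x : N, ∃ y : N, ∀ z : N, E z y ↔ (E z x ∧ D z))
    (hcoll : ∀ R : N → N → Prop, ∀ x : N, (∀ z : N, E z x → ∃ t : N, R z t) →
      ∃ y : N, ∀ z : N, E z x → ∃ t : N, E t y ∧ R z t) : ModelsZFCMinus M := by
  refine ⟨(transfer j _ _).2 hN.extensionality, (transfer j _ _).2 hN.foundation,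
    (transfer j _ _).2 hN.pairing, (transfer j _ _).2 hN.union, (transfer j _ _).2 hN.infinity,
    fun D hD => ?_, fun R hR => ?_, (transfer j _ _).2 hN.wellOrdering⟩
  -- The class `Q` is given in `N` by the same formula. In `N` separation holds for every class, and
  -- the existence of the separated set is reflected back to `M`.
  · obtain ⟨Q, hQ⟩ := CoDef.exists_of_definable j hD
    have hQ' {n : ℕ} (i : Fin n) : CoDef SetLang id j n (fun v => v i ∈ D)
        (fun v => Q fun _ => v i) := hQ.subst (fun _ v => v i) (fun _ v => v i) fun _ => inferInstance
    exact (transfer j _ _).2 (hsep fun z => Q fun _ => z)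
  · obtain ⟨Q, hQ⟩ := CoDef.exists_of_definable j hR
    have hQ' {n : ℕ} (i i' : Fin n) : CoDef SetLang id j n (fun v => (v i, v i') ∈ R)
        (fun v => Q ![v i, v i']) := by
      have := hQ.subst (![fun v => v i, fun v => v i']) ![fun v => v i, fun v => v i']
        (by simp [Fin.forall_fin_succ]; constructor <;> infer_instance)
      refine this.congr (fun v => Iff.rfl) fun v => iff_of_eq (congrArg _ ?_)
      funext i
      fin_cases i <;> rfl
    exact (transfer j _ _).2 (hcoll fun z t => Q ![z, t])

end

/-- The inclusion of an elementary substructure, given as a class of sets. -/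
theorem exists_elementaryEmbedding_image {U : Set ZFSet.{u}} (S : SetLang.ElementarySubstructure U) :
    ∃ j : (Subtype.val '' (S : Set U) : Set ZFSet.{u}) ↪ₑ[SetLang] U, ∀ x, (j x).1 = x.1 := by
  let e : (Subtype.val '' (S : Set U) : Set ZFSet.{u}) ≃ S :=
    (Equiv.Set.image Subtype.val (S : Set U) Subtype.val_injective).symm
  have he (x) : (e x).1.1 = x.1 := by
    have := (Equiv.Set.image Subtype.val (S : Set U) Subtype.val_injective).apply_symm_apply x
    exact congrArg Subtype.val this
  let e' : (Subtype.val '' (S : Set U) : Set ZFSet.{u}) ≃[SetLang] S :=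
    { e with
      map_fun' := fun f => Empty.elim f
      map_rel' := fun {n} r x => by
        cases r
        change ((e (x 0)).1.1 ∈ (e (x 1)).1.1) ↔ (x 0).1 ∈ (x 1).1
        rw [he, he] }
  exact ⟨S.subtype.comp e'.toElementaryEmbedding, fun x => he x⟩

/-- Natural numbers are definable one after another, so they belong to the range of every elementary
embedding. -/
theorem IsTransitiveModel.exists_nat_eq {U : Set ZFSet.{u}} (hU : IsTransitiveModel U) {M : Type*}
    [SetLang.Structure M] (j : M ↪ₑ[SetLang] U) (m : ℕ) : ∃ z : M, j z = hU.nat m := by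
  induction m with
  | zero =>
    obtain ⟨z, hz⟩ := (transfer j (∃ z : M, ∀ t, ¬ E t z) (∃ z : U, ∀ t, ¬ E t z)).2
      ⟨hU.nat 0, fun t => ZFSet.notMem_empty _⟩
    have hz' := (transfer j (∀ t, ¬ E t z) (∀ t, ¬ E t (j z))).1 hz
    exact ⟨z, hU.good.ext fun t => iff_of_false (hz' t) (ZFSet.notMem_empty _)⟩
  | succ m ih =>
    obtain ⟨y, hy⟩ := ih
    have hsucc (t : U) : E t (hU.nat (m + 1)) ↔ E t (j y) ∨ t = j y := by
      rw [hy, E_iff]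
      change t.1 ∈ insert _ _ ↔ _
      rw [ZFSet.mem_insert_iff, Subtype.ext_iff, or_comm]
      rfl
    obtain ⟨z, hz⟩ := (transfer j (∃ z : M, ∀ t, E t z ↔ E t y ∨ t = y)
      (∃ z : U, ∀ t, E t z ↔ E t (j y) ∨ t = j y)).2 ⟨hU.nat (m + 1), hsucc⟩
    have hz' := (transfer j (∀ t, E t z ↔ E t y ∨ t = y)
      (∀ t, E t (j z) ↔ E t (j y) ∨ t = j y)).1 hz
    exact ⟨z, hU.good.ext fun t => (hz' t).trans (hsucc t).symm⟩

/-- The set `f` enumerates the members of `x` by natural numbers. -/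
def Enumerates {W : Type*} [SetLang.Structure W] (f x : W) : Prop :=
  ∀ y, E y x → ∃ m, IsNat m ∧ Related f m y ∧ ∀ y', Related f m y' → y' = y

theorem HC.exists_enumerates (x : HC) : ∃ f, Enumerates f x := by
  have hU := HC.isTransitiveModel
  obtain ⟨e, he⟩ := Set.countable_iff_exists_injOn.1 (HC.countable_members x)
  have hp (y : HC) : ZFSet.pair (natCode (e y)) y.1 ∈ HC := hU.good.pair_mem (hU.nat _).2 y.2
  obtain ⟨f, hf⟩ := HC.exists_of_countable ((HC.countable_members x).image fun y => (⟨_, hp y⟩ : HC))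
  refine ⟨f, fun y hy => ⟨hU.nat (e y), hU.isNat_iff.2 ⟨_, rfl⟩, ?_, fun y' hy' => ?_⟩⟩
  · rw [hU.good.related_iff]
    exact (hf ⟨_, hp y⟩).2 ⟨y, hy, rfl⟩
  · rw [hU.good.related_iff] at hy'
    obtain ⟨z, hz, hzy⟩ := (hf ⟨_, hU.good.pair_mem (hU.nat _).2 y'.2⟩).1 hy'
    obtain ⟨h1, h2⟩ := ZFSet.pair_inj.1 (congrArg Subtype.val hzy)
    rw [← Subtype.ext h2]
    exact he hz hy (natCode_injective h1)

/-- Every countable set of hereditarily countable sets is contained in a countable transitive model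
of `ZFC⁻`. -/
theorem exists_countable_transitiveModel {s : Set ZFSet.{0}} (hs : s.Countable) (hsHC : s ⊆ HC) :
    ∃ V : Set ZFSet.{0}, IsTransitiveModel V ∧ V.Countable ∧ s ⊆ V := by
  have hU := HC.isTransitiveModel
  have hinf : Infinite HC := Infinite.of_injective _ hU.nat_injective
  obtain ⟨S, hS, hScard⟩ := exists_elementarySubstructure_card_eq SetLang
    (Subtype.val ⁻¹' s : Set HC) (ℵ₀ : Cardinal.{1}) le_rfl (by
      simpa using (hs.preimage (f := (Subtype.val : HC → ZFSet.{0})) Subtype.val_injective).le_aleph0)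
    (by
      have : Countable SetLang.Symbols := by
        have : Countable (Σ l, SetRel l) := by
          refine Function.Injective.countable (f := fun x : Σ l, SetRel l => x.1) ?_
          rintro ⟨_, ⟨⟩⟩ ⟨_, ⟨⟩⟩ _
          rfl
        have : IsEmpty (Σ l, SetLang.Functions l) := ⟨fun f => Empty.elim f.2⟩
        exact inferInstanceAs (Countable ((Σ l, SetLang.Functions l) ⊕ Σ l, SetRel l))
      rw [lift_aleph0]
      exact lift_le_aleph0.2 (mk_le_aleph0 (α := SetLang.Symbols)))
    (by simp)
  obtain ⟨j, hj⟩ := exists_elementaryEmbedding_image S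
  have hScount : (S : Set HC).Countable := by
    rw [← le_aleph0_iff_set_countable]
    simpa using hScard.le
  refine ⟨_, ⟨?_, ModelsZFCMinus.of_elementary j hU.2 (fun D x => ?_) fun R x h => ?_⟩,
    hScount.image _, fun x hx => ⟨⟨x, hsHC hx⟩, hS hx, rfl⟩⟩
  -- Transitivity of the submodel: it contains an enumeration `f` of the countable set `x` and all
  -- natural numbers, hence every value of `f`, and `y` is one of them.
  · intro x hx y hy
    let x' : (Subtype.val '' (S : Set HC) : Set ZFSet.{0}) := ⟨x, hx⟩
    obtain ⟨f, hf⟩ := (@transfer _ _ _ _ j (∃ f, Enumerates f x')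
      (∃ f, Enumerates f (j x')) (by unfold Enumerates; infer_instance)).2 (HC.exists_enumerates _)
    have hf' := (@transfer _ _ _ _ j (Enumerates f x')
      (Enumerates (j f) (j x')) (by unfold Enumerates; infer_instance)).1 hf
    have hyx : y ∈ (j x').1 := by rwa [hj]
    obtain ⟨m, hm, hmy, hy'⟩ := hf' ⟨y, hU.1 _ (j x').2 _ hyx⟩ hyx
    obtain ⟨i, rfl⟩ := hU.isNat_iff.1 hm
    obtain ⟨z, hz⟩ := hU.exists_nat_eq j i
    rw [← hz] at hmy hy'
    obtain ⟨y₀, hy₀⟩ := (transfer j (∃ y, Related f z y) (∃ y, Related (j f) (j z) y)).2 ⟨_, hmy⟩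
    have := hy' (j y₀) ((transfer j (Related f z y₀) (Related (j f) (j z) (j y₀))).1 hy₀)
    rw [← show (j y₀).1 = y from congrArg Subtype.val this, hj]
    exact y₀.2
  · obtain ⟨y, hy⟩ := HC.exists_of_countable (s := {z | E z x ∧ D z})
      ((HC.countable_members x).mono fun z hz => hz.1)
    exact ⟨y, hy⟩
  · choose! t ht using h
    obtain ⟨y, hy⟩ := HC.exists_of_countable ((HC.countable_members x).image t)
    exact ⟨y, fun z hz => ⟨t z, (hy _).2 ⟨z, hz, rfl⟩, ht z hz⟩⟩

/-! ### Codes of theories -/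

theorem IsHF.pair {x y : ZFSet.{u}} (hx : IsHF x) (hy : IsHF y) : IsHF (ZFSet.pair x y) := by
  have hs {z : ZFSet.{u}} (hz : IsHF z) : IsHF ({z} : ZFSet.{u}) := by
    rw [show ({z} : ZFSet.{u}) = Insert.insert z ∅ from by ext; simp]
    exact hz.insert isHF_empty
  exact (hs hx).insert (hs (hx.insert (hs hy)))

theorem isHF_tupleCode {l : List ZFSet.{u}} (h : ∀ x ∈ l, IsHF x) : IsHF (tupleCode l) := by
  induction l with
  | nil => exact isHF_empty
  | cons a l ih =>
    exact (h a List.mem_cons_self).pair (ih fun x hx => h x (List.mem_cons_of_mem a hx))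

namespace CountableTheory

variable (T : CountableTheory)

theorem countable_symbols : Countable T.L.Symbols := T.num_injective.countable

theorem countable_boundedFormula (m : ℕ) : Countable (T.L.BoundedFormula Empty m) := by
  have := T.countable_symbols
  have h1 : #(Σ m, T.L.BoundedFormula Empty m) ≤ ℵ₀ := by
    refine BoundedFormula.card_le.trans (max_le le_rfl ?_)
    simpa [Language.card] using mk_le_aleph0 (α := T.L.Symbols)
  have : Countable (Σ m, T.L.BoundedFormula Empty m) := mk_le_aleph0_iff.1 h1
  exact (sigma_mk_injective (i := m)).countable

theorem isHF_termCode {α : Type} {c : α → ZFSet.{u}} (hc : ∀ a, IsHF (c a)) (t : T.L.Term α) :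
    IsHF (T.termCode c t) := by
  induction t with
  | var x => exact (GoodClass.natCode_isHF 0).pair (hc x)
  | func f ts ih =>
    refine (GoodClass.natCode_isHF 1).pair ((GoodClass.natCode_isHF _).pair (isHF_tupleCode fun x hx => ?_))
    obtain ⟨i, rfl⟩ := (List.mem_ofFn' _ _).1 hx
    exact ih i

theorem isHF_formulaCode {m : ℕ} (φ : T.L.BoundedFormula Empty m) : IsHF (T.formulaCode φ : ZFSet.{u}) := by
  have hc {m : ℕ} (x : Empty ⊕ Fin m) :
      IsHF ((Sum.elim Empty.elim (fun i : Fin m => natCode i) : _ → ZFSet.{u}) x) := by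
    rcases x with x | x
    · exact x.elim
    · exact GoodClass.natCode_isHF _
  induction φ with
  | falsum => exact (GoodClass.natCode_isHF 0).pair isHF_empty
  | equal t₁ t₂ =>
    exact (GoodClass.natCode_isHF 1).pair ((T.isHF_termCode hc _).pair (T.isHF_termCode hc _))
  | rel r ts =>
    refine (GoodClass.natCode_isHF 2).pair ((GoodClass.natCode_isHF _).pair (isHF_tupleCode fun x hx => ?_))
    obtain ⟨i, rfl⟩ := (List.mem_ofFn' _ _).1 hx
    exact T.isHF_termCode hc _
  | imp φ ψ h1 h2 => exact (GoodClass.natCode_isHF 3).pair (h1.pair h2)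
  | all φ h => exact (GoodClass.natCode_isHF 4).pair h

theorem languageCode_mem_HC : T.languageCode ∈ HC := by
  have := T.countable_symbols
  refine codeSet_mem_HC fun s _ => IsHF.mem_HC ?_
  rcases s with ⟨m, f⟩ | ⟨m, r⟩
  · exact (GoodClass.natCode_isHF 0).pair ((GoodClass.natCode_isHF _).pair (GoodClass.natCode_isHF _))
  · exact (GoodClass.natCode_isHF 1).pair ((GoodClass.natCode_isHF _).pair (GoodClass.natCode_isHF _))

theorem theoryCode_mem_HC : T.theoryCode ∈ HC := by
  have : Countable T.L.Sentence := T.countable_boundedFormula 0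
  exact codeSet_mem_HC fun φ _ => (T.isHF_formulaCode φ).mem_HC

end CountableTheory

theorem hypergraphCode_mem_HC (S : Set (Finset ℕ)) : hypergraphCode S ∈ HC :=
  codeSet_mem_HC fun s _ => (isHF_finsetCode s).mem_HC

/-- Countably many hereditarily countable sets, two countable theories and a hypergraph belong to
a countable transitive model. -/
theorem exists_countable_transitiveModel_memClass (T₀ T₁ : CountableTheory) (S : Set (Finset ℕ))
    {s : Set ZFSet.{0}} (hs : s.Countable) (hsHC : s ⊆ HC) : ∃ V : Set ZFSet.{0},
      IsTransitiveModel V ∧ V.Countable ∧ T₀.MemClass V ∧ T₁.MemClass V ∧ hypergraphCode S ∈ V ∧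
        s ⊆ V := by
  obtain ⟨V, hV, hVc, hsV⟩ := exists_countable_transitiveModel
    (s := s ∪ {T₀.languageCode, T₀.theoryCode, T₁.languageCode, T₁.theoryCode, hypergraphCode S})
    (hs.union (Set.toFinite _).countable) (by
      refine Set.union_subset hsHC ?_
      rintro x (rfl | rfl | rfl | rfl | rfl)
      exacts [T₀.languageCode_mem_HC, T₀.theoryCode_mem_HC, T₁.languageCode_mem_HC,
        T₁.theoryCode_mem_HC, hypergraphCode_mem_HC S])
  refine ⟨V, hV, hVc, ⟨hsV ?_, hsV ?_⟩, ⟨hsV ?_, hsV ?_⟩, hsV ?_, Set.subset_union_left.trans hsV⟩ <;>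
    simp

/-! ### Pseudosaturation and minimality -/

section

variable {n k : ℕ}

theorem mem_deltaCode_iff_exists {I D : ZFSet.{u}} {S : Set (Finset ℕ)} (hI : I = indexCode k)
    (hD : D = deltaCode n k S) : (∀ z, z ∈ I ↔ ∃ c, subCode (k - 1) c = z) ∧
      ∀ z, z ∈ D ↔ ∃ s ∈ deltaPattern n k S, codeSet (subCode (k - 1)) (s : Set (Sub (k - 1))) = z := by
  subst hI hD
  exact ⟨fun z => mem_indexCode, fun z => mem_codeSet⟩

variable {V : Set ZFSet.{u}} {hV : IsTransitiveModel V} {W : Type w} [SetLang.Structure W]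
  {j : V ↪ₑ[SetLang] W} {l : Cardinal.{w}} {S : Set (Finset ℕ)}

theorem StdPseudosaturated.lt_patternCardinal_delta (hl : ℵ₀ ≤ l) {T : CountableTheory}
    {M : InnerModel V T} (h : StdPseudosaturated j hV M (Order.succ l)) (hT : T.Complete)
    (hΔ : Admits T (deltaPattern n k S)) {I D : V} (hI : I.1 = indexCode k)
    (hD : D.1 = deltaCode n k S) : (l : WithTop Cardinal.{w}) < patternCardinal j I D :=
  h.lt_patternCardinal hl hT hΔ (subCode_injective _) (mem_deltaCode_iff_exists hI hD).1
    (mem_deltaCode_iff_exists hI hD).2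

theorem Tnk_isComplete (hk : 2 ≤ k) (hkn : k < n) : (Tnk n k).Complete := by
  obtain ⟨S₀, hS₀⟩ := exists_isRandomCliqueFree hk hkn
  exact Tnk_complete hk hkn hS₀

/-- A single pseudosaturated image already makes the cardinal large, and a large cardinal makes the
image of every model pseudosaturated. The two forms coincide because `V` contains some model. -/
theorem pseudosaturates_iff (hk : 2 ≤ k) (hkn : k < n) (hl : ℵ₀ ≤ l) (hS : IsRandom k S) {I D : V}
    (hI : I.1 = indexCode k) (hD : D.1 = deltaCode n k S) :
    (Pseudosaturates j hV (Order.succ l) (Tnk n k) ↔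
      (l : WithTop Cardinal.{w}) < patternCardinal j I D) ∧
    (PseudosaturatesEvery j hV (Order.succ l) (Tnk n k) ↔
      (l : WithTop Cardinal.{w}) < patternCardinal j I D) := by
  obtain ⟨M₀⟩ := hV.nonempty_innerModel hk hkn
  have h1 {M : InnerModel V (Tnk n k)} (h : StdPseudosaturated j hV M (Order.succ l)) :
      (l : WithTop Cardinal.{w}) < patternCardinal j I D :=
    h.lt_patternCardinal_delta hl (Tnk_isComplete hk hkn) (admits_deltaPattern hk hkn le_rfl S) hI hD
  have h2 (M : InnerModel V (Tnk n k)) (h : (l : WithTop Cardinal.{w}) < patternCardinal j I D) :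
      StdPseudosaturated j hV M (Order.succ l) :=
    M.stdPseudosaturated_of_lt_patternCardinal hV j hk hkn hS hI hD hl h
  exact ⟨⟨fun ⟨M, hM⟩ => h1 hM, fun h => ⟨M₀, h2 M₀ h⟩⟩, ⟨fun h => h1 (h M₀), fun h M => h2 M h⟩⟩

/-- Pseudosaturation of a theory that admits the pattern bounds the characteristic cardinal from
below, and for `T_{n,k}` this bound is already sufficient. -/
theorem crossLE_of_admits (κ : Cardinal.{w}) (hk : 2 ≤ k) (hkn : k < n) (hS : IsRandom k S)
    {T : CountableTheory} (hT : T.Complete) (hΔ : Admits T (deltaPattern n k S)) :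
    CrossLE κ (Tnk n k) T := by
  intro l hl
  obtain ⟨V, hV, hVc, h₀, h₁, hSV, -⟩ :=
    exists_countable_transitiveModel_memClass (Tnk n k) T S Set.countable_empty (Set.empty_subset _)
  refine ⟨V, hV, hVc, h₀, h₁, fun W _ _ j _ _ ⟨M, hM⟩ => ?_⟩
  have hlt := hM.lt_patternCardinal_delta hl hT hΔ (I := ⟨_, hV.indexCode_mem k⟩)
    (D := ⟨_, hV.deltaCode_mem n k S hSV⟩) rfl rfl
  exact (pseudosaturates_iff hk hkn hl hS rfl rfl).1.2 hlt

end

/-! ### Sequences which detect pseudofiniteness -/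

/-- The functions `e` on `o` give a sequence of parameters for which `P` is finitely satisfiable,
but no tuple satisfies infinitely many instances. -/
def IsDispersed {W : Type*} [SetLang.Structure W] {a b : ℕ} (P : (Fin (a + b) → W) → Prop)
    (U o : W) (e : Fin b → W) : Prop :=
  (∀ i, E i o → ∀ l, ∃ y, E y U ∧ Related (e l) i y ∧ ∀ y', Related (e l) i y' → y' = y) ∧
  (∀ d, IsFin d → (∀ i, E i d → E i o) → ∃ x : Fin a → W, (∀ l, E (x l) U) ∧
    ∀ i, E i d → ∀ z : Fin (a + b) → W, (∀ l, z (Fin.castAdd b l) = x l) →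
      (∀ l, Related (e l) i (z (Fin.natAdd a l))) → Ap P z) ∧
  ∀ x : Fin a → W, (∀ l, E (x l) U) → ∃ Y, IsFin Y ∧ ∀ i, E i o →
    (∀ z : Fin (a + b) → W, (∀ l, z (Fin.castAdd b l) = x l) →
      (∀ l, Related (e l) i (z (Fin.natAdd a l))) → Ap P z) → E i Y

section

variable {V : Set ZFSet.{u}} {T : CountableTheory} {a b : ℕ} {φ : T.L.BoundedFormula Empty (a + b)}

theorem InnerModel.isDispersed (hV : IsTransitiveModel V) (M : InnerModel V T)
    {c : ℕ → Fin b → (M.carrier : ZFSet.{u})} {o : V} (ho : ∀ z, E z o ↔ ∃ i, z = hV.nat i)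
    {e : Fin b → V} (he : ∀ l i y, Related (e l) (hV.nat i) y ↔ y = M.elem hV (c i l))
    (h₁ : letI := M.str; ∀ s : Finset ℕ, ∃ x : Fin a → (M.carrier : ZFSet.{u}), ∀ i ∈ s,
      φ.Realize default (Fin.append x (c i)))
    (h₂ : letI := M.str; ∀ x : Fin a → (M.carrier : ZFSet.{u}),
      {i | φ.Realize default (Fin.append x (c i))}.Finite) :
    letI := M.str; IsDispersed (Holds (M.elem hV) φ) M.carrier o e := by
  let _ := M.str
  have hM := M.represents hV
  have hz (i : ℕ) (x : Fin a → (M.carrier : ZFSet.{u})) :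
      (∀ z : Fin (a + b) → V, (∀ l, z (Fin.castAdd b l) = M.elem hV (x l)) →
        (∀ l, Related (e l) (hV.nat i) (z (Fin.natAdd a l))) → Ap (Holds (M.elem hV) φ) z) ↔
      φ.Realize default (Fin.append x (c i)) := by
    simp only [he, forall_eq_append_iff]
    rw [← hM.holds_iff, Ap]
    refine iff_of_eq (congrArg _ (funext fun l => ?_))
    refine Fin.addCases (fun l => ?_) (fun l => ?_) l <;> simp
  refine ⟨fun i hi l => ?_, fun d hd hdo => ?_, fun x hx => ?_⟩
  · obtain ⟨i, rfl⟩ := (ho i).1 hi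
    exact ⟨M.elem hV (c i l), (c i l).2, (he _ _ _).2 rfl, fun y hy => (he _ _ _).1 hy⟩
  · have hfin : {i | E (hV.nat i) d}.Finite := (hV.isFin_iff.1 hd).preimage hV.nat_injective.injOn
    obtain ⟨x, hx⟩ := h₁ hfin.toFinset
    refine ⟨fun l => M.elem hV (x l), fun l => (x l).2, fun i hi => ?_⟩
    obtain ⟨i, rfl⟩ := (ho i).1 (hdo i hi)
    exact (hz i x).2 (hx i (by simpa using hi))
  · obtain ⟨x, rfl⟩ := hM.forall_iff.1 hx
    obtain ⟨Y, hY⟩ := hV.good.exists_of_finite ((h₂ x).image hV.nat)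
    refine ⟨Y, hV.isFin_iff.2 (((h₂ x).image hV.nat).subset fun z hz => (hY z).1 hz),
      fun i hi hi' => ?_⟩
    obtain ⟨i, rfl⟩ := (ho i).1 hi
    exact (hY _).2 ⟨i, (hz i x).1 hi', rfl⟩

variable {W : Type w} [SetLang.Structure W]

set_option synthInstance.maxSize 1000 in
set_option synthInstance.maxHeartbeats 200000 in
-- The instances with index in `X` are finitely satisfiable, so by saturation some tuple satisfies
-- them all. By transfer, the indices whose instances are satisfied by one tuple are covered by a
-- set which is finite in `W`, and this set covers `X`.
theorem StdSaturated.pseudofinite {j : V ↪ₑ[SetLang] W} {hV : IsTransitiveModel V}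
    {M : InnerModel V T} {l : Cardinal.{w}} (hl : ℵ₀ ≤ l) (h : StdSaturated j hV M (Order.succ l))
    {o : V} {e : Fin b → V} (he : letI := M.str; IsDispersed (Holds (M.elem hV) φ) M.carrier o e)
    {X : Set W} (hXo : ∀ x ∈ X, E x (j o)) (hXl : #X ≤ l) : Pseudofinite X := by
  have hdisp : letI := stdStructure j hV M; IsDispersed
      (Holds (Subtype.val : Members (j M.carrier) → W) φ) (j M.carrier) (j o) (fun l => j (e l)) := by
    let _ := M.str
    let _ := stdStructure j hV M
    have : CoDef SetLang id j (a + b) (Holds (M.elem hV) φ)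
      (Holds (Subtype.val : Members (j M.carrier) → W) φ) := M.coDef_holds hV j φ
    exact (@transfer _ _ _ _ j (IsDispersed (Holds (M.elem hV) φ) M.carrier o e)
      (IsDispersed (Holds (Subtype.val : Members (j M.carrier) → W) φ) (j M.carrier) (j o)
        (fun l => j (e l)))
      (by unfold IsDispersed; infer_instance)).1 he
  let _ := stdStructure j hV M
  have := members_nonempty j hV M
  have hrep := M.represents_std hV j
  obtain ⟨h1, h2, h3⟩ := hdisp
  choose y hyU hyr hyu using fun (i : X) l => h1 i.1 (hXo _ i.2) l
  let y' : X × Fin b → Members (j M.carrier) := fun i => ⟨y i.1 i.2, hyU i.1 i.2⟩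
  let A : Set (Members (j M.carrier)) := Set.range y'
  have hA := h A (by
    rw [Order.lt_succ_iff]
    refine (mk_range_le.trans ?_)
    rw [mk_prod, lift_id', mk_fin]
    refine (mul_le_mul' hXl ?_).trans (mul_eq_self hl).le
    simpa using (natCast_lt_aleph0 (n := b)).le.trans hl)
  let ψ : X → T.L.Formula (A ⊕ Fin a) := fun i =>
    φ.toFormula.relabel (Sum.elim Empty.elim (Fin.append Sum.inr fun l => Sum.inl ⟨y' (i, l), _, rfl⟩))
  have hψ (i : X) (x : Fin a → Members (j M.carrier)) :
      (ψ i).Realize (Sum.elim Subtype.val x) ↔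
        ∀ z : Fin (a + b) → W, (∀ l, z (Fin.castAdd b l) = x l) →
        (∀ l, Related (j (e l)) i (z (Fin.natAdd a l))) →
          Ap (Holds (Subtype.val : Members (j M.carrier) → W) φ) z := by
    have hr (l z) : Related (j (e l)) i z ↔ z = y i l :=
      ⟨hyu i l z, by rintro rfl; exact hyr i l⟩
    simp only [hr, forall_eq_append_iff, ψ, Formula.realize_relabel,
      BoundedFormula.realize_toFormula, Ap]
    have := hrep.holds_iff φ (Fin.append x fun l => y' (i, l))
    refine Iff.trans (iff_of_eq (congrArg₂ _ (Subsingleton.elim _ _) (funext fun l => ?_)))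
      (this.symm.trans (iff_of_eq (congrArg _ (funext fun l => ?_))))
    · refine Fin.addCases (fun l => ?_) (fun l => ?_) l <;> simp
    · refine Fin.addCases (fun l => ?_) (fun l => ?_) l <;> simp [y']
  obtain ⟨x, hx⟩ := hA.exists_realize ψ fun F => by
    obtain ⟨d, hd, hdF⟩ := hV.exists_code_of_finite j (F.finite_toSet.image Subtype.val)
    obtain ⟨x, hxU, hx⟩ := h2 d hd fun i hi => by
      obtain ⟨i, -, rfl⟩ := (hdF i).1 hi
      exact hXo _ i.2
    exact ⟨fun l => ⟨x l, hxU l⟩, fun i hi => (hψ i _).2 (hx i ((hdF _).2 ⟨i, hi, rfl⟩))⟩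
  obtain ⟨Y, hY, hY'⟩ := h3 (fun l => (x l).1) fun l => (x l).2
  exact ⟨Y, hY, fun i hi => hY' i (hXo i hi) ((hψ ⟨i, hi⟩ x).1 (hx ⟨i, hi⟩))⟩

end

/-! ### Models on the natural numbers -/

/-- The set of natural numbers. -/
def omegaCode : ZFSet.{u} := codeSet natCode Set.univ

theorem mem_omegaCode {z : ZFSet.{u}} : z ∈ omegaCode ↔ ∃ i, natCode i = z := by
  simp [omegaCode, mem_codeSet]

theorem IsTransitiveModel.omegaCode_mem {V : Set ZFSet.{u}} (hV : IsTransitiveModel V) :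
    omegaCode ∈ V := by
  obtain ⟨o, ho⟩ := hV.exists_omega
  convert o.2
  ext z
  rw [mem_omegaCode]
  constructor
  · rintro ⟨i, rfl⟩
    exact (ho (hV.nat i)).2 ⟨i, rfl⟩
  · intro hz
    obtain ⟨i, hi⟩ := (ho ⟨z, hV.1 _ o.2 _ hz⟩).1 hz
    exact ⟨i, (congrArg Subtype.val hi).symm⟩

/-- The bijection between the natural numbers and their codes. -/
def omegaEquiv : ℕ ≃ (omegaCode : ZFSet.{u}) :=
  Equiv.ofBijective (fun i => ⟨natCode i, mem_omegaCode.2 ⟨i, rfl⟩⟩)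
    ⟨fun i i' h => natCode_injective (congrArg (fun z : (omegaCode : ZFSet.{u}) => z.1) h),
      fun z => by
        obtain ⟨i, hi⟩ := mem_omegaCode.1 z.2
        exact ⟨i, Subtype.ext hi⟩⟩

section

variable (T : CountableTheory) [T.L.Structure ℕ]

/-- The structure on the codes of the natural numbers. -/
@[reducible] def omegaStructure : T.L.Structure (omegaCode : ZFSet.{u}) :=
  Equiv.inducedStructure omegaEquiv

/-- The interpretation of the symbols, as a set. -/
def interpCode : ZFSet.{u} :=
  letI := omegaStructure.{u} T
  ZFSet.range (fun s : T.L.Symbols =>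
    ZFSet.pair (natCode (T.num s)) (symbolGraph T.L (U := omegaCode.{u}) s))

theorem range_mem_HC {α : Type*} [Countable α] {f : α → ZFSet.{0}} (h : ∀ a, f a ∈ HC) :
    ZFSet.range f ∈ HC := by
  refine mem_HC.2 ⟨(Set.countable_range f).mono fun z hz => ZFSet.mem_range.1 hz, fun z hz => ?_⟩
  obtain ⟨a, rfl⟩ := ZFSet.mem_range.1 hz
  exact h a

theorem interpCode_mem_HC : interpCode T ∈ HC := by
  have := T.countable_symbols
  let _ := omegaStructure.{0} T
  have : Countable (omegaCode : ZFSet.{0}) := omegaEquiv.{0}.symm.injective.countable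
  have hnat (x : (omegaCode : ZFSet.{0})) : IsHF x.1 := by
    obtain ⟨i, hi⟩ := mem_omegaCode.1 x.2
    exact hi ▸ GoodClass.natCode_isHF i
  refine range_mem_HC fun s => HC.isTransitiveModel.good.pair_mem (GoodClass.natCode_isHF _).mem_HC ?_
  rcases s with ⟨m, f⟩ | ⟨m, r⟩
  · refine range_mem_HC fun a => (isHF_tupleCode fun x hx => ?_).mem_HC
    rcases List.mem_append.1 hx with hx | hx
    · obtain ⟨i, rfl⟩ := (List.mem_ofFn' _ _).1 hx
      exact hnat _
    · rw [List.mem_singleton.1 hx]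
      exact hnat _
  · refine range_mem_HC fun a => (isHF_tupleCode fun x hx => ?_).mem_HC
    obtain ⟨i, rfl⟩ := (List.mem_ofFn' _ _).1 hx
    exact hnat _

/-- A model on the natural numbers, as a model in `V`. -/
def natInnerModel {V : Set ZFSet.{u}} (hV : IsTransitiveModel V) (h : interpCode T ∈ V)
    (hT : ℕ ⊨ T.thy) : InnerModel V T where
  carrier := ⟨omegaCode, hV.omegaCode_mem⟩
  nonempty := ⟨omegaEquiv 0⟩
  str := omegaStructure T
  interp_mem := h
  models := by
    let _ := omegaStructure.{u} T
    exact StrongHomClass.theory_model (Equiv.inducedStructureEquiv (L := T.L) omegaEquiv.{u})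

end

/-! ### The independence property -/

/-- The `m`-th interval of length `r`. -/
def block (r m : ℕ) : Finset ℕ := Finset.Ico (m * r) (m * r + r)

theorem mem_block {r m x : ℕ} (hr : 0 < r) : x ∈ block r m ↔ x / r = m := by
  rw [block, Finset.mem_Ico, Nat.div_eq_iff hr]
  have : m * r + r - 1 + 1 = m * r + r := by omega
  omega

theorem card_block (r m : ℕ) : (block r m).card = r := by simp [block]

/-- The pattern `Δ_{n,k}(S)` has an infinite set of independent indices. -/
theorem exists_independent_indices {n k : ℕ} (hk : 2 ≤ k) (hkn : k < n) {S : Set (Finset ℕ)}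
    (hS : IsRandom k S) : ∃ c : ℕ → Sub (k - 1), ∀ A B : Finset ℕ, Disjoint A B →
      ∃ s ∈ deltaPattern n k S, (∀ m ∈ A, c m ∈ s) ∧ ∀ m ∈ B, insert (c m) s ∉ deltaPattern n k S := by
  classical
  obtain ⟨r, rfl⟩ : ∃ r, n = r + 1 := ⟨n - 1, by omega⟩
  have hr : 0 < r := by omega
  -- A disjoint union of infinitely many `(n - 1)`-cliques is embedded into `S`; the `m`-th index
  -- will be the image of the first `k - 1` vertices of the `m`-th clique.
  obtain ⟨f, hf, hfS⟩ := (isRandom_iff (n := r + 1).1 hS).exists_embedding hk hkn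
    {e | ∃ m, e ⊆ block r m} fun h => h.elim
  let base (m : ℕ) : Finset ℕ := Finset.Ico (m * r) (m * r + (k - 1))
  have hbase (m) : base m ⊆ block r m := Finset.Ico_subset_Ico_right (by omega)
  have hbase' (m) : (base m).card = k - 1 := by simp [base]
  have hblock {e : Finset ℕ} {m m' : ℕ} (hek : e.card = k - 1) (he : e ⊆ block r m)
      (he' : e ⊆ block r m') : m = m' := by
    obtain ⟨x, hx⟩ := Finset.card_pos.1 (show 0 < e.card by omega)
    rw [← (mem_block hr).1 (he hx), ← (mem_block hr).1 (he' hx)]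
  have hcl (m) : IsClique k S ((block r m).image f) := by
    rw [isClique_iff, cliqueOn_image hf hfS]
    exact fun e he _ => ⟨m, he⟩
  refine ⟨fun m => ⟨(base m).image f, by rw [Finset.card_image_of_injective _ hf, hbase']⟩,
    fun A B hAB => ?_⟩
  -- In the cliques indexed by `A` only the distinguished subset is taken, and in those indexed by
  -- `B` everything except the distinguished one. Adding the latter then completes a clique.
  let P (c : Finset ℕ) : Prop := ∃ m ∈ A ∪ B, ∃ e ⊆ block r m, c = e.image f ∧
    ((m ∈ A ∧ e = base m) ∨ (m ∈ B ∧ e ≠ base m))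
  have hfin₀ : {c : Finset ℕ | P c}.Finite := by
    refine ((A ∪ B).biUnion fun m =>
      (block r m).powerset.image fun e => e.image f).finite_toSet.subset ?_
    rintro _ ⟨m, hm, e, he, rfl, -⟩
    exact Finset.mem_coe.2 (Finset.mem_biUnion.2 ⟨m, hm, Finset.mem_image_of_mem _
      (Finset.mem_powerset.2 he)⟩)
  have hfin₁ : (Subtype.val ⁻¹' {c : Finset ℕ | P c} : Set (Sub (k - 1))).Finite :=
    hfin₀.preimage Subtype.val_injective.injOn
  have hfin : {c : Sub (k - 1) | P c.1}.Finite := hfin₁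
  have hP {m : ℕ} {e : Finset ℕ} (hek : e.card = k - 1) (he : e ⊆ block r m)
      (h : P (e.image f)) : (m ∈ A ∧ e = base m) ∨ (m ∈ B ∧ e ≠ base m) := by
    obtain ⟨m', -, e', he', hee', h⟩ := h
    obtain rfl := Finset.image_injective hf hee'
    rwa [hblock hek he he']
  refine ⟨hfin.toFinset, ?_, fun m hm => ?_, fun m hm hmem => ?_⟩
  · rintro ⟨v, hvr, hvs, hvS⟩
    simp only [Nat.add_sub_cancel] at hvr
    have hvs' (c : Finset ℕ) (hc : c ⊆ v) (hck : c.card = k - 1) : P c := by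
      simpa using hvs ⟨c, hck⟩ hc
    have hvf : (v : Set ℕ) ⊆ Set.range f := by
      intro x hx
      obtain ⟨c, hxc, hcv, hck⟩ := Finset.exists_subsuperset_card_eq (s := {x}) (t := v) (n := k - 1)
        (by simpa using hx) (by rw [Finset.card_singleton]; omega) (by omega)
      obtain ⟨m, -, e, -, rfl, -⟩ := hvs' c hcv hck
      obtain ⟨y, -, hy⟩ := Finset.mem_image.1 (hxc (Finset.mem_singleton_self x))
      exact ⟨y, hy⟩
    obtain ⟨w, rfl⟩ : ∃ w : Finset ℕ, w.image f = v := by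
      obtain ⟨w, -, hw⟩ := Finset.subset_set_image_iff.1
        (show (v : Set ℕ) ⊆ f '' Set.univ by rwa [Set.image_univ])
      exact ⟨w, hw⟩
    rw [Finset.card_image_of_injective _ hf] at hvr
    rw [isClique_iff, cliqueOn_image hf hfS] at hvS
    obtain ⟨x₀, hx₀⟩ := Finset.card_pos.1 (show 0 < w.card by omega)
    -- Any two vertices of the clique share an edge, and edges stay within one block.
    have hwb : w ⊆ block r (x₀ / r) := by
      intro x hx
      obtain ⟨e, hxe, hew, hek⟩ := Finset.exists_subsuperset_card_eq (s := {x, x₀}) (t := w) (n := k)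
        (by intro z; simp only [Finset.mem_insert, Finset.mem_singleton]
            rintro (rfl | rfl) <;> assumption)
        (Finset.card_le_two.trans hk) (by omega)
      obtain ⟨m, hm⟩ := hvS e hew hek
      rw [mem_block hr, (mem_block hr).1 (hm (hxe (by simp))), (mem_block hr).1 (hm (hxe (by simp)))]
    obtain rfl := Finset.eq_of_subset_of_card_le hwb (by rw [card_block, hvr])
    set m := x₀ / r
    have h1 := hP (hbase' m) (hbase m) (hvs' _ (Finset.image_subset_image (hbase m))
      (by rw [Finset.card_image_of_injective _ hf, hbase']))
    have hmA : m ∈ A := by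
      rcases h1 with h | h
      · exact h.1
      · exact (h.2 rfl).elim
    -- The initial segment shifted by one is a second `(k - 1)`-subset, which fits into the block as
    -- `k ≤ r`. That both are required puts `m` into `A` and into `B`.
    let e : Finset ℕ := Finset.Ico (m * r + 1) (m * r + k)
    have hek : e.card = k - 1 := by simp only [e, Nat.card_Ico]; omega
    have he : e ⊆ block r m := Finset.Ico_subset_Ico (by omega) (by omega)
    have heb : e ≠ base m := by
      intro h
      have : m * r ∈ e := h ▸ Finset.mem_Ico.2 ⟨le_rfl, by omega⟩
      rw [Finset.mem_Ico] at this
      omega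
    rcases hP hek he (hvs' _ (Finset.image_subset_image he)
      (by rw [Finset.card_image_of_injective _ hf, hek])) with h | h
    · exact heb h.2
    · exact Finset.disjoint_left.1 hAB hmA h.1
  · rw [Set.Finite.mem_toFinset]
    exact ⟨m, Finset.mem_union_left _ hm, _, hbase m, rfl, Or.inl ⟨hm, rfl⟩⟩
  · refine hmem ⟨(block r m).image f, by rw [Finset.card_image_of_injective _ hf, card_block]; rfl,
      fun c hc => ?_, hcl m⟩
    obtain ⟨e, he, hec⟩ := Finset.subset_image_iff.1 hc
    rw [Finset.mem_insert, Set.Finite.mem_toFinset]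
    by_cases heb : e = base m
    · exact Or.inl (Subtype.ext (by rw [← hec, heb]))
    · exact Or.inr ⟨m, Finset.mem_union_right _ hm, e, by exact_mod_cast he, hec.symm,
        Or.inr ⟨hm, heb⟩⟩

/-- The parameters `d` are independent for the formula `φ`. -/
def Independent {L : FirstOrder.Language.{0, 0}} {a b : ℕ} (φ : L.Formula (Fin a ⊕ Fin b))
    {N : Type*} [L.Structure N] (d : ℕ → Fin b → N) : Prop :=
  ∀ A B : Finset ℕ, Disjoint A B → ∃ x : Fin a → N, (∀ m ∈ A, φ.Realize (Sum.elim x (d m))) ∧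
    ∀ m ∈ B, ¬ φ.Realize (Sum.elim x (d m))

theorem Admits.exists_independent {T : CountableTheory} {n k : ℕ} (hk : 2 ≤ k) (hkn : k < n)
    {S : Set (Finset ℕ)} (hS : IsRandom k S) (h : Admits T (deltaPattern n k S)) :
    ∃ (a b : ℕ) (φ : T.L.Formula (Fin a ⊕ Fin b)) (N : Theory.ModelType.{0, 0, 0} T.thy)
      (d : ℕ → Fin b → N), Independent φ d := by
  classical
  obtain ⟨a, b, φ, N, y, hy⟩ := h
  obtain ⟨c, hc⟩ := exists_independent_indices hk hkn hS
  refine ⟨a, b, φ, N, fun m => y (c m), fun A B hAB => ?_⟩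
  obtain ⟨s, hs, hA, hB⟩ := hc A B hAB
  obtain ⟨x, hx⟩ := (hy s).2 hs
  refine ⟨x, fun m hm => hx _ (hA m hm), fun m hm hφ => hB m hm ((hy _).1 ⟨x, fun i hi => ?_⟩)⟩
  rcases Finset.mem_insert.1 hi with rfl | hi
  exacts [hφ, hx i hi]

/-! ### From independence to dispersed sequences in a countable model -/

section

variable {L : FirstOrder.Language.{0, 0}} {a b : ℕ} {φ : L.Formula (Fin a ⊕ Fin b)} {N : Type}
  [L.Structure N] {d : ℕ → Fin b → N}

/-- Independent parameters define pairwise different sets of tuples, and a finite structure has only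
finitely many of these. Infinity is needed for an elementary substructure of size exactly `ℵ₀`. -/
theorem Independent.infinite (h : Independent φ d) : Infinite N := by
  by_contra hN
  rw [not_infinite_iff_finite] at hN
  refine not_injective_infinite_finite
    (fun m => {x : Fin a → N | φ.Realize (Sum.elim x (d m))}) fun m m' hmm' => ?_
  by_contra hne
  obtain ⟨x, h1, h2⟩ := h {m} {m'} (by simpa using hne)
  have h1 : x ∈ {x : Fin a → N | φ.Realize (Sum.elim x (d m))} := h1 m (by simp)
  rw [show {x : Fin a → N | φ.Realize (Sum.elim x (d m))} = _ from hmm'] at h1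
  exact h2 m' (by simp) h1

/-- An independent sequence is found in a countable model. -/
theorem Independent.exists_nat [Countable L.Symbols] (h : Independent φ d) :
    ∃ _ : L.Structure ℕ, L.ElementarilyEquivalent N ℕ ∧ ∃ d' : ℕ → Fin b → ℕ, Independent φ d' := by
  classical
  have := h.infinite
  choose! x hx using h
  -- The countable substructure has to contain the parameters and a solution for every pair of
  -- finite sets.
  let s : Set N := Set.range (fun p : ℕ × Fin b => d p.1 p.2) ∪
    Set.range (fun p : (Finset ℕ × Finset ℕ) × Fin a => x p.1.1 p.1.2 p.2)
  have hs : s.Countable := (Set.countable_range _).union (Set.countable_range _)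
  obtain ⟨M, hM, hcard⟩ := exists_elementarySubstructure_card_eq L s (ℵ₀ : Cardinal.{0}) le_rfl
    (by simpa using hs.le_aleph0) (by simpa [Language.card] using mk_le_aleph0 (α := L.Symbols))
    (by simp)
  obtain ⟨e⟩ : Nonempty (M ≃ ℕ) := by
    rw [lift_id, lift_id] at hcard
    exact Cardinal.eq.1 (hcard.trans mk_nat.symm)
  let str : L.Structure ℕ := e.inducedStructure
  let g : M ≃[L] ℕ := e.inducedStructureEquiv
  have hd (m l) : d m l ∈ M := hM (Or.inl ⟨(m, l), rfl⟩)
  have hx' (A B l) : x A B l ∈ M := hM (Or.inr ⟨((A, B), l), rfl⟩)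
  have hφ (A B m) : φ.Realize (Sum.elim (fun l => g ⟨x A B l, hx' A B l⟩) fun l => g ⟨d m l, hd m l⟩) ↔
      φ.Realize (Sum.elim (x A B) (d m)) := by
    have h1 := StrongHomClass.realize_formula g φ
      (v := Sum.elim (fun l => (⟨x A B l, hx' A B l⟩ : M)) fun l => ⟨d m l, hd m l⟩)
    have h2 := M.subtype.map_formula φ
      (Sum.elim (fun l => (⟨x A B l, hx' A B l⟩ : M)) fun l => ⟨d m l, hd m l⟩)
    rw [Sum.comp_elim] at h1 h2
    exact h1.trans h2.symm
  refine ⟨str, M.subtype.elementarilyEquivalent.symm.trans (StrongHomClass.elementarilyEquivalent g),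
    fun m l => g ⟨d m l, hd m l⟩, fun A B hAB => ⟨fun l => g ⟨x A B l, hx' A B l⟩, fun m hm => ?_,
      fun m hm => ?_⟩⟩
  · exact (hφ A B m).2 ((hx A B hAB).1 m hm)
  · exact (hφ A B m).not.2 ((hx A B hAB).2 m hm)

/-- Enumerate `X`. For each `m`, infinitely many indices are coded as `Nat.pair m i`, but there are
only finitely many traces of `R` on the elements of `X` with number below `m`, so two of these
indices have the same trace. An element of number `g x` can then distinguish the `m`-th pair only
when `m ≤ g x`. The coding keeps all values of `u` apart from all values of `v`. -/
theorem exists_almost_constant {X : Type*} [Countable X] (R : X → ℕ → Prop) :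
    ∃ u v : ℕ → ℕ, (∀ m m', u m ≠ v m') ∧ ∀ x, {m | R x (u m) ∧ ¬ R x (v m)}.Finite := by
  obtain ⟨g, hg⟩ := exists_injective_nat X
  have key (m : ℕ) : ∃ i i' : ℕ, i ≠ i' ∧
      ∀ x, g x < m → (R x (Nat.pair m i) ↔ R x (Nat.pair m i')) := by
    have := not_injective_infinite_finite
      fun i => {t : Fin m | ∃ x, g x = t ∧ R x (Nat.pair m i)}
    simp only [Function.Injective, not_forall] at this
    obtain ⟨i, i', h, hne⟩ := this
    refine ⟨i, i', hne, fun x hx => ?_⟩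
    have hmem (i) : (⟨g x, hx⟩ : Fin m) ∈ {t : Fin m | ∃ x, g x = t ∧ R x (Nat.pair m i)} ↔
        R x (Nat.pair m i) :=
      ⟨fun ⟨y, hy, hR⟩ => hg hy ▸ hR, fun hR => ⟨x, rfl, hR⟩⟩
    rw [← hmem i, ← hmem i', h]
  choose u v huv hR using key
  refine ⟨fun m => Nat.pair m (u m), fun m => Nat.pair m (v m), fun m m' h => ?_, fun x => ?_⟩
  · obtain ⟨rfl, h⟩ := Nat.pair_eq_pair.1 h
    exact huv m h
  · refine (Set.finite_le_nat (g x)).subset fun m hm => ?_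
    by_contra hlt
    exact hm.2 ((hR m x (not_le.1 hlt)).1 hm.1)

/-- From an independent sequence in a countable model one obtains a finitely satisfiable sequence
of instances such that no tuple satisfies infinitely many of them. -/
theorem Independent.exists_dispersed [Countable N] (h : Independent φ d) :
    ∃ (θ : L.BoundedFormula Empty (a + (b + b))) (c : ℕ → Fin (b + b) → N),
      (∀ s : Finset ℕ, ∃ x : Fin a → N, ∀ i ∈ s, θ.Realize default (Fin.append x (c i))) ∧
      ∀ x : Fin a → N, {i | θ.Realize default (Fin.append x (c i))}.Finite := by
  classical
  obtain ⟨u, v, huv, hfin⟩ := exists_almost_constant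
    fun (x : Fin a → N) i => φ.Realize (Sum.elim x (d i))
  -- The formula `θ(x; y, y')` is `φ(x, y) ∧ ¬ φ(x, y')`. For the pairs `d (u i)`, `d (v i)`,
  -- independence makes it finitely satisfiable, because the ranges of `u` and `v` are disjoint, and
  -- no `x` distinguishes infinitely many of the pairs.
  let θ : L.Formula (Fin a ⊕ Fin (b + b)) :=
    φ.relabel (Sum.map id (Fin.castAdd b)) ⊓ ∼(φ.relabel (Sum.map id (Fin.natAdd b)))
  have hθ (x : Fin a → N) (i : ℕ) : (appendFormula θ).Realize default
      (Fin.append x (Fin.append (d (u i)) (d (v i)))) ↔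
      φ.Realize (Sum.elim x (d (u i))) ∧ ¬ φ.Realize (Sum.elim x (d (v i))) := by
    rw [realize_appendFormula, Formula.realize_inf, Formula.realize_not, Formula.realize_relabel,
      Formula.realize_relabel]
    refine and_congr (iff_of_eq (congrArg _ ?_)) (not_congr (iff_of_eq (congrArg _ ?_))) <;>
    · funext l
      rcases l with l | l
      · rfl
      · simp only [Function.comp_apply, Sum.map_inr, Sum.elim_inr, Fin.append_left, Fin.append_right]
  refine ⟨appendFormula θ, fun i => Fin.append (d (u i)) (d (v i)), fun s => ?_, fun x => ?_⟩
  · obtain ⟨x, hA, hB⟩ := h (s.image u) (s.image v) (by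
      rw [Finset.disjoint_left]
      intro y hy hy'
      obtain ⟨i, -, rfl⟩ := Finset.mem_image.1 hy
      obtain ⟨i', -, h⟩ := Finset.mem_image.1 hy'
      exact huv i i' h.symm)
    exact ⟨x, fun i hi => (hθ x i).2 ⟨hA _ (Finset.mem_image_of_mem u hi),
      hB _ (Finset.mem_image_of_mem v hi)⟩⟩
  · simpa only [hθ] using hfin x

end

/-- A theory which admits `Δ_{n,k}(S)` has a model on the natural numbers with a finitely satisfiable
sequence of instances such that no tuple satisfies infinitely many of them. -/
theorem Admits.exists_dispersed {T : CountableTheory} {n k : ℕ} (hk : 2 ≤ k) (hkn : k < n)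
    {S : Set (Finset ℕ)} (hS : IsRandom k S) (h : Admits T (deltaPattern n k S)) :
    ∃ _ : T.L.Structure ℕ, ℕ ⊨ T.thy ∧ ∃ (a b : ℕ) (θ : T.L.BoundedFormula Empty (a + b))
      (c : ℕ → Fin b → ℕ),
      (∀ s : Finset ℕ, ∃ x : Fin a → ℕ, ∀ i ∈ s, θ.Realize default (Fin.append x (c i))) ∧
      ∀ x : Fin a → ℕ, {i | θ.Realize default (Fin.append x (c i))}.Finite := by
  have := T.countable_symbols
  obtain ⟨a, b, φ, N, d, hd⟩ := h.exists_independent hk hkn hS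
  obtain ⟨str, hN, d', hd'⟩ := hd.exists_nat
  obtain ⟨θ, c, hc⟩ := hd'.exists_dispersed
  refine ⟨str, hN.theory_model, a, b + b, θ, c, ?_⟩
  convert hc

/-! ### Saturation and minimality -/

/-- The graph of a sequence of natural numbers, as a set. -/
def sequenceCode (c : ℕ → ℕ) : ZFSet.{u} :=
  codeSet (fun i => ZFSet.pair (natCode i) (natCode (c i))) Set.univ

theorem sequenceCode_mem_HC (c : ℕ → ℕ) : sequenceCode c ∈ HC :=
  codeSet_mem_HC fun i _ => ((GoodClass.natCode_isHF i).pair (GoodClass.natCode_isHF _)).mem_HC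

theorem pair_mem_sequenceCode {c : ℕ → ℕ} {i : ℕ} {y : ZFSet.{u}} :
    ZFSet.pair (natCode i) y ∈ sequenceCode c ↔ y = natCode (c i) := by
  simp [sequenceCode, mem_codeSet, ZFSet.pair_inj, natCode_injective.eq_iff, eq_comm]

theorem natInnerModel_isDispersed {T : CountableTheory} [T.L.Structure ℕ] {V : Set ZFSet.{u}}
    (hV : IsTransitiveModel V) (h : interpCode T ∈ V) (hT : ℕ ⊨ T.thy) {a b : ℕ}
    {θ : T.L.BoundedFormula Empty (a + b)} {c : ℕ → Fin b → ℕ}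
    (h₁ : ∀ s : Finset ℕ, ∃ x : Fin a → ℕ, ∀ i ∈ s, θ.Realize default (Fin.append x (c i)))
    (h₂ : ∀ x : Fin a → ℕ, {i | θ.Realize default (Fin.append x (c i))}.Finite)
    {o : V} (ho : o.1 = omegaCode) {e : Fin b → V} (he : ∀ l, (e l).1 = sequenceCode fun i => c i l) :
    letI := (natInnerModel T hV h hT).str
    IsDispersed (Holds ((natInnerModel T hV h hT).elem hV) θ) (natInnerModel T hV h hT).carrier o e := by
  let _ := omegaStructure.{u} T
  let g : ℕ ≃[T.L] (omegaCode : ZFSet.{u}) := Equiv.inducedStructureEquiv omegaEquiv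
  have hg (i : ℕ) : (g i).1 = natCode i := rfl
  have hθ (x : Fin a → ℕ) (i : ℕ) :
      θ.Realize default (Fin.append (fun l => g (x l)) fun l => g (c i l)) ↔
        θ.Realize default (Fin.append x (c i)) := by
    have := StrongHomClass.realize_boundedFormula g θ (v := default) (xs := Fin.append x (c i))
    refine Iff.trans (iff_of_eq (congrArg₂ _ (Subsingleton.elim _ _) (funext fun l => ?_))) this
    refine Fin.addCases (fun l => ?_) (fun l => ?_) l <;> simp
  refine (natInnerModel T hV h hT).isDispersed (c := fun i l => g (c i l)) hV (fun z => ?_)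
    (fun l i y => ?_) (fun s => ?_) fun x => ?_
  · rw [E_iff, ho, mem_omegaCode]
    exact exists_congr fun i => ⟨fun h => Subtype.ext h.symm, fun h => (congrArg Subtype.val h).symm⟩
  · rw [hV.good.related_iff, he]
    exact pair_mem_sequenceCode.trans ⟨fun h => Subtype.ext h, fun h => congrArg Subtype.val h⟩
  · obtain ⟨x, hx⟩ := h₁ s
    exact ⟨fun l => g (x l), fun i hi => (hθ x i).2 (hx i hi)⟩
  · obtain ⟨x, rfl⟩ : ∃ x' : Fin a → ℕ, (fun l => g (x' l)) = x :=
      ⟨fun l => g.symm (x l), funext fun l => g.apply_symm_apply _⟩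
    refine (h₂ x).subset fun i hi => (hθ x i).1 hi

/-- Saturation of `j_std(M₁)` is used twice: it makes the characteristic cardinal large, so that
`j_std(M₀)` is pseudosaturated, and it makes all small subsets of `j(ω)` pseudofinite, so that
pseudosaturation of `j_std(M₀)` is saturation. The second use is the reason for choosing both models
on `ω` and for putting a dispersed sequence into `V`. -/
theorem starLE_of_admits (κ : Cardinal.{w}) {n k : ℕ} (hk : 2 ≤ k) (hkn : k < n)
    {S : Set (Finset ℕ)} (hS : IsRandom k S) {T : CountableTheory} (hT : T.Complete)
    (hΔ : Admits T (deltaPattern n k S)) : StarLE κ (Tnk n k) T := by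
  intro l hl
  obtain ⟨str, hmod, a, b, θ, c, h₁, h₂⟩ := hΔ.exists_dispersed hk hkn hS
  obtain ⟨S₀, hS₀⟩ := exists_isRandomCliqueFree hk hkn
  let _ : (HyperLang k).Structure ℕ := hyperStructure k S₀
  let _ : (Tnk n k).L.Structure ℕ := hyperStructure k S₀
  have hmod₀ : ℕ ⊨ (Tnk n k).thy := (models_hyperTheory_iff hk hkn hS₀).2 (isGenericModel_nat hS₀)
  obtain ⟨V, hV, hVc, hV₀, hV₁, hSV, hsV⟩ := exists_countable_transitiveModel_memClass (Tnk n k) T S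
    (s := {interpCode T, interpCode (Tnk n k)} ∪ Set.range fun l : Fin b => sequenceCode fun i => c i l)
    (((Set.toFinite _).countable).union (Set.countable_range _)) (by
      rintro x ((rfl | rfl) | ⟨l, rfl⟩)
      exacts [interpCode_mem_HC T, interpCode_mem_HC (Tnk n k), sequenceCode_mem_HC _])
  have hT' : interpCode T ∈ V := hsV (Or.inl (Or.inl rfl))
  have hTnk : interpCode (Tnk n k) ∈ V := hsV (Or.inl (Or.inr rfl))
  let M₀ := natInnerModel (Tnk n k) hV hTnk hmod₀
  let M₁ := natInnerModel T hV hT' hmod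
  refine ⟨V, hV, hVc, hV₀, hV₁, M₀, M₁, fun W _ _ j _ _ hsat => ?_⟩
  have hdisp := natInnerModel_isDispersed hV hT' hmod h₁ h₂ (o := ⟨omegaCode, hV.omegaCode_mem⟩) rfl
    (e := fun l => ⟨_, hsV (Or.inr ⟨l, rfl⟩)⟩) fun l => rfl
  have hpf : StdPseudosaturated j hV M₁ (Order.succ l) := fun A _ hA => hsat A hA
  have hlt := hpf.lt_patternCardinal_delta hl hT hΔ (I := ⟨_, hV.indexCode_mem k⟩)
    (D := ⟨_, hV.deltaCode_mem n k S hSV⟩) rfl rfl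
  have hM₀ := M₀.stdPseudosaturated_of_lt_patternCardinal hV j hk hkn hS rfl rfl hl hlt
  intro A hA
  refine hM₀ A ?_ hA
  -- The universe of `M₀` is `ω`, which is also the index set of the dispersed sequence in `M₁`.
  refine StdSaturated.pseudofinite hl hsat hdisp ?_ ?_
  · rintro _ ⟨x, -, rfl⟩
    exact x.2
  · exact mk_image_le.trans (Order.lt_succ_iff.1 hA)

theorem crossLE_Tnk {n n' k : ℕ} (κ : Cardinal.{w}) (hk : 2 ≤ k) (hkn : k < n) (hn : n ≤ n') :
    CrossLE κ (Tnk n k) (Tnk n' k) := by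
  obtain ⟨S, hS⟩ := exists_isRandom hk
  exact crossLE_of_admits κ hk hkn hS (Tnk_isComplete hk (hkn.trans_le hn))
    (admits_deltaPattern hk hkn hn S)

end CardChar

end

theorem theorem7p12 (n k : ℕ) (hk : 2 ≤ k) (hkn : k < n) :
    (∀ (V : Set ZFSet.{u}) (hV : IsTransitiveModel V)
        (W : Type w) [SetLang.Structure W] (j : V ↪ₑ[SetLang] W), OmegaNonstandard W →
      ∀ l : Cardinal.{w}, Cardinal.aleph0 ≤ l →
      ∀ S : Set (Finset ℕ), IsRandom k S → hypergraphCode S ∈ V →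
        ∃ I D : V, (I : ZFSet.{u}) = indexCode k ∧ (D : ZFSet.{u}) = deltaCode n k S ∧
          (Pseudosaturates j hV (Order.succ l) (Tnk n k) ↔
            (l : WithTop Cardinal.{w}) < patternCardinal j I D) ∧
          (PseudosaturatesEvery j hV (Order.succ l) (Tnk n k) ↔
            (l : WithTop Cardinal.{w}) < patternCardinal j I D)) ∧
    (∀ S : Set (Finset ℕ), IsRandom k S →
      IsMinimalAdmitting (CrossLE.{w} 1) (Tnk n k) (deltaPattern n k S) ∧
      ∀ κ : Cardinal.{w}, (κ = 1 ∨ Cardinal.aleph0 ≤ κ) →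
        IsMinimalAdmitting (CrossLE κ) (Tnk n k) (deltaPattern n k S) ∧
        IsMinimalAdmitting (StarLE κ) (Tnk n k) (deltaPattern n k S)) ∧
    (∀ n' : ℕ, n ≤ n' → CrossLE.{w} 1 (Tnk n k) (Tnk n' k)) := by
  refine ⟨fun V hV W _ j _ l hl S hS hSV => ?_, fun S hS => ?_, fun n' hn => crossLE_Tnk 1 hk hkn hn⟩
  · exact ⟨⟨_, hV.indexCode_mem k⟩, ⟨_, hV.deltaCode_mem n k S hSV⟩, rfl, rfl,
      pseudosaturates_iff hk hkn hl hS rfl rfl⟩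
  · have hT := Tnk_isComplete hk hkn
    have hΔ := admits_deltaPattern hk hkn le_rfl S
    have hcross (κ : Cardinal.{w}) : IsMinimalAdmitting (CrossLE κ) (Tnk n k) (deltaPattern n k S) :=
      ⟨hT, hΔ, fun T hT hΔ => crossLE_of_admits κ hk hkn hS hT hΔ⟩
    exact ⟨hcross 1, fun κ _ => ⟨hcross κ, hT, hΔ,
      fun T hT hΔ => starLE_of_admits κ hk hkn hS hT hΔ⟩⟩
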